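/- Let $N\ge 1$ be an integer, let $m>N/2$ be real, and put $q_\star=\frac{N+2}{N+1}$. Let $H^1_m(\mathbb R^N)$ be the space of all $v\in H^1(\mathbb R^N)$ (real-valued, with weak gradient $\nabla v$) such that $$\|v\|_m=\Bigl(\int_{\mathbb R^N}(1+|\xi|^{2m})\bigl(|v(\xi)|^2+|\nabla v(\xi)|^2\bigr)\,d\xi\Bigr)^{1/2}<\infty .$$ Let $\mathcal L v=\Delta v+\frac12\,\xi\cdot\nabla v+\frac N2\,v$, let $G(\xi)=(4\pi)^{-N/2}e^{-|\xi|^2/4}$, $E_c=\{\alpha G:\alpha\in\mathbb R\}$ and $E_s=\{w\in H^1_m(\mathbb R^N):\int_{\mathbb R^N}w\,d\xi=0\}$, and let $e^{\tau\mathcal L}$ be the semigroup $$(e^{\tau\mathcal L}w)(\xi)=e^{N\tau/2}\int_{\mathbb R^N} g\bigl(e^\tau-1,\;e^{\tau/2}\xi-y\bigr)\,w(y)\,dy\quad(\tau>0),\qquad e^{0\mathcal L}w=w,$$ where $g(t,x)=t^{-N/2}G(x/\sqrt t)$ is the heat kernel. Fix $\chi\in C^\infty([0,\infty))$ with $0\le\chi\le1$,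 $\chi(r)=1$ for $r\le 1$ and $\chi(r)=0$ for $r\ge 4$. For $\varrho>0$ let $F_\varrho(v)=\chi\bigl(\|v\|_m^2/\varrho^2\bigr)\,|\nabla v|^{q_\star}$ and consider the truncated rescaled equation $$\partial_\tau v=\mathcal L v-F_\varrho(v),\qquad v(0)=v_0\in H^1_m(\mathbb R^N),$$ whose solutions are understood as functions $v\in C([0,\infty);H^1_m(\mathbb R^N))$ with $v(\tau)=e^{\tau\mathcal L}v_0-\int_0^\tau e^{(\tau-s)\mathcal L}F_\varrho(v(s))\,ds$ for all $\tau\ge 0$. Theorem. Let $\mu\in(0,1/2)$ satisfy $2\mu<m-\frac N2$. Then there is $\varrho_0>0$ such that for every $\varrho\in(0,\varrho_0)$ the following holds. For every $v_0\in H^1_m(\mathbb R^N)$ the truncated equation has a unique global solution $\tau\mapsto\varphi_\tau(v_0)$, and there is a globally Lipschitz continuous map $f\in C^1(E_c;E_s)$ with $f(0)=0$ and $Df(0)=0$ such that the set $W_c=\{\alpha G+f(\alpha G):\alpha\in\mathbb R\}\subset H^1_m(\mathbb R^N)$ has these properties: (a) $\varphi_\tau(W_c)=W_c$ for every $\tau\ge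 0$; (b) for every $v_0\in H^1_m(\mathbb R^N)$ there is a unique $w_0\in W_c$ for which there exists a constant $C>0$ with $$\|\varphi_\tau(v_0)-\varphi_\tau(w_0)\|_m\le C\,e^{-\mu\tau}\qquad\text{for all }\tau\ge 0 .$$ -/

import Mathlib

open MeasureTheory Set
open scoped ContDiff NNReal

noncomputable section

namespace ViscousHJ

/-- `ℝ^N` with its Euclidean norm. -/
abbrev Eu (N : ℕ) : Type := EuclideanSpace ℝ (Fin N)

/-- The critical exponent `q⋆ = (N + 2) / (N + 1)`. -/
def qStar (N : ℕ) : ℝ := ((N : ℝ) + 2) / ((N : ℝ) + 1)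

/-! ### The weighted spaces -/

/-- The measure `(1 + |ξ|^{2m}) dξ` on `ℝ^N`. -/
def weightedMeasure (N : ℕ) (m : ℝ) : Measure (Eu N) :=
  (volume : Measure (Eu N)).withDensity fun ξ => ENNReal.ofReal (1 + ‖ξ‖ ^ (2 * m))

/-- `L²_m(ℝ^N) = L²(ℝ^N; (1 + |ξ|^{2m}) dξ)`; its norm is `|·|_m`. -/
abbrev L2m (N : ℕ) (m : ℝ) : Type := Lp ℝ 2 (weightedMeasure N m)

/-- Vector fields on `ℝ^N` with components in `L²_m(ℝ^N)`. -/
abbrev L2mVec (N : ℕ) (m : ℝ) : Type := Lp (Eu N) 2 (weightedMeasure N m)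

/-- `g` is the weak (distributional) gradient of `u` on `ℝ^N`. -/
def IsWeakGradient {N : ℕ} (u : Eu N → ℝ) (g : Eu N → Eu N) : Prop :=
  ∀ ψ : Eu N → ℝ, ContDiff ℝ ∞ ψ → HasCompactSupport ψ → ∀ e : Eu N,
    ∫ ξ, u ξ * fderiv ℝ ψ ξ e = -∫ ξ, inner ℝ (g ξ) e * ψ ξ

theorem volume_le_weightedMeasure (N : ℕ) (m : ℝ) :
    (volume : Measure (Eu N)) ≤ weightedMeasure N m := by
  have h : (volume : Measure (Eu N)).withDensity 1 ≤ weightedMeasure N m := by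
    refine withDensity_mono (Filter.Eventually.of_forall fun ξ => ?_)
    have : (0 : ℝ) ≤ ‖ξ‖ ^ (2 * m) := by positivity
    simp only [Pi.one_apply]
    rw [← ENNReal.ofReal_one]
    exact ENNReal.ofReal_le_ofReal (by linarith)
  simpa using h

theorem memLp_volume {N : ℕ} {m : ℝ} {F : Type*} [NormedAddCommGroup F]
    (u : Lp F 2 (weightedMeasure N m)) : MemLp u 2 (volume : Measure (Eu N)) :=
  (Lp.memLp u).mono_measure (volume_le_weightedMeasure N m)

theorem ae_volume {N : ℕ} {m : ℝ} {p : Eu N → Prop}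
    (h : ∀ᵐ ξ ∂(weightedMeasure N m), p ξ) : ∀ᵐ ξ, p ξ :=
  (Measure.absolutelyContinuous_of_le (volume_le_weightedMeasure N m)).ae_le h

theorem memLp_test {N : ℕ} {ψ : Eu N → ℝ} (hψ : Continuous ψ) (hc : HasCompactSupport ψ) :
    MemLp ψ 2 (volume : Measure (Eu N)) :=
  hψ.memLp_of_hasCompactSupport hc

theorem integrable_pairing {N : ℕ} {m : ℝ} (u : L2m N m) {ψ : Eu N → ℝ}
    (hψ : Continuous ψ) (hc : HasCompactSupport ψ) :
    Integrable (fun ξ => u ξ * ψ ξ) :=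
  (memLp_volume u).integrable_mul (memLp_test hψ hc)

theorem integrable_pairing_vec {N : ℕ} {m : ℝ} (g : L2mVec N m) (e : Eu N) {ψ : Eu N → ℝ}
    (hψ : Continuous ψ) (hc : HasCompactSupport ψ) :
    Integrable (fun ξ => inner ℝ (g ξ) e * ψ ξ) :=
  ((memLp_volume g).inner_const e).integrable_mul (memLp_test hψ hc)

theorem continuous_fderiv_test {N : ℕ} {ψ : Eu N → ℝ} (hψ : ContDiff ℝ ∞ ψ) (e : Eu N) :
    Continuous fun ξ => fderiv ℝ ψ ξ e :=
  (hψ.continuous_fderiv (by simp)).clm_apply continuous_const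

/-- The space `H¹_m(ℝ^N)`, realised as the pairs `(v, ∇v)` in `L²_m × (L²_m)^N` whose second
entry is the weak gradient of the first. The norm inherited from the `ℓ²`-product is
`‖v‖_m = (|v|_m² + |∇v|_m²)^{1/2}`. -/
def H1m (N : ℕ) (m : ℝ) : Submodule ℝ (WithLp 2 (L2m N m × L2mVec N m)) where
  carrier := {v | IsWeakGradient v.fst v.snd}
  zero_mem' := by
    intro ψ _ _ e
    have h1 := ae_volume (Lp.coeFn_zero ℝ 2 (weightedMeasure N m))
    have h2 := ae_volume (Lp.coeFn_zero (Eu N) 2 (weightedMeasure N m))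
    have e1 : ∫ ξ, ((0 : L2m N m) : Eu N → ℝ) ξ * fderiv ℝ ψ ξ e = 0 :=
      integral_eq_zero_of_ae (by filter_upwards [h1] with ξ h; rw [h]; simp)
    have e2 : ∫ ξ, inner ℝ (((0 : L2mVec N m) : Eu N → Eu N) ξ) e * ψ ξ = 0 :=
      integral_eq_zero_of_ae (by filter_upwards [h2] with ξ h; rw [h]; simp)
    exact e1.trans (by rw [← neg_zero, ← e2]; rfl)
  add_mem' := by
    intro v w hv hw ψ hψ hc e
    have h1 := ae_volume (Lp.coeFn_add v.fst w.fst)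
    have h2 := ae_volume (Lp.coeFn_add v.snd w.snd)
    have hd := continuous_fderiv_test hψ e
    have hdc : HasCompactSupport fun ξ => fderiv ℝ ψ ξ e := hc.fderiv_apply ℝ e
    have e1 : ∫ ξ, (v.fst + w.fst : L2m N m) ξ * fderiv ℝ ψ ξ e
        = (∫ ξ, v.fst ξ * fderiv ℝ ψ ξ e) + ∫ ξ, w.fst ξ * fderiv ℝ ψ ξ e := by
      rw [← integral_add (integrable_pairing v.fst hd hdc) (integrable_pairing w.fst hd hdc)]
      refine integral_congr_ae ?_
      filter_upwards [h1] with ξ h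
      rw [h, Pi.add_apply, add_mul]
    have e2 : ∫ ξ, inner ℝ ((v.snd + w.snd : L2mVec N m) ξ) e * ψ ξ
        = (∫ ξ, inner ℝ (v.snd ξ) e * ψ ξ) + ∫ ξ, inner ℝ (w.snd ξ) e * ψ ξ := by
      rw [← integral_add (integrable_pairing_vec v.snd e hψ.continuous hc)
        (integrable_pairing_vec w.snd e hψ.continuous hc)]
      refine integral_congr_ae ?_
      filter_upwards [h2] with ξ h
      rw [h, Pi.add_apply, inner_add_left, add_mul]
    have := hv ψ hψ hc e
    have := hw ψ hψ hc e
    simp only [WithLp.add_fst, WithLp.add_snd]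
    rw [e1, e2]
    linarith
  smul_mem' := by
    intro c v hv ψ hψ hc e
    have h1 := ae_volume (Lp.coeFn_smul c v.fst)
    have h2 := ae_volume (Lp.coeFn_smul c v.snd)
    have e1 : ∫ ξ, (c • v.fst : L2m N m) ξ * fderiv ℝ ψ ξ e
        = c * ∫ ξ, v.fst ξ * fderiv ℝ ψ ξ e := by
      rw [← integral_const_mul]
      refine integral_congr_ae ?_
      filter_upwards [h1] with ξ h
      simp [h, mul_assoc]
    have e2 : ∫ ξ, inner ℝ ((c • v.snd : L2mVec N m) ξ) e * ψ ξ
        = c * ∫ ξ, inner ℝ (v.snd ξ) e * ψ ξ := by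
      rw [← integral_const_mul]
      refine integral_congr_ae ?_
      filter_upwards [h2] with ξ h
      simp [h, inner_smul_left, mul_assoc]
    have := hv ψ hψ hc e
    simp only [WithLp.smul_fst, WithLp.smul_snd]
    rw [e1, e2, this]
    ring

/-- The function `v` underlying an element of `H¹_m` (defined almost everywhere). -/
def H1m.toFun {N : ℕ} {m : ℝ} (v : H1m N m) : Eu N → ℝ := v.1.fst

/-- The gradient `∇v` of an element of `H¹_m` (defined almost everywhere). -/
def H1m.grad {N : ℕ} {m : ℝ} (v : H1m N m) : Eu N → Eu N := v.1.snd

/-! ### The Gaussian and the linear semigroup -/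

/-- `G(ξ) = (4π)^{-N/2} exp(-|ξ|²/4)`. -/
def gaussian (N : ℕ) (ξ : Eu N) : ℝ :=
  (4 * Real.pi) ^ (-((N : ℝ) / 2)) * Real.exp (-‖ξ‖ ^ 2 / 4)

/-- The heat kernel `g(t, x) = t^{-N/2} G(x / t^{1/2})`. -/
def heatKernel (N : ℕ) (t : ℝ) (x : Eu N) : ℝ :=
  t ^ (-((N : ℝ) / 2)) * gaussian N ((√t)⁻¹ • x)

/-- The differential expression `𝓛 v = Δ v + ½ ξ · ∇v + (N/2) v`. -/
def opL (N : ℕ) (v : Eu N → ℝ) (ξ : Eu N) : ℝ :=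
  (∑ i : Fin N, fderiv ℝ (fun η => fderiv ℝ v η (EuclideanSpace.single i 1)) ξ
      (EuclideanSpace.single i 1))
    + 1 / 2 * fderiv ℝ v ξ ξ + (N : ℝ) / 2 * v ξ

/-- The integral kernel of `e^{τ𝓛}` for `τ > 0`. The substitution
`u(t, x) = (1 + t)^{-N/2} v(ln (1 + t), x / (1 + t)^{1/2})` turns `∂_τ v = 𝓛 v` into the heat
equation, so that `(e^{τ𝓛} w)(ξ) = e^{Nτ/2} (g(e^τ - 1, ·) * w)(e^{τ/2} ξ)`. -/
def kernelL (N : ℕ) (τ : ℝ) (ξ y : Eu N) : ℝ :=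
  Real.exp ((N : ℝ) * τ / 2) * heatKernel N (Real.exp τ - 1) (Real.exp (τ / 2) • ξ - y)

/-- The semigroup `e^{τ𝓛}`, `τ ≥ 0`, acting on functions. -/
def semigroupL (N : ℕ) (τ : ℝ) (w : Eu N → ℝ) (ξ : Eu N) : ℝ :=
  if 0 < τ then ∫ y, kernelL N τ ξ y * w y else w ξ

theorem hasFDerivAt_gaussian (N : ℕ) (ξ : Eu N) :
    HasFDerivAt (gaussian N) ((-(1 / 2 : ℝ) * gaussian N ξ) • innerSL ℝ ξ) ξ := by
  have h := ((hasStrictFDerivAt_norm_sq ξ).hasFDerivAt.const_mul (-(1 / 4 : ℝ))).exp.const_mul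
    ((4 * Real.pi) ^ (-((N : ℝ) / 2)))
  have e : gaussian N = fun y : Eu N =>
      (4 * Real.pi) ^ (-((N : ℝ) / 2)) * Real.exp (-(1 / 4 : ℝ) * ‖y‖ ^ 2) := by
    funext y
    simp only [gaussian]
    congr 2
    ring
  rw [e]
  refine h.congr_fderiv ?_
  ext z
  simp
  ring

theorem continuous_gaussian (N : ℕ) : Continuous (gaussian N) := by
  unfold gaussian
  fun_prop

theorem integrable_weighted_gaussian (N : ℕ) {m : ℝ} (hm : 0 ≤ m) :
    Integrable fun ξ : Eu N => (1 + ‖ξ‖ ^ (2 * m)) * ((1 + ‖ξ‖ ^ 2) * gaussian N ξ ^ 2) := by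
  set c : ℝ := ((4 * Real.pi) ^ (-((N : ℝ) / 2))) ^ 2 with hc
  have hI : Integrable fun ξ : Eu N => Real.exp (-(1 / 4 : ℝ) * ‖ξ‖ ^ 2) := by
    have := (GaussianFourier.integrable_cexp_neg_mul_sq_norm_add (V := Eu N)
      (b := (1 / 4 : ℂ)) (by norm_num) 0 0).norm
    refine this.congr (Filter.Eventually.of_forall fun ξ => ?_)
    simp only [Complex.norm_exp]
    congr 1
    simp
    rw [← Complex.ofReal_pow, Complex.ofReal_re]
  refine Integrable.mono' (hI.const_mul (c * 8 * (2 * Real.exp (8 * m ^ 2)))) ?_ ?_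
  · have h1 : Continuous fun ξ : Eu N => ‖ξ‖ ^ (2 * m) :=
      continuous_norm.rpow_const fun _ => Or.inr (by positivity)
    have h2 := continuous_gaussian N
    exact (by fun_prop : Continuous fun ξ : Eu N =>
      (1 + ‖ξ‖ ^ (2 * m)) * ((1 + ‖ξ‖ ^ 2) * gaussian N ξ ^ 2)).aestronglyMeasurable
  · refine Filter.Eventually.of_forall fun ξ => ?_
    set r := ‖ξ‖ with hr
    have hr0 : 0 ≤ r := norm_nonneg ξ
    have hg : gaussian N ξ ^ 2 = c * Real.exp (-(1 / 2 : ℝ) * r ^ 2) := by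
      simp only [gaussian, mul_pow, hc, ← Real.exp_nat_mul]
      congr 2
      push_cast
      ring
    have hrm : r ^ (2 * m) ≤ Real.exp (8 * m ^ 2) * Real.exp (1 / 8 * r ^ 2) := by
      have h1 : r ≤ Real.exp r := by linarith [Real.add_one_le_exp r]
      calc r ^ (2 * m) ≤ Real.exp r ^ (2 * m) :=
            Real.rpow_le_rpow hr0 h1 (by positivity)
        _ = Real.exp (r * (2 * m)) := by rw [← Real.exp_mul]
        _ ≤ Real.exp (8 * m ^ 2 + 1 / 8 * r ^ 2) := by
            apply Real.exp_le_exp.mpr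
            nlinarith [sq_nonneg (r - 8 * m)]
        _ = _ := Real.exp_add _ _
    have h1 : (1 : ℝ) ≤ Real.exp (8 * m ^ 2) * Real.exp (1 / 8 * r ^ 2) := by
      rw [← Real.exp_add]
      exact Real.one_le_exp (by positivity)
    have h2 : 1 + r ^ 2 ≤ 8 * Real.exp (1 / 8 * r ^ 2) := by
      linarith [Real.add_one_le_exp (1 / 8 * r ^ 2)]
    have hc0 : 0 ≤ c := by positivity
    have hrm0 : 0 ≤ r ^ (2 * m) := by positivity
    rw [Real.norm_of_nonneg (by positivity), hg]
    have key : (1 + r ^ (2 * m)) * (1 + r ^ 2) ≤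
        (2 * (Real.exp (8 * m ^ 2) * Real.exp (1 / 8 * r ^ 2))) *
          (8 * Real.exp (1 / 8 * r ^ 2)) :=
      mul_le_mul (by linarith) h2 (by positivity) (by positivity)
    have hE : Real.exp (-(1 / 4 : ℝ) * r ^ 2) =
        Real.exp (1 / 8 * r ^ 2) * Real.exp (1 / 8 * r ^ 2) *
          Real.exp (-(1 / 2 : ℝ) * r ^ 2) := by
      rw [← Real.exp_add, ← Real.exp_add]
      congr 1
      ring
    calc (1 + r ^ (2 * m)) * ((1 + r ^ 2) * (c * Real.exp (-(1 / 2 : ℝ) * r ^ 2)))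
        = (1 + r ^ (2 * m)) * (1 + r ^ 2) * (c * Real.exp (-(1 / 2 : ℝ) * r ^ 2)) := by ring
      _ ≤ (2 * (Real.exp (8 * m ^ 2) * Real.exp (1 / 8 * r ^ 2))) *
          (8 * Real.exp (1 / 8 * r ^ 2)) * (c * Real.exp (-(1 / 2 : ℝ) * r ^ 2)) :=
          mul_le_mul_of_nonneg_right key (by positivity)
      _ = _ := by rw [hE]; ring

theorem memLp_weighted_of_le {N : ℕ} {m : ℝ} (hm : 0 ≤ m) {F : Type*} [NormedAddCommGroup F]
    {u : Eu N → F} (hu : Continuous u)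
    (h : ∀ ξ, ‖u ξ‖ ^ 2 ≤ (1 + ‖ξ‖ ^ 2) * gaussian N ξ ^ 2) :
    MemLp u 2 (weightedMeasure N m) := by
  have hw : Continuous fun ξ : Eu N => ‖ξ‖ ^ (2 * m) :=
    continuous_norm.rpow_const fun _ => Or.inr (by positivity)
  rw [← memLp_norm_iff hu.aestronglyMeasurable,
    memLp_two_iff_integrable_sq hu.norm.aestronglyMeasurable]
  unfold weightedMeasure
  rw [integrable_withDensity_iff_integrable_smul' (by fun_prop)
    (Filter.Eventually.of_forall fun _ => ENNReal.ofReal_lt_top)]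
  refine Integrable.mono' (integrable_weighted_gaussian N hm) ?_ ?_
  · refine Continuous.aestronglyMeasurable ?_
    have e : (fun ξ : Eu N => (ENNReal.ofReal (1 + ‖ξ‖ ^ (2 * m))).toReal • ‖u ξ‖ ^ 2) =
        fun ξ : Eu N => (1 + ‖ξ‖ ^ (2 * m)) * ‖u ξ‖ ^ 2 := by
      funext ξ
      rw [ENNReal.toReal_ofReal (by positivity), smul_eq_mul]
    rw [e]
    fun_prop
  · refine Filter.Eventually.of_forall fun ξ => ?_
    rw [ENNReal.toReal_ofReal (by positivity), smul_eq_mul, Real.norm_of_nonneg (by positivity)]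
    exact mul_le_mul_of_nonneg_left (h ξ) (by positivity)

theorem memLp_gaussian (N : ℕ) {m : ℝ} (hm : 0 ≤ m) :
    MemLp (gaussian N) 2 (weightedMeasure N m) := by
  refine memLp_weighted_of_le hm (continuous_gaussian N) fun ξ => ?_
  rw [Real.norm_eq_abs, sq_abs]
  nlinarith [mul_nonneg (sq_nonneg ‖ξ‖) (sq_nonneg (gaussian N ξ))]

theorem memLp_gaussian_grad (N : ℕ) {m : ℝ} (hm : 0 ≤ m) :
    MemLp (fun ξ => (-(1 / 2 : ℝ) * gaussian N ξ) • ξ) 2 (weightedMeasure N m) := by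
  have hg := continuous_gaussian N
  refine memLp_weighted_of_le hm (by fun_prop) fun ξ => ?_
  rw [norm_smul, mul_pow, Real.norm_eq_abs, sq_abs]
  nlinarith [mul_nonneg (sq_nonneg ‖ξ‖) (sq_nonneg (gaussian N ξ)), sq_nonneg (gaussian N ξ)]

theorem isWeakGradient_gaussian (N : ℕ) :
    IsWeakGradient (gaussian N) fun ξ => (-(1 / 2 : ℝ) * gaussian N ξ) • ξ := by
  intro ψ hψ hc e
  have hg := continuous_gaussian N
  have hd := continuous_fderiv_test hψ e
  have hdc : HasCompactSupport fun ξ => fderiv ℝ ψ ξ e := hc.fderiv_apply ℝ e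
  have hfd : ∀ ξ, fderiv ℝ (gaussian N) ξ e
      = inner ℝ ((-(1 / 2 : ℝ) * gaussian N ξ) • ξ) e := fun ξ => by
    rw [(hasFDerivAt_gaussian N ξ).fderiv]
    simp [inner_smul_left]
  have hcont : Continuous fun ξ => fderiv ℝ (gaussian N) ξ e := by
    simp only [hfd]
    fun_prop
  have key := integral_mul_fderiv_eq_neg_fderiv_mul_of_integrable (μ := volume)
    (f := gaussian N) (g := ψ) (v := e)
    ((hcont.mul hψ.continuous).integrable_of_hasCompactSupport hc.mul_left)
    ((hg.mul hd).integrable_of_hasCompactSupport hdc.mul_left)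
    ((hg.mul hψ.continuous).integrable_of_hasCompactSupport hc.mul_left)
    (fun x _ => (hasFDerivAt_gaussian N x).differentiableAt)
    (fun x _ => (hψ.differentiable (by simp)).differentiableAt)
  rw [key]
  simp only [hfd]

theorem nonneg_of_half_lt {N : ℕ} {m : ℝ} (hm : (N : ℝ) / 2 < m) : 0 ≤ m :=
  (by positivity : (0 : ℝ) ≤ (N : ℝ) / 2).trans hm.le

/-- The Gaussian `G`, with `∇G = -½ ξ G`, as an element of `H¹_m(ℝ^N)`. -/
def gaussianH1m (N : ℕ) (m : ℝ) (hm : (N : ℝ) / 2 < m) : H1m N m :=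
  ⟨WithLp.toLp 2 ((memLp_gaussian N (nonneg_of_half_lt hm)).toLp,
    (memLp_gaussian_grad N (nonneg_of_half_lt hm)).toLp), by
    intro ψ hψ hc e
    have h1 := ae_volume (memLp_gaussian N (nonneg_of_half_lt hm)).coeFn_toLp
    have h2 := ae_volume (memLp_gaussian_grad N (nonneg_of_half_lt hm)).coeFn_toLp
    refine Eq.trans (integral_congr_ae ?_) ((isWeakGradient_gaussian N ψ hψ hc e).trans
      (congrArg Neg.neg (integral_congr_ae ?_)))
    · filter_upwards [h1] with ξ h
      exact congrArg (· * fderiv ℝ ψ ξ e) h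
    · filter_upwards [h2] with ξ h
      exact congrArg (fun z => inner ℝ z e * ψ ξ) h.symm⟩

/-- For `τ > 0` the kernel of `e^{τ𝓛}` solves `∂_τ k = 𝓛 k`. -/
theorem hasDerivAt_kernelL (N : ℕ) {τ : ℝ} (hτ : 0 < τ) (ξ y : Eu N) :
    HasDerivAt (fun σ => kernelL N σ ξ y) (opL N (fun η => kernelL N τ η y) ξ) τ := by
  have ht : 0 < Real.exp τ - 1 := by linarith [Real.add_one_lt_exp hτ.ne']
  have hk : ∀ σ : ℝ, 0 < σ → ∀ η : Eu N, kernelL N σ η y =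
      (4 * Real.pi) ^ (-((N : ℝ) / 2)) * (Real.exp ((N : ℝ) * σ / 2) *
        ((Real.exp σ - 1) ^ (-((N : ℝ) / 2)) *
          Real.exp (-(1 / 4) * (Real.exp σ - 1)⁻¹ * ‖Real.exp (σ / 2) • η - y‖ ^ 2))) := by
    intro σ hσ η
    have ht : 0 < Real.exp σ - 1 := by linarith [Real.add_one_lt_exp hσ.ne']
    have e : -‖(√(Real.exp σ - 1))⁻¹ • (Real.exp (σ / 2) • η - y)‖ ^ 2 / 4 =
        -(1 / 4) * (Real.exp σ - 1)⁻¹ * ‖Real.exp (σ / 2) • η - y‖ ^ 2 := by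
      rw [norm_smul, mul_pow, norm_inv, Real.norm_eq_abs, inv_pow, sq_abs, Real.sq_sqrt ht.le]
      ring
    simp only [kernelL, heatKernel, gaussian, e]
    ring
  set t := Real.exp τ - 1 with htd
  set s := Real.exp (τ / 2) with hs
  have hs2 : s * s = t + 1 := by
    rw [hs, htd, ← Real.exp_add]
    ring_nf
  -- space derivatives
  have hsp : ∀ η : Eu N, HasFDerivAt (fun η => kernelL N τ η y)
      ((-(1 / 2) * t⁻¹ * s * kernelL N τ η y) • innerSL ℝ (s • η - y)) η := by
    intro η
    have h0 : HasFDerivAt (fun η : Eu N => s • η - y) (s • ContinuousLinearMap.id ℝ (Eu N)) η :=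
      ((hasFDerivAt_id η).const_smul s).sub_const y
    have h := (((((h0.norm_sq).const_mul (-(1 / 4) * t⁻¹)).exp.const_mul
      (t ^ (-((N : ℝ) / 2)))).const_mul (Real.exp ((N : ℝ) * τ / 2))).const_mul
      ((4 * Real.pi) ^ (-((N : ℝ) / 2))))
    have e : (fun η => kernelL N τ η y) = _ := funext (hk τ hτ)
    rw [e]
    refine h.congr_fderiv ?_
    ext z
    simp [hk τ hτ η]
    ring
  have hfd : ∀ η z, fderiv ℝ (fun η => kernelL N τ η y) η z =
      -(1 / 2) * t⁻¹ * s * kernelL N τ η y * inner ℝ (s • η - y) z := by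
    intro η z
    rw [(hsp η).fderiv, smul_apply, innerSL_apply_apply, smul_eq_mul]
  have hfd2 : ∀ i : Fin N, fderiv ℝ (fun η => fderiv ℝ (fun η => kernelL N τ η y) η
      (EuclideanSpace.single i 1)) ξ (EuclideanSpace.single i 1) =
      (1 / 4 * t⁻¹ ^ 2 * s ^ 2 * ((s • ξ - y) i) ^ 2 - 1 / 2 * t⁻¹ * s ^ 2) *
        kernelL N τ ξ y := by
    intro i
    have e : (fun η => fderiv ℝ (fun η => kernelL N τ η y) η (EuclideanSpace.single i 1)) =
        fun η => -(1 / 2) * t⁻¹ * s * kernelL N τ η y *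
          inner ℝ (s • η - y) (EuclideanSpace.single i 1) := funext fun η => hfd η _
    rw [e]
    have h0 : HasFDerivAt (fun η : Eu N => s • η - y) (s • ContinuousLinearMap.id ℝ (Eu N)) ξ :=
      ((hasFDerivAt_id ξ).const_smul s).sub_const y
    have h1 := (((hsp ξ).const_mul (-(1 / 2) * t⁻¹ * s)).mul
      (h0.inner ℝ (hasFDerivAt_const (EuclideanSpace.single i (1 : ℝ)) ξ)))
    refine (congrArg (fun A : Eu N →L[ℝ] ℝ => A (EuclideanSpace.single i 1)) h1.fderiv).trans ?_
    simp [EuclideanSpace.inner_single_right]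
    ring_nf
  have hL : opL N (fun η => kernelL N τ η y) ξ =
      (1 / 4 * t⁻¹ ^ 2 * s ^ 2 * ‖s • ξ - y‖ ^ 2 - (N : ℝ) / 2 * t⁻¹ * s ^ 2
        - 1 / 4 * t⁻¹ * s * inner ℝ (s • ξ - y) ξ + (N : ℝ) / 2) * kernelL N τ ξ y := by
    unfold opL
    simp only [hfd2]
    rw [hfd, ← Finset.sum_mul, Finset.sum_sub_distrib, ← Finset.mul_sum,
      EuclideanSpace.real_norm_sq_eq]
    simp
    ring
  rw [hL]
  -- time derivative
  have hE : HasDerivAt (fun σ => Real.exp σ - 1) (Real.exp τ) τ :=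
    (Real.hasDerivAt_exp τ).sub_const 1
  have hS : HasDerivAt (fun σ : ℝ => Real.exp (σ / 2)) (s * (1 / 2)) τ :=
    ((hasDerivAt_id τ).div_const 2).exp
  have hX : HasDerivAt (fun σ : ℝ => Real.exp (σ / 2) • ξ - y) ((s * (1 / 2)) • ξ) τ :=
    (hS.smul_const ξ).sub_const y
  have h1 := ((((hasDerivAt_id τ).const_mul (N : ℝ)).div_const 2).exp.mul
    ((hE.rpow_const (p := -((N : ℝ) / 2)) (Or.inl ht.ne')).mul
      (((hE.inv ht.ne').const_mul (-(1 / 4))).mul hX.norm_sq).exp)).const_mul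
    ((4 * Real.pi) ^ (-((N : ℝ) / 2)))
  have hev : (fun σ => kernelL N σ ξ y) =ᶠ[nhds τ] _ :=
    Filter.eventually_of_mem (Ioi_mem_nhds hτ) fun σ hσ => hk σ hσ ξ
  refine (h1.congr_of_eventuallyEq hev).congr_deriv ?_
  rw [hk τ hτ ξ]
  have hrp : t ^ (-((N : ℝ) / 2) - 1) = t ^ (-((N : ℝ) / 2)) * t⁻¹ := by
    rw [Real.rpow_sub_one ht.ne', div_eq_mul_inv]
  have hs2' : Real.exp τ = s ^ 2 := by rw [sq, hs2, htd]; ring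
  simp only [id, Pi.mul_apply, Pi.inv_apply]
  simp only [← htd, ← hs, hrp]
  simp only [hs2']
  simp only [inner_smul_right]
  field_simp
  ring

/-- The centre space `E_c = {α G | α ∈ ℝ}`. -/
def Ec (N : ℕ) (m : ℝ) (hm : (N : ℝ) / 2 < m) : Submodule ℝ (H1m N m) :=
  Submodule.span ℝ {gaussianH1m N m hm}

/-- The element `α G` of `E_c`. -/
def Ec.smulG (N : ℕ) (m : ℝ) (hm : (N : ℝ) / 2 < m) (α : ℝ) : Ec N m hm :=
  α • ⟨gaussianH1m N m hm, Submodule.mem_span_singleton_self _⟩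

/-- The stable space `E_s = {w ∈ H¹_m | ∫ w = 0}`. (For `m > N/2` every `w ∈ H¹_m` is
integrable, so the first conjunct is then automatic.) -/
def Es (N : ℕ) (m : ℝ) : Submodule ℝ (H1m N m) where
  carrier := {w | Integrable (H1m.toFun w) ∧ ∫ ξ, H1m.toFun w ξ = 0}
  zero_mem' := by
    have h : H1m.toFun (0 : H1m N m) =ᵐ[volume] (0 : Eu N → ℝ) :=
      ae_volume (Lp.coeFn_zero ℝ 2 (weightedMeasure N m))
    exact ⟨(integrable_zero _ _ _).congr h.symm, integral_eq_zero_of_ae h⟩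
  add_mem' := by
    rintro v w ⟨hv, hv0⟩ ⟨hw, hw0⟩
    have h : H1m.toFun (v + w) =ᵐ[volume] H1m.toFun v + H1m.toFun w :=
      ae_volume (Lp.coeFn_add v.1.fst w.1.fst)
    refine ⟨(hv.add hw).congr h.symm, ?_⟩
    rw [integral_congr_ae h]
    simp only [Pi.add_apply]
    rw [integral_add hv hw, hv0, hw0, add_zero]
  smul_mem' := by
    rintro c v ⟨hv, hv0⟩
    have h : H1m.toFun (c • v) =ᵐ[volume] c • H1m.toFun v :=
      ae_volume (Lp.coeFn_smul c v.1.fst)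
    refine ⟨(hv.smul c).congr h.symm, ?_⟩
    rw [integral_congr_ae h]
    simp only [Pi.smul_apply]
    rw [integral_smul, hv0, smul_zero]

/-! ### The truncated equation -/

/-- `χ ∈ C^∞([0,∞))` with `0 ≤ χ ≤ 1`, `χ = 1` on `[0,1]` and `χ = 0` on `[4,∞)`. -/
structure IsCutoff (χ : ℝ → ℝ) : Prop where
  smooth : ContDiffOn ℝ ∞ χ (Ici 0)
  nonneg : ∀ r, 0 ≤ r → 0 ≤ χ r
  le_one : ∀ r, 0 ≤ r → χ r ≤ 1
  eq_zero : ∀ r, 4 ≤ r → χ r = 0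
  eq_one : ∀ r, 0 ≤ r → r ≤ 1 → χ r = 1

/-- The truncated nonlinearity `F_ρ(v) = χ(‖v‖_m² / ρ²) |∇v|^{q⋆}`. -/
def truncF {N : ℕ} {m : ℝ} (χ : ℝ → ℝ) (ρ : ℝ) (v : H1m N m) (ξ : Eu N) : ℝ :=
  χ (‖v‖ ^ 2 / ρ ^ 2) * ‖H1m.grad v ξ‖ ^ qStar N

/-- `v ∈ C([0,∞); H¹_m)` is a global (mild) solution of `∂_τ v = 𝓛 v - F_ρ(v)`, `v(0) = v₀`:
`v(τ) = e^{τ𝓛} v₀ - ∫₀^τ e^{(τ-s)𝓛} F_ρ(v(s)) ds` for all `τ ≥ 0`. -/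
structure IsSolution {N : ℕ} {m : ℝ} (χ : ℝ → ℝ) (ρ : ℝ) (v₀ : H1m N m) (v : ℝ → H1m N m) :
    Prop where
  continuousOn : ContinuousOn v (Ici 0)
  integrable : ∀ τ, 0 ≤ τ → ∀ᵐ ξ : Eu N,
    IntervalIntegrable (fun s => semigroupL N (τ - s) (truncF χ ρ (v s)) ξ) volume 0 τ
  duhamel : ∀ τ, 0 ≤ τ → ∀ᵐ ξ : Eu N,
    H1m.toFun (v τ) ξ = semigroupL N τ (H1m.toFun v₀) ξ
      - ∫ s in (0 : ℝ)..τ, semigroupL N (τ - s) (truncF χ ρ (v s)) ξ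

/-- `φ_τ`, `τ ≥ 0`, is the semiflow of the truncated equation: for every `v₀ ∈ H¹_m` the map
`τ ↦ φ_τ(v₀)` is the unique global solution with initial value `v₀`. -/
def IsTruncatedSemiflow {N : ℕ} {m : ℝ} (χ : ℝ → ℝ) (ρ : ℝ) (φ : ℝ → H1m N m → H1m N m) :
    Prop :=
  ∀ v₀ : H1m N m, IsSolution χ ρ v₀ (fun τ => φ τ v₀) ∧
    ∀ v : ℝ → H1m N m, IsSolution χ ρ v₀ v → ∀ τ, 0 ≤ τ → v τ = φ τ v₀

/-- `W_c = {α G + f(α G) | α ∈ ℝ}`. -/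
def Wc {N : ℕ} {m : ℝ} (hm : (N : ℝ) / 2 < m) (f : Ec N m hm → Es N m) : Set (H1m N m) :=
  {w | ∃ α : ℝ, w = (Ec.smulG N m hm α : H1m N m) + (f (Ec.smulG N m hm α) : H1m N m)}

end ViscousHJ

end

open ViscousHJ

/-! ### Centre manifolds of maps -/

namespace CentreMap

open Filter Topology BoundedContinuousFunction

variable {E : Type*} [NormedAddCommGroup E]

/-! The linear part is explicit. In self-similar variables the semigroup e^{τ𝓛} fixes G and
preserves the mass ∫v, so in the coordinates v = αG + z with α = ∫v and z ∈ E_s it acts as (α, z) ↦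
(α, D_τ z). On mass-free functions its kernel k(ξ, y) may be replaced by k(ξ, y) - k(ξ, 0), and this
difference gains a factor e^{-sτ/2} for every s in [0, 1] with s < m - N/2
(`exists_norm_linearFlow_Es_le`). Since 2μ < min(1, m - N/2), one can take s/2 > μ, and a long time
T gives ‖D_T‖ ≤ e^{-μT}/2.

The nonlinearity is small and differentiable. The map v ↦ |∇v|^{q⋆} sends H¹_m to L^{2/q⋆}_m and has
a first order expansion with remainder of order q⋆ > 1. Truncation at radius ρ makes it bounded,
with Lipschitz constant O(ρ^{q⋆-1}) (`Mild.isNonlinearity_truncation`). Gaussian bounds and a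
weighted Schur–Young inequality show that e^{τ𝓛} maps L^{2/q⋆}_m back to H¹_m with norm O(τ^{-γ})
for small τ, where γ = 1/2 + N/(4(N+1)) < 1. For small ρ the Duhamel equation is therefore a
contraction on [0, T], with T independent of the data. Solutions glue to a global semiflow φ, and
φ_T differs from e^{T𝓛} by a bounded map with small Lipschitz constant and an expansion of the same
order (`Mild.exists_semiflow`).

The rest concerns one map (α, z) ↦ (α + R₁, D_T z + R₂) on ℝ × E_s. The graph transform contracts
the space of bounded 1-Lipschitz graphs, and its fixed point is f
(`CentreMap.IsSmall.transform_contracting`). The slope of f solves a fixed point equation of its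
own, and iterating the expansion along the map shows that this slope really is the derivative
(`tangent_estimate`). The vertical distance to the graph shrinks by lam + 2ε ≤ e^{-μT} per step,
whereas distances on the graph shrink by at most 1 - ε. Pulling back the base coordinate of an orbit
thus converges to the start of a shadowing orbit (`exists_phase`), and the gap between the two rates
makes it unique (`phase_unique`).

Invariance under every φ_τ, not only φ_T, follows because the graph contains every point with a
backward orbit of bounded z-component, and φ_τ commutes with φ_T, so it preserves such orbits
(`mapsTo_invariantSet`). -/

theorem norm_graph_sub {f : ℝ → E} (hf : ∀ x y, ‖f x - f y‖ ≤ |x - y|) (α β : ℝ) :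
    ‖(α, f α) - (β, f β)‖ = |α - β| := by
  rw [Prod.mk_sub_mk, Prod.norm_mk, Real.norm_eq_abs]
  exact max_eq_left (hf α β)

theorem norm_fibre_sub (α : ℝ) (z z' : E) : ‖(α, z) - (α, z')‖ = ‖z - z'‖ := by
  rw [Prod.mk_sub_mk, Prod.norm_mk, sub_self, norm_zero]
  exact max_eq_right (norm_nonneg _)

/-- The class of admissible graphs: bounded maps with Lipschitz constant one. -/
abbrev Graph (E : Type*) [NormedAddCommGroup E] : Type _ :=
  {f : ℝ →ᵇ E // ∀ x y, ‖f x - f y‖ ≤ |x - y|}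

theorem isClosed_graph : IsClosed {f : ℝ →ᵇ E | ∀ x y, ‖f x - f y‖ ≤ |x - y|} := by
  simp only [Set.ofPred_forall]
  refine isClosed_iInter fun x => isClosed_iInter fun y => ?_
  exact isClosed_le ((continuous_eval_const x).sub (continuous_eval_const y)).norm
    continuous_const

instance [CompleteSpace E] : CompleteSpace (Graph E) :=
  isClosed_graph.completeSpace_coe

instance : Nonempty (Graph E) := ⟨⟨0, by simp⟩⟩

variable [NormedSpace ℝ E]

/-- The map `(α, z) ↦ (α + R₁(α, z), B z + R₂(α, z))` on `ℝ × E`. -/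
def step (B : E →L[ℝ] E) (R : ℝ × E → ℝ × E) (x : ℝ × E) : ℝ × E :=
  (x.1 + (R x).1, B x.2 + (R x).2)

/-- `R` is a bounded perturbation, with small Lipschitz constant `ε`, of the map
`(α, z) ↦ (α, B z)` whose second component is a contraction. -/
structure IsSmall (B : E →L[ℝ] E) (R : ℝ × E → ℝ × E) (lam ε b : ℝ) : Prop where
  norm_le : ‖B‖ ≤ lam
  lip : ∀ x y, ‖R x - R y‖ ≤ ε * ‖x - y‖
  bdd : ∀ x, ‖R x‖ ≤ b
  lam_le : lam ≤ 1 / 4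
  eps_le : ε ≤ 1 / 8

/-- The induced map on the base: `α ↦ α + R₁(α, f α)`. -/
def base (R : ℝ × E → ℝ × E) (f : ℝ → E) (α : ℝ) : ℝ := α + (R (α, f α)).1

namespace IsSmall

variable {B : E →L[ℝ] E} {R : ℝ × E → ℝ × E} {lam ε b : ℝ}

theorem norm_apply_le (h : IsSmall B R lam ε b) (z : E) : ‖B z‖ ≤ lam * ‖z‖ :=
  (B.le_opNorm z).trans (mul_le_mul_of_nonneg_right h.norm_le (norm_nonneg z))

theorem lam_nonneg (h : IsSmall B R lam ε b) : 0 ≤ lam := (norm_nonneg B).trans h.norm_le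

theorem eps_nonneg (h : IsSmall B R lam ε b) : 0 ≤ ε := by
  have := h.lip (1, 0) (0, 0)
  have h1 : ‖((1 : ℝ), (0 : E)) - (0, 0)‖ = 1 := by simp [Prod.norm_def]
  rw [h1, mul_one] at this
  exact (norm_nonneg _).trans this

theorem lip_fst (h : IsSmall B R lam ε b) (x y : ℝ × E) :
    |(R x).1 - (R y).1| ≤ ε * ‖x - y‖ :=
  (norm_fst_le (R x - R y)).trans (h.lip x y)

theorem lip_snd (h : IsSmall B R lam ε b) (x y : ℝ × E) :
    ‖(R x).2 - (R y).2‖ ≤ ε * ‖x - y‖ :=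
  (norm_snd_le (R x - R y)).trans (h.lip x y)

/-- Along a 1-Lipschitz graph `R₁` has Lipschitz constant `ε`, so identity plus `R₁` shrinks
distances by at most `1 - ε`. This makes the base map invertible, and later keeps distinct orbits on
the manifold apart. -/
theorem base_expand (h : IsSmall B R lam ε b) {f : ℝ → E}
    (hf : ∀ x y, ‖f x - f y‖ ≤ |x - y|) (α β : ℝ) :
    (1 - ε) * |α - β| ≤ |base R f α - base R f β| := by
  have h1 := h.lip_fst (α, f α) (β, f β)
  rw [norm_graph_sub hf] at h1
  have h2 : α - β = (base R f α - base R f β) - ((R (α, f α)).1 - (R (β, f β)).1) := by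
    simp only [base]; ring
  have h3 := abs_sub (base R f α - base R f β) ((R (α, f α)).1 - (R (β, f β)).1)
  rw [← h2] at h3
  linarith

/-- Solving α + R₁(α, f α) = y is the fixed point problem α = y - R₁(α, f α), which is a contraction
since `ε ≤ 1/8`; the ratio 1/2 is a convenient over-estimate. -/
theorem base_surjective (h : IsSmall B R lam ε b) {f : ℝ → E}
    (hf : ∀ x y, ‖f x - f y‖ ≤ |x - y|) : Function.Surjective (base R f) := by
  intro y
  have hc : ContractingWith (1 / 2 : ℝ≥0) fun α => y - (R (α, f α)).1 := by
    refine ⟨by norm_num [← NNReal.coe_lt_coe], LipschitzWith.of_dist_le_mul fun α β => ?_⟩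
    rw [Real.dist_eq, Real.dist_eq]
    have h1 := h.lip_fst (β, f β) (α, f α)
    rw [norm_graph_sub hf, abs_sub_comm β α] at h1
    have h2 : y - (R (α, f α)).1 - (y - (R (β, f β)).1) = (R (β, f β)).1 - (R (α, f α)).1 := by
      ring
    rw [h2]
    push_cast
    nlinarith [abs_nonneg (α - β), h.eps_le]
  refine ⟨hc.fixedPoint, ?_⟩
  have := hc.fixedPoint_isFixedPt
  rw [Function.IsFixedPt] at this
  simp only [base]
  linarith

/-- A right inverse of the base map. -/
noncomputable def baseInv (h : IsSmall B R lam ε b) (f : Graph E) : ℝ → ℝ :=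
  Function.surjInv (h.base_surjective f.2)

theorem base_baseInv (h : IsSmall B R lam ε b) (f : Graph E) (β : ℝ) :
    base R f.1 (h.baseInv f β) = β :=
  Function.surjInv_eq (h.base_surjective f.2) β

theorem base_injective (h : IsSmall B R lam ε b) {f : ℝ → E}
    (hf : ∀ x y, ‖f x - f y‖ ≤ |x - y|) : Function.Injective (base R f) := by
  intro α β hab
  have := h.base_expand hf α β
  rw [hab, sub_self, abs_zero] at this
  have h1 : 0 < 1 - ε := by linarith [h.eps_le]
  have h2 : |α - β| ≤ 0 := by nlinarith [abs_nonneg (α - β)]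
  exact sub_eq_zero.mp (abs_nonpos_iff.mp h2)

theorem baseInv_base (h : IsSmall B R lam ε b) (f : Graph E) (α : ℝ) :
    h.baseInv f (base R f.1 α) = α :=
  h.base_injective f.2 (h.base_baseInv f _)

/-- The factor 8/7 is 1/(1 - ε) at the largest admissible ε = 1/8. -/
theorem baseInv_lip (h : IsSmall B R lam ε b) (f : Graph E) (α β : ℝ) :
    |h.baseInv f α - h.baseInv f β| ≤ 8 / 7 * |α - β| := by
  have := h.base_expand f.2 (h.baseInv f α) (h.baseInv f β)
  rw [h.base_baseInv, h.base_baseInv] at this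
  nlinarith [h.eps_le, abs_nonneg (h.baseInv f α - h.baseInv f β)]

/-- The image of the graph of `f` as a graph over the base. -/
noncomputable def transformFun (h : IsSmall B R lam ε b) (f : Graph E) (β : ℝ) : E :=
  B (f.1 (h.baseInv f β)) + (R (h.baseInv f β, f.1 (h.baseInv f β))).2

theorem transformFun_base (h : IsSmall B R lam ε b) (f : Graph E) (α : ℝ) :
    h.transformFun f (base R f.1 α) = B (f.1 α) + (R (α, f.1 α)).2 := by
  rw [transformFun, h.baseInv_base]

/-- The image varies by at most `lam + ε` times the displacement of the preimage, and pulling back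
costs 8/7. The product is at most (1/4 + 1/8)·8/7 = 3/7, so the class of 1-Lipschitz graphs is
preserved with room to spare. -/
theorem transformFun_lip (h : IsSmall B R lam ε b) (f : Graph E) (β β' : ℝ) :
    ‖h.transformFun f β - h.transformFun f β'‖ ≤ |β - β'| := by
  have h1 := h.lip_snd (h.baseInv f β, f.1 (h.baseInv f β)) (h.baseInv f β', f.1 (h.baseInv f β'))
  rw [norm_graph_sub f.2] at h1
  have h2 := h.norm_apply_le (f.1 (h.baseInv f β) - f.1 (h.baseInv f β'))
  rw [map_sub] at h2
  have h3 := f.2 (h.baseInv f β) (h.baseInv f β')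
  have h4 := h.baseInv_lip f β β'
  have h5 : ‖h.transformFun f β - h.transformFun f β'‖ ≤
      ‖B (f.1 (h.baseInv f β)) - B (f.1 (h.baseInv f β'))‖ +
      ‖(R (h.baseInv f β, f.1 (h.baseInv f β))).2
        - (R (h.baseInv f β', f.1 (h.baseInv f β'))).2‖ := by
    simp only [transformFun]
    rw [add_sub_add_comm]
    exact norm_add_le _ _
  nlinarith [h.lam_nonneg, h.eps_nonneg, h.lam_le, h.eps_le,
    abs_nonneg (h.baseInv f β - h.baseInv f β'), norm_nonneg (f.1 (h.baseInv f β)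
    - f.1 (h.baseInv f β')), mul_le_mul_of_nonneg_left h3 h.lam_nonneg]

/-- The graph transform. -/
noncomputable def transform (h : IsSmall B R lam ε b) (f : Graph E) : Graph E :=
  ⟨BoundedContinuousFunction.ofNormedAddCommGroup (h.transformFun f)
    (LipschitzWith.of_dist_le_mul (K := 1) fun x y => by
      rw [dist_eq_norm, NNReal.coe_one, one_mul, Real.dist_eq]
      exact h.transformFun_lip f x y).continuous
    (lam * ‖f.1‖ + b) fun β => by
      refine (norm_add_le _ _).trans (add_le_add ?_ ((norm_snd_le _).trans (h.bdd _)))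
      exact (h.norm_apply_le _).trans
        (mul_le_mul_of_nonneg_left (f.1.norm_coe_le_norm _) h.lam_nonneg),
    h.transformFun_lip f⟩

/-- The two images are compared over a common preimage α rather than over a common β. The heights
differ by `lam + ε` times the gap, and the base points of the images by a further `ε`; since the
second image is 1-Lipschitz, correcting the base point costs no more than that. In total `lam + 2ε ≤
1/2`. -/
theorem transform_contracting (h : IsSmall B R lam ε b) :
    ContractingWith (1 / 2 : ℝ≥0) h.transform := by
  refine ⟨by norm_num [← NNReal.coe_lt_coe], LipschitzWith.of_dist_le_mul fun f f' => ?_⟩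
  rw [Subtype.dist_eq, Subtype.dist_eq, BoundedContinuousFunction.dist_le (by positivity)]
  intro β
  obtain ⟨α, rfl⟩ := h.base_surjective f.2 β
  have hd : ‖f.1 α - f'.1 α‖ ≤ dist f.1 f'.1 := by
    rw [← dist_eq_norm]
    exact BoundedContinuousFunction.dist_coe_le_dist α
  have h1 : h.transformFun f (base R f.1 α) - h.transformFun f' (base R f'.1 α)
      = B (f.1 α - f'.1 α) + ((R (α, f.1 α)).2 - (R (α, f'.1 α)).2) := by
    rw [transformFun_base, transformFun_base, map_sub]
    abel
  have h2 := h.lip_snd (α, f.1 α) (α, f'.1 α)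
  have h3 := h.lip_fst (α, f'.1 α) (α, f.1 α)
  rw [norm_fibre_sub] at h2 h3
  rw [norm_sub_rev] at h3
  have h4 := h.transformFun_lip f' (base R f'.1 α) (base R f.1 α)
  have h5 : base R f'.1 α - base R f.1 α = (R (α, f'.1 α)).1 - (R (α, f.1 α)).1 := by
    simp only [base]; ring
  rw [h5] at h4
  have h6 := h.norm_apply_le (f.1 α - f'.1 α)
  change dist (h.transformFun f (base R f.1 α)) (h.transformFun f' (base R f.1 α)) ≤ _
  rw [dist_eq_norm]
  have h7 := norm_sub_le_norm_sub_add_norm_sub (h.transformFun f (base R f.1 α))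
    (h.transformFun f' (base R f'.1 α)) (h.transformFun f' (base R f.1 α))
  rw [h1] at h7
  have h8 := norm_add_le (B (f.1 α - f'.1 α)) ((R (α, f.1 α)).2 - (R (α, f'.1 α)).2)
  push_cast
  nlinarith [dist_nonneg (x := f.1) (y := f'.1), norm_nonneg (f.1 α - f'.1 α), h.lam_nonneg,
    h.eps_nonneg, h.lam_le, h.eps_le]

/-- One step of the equation satisfied by the derivative of the centre map. -/
noncomputable def slope (B : E →L[ℝ] E) (A : ℝ × E →L[ℝ] ℝ × E) (u : E) : E :=
  (1 + (A (1, u)).1)⁻¹ • (B u + (A (1, u)).2)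

/-! ### Slopes of invariant graphs and recovery of the derivative -/

section Slope

variable {A : ℝ × E →L[ℝ] ℝ × E}

theorem norm_deriv_apply_le (hA : ‖A‖ ≤ ε) {u : E} (hu : ‖u‖ ≤ 1) : ‖A (1, u)‖ ≤ ε := by
  have h1 : ‖((1 : ℝ), u)‖ ≤ 1 := by simp [Prod.norm_def, hu]
  calc ‖A (1, u)‖ ≤ ‖A‖ * ‖((1 : ℝ), u)‖ := A.le_opNorm _
    _ ≤ ‖A‖ * 1 := mul_le_mul_of_nonneg_left h1 (norm_nonneg A)
    _ ≤ ε := by linarith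

theorem one_add_fst_ge (h : IsSmall B R lam ε b) (hA : ‖A‖ ≤ ε) {u : E} (hu : ‖u‖ ≤ 1) :
    7 / 8 ≤ 1 + (A (1, u)).1 := by
  have := (norm_fst_le (A (1, u))).trans (norm_deriv_apply_le hA hu)
  rw [Real.norm_eq_abs] at this
  linarith [neg_abs_le (A (1, u)).1, h.eps_le]

theorem smul_slope (h : IsSmall B R lam ε b) (hA : ‖A‖ ≤ ε) {u : E} (hu : ‖u‖ ≤ 1) :
    (1 + (A (1, u)).1) • slope B A u = B u + (A (1, u)).2 := by
  have := h.one_add_fst_ge hA hu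
  rw [slope, smul_smul, mul_inv_cancel₀ (by linarith), one_smul]

/-- The numerator is at most `lam + ε ≤ 3/8` and the denominator at least 7/8, so the unit ball is
preserved when slopes are iterated. -/
theorem norm_slope_le (h : IsSmall B R lam ε b) (hA : ‖A‖ ≤ ε) {u : E} (hu : ‖u‖ ≤ 1) :
    ‖slope B A u‖ ≤ 1 := by
  have h1 := h.one_add_fst_ge hA hu
  have h2 := congrArg norm (h.smul_slope hA hu)
  rw [norm_smul, Real.norm_of_nonneg (by linarith)] at h2
  have h3 := norm_add_le (B u) (A (1, u)).2
  have h4 := h.norm_apply_le u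
  have h5 := (norm_snd_le (A (1, u))).trans (norm_deriv_apply_le hA hu)
  nlinarith [h.lam_le, h.eps_le, h.lam_nonneg, norm_nonneg (slope B A u), norm_nonneg u]

/-- Multiplying by the denominator of the first slope avoids differences of quotients: what remains
is bounded by `(lam + 2ε)‖u - u'‖ ≤ ½‖u - u'‖`, and division by 7/8 gives 4/7. -/
theorem slope_lip (h : IsSmall B R lam ε b) (hA : ‖A‖ ≤ ε) {u u' : E} (hu : ‖u‖ ≤ 1)
    (hu' : ‖u'‖ ≤ 1) : ‖slope B A u - slope B A u'‖ ≤ 4 / 7 * ‖u - u'‖ := by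
  have h1 := h.one_add_fst_ge hA hu
  have e : A (1, u) - A (1, u') = A (0, u - u') := by
    rw [← map_sub]; simp
  have h0 : ‖((0 : ℝ), u - u')‖ = ‖u - u'‖ := by simp [Prod.norm_def]
  have h2 : ‖A (0, u - u')‖ ≤ ε * ‖u - u'‖ := by
    refine (A.le_opNorm _).trans ?_
    rw [h0]
    exact mul_le_mul_of_nonneg_right hA (norm_nonneg _)
  have h3 : (1 + (A (1, u)).1) • (slope B A u - slope B A u') =
      B (u - u') + (A (0, u - u')).2 - (A (0, u - u')).1 • slope B A u' := by
    have k1 := h.smul_slope hA hu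
    have k2 := h.smul_slope hA hu'
    have e1 : (A (0, u - u')).1 = (A (1, u)).1 - (A (1, u')).1 := by rw [← e]; rfl
    have e2 : (A (0, u - u')).2 = (A (1, u)).2 - (A (1, u')).2 := by rw [← e]; rfl
    rw [e1, e2, smul_sub, k1, map_sub]
    have : (1 + (A (1, u)).1) • slope B A u' =
        (1 + (A (1, u')).1) • slope B A u' + ((A (1, u)).1 - (A (1, u')).1) • slope B A u' := by
      rw [← add_smul]; congr 1; ring
    rw [this, k2]
    abel
  have h4 := congrArg norm h3
  rw [norm_smul, Real.norm_of_nonneg (by linarith)] at h4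
  have h5 := norm_sub_le (B (u - u') + (A (0, u - u')).2) ((A (0, u - u')).1 • slope B A u')
  have h6 := norm_add_le (B (u - u')) (A (0, u - u')).2
  have h7 := (norm_snd_le (A (0, u - u'))).trans h2
  have h8 := (norm_fst_le (A (0, u - u'))).trans h2
  have h9 : ‖(A (0, u - u')).1 • slope B A u'‖ ≤ ε * ‖u - u'‖ := by
    rw [norm_smul]
    have := h.norm_slope_le hA hu'
    nlinarith [norm_nonneg (A (0, u - u')).1, norm_nonneg (slope B A u')]
  have h10 := h.norm_apply_le (u - u')
  nlinarith [h.lam_le, h.eps_le, h.lam_nonneg, h.eps_nonneg,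
    norm_nonneg (slope B A u - slope B A u'), norm_nonneg (u - u')]

end Slope

theorem hasDerivAt_of_tangent_estimate {f p : ℝ → E} {c θ : ℝ} (hθ : 0 < θ)
    (hf : ∀ α β : ℝ, ‖f β - f α - (β - α) • p α‖ ≤ c * |β - α| ^ (1 + θ)) (α : ℝ) :
    HasDerivAt f (p α) α := by
  rw [hasDerivAt_iff_isLittleO]
  refine Asymptotics.IsBigO.trans_isLittleO
    (g := fun β : ℝ => ‖β - α‖ ^ (1 + θ)) ?_ ?_
  · refine Asymptotics.IsBigO.of_bound c (Eventually.of_forall fun β => ?_)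
    rw [Real.norm_of_nonneg (by positivity : 0 ≤ ‖β - α‖ ^ (1 + θ))]
    exact hf α β
  · have h1 : (fun β : ℝ => ‖β - α‖ ^ (1 + θ)) = fun β => ‖β - α‖ ^ θ * ‖β - α‖ := by
      funext β
      rw [add_comm, Real.rpow_add' (norm_nonneg _) (by linarith), Real.rpow_one]
    rw [h1]
    have h2 : Tendsto (fun β : ℝ => ‖β - α‖ ^ θ) (𝓝 α) (𝓝 0) := by
      have : Continuous fun β : ℝ => ‖β - α‖ ^ θ :=
        (continuous_id.sub continuous_const).norm.rpow_const fun _ => Or.inr hθ.le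
      simpa [Real.zero_rpow hθ.ne'] using this.tendsto α
    have h3 := (Asymptotics.isLittleO_one_iff ℝ).mpr h2
    have h4 := h3.mul_isBigO (Asymptotics.isBigO_refl (fun β : ℝ => ‖β - α‖) (𝓝 α))
    simp only [one_mul] at h4
    exact h4.norm_right.trans_isBigO
      (Asymptotics.IsBigO.of_bound 1 (Eventually.of_forall fun β => by simp))

/-- Adding the estimate at (α, β) to the one at (β, α) eliminates `f` and leaves (β - α)(p β - p α),
so `p` is even Hölder continuous with exponent θ. -/
theorem continuous_of_tangent_estimate {f p : ℝ → E} {c θ : ℝ} (hθ : 0 < θ)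
    (hf : ∀ α β : ℝ, ‖f β - f α - (β - α) • p α‖ ≤ c * |β - α| ^ (1 + θ)) :
    Continuous p := by
  have key : ∀ α β : ℝ, ‖p β - p α‖ ≤ 2 * c * |β - α| ^ θ := by
    intro α β
    rcases eq_or_ne α β with rfl | hne
    · simp [Real.zero_rpow hθ.ne']
    have hpos : 0 < |β - α| := abs_pos.mpr (sub_ne_zero.mpr hne.symm)
    have h1 := hf α β
    have h2 := hf β α
    have h3 : (β - α) • (p β - p α) = (f β - f α - (β - α) • p α) + (f α - f β - (α - β) • p β) := by
      rw [smul_sub, ← neg_sub β α, neg_smul]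
      abel
    have h4 := norm_add_le (f β - f α - (β - α) • p α) (f α - f β - (α - β) • p β)
    rw [← h3, norm_smul, Real.norm_eq_abs] at h4
    rw [abs_sub_comm α β] at h2
    rw [Real.rpow_add hpos, Real.rpow_one] at h1 h2
    have : |β - α| * ‖p β - p α‖ ≤ |β - α| * (2 * c * |β - α| ^ θ) := by linarith
    exact le_of_mul_le_mul_left this hpos
  rw [continuous_iff_continuousAt]
  intro α
  rw [ContinuousAt, tendsto_iff_norm_sub_tendsto_zero]
  have h1 : Tendsto (fun β : ℝ => 2 * c * |β - α| ^ θ) (𝓝 α) (𝓝 0) := by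
    have : Continuous fun β : ℝ => 2 * c * |β - α| ^ θ :=
      ((continuous_id.sub continuous_const).abs.rpow_const fun _ => Or.inr hθ.le).const_mul _
    simpa [Real.zero_rpow hθ.ne'] using this.tendsto α
  exact squeeze_zero (fun _ => norm_nonneg _) (fun β => key α β) h1

variable [CompleteSpace E]

/-- The map whose graph is the centre manifold. -/
noncomputable def centre (h : IsSmall B R lam ε b) : Graph E :=
  h.transform_contracting.fixedPoint

/-- This is the fixed point equation read along the parametrisation β = base α, a form in which the
inverse of the base map no longer appears. -/
theorem centre_base (h : IsSmall B R lam ε b) (α : ℝ) :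
    h.centre.1 (base R h.centre.1 α) = B (h.centre.1 α) + (R (α, h.centre.1 α)).2 := by
  have h1 : h.transform h.centre = h.centre := h.transform_contracting.fixedPoint_isFixedPt
  rw [← h.transformFun_base]
  exact (congrArg (fun g : Graph E => g.1 (base R h.centre.1 α)) h1).symm

/-- The vertical distance to the centre manifold is contracted. -/
theorem step_dist (h : IsSmall B R lam ε b) (x : ℝ × E) :
    ‖(step B R x).2 - h.centre.1 (step B R x).1‖ ≤
      (lam + 2 * ε) * ‖x.2 - h.centre.1 x.1‖ := by
  obtain ⟨α, z⟩ := x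
  set f := h.centre with hf
  have h1 := h.lip_snd (α, z) (α, f.1 α)
  have h2 := h.lip_fst (α, f.1 α) (α, z)
  rw [norm_fibre_sub] at h1 h2
  rw [norm_sub_rev] at h2
  -- The point of the graph below (α, z) is mapped over a slightly different base point. Correcting
  -- this along the 1-Lipschitz graph costs one more `ε`, hence the factor `lam + 2ε`.
  have h3 := f.2 (base R f.1 α) (step B R (α, z)).1
  have h4 : base R f.1 α - (step B R (α, z)).1 = (R (α, f.1 α)).1 - (R (α, z)).1 := by
    simp only [base, step]; ring
  rw [h4, h.centre_base] at h3
  have h5 := h.norm_apply_le (z - f.1 α)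
  have h6 : (step B R (α, z)).2 - f.1 (step B R (α, z)).1 =
      B (z - f.1 α) + ((R (α, z)).2 - (R (α, f.1 α)).2)
      + (B (f.1 α) + (R (α, f.1 α)).2 - f.1 (step B R (α, z)).1) := by
    rw [map_sub]
    simp only [step]
    abel
  rw [h6]
  refine (norm_add₃_le).trans ?_
  dsimp only
  linarith

/-- The points of the centre manifold. -/
def manifold (h : IsSmall B R lam ε b) : Set (ℝ × E) := range fun α => (α, h.centre.1 α)

theorem mem_manifold_iff (h : IsSmall B R lam ε b) (x : ℝ × E) :
    x ∈ h.manifold ↔ x.2 = h.centre.1 x.1 := by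
  constructor
  · rintro ⟨α, rfl⟩
    rfl
  · intro hx
    exact ⟨x.1, Prod.ext rfl hx.symm⟩

theorem step_centre (h : IsSmall B R lam ε b) (α : ℝ) :
    step B R (α, h.centre.1 α) =
      (base R h.centre.1 α, h.centre.1 (base R h.centre.1 α)) := by
  rw [h.centre_base]
  rfl

theorem image_manifold (h : IsSmall B R lam ε b) : step B R '' h.manifold = h.manifold := by
  ext x
  constructor
  · rintro ⟨_, ⟨α, rfl⟩, rfl⟩
    exact ⟨_, (h.step_centre α).symm⟩
  · rintro ⟨β, rfl⟩
    obtain ⟨α, rfl⟩ := h.base_surjective h.centre.2 β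
    exact ⟨_, ⟨α, rfl⟩, h.step_centre α⟩

/-- A point with a backward orbit whose second component stays bounded lies on the manifold. -/
theorem mem_manifold_of_backward (h : IsSmall B R lam ε b) (u : ℕ → ℝ × E)
    (hu : ∀ n, step B R (u (n + 1)) = u n) (c : ℝ) (hc : ∀ n, ‖(u n).2‖ ≤ c) :
    u 0 ∈ h.manifold := by
  rw [mem_manifold_iff]
  have h1 : ∀ n, ‖(u 0).2 - h.centre.1 (u 0).1‖ ≤
      (lam + 2 * ε) ^ n * ‖(u n).2 - h.centre.1 (u n).1‖ := by
    intro n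
    induction n with
    | zero => simp
    | succ n ih =>
      have := h.step_dist (u (n + 1))
      rw [hu] at this
      refine ih.trans ?_
      rw [pow_succ, mul_assoc]
      exact mul_le_mul_of_nonneg_left this
        (pow_nonneg (by linarith [h.lam_nonneg, h.eps_nonneg]) n)
  have h2 : ∀ n, ‖(u 0).2 - h.centre.1 (u 0).1‖ ≤
      (lam + 2 * ε) ^ n * (c + ‖h.centre.1‖) := by
    intro n
    refine (h1 n).trans (mul_le_mul_of_nonneg_left ?_
      (pow_nonneg (by linarith [h.lam_nonneg, h.eps_nonneg]) n))
    exact (norm_sub_le _ _).trans (add_le_add (hc n) (h.centre.1.norm_coe_le_norm _))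
  have h3 : Tendsto (fun n : ℕ => (lam + 2 * ε) ^ n * (c + ‖h.centre.1‖)) atTop (𝓝 0) := by
    simpa using (tendsto_pow_atTop_nhds_zero_of_lt_one
      (by linarith [h.lam_nonneg, h.eps_nonneg] : 0 ≤ lam + 2 * ε)
      (by linarith [h.lam_le, h.eps_le])).mul_const (c + ‖h.centre.1‖)
  have h4 := ge_of_tendsto' h3 h2
  exact sub_eq_zero.mp (norm_le_zero_iff.mp h4)

/-- The origin is a fixed point, hence its own bounded backward orbit. -/
theorem centre_zero (h : IsSmall B R lam ε b) (h0 : R 0 = 0) : h.centre.1 0 = 0 := by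
  have := h.mem_manifold_of_backward (fun _ => 0) (fun n => by simp [step, h0]) 0 (by simp)
  rw [mem_manifold_iff] at this
  exact this.symm

/-- The relation satisfied by `p` is obtained by formally differentiating the invariance of the
graph. Iterating it from the zero field gives increments of size (4/7)^n, by `slope_lip`. Pointwise
limits suffice: neither `A` nor `p` needs to be continuous here, because continuity of `p` is
recovered afterwards from the tangent estimate. -/
theorem exists_slope_field (h : IsSmall B R lam ε b) (A : ℝ × E → ℝ × E →L[ℝ] ℝ × E)
    (hA : ∀ x, ‖A x‖ ≤ ε) : ∃ p : ℝ → E, (∀ α, ‖p α‖ ≤ 1) ∧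
      ∀ α, p (base R h.centre.1 α) = slope B (A (α, h.centre.1 α)) (p α) := by
  let Ψ : (ℝ → E) → ℝ → E := fun p β =>
    slope B (A (h.baseInv h.centre β, h.centre.1 (h.baseInv h.centre β)))
      (p (h.baseInv h.centre β))
  let P : ℕ → ℝ → E := fun n => Ψ^[n] 0
  have hP : ∀ n β, P (n + 1) β = Ψ (P n) β := fun n β => by
    simp only [P, Function.iterate_succ_apply']
  have hb : ∀ n β, ‖P n β‖ ≤ 1 := by
    intro n
    induction n with
    | zero => intro β; simp [P]
    | succ n ih =>
      intro β
      rw [hP]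
      exact h.norm_slope_le (hA _) (ih _)
  have hd : ∀ n β, dist (P n β) (P (n + 1) β) ≤ 1 * (4 / 7) ^ n := by
    intro n
    induction n with
    | zero =>
      intro β
      rw [pow_zero, dist_eq_norm, norm_sub_rev]
      simpa [P] using hb 1 β
    | succ n ih =>
      intro β
      rw [hP n, hP (n + 1), dist_eq_norm]
      refine (h.slope_lip (hA _) (hb n _) (hb (n + 1) _)).trans ?_
      have := ih (h.baseInv h.centre β)
      rw [dist_eq_norm] at this
      rw [pow_succ]
      linarith
  have hcau : ∀ β, ∃ l, Tendsto (fun n => P n β) atTop (𝓝 l) := fun β =>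
    cauchySeq_tendsto_of_complete (cauchySeq_of_le_geometric _ _ (by norm_num) fun n => hd n β)
  choose p hp using hcau
  have hp1 : ∀ α, ‖p α‖ ≤ 1 := fun α =>
    le_of_tendsto' (hp α).norm fun n => hb n α
  refine ⟨p, hp1, fun α => ?_⟩
  have h1 : Tendsto (fun n => P (n + 1) (base R h.centre.1 α)) atTop
      (𝓝 (p (base R h.centre.1 α))) := (hp _).comp (tendsto_add_atTop_nat 1)
  refine tendsto_nhds_unique h1 ?_
  rw [tendsto_iff_norm_sub_tendsto_zero]
  have h2 : Tendsto (fun n => 4 / 7 * ‖P n α - p α‖) atTop (𝓝 0) := by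
    simpa using (tendsto_iff_norm_sub_tendsto_zero.mp (hp α)).const_mul (4 / 7)
  refine squeeze_zero (fun _ => norm_nonneg _) (fun n => ?_) h2
  have h3 : P (n + 1) (base R h.centre.1 α) = slope B (A (α, h.centre.1 α)) (P n α) := by
    rw [hP]
    simp only [Ψ, h.baseInv_base]
  rw [h3]
  exact h.slope_lip (hA _) (hb n α) (hp1 α)

/-- The deviation of `f` from its tangent satisfies a contraction estimate along the map. -/
theorem tangent_step (h : IsSmall B R lam ε b) {A : ℝ × E → ℝ × E →L[ℝ] ℝ × E}
    (hA : ∀ x, ‖A x‖ ≤ ε) {c θ : ℝ}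
    (hR : ∀ x y, ‖R y - R x - A x (y - x)‖ ≤ c * ‖y - x‖ ^ (1 + θ))
    {p : ℝ → E} (hp1 : ∀ α, ‖p α‖ ≤ 1)
    (hp : ∀ α, p (base R h.centre.1 α) = slope B (A (α, h.centre.1 α)) (p α)) (α β : ℝ) :
    ‖h.centre.1 (base R h.centre.1 β) - h.centre.1 (base R h.centre.1 α)
        - (base R h.centre.1 β - base R h.centre.1 α) • p (base R h.centre.1 α)‖ ≤
      1 / 2 * ‖h.centre.1 β - h.centre.1 α - (β - α) • p α‖ + 2 * c * |β - α| ^ (1 + θ) := by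
  set f := h.centre.1 with hf
  set x : ℝ × E := (α, f α) with hx
  set D := f β - f α - (β - α) • p α with hD
  set Q := R (β, f β) - R x - A x ((β, f β) - x) with hQ
  have hQn : ‖Q‖ ≤ c * |β - α| ^ (1 + θ) := by
    have := hR x (β, f β)
    rwa [norm_graph_sub h.centre.2] at this
  have hxy : (β, f β) - x = (β - α) • ((1 : ℝ), p α) + (0, D) := by
    rw [hx, hD]
    ext <;> simp
  have hAx : A x ((β, f β) - x) = (β - α) • A x (1, p α) + A x (0, D) := by
    rw [hxy, map_add, map_smul]
  have hRβ : R (β, f β) = R x + ((β - α) • A x (1, p α) + A x (0, D)) + Q := by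
    rw [hQ, hAx]; abel
  have hb1 : base R f β - base R f α =
      (β - α) * (1 + (A x (1, p α)).1) + (A x (0, D)).1 + Q.1 := by
    simp only [base]
    rw [hRβ]
    simp only [Prod.fst_add, Prod.smul_fst, smul_eq_mul]
    ring
  have hs := h.smul_slope (hA x) (hp1 α)
  rw [← hp α] at hs
  -- By the slope equation the multiples of β - α cancel exactly, leaving only `D` and the remainder
  -- `Q`. As ‖p‖ ≤ 1, the terms in `D` add up to `(lam + 2ε)‖D‖ ≤ ½‖D‖`, and `Q` enters at most
  -- twice.
  have hkey : f (base R f β) - f (base R f α) - (base R f β - base R f α) • p (base R f α) =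
      B D + (A x (0, D)).2 + Q.2 - ((A x (0, D)).1 + Q.1) • p (base R f α) := by
    rw [hb1, h.centre_base, h.centre_base, ← hf, hRβ]
    have e1 : ((β - α) * (1 + (A x (1, p α)).1) + (A x (0, D)).1 + Q.1) • p (base R f α) =
        (β - α) • (B (p α) + (A x (1, p α)).2) + ((A x (0, D)).1 + Q.1) • p (base R f α) := by
      rw [← hs, smul_smul, ← add_smul]
      congr 1
      ring
    have e2 : B D = B (f β) - B (f α) - (β - α) • B (p α) := by
      rw [hD, map_sub, map_sub, map_smul]
    rw [e1, e2, smul_add]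
    simp only [Prod.snd_add, Prod.smul_snd]
    abel
  rw [hkey]
  have h0 : ‖((0 : ℝ), D)‖ = ‖D‖ := by simp [Prod.norm_def]
  have h2 : ‖A x (0, D)‖ ≤ ε * ‖D‖ := by
    refine ((A x).le_opNorm _).trans ?_
    rw [h0]
    exact mul_le_mul_of_nonneg_right (hA x) (norm_nonneg _)
  have k1 := norm_sub_le (B D + (A x (0, D)).2 + Q.2) (((A x (0, D)).1 + Q.1) • p (base R f α))
  have k2 := norm_add₃_le (a := B D) (b := (A x (0, D)).2) (c := Q.2)
  have k3 : ‖((A x (0, D)).1 + Q.1) • p (base R f α)‖ ≤ ‖(A x (0, D)).1‖ + ‖Q.1‖ := by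
    rw [norm_smul]
    have := norm_add_le (A x (0, D)).1 Q.1
    nlinarith [hp1 (base R f α), norm_nonneg (p (base R f α)),
      norm_nonneg ((A x (0, D)).1 + Q.1)]
  have k4 := (norm_fst_le (A x (0, D))).trans h2
  have k5 := (norm_snd_le (A x (0, D))).trans h2
  have k6 := (norm_fst_le Q).trans hQn
  have k7 := (norm_snd_le Q).trans hQn
  have k8 := h.norm_apply_le D
  nlinarith [h.lam_le, h.eps_le, norm_nonneg D]

/-- Start from the crude bound 2|β - α|, valid because `f` and `p` are bounded by one in the
relevant senses, and apply `tangent_step` along preimages under the base map. Each step multiplies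
the linear term by ½·8/7 = 4/7, so it disappears in the limit. The superlinear term reproduces
itself: (½·8c + 2c)·64/49 ≤ 8c, where 64/49 = (8/7)² bounds (8/7)^{1+θ} since θ ≤ 1. -/
theorem tangent_estimate (h : IsSmall B R lam ε b) {A : ℝ × E → ℝ × E →L[ℝ] ℝ × E}
    (hA : ∀ x, ‖A x‖ ≤ ε) {c θ : ℝ} (hc : 0 ≤ c) (hθ : 0 < θ) (hθ1 : θ ≤ 1)
    (hR : ∀ x y, ‖R y - R x - A x (y - x)‖ ≤ c * ‖y - x‖ ^ (1 + θ))
    {p : ℝ → E} (hp1 : ∀ α, ‖p α‖ ≤ 1)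
    (hp : ∀ α, p (base R h.centre.1 α) = slope B (A (α, h.centre.1 α)) (p α)) (α β : ℝ) :
    ‖h.centre.1 β - h.centre.1 α - (β - α) • p α‖ ≤ 8 * c * |β - α| ^ (1 + θ) := by
  have key : ∀ n : ℕ, ∀ α β : ℝ, ‖h.centre.1 β - h.centre.1 α - (β - α) • p α‖ ≤
      8 * c * |β - α| ^ (1 + θ) + 2 * (4 / 7) ^ n * |β - α| := by
    intro n
    induction n with
    | zero =>
      intro α β
      have h1 := norm_sub_le (h.centre.1 β - h.centre.1 α) ((β - α) • p α)
      have h2 := h.centre.2 β α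
      rw [norm_smul, Real.norm_eq_abs] at h1
      have h3 : 0 ≤ 8 * c * |β - α| ^ (1 + θ) := by positivity
      rw [pow_zero]
      nlinarith [hp1 α, abs_nonneg (β - α)]
    | succ n ih =>
      intro α' β'
      obtain ⟨α, rfl⟩ := h.base_surjective h.centre.2 α'
      obtain ⟨β, rfl⟩ := h.base_surjective h.centre.2 β'
      have h1 := h.tangent_step hA hR hp1 hp α β
      have h2 := ih α β
      set δ := |β - α|
      set δ' := |base R h.centre.1 β - base R h.centre.1 α| with hδ'
      have h3 : δ ≤ 8 / 7 * δ' := by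
        have := h.base_expand h.centre.2 β α
        nlinarith [h.eps_le, abs_nonneg (β - α)]
      have h4 : δ ^ (1 + θ) ≤ 64 / 49 * δ' ^ (1 + θ) := by
        calc δ ^ (1 + θ) ≤ (8 / 7 * δ') ^ (1 + θ) :=
              Real.rpow_le_rpow (abs_nonneg _) h3 (by linarith)
          _ = (8 / 7) ^ (1 + θ) * δ' ^ (1 + θ) :=
              Real.mul_rpow (by norm_num) (abs_nonneg _)
          _ ≤ (8 / 7) ^ (2 : ℝ) * δ' ^ (1 + θ) :=
              mul_le_mul_of_nonneg_right
                (Real.rpow_le_rpow_of_exponent_le (by norm_num) (by linarith)) (by positivity)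
          _ = 64 / 49 * δ' ^ (1 + θ) := by norm_num
      have h5 : (0 : ℝ) ≤ (4 / 7) ^ n := by positivity
      have h6 : c * δ ^ (1 + θ) ≤ c * (64 / 49 * δ' ^ (1 + θ)) :=
        mul_le_mul_of_nonneg_left h4 hc
      have h7 : (4 / 7 : ℝ) ^ n * δ ≤ (4 / 7) ^ n * (8 / 7 * δ') :=
        mul_le_mul_of_nonneg_left h3 h5
      have h8 : 0 ≤ c * δ' ^ (1 + θ) := by positivity
      rw [pow_succ]
      linarith
  have hlim : Tendsto (fun n : ℕ => 8 * c * |β - α| ^ (1 + θ) + 2 * (4 / 7) ^ n * |β - α|)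
      atTop (𝓝 (8 * c * |β - α| ^ (1 + θ) + 2 * 0 * |β - α|)) :=
    (((tendsto_pow_atTop_nhds_zero_of_lt_one (by norm_num) (by norm_num)).const_mul
      2).mul_const _).const_add _
  have := ge_of_tendsto' hlim fun n => key n α β
  simpa using this

/-- The centre map is continuously differentiable when the perturbation has a first order
expansion with a remainder of higher order. -/
theorem contDiff_centre (h : IsSmall B R lam ε b) {A : ℝ × E → ℝ × E →L[ℝ] ℝ × E}
    (hA : ∀ x, ‖A x‖ ≤ ε) {c θ : ℝ} (hc : 0 ≤ c) (hθ : 0 < θ) (hθ1 : θ ≤ 1)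
    (hR : ∀ x y, ‖R y - R x - A x (y - x)‖ ≤ c * ‖y - x‖ ^ (1 + θ))
    (h0 : R 0 = 0) (hA0 : A 0 = 0) :
    ContDiff ℝ 1 h.centre.1 ∧ HasDerivAt h.centre.1 0 0 := by
  obtain ⟨p, hp1, hp⟩ := h.exists_slope_field A hA
  have ht := h.tangent_estimate hA hc hθ hθ1 hR hp1 hp
  have hd := hasDerivAt_of_tangent_estimate hθ ht
  refine ⟨?_, ?_⟩
  · rw [contDiff_one_iff_deriv]
    refine ⟨fun α => (hd α).differentiableAt, ?_⟩
    have : deriv h.centre.1 = p := funext fun α => (hd α).deriv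
    rw [this]
    exact continuous_of_tangent_estimate hθ ht
  · have hz := h.centre_zero h0
    have h1 := hp 0
    rw [hz] at h1
    have h2 : base R h.centre.1 0 = 0 := by
      simp only [base, hz, zero_add]
      rw [← Prod.zero_eq_mk, h0]
      rfl
    rw [h2, ← Prod.zero_eq_mk, hA0] at h1
    have h3 : p 0 = B (p 0) := by simpa [slope] using h1
    have h4 := h.norm_apply_le (p 0)
    rw [← h3] at h4
    have h5 : ‖p 0‖ ≤ 0 := by nlinarith [h.lam_le, norm_nonneg (p 0)]
    have h6 := hd 0
    rwa [norm_le_zero_iff.mp h5] at h6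

/-! #### Asymptotic phase -/

theorem iterate_step_centre (h : IsSmall B R lam ε b) (α : ℝ) (n : ℕ) :
    (step B R)^[n] (α, h.centre.1 α) =
      ((base R h.centre.1)^[n] α, h.centre.1 ((base R h.centre.1)^[n] α)) := by
  induction n with
  | zero => rfl
  | succ n ih => rw [Function.iterate_succ_apply', ih, h.step_centre, Function.iterate_succ_apply']

theorem iterate_dist (h : IsSmall B R lam ε b) (x : ℝ × E) (n : ℕ) :
    ‖((step B R)^[n] x).2 - h.centre.1 ((step B R)^[n] x).1‖ ≤
      (lam + 2 * ε) ^ n * ‖x.2 - h.centre.1 x.1‖ := by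
  induction n with
  | zero => simp
  | succ n ih =>
    rw [Function.iterate_succ_apply']
    refine (h.step_dist _).trans ?_
    rw [pow_succ', mul_assoc]
    exact mul_le_mul_of_nonneg_left ih (by linarith [h.lam_nonneg, h.eps_nonneg])

theorem base_sub_step (h : IsSmall B R lam ε b) (x : ℝ × E) :
    |base R h.centre.1 x.1 - (step B R x).1| ≤ ε * ‖x.2 - h.centre.1 x.1‖ := by
  obtain ⟨α, z⟩ := x
  have h2 := h.lip_fst (α, h.centre.1 α) (α, z)
  rw [norm_fibre_sub, norm_sub_rev] at h2
  have h4 : base R h.centre.1 α - (step B R (α, z)).1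
      = (R (α, h.centre.1 α)).1 - (R (α, z)).1 := by
    simp only [base, step]; ring
  dsimp only
  rwa [h4]

/-- Every orbit is shadowed by an orbit on the centre manifold. -/
theorem exists_phase (h : IsSmall B R lam ε b) (x : ℝ × E) :
    ∃ β : ℝ, ∃ c : ℝ, ∀ n : ℕ,
      ‖(step B R)^[n] x - (step B R)^[n] (β, h.centre.1 β)‖ ≤ c * (lam + 2 * ε) ^ n := by
  set κ := lam + 2 * ε with hκ
  have hκ0 : 0 ≤ κ := by linarith [h.lam_nonneg, h.eps_nonneg]
  have hκ1 : κ ≤ 1 / 2 := by linarith [h.lam_le, h.eps_le]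
  set d := ‖x.2 - h.centre.1 x.1‖ with hd
  have hd0 : 0 ≤ d := norm_nonneg _
  -- The base coordinates `a n` of the given orbit form a pseudo-orbit of the base map whose errors
  -- decay like κ^n. The shadowing orbit starts at the limit of the pullbacks K^j (a j).
  let a : ℕ → ℝ := fun n => ((step B R)^[n] x).1
  let K := h.baseInv h.centre
  have hK : ∀ s t, |K s - K t| ≤ 8 / 7 * |s - t| := h.baseInv_lip h.centre
  have hKn : ∀ n s t, |K^[n] s - K^[n] t| ≤ (8 / 7) ^ n * |s - t| := by
    intro n
    induction n with
    | zero => simp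
    | succ n ih =>
      intro s t
      rw [Function.iterate_succ_apply', Function.iterate_succ_apply', pow_succ', mul_assoc]
      exact (hK _ _).trans (mul_le_mul_of_nonneg_left (ih s t) (by norm_num))
  have ha : ∀ n, |K (a (n + 1)) - a n| ≤ κ ^ n * d := by
    intro n
    have h1 := h.base_sub_step ((step B R)^[n] x)
    rw [← Function.iterate_succ_apply' (step B R)] at h1
    have h2 := hK (a (n + 1)) (base R h.centre.1 (a n))
    have h3 : K (base R h.centre.1 (a n)) = a n := h.baseInv_base h.centre _
    rw [h3, abs_sub_comm (a (n + 1))] at h2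
    have h4 := h.iterate_dist x n
    have h5 : |base R h.centre.1 (a n) - a (n + 1)| ≤ ε * (κ ^ n * d) :=
      h1.trans (mul_le_mul_of_nonneg_left h4 h.eps_nonneg)
    have h6 : 0 ≤ κ ^ n * d := by positivity
    nlinarith [h.eps_le]
  -- Each pullback amplifies an error by at most 8/7, while the errors themselves decay with ratio κ
  -- ≤ 1/2; the product 4/7 makes the pullbacks Cauchy. Summing the geometric series gives the
  -- factor 1/(1 - 4/7) = 7/3.
  have hcau : ∀ n, ∃ l, Tendsto (fun j => K^[j] (a (n + j))) atTop (𝓝 l) ∧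
      |a n - l| ≤ 7 / 3 * d * κ ^ n := by
    intro n
    have hstep : ∀ j, dist (K^[j] (a (n + j))) (K^[j + 1] (a (n + (j + 1)))) ≤
        (κ ^ n * d) * (4 / 7) ^ j := by
      intro j
      rw [Function.iterate_succ_apply, Real.dist_eq, abs_sub_comm]
      refine (hKn j _ _).trans ?_
      have h1 := ha (n + j)
      rw [pow_add] at h1
      have h2 : κ ^ j ≤ (1 / 2) ^ j := pow_le_pow_left₀ hκ0 hκ1 j
      have h3 : (8 / 7 : ℝ) ^ j * (1 / 2) ^ j = (4 / 7) ^ j := by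
        rw [← mul_pow]; norm_num
      calc (8 / 7 : ℝ) ^ j * |K (a (n + (j + 1))) - a (n + j)|
          ≤ (8 / 7 : ℝ) ^ j * (κ ^ n * κ ^ j * d) :=
            mul_le_mul_of_nonneg_left h1 (by positivity)
        _ ≤ (8 / 7 : ℝ) ^ j * (κ ^ n * (1 / 2) ^ j * d) := by gcongr
        _ = (κ ^ n * d) * (4 / 7) ^ j := by rw [← h3]; ring
    obtain ⟨l, hl⟩ := cauchySeq_tendsto_of_complete
      (cauchySeq_of_le_geometric (4 / 7) (κ ^ n * d) (by norm_num) hstep)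
    refine ⟨l, hl, ?_⟩
    have := dist_le_of_le_geometric_of_tendsto₀ (4 / 7) (κ ^ n * d) (by norm_num) hstep hl
    rw [Real.dist_eq] at this
    simp only [Function.iterate_zero, id, add_zero] at this
    refine this.trans (le_of_eq ?_)
    ring
  choose l hl hla using hcau
  have hbase_lip : ∀ s t, |base R h.centre.1 s - base R h.centre.1 t| ≤ 2 * |s - t| := by
    intro s t
    have h1 := h.lip_fst (s, h.centre.1 s) (t, h.centre.1 t)
    rw [norm_graph_sub h.centre.2] at h1
    have h2 : base R h.centre.1 s - base R h.centre.1 t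
        = (s - t) + ((R (s, h.centre.1 s)).1 - (R (t, h.centre.1 t)).1) := by
      simp only [base]; ring
    rw [h2]
    refine (abs_add_le _ _).trans ?_
    nlinarith [h.eps_le, abs_nonneg (s - t)]
  have hbase_cont : Continuous (base R h.centre.1) :=
    (LipschitzWith.of_dist_le_mul (K := 2) fun s t => by
      rw [Real.dist_eq, Real.dist_eq]; exact hbase_lip s t).continuous
  have hls : ∀ n, base R h.centre.1 (l n) = l (n + 1) := by
    intro n
    have h1 : Tendsto (fun j => base R h.centre.1 (K^[j + 1] (a (n + (j + 1))))) atTop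
        (𝓝 (base R h.centre.1 (l n))) :=
      ((hbase_cont.tendsto _).comp (hl n)).comp (tendsto_add_atTop_nat 1)
    refine tendsto_nhds_unique h1 ?_
    refine (hl (n + 1)).congr fun j => ?_
    rw [Function.iterate_succ_apply', h.base_baseInv]
    congr 2
    ring
  have hln : ∀ n, (base R h.centre.1)^[n] (l 0) = l n := by
    intro n
    induction n with
    | zero => rfl
    | succ n ih => rw [Function.iterate_succ_apply', ih, hls]
  -- The base error contributes 7/3·d and reappears in the fibre through the 1-Lipschitz graph; the
  -- vertical distance to the graph adds `d`.
  refine ⟨l 0, 7 / 3 * d + d, fun n => ?_⟩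
  rw [h.iterate_step_centre, hln]
  have h1 := hla n
  have h2 := h.iterate_dist x n
  have h3 := h.centre.2 (a n) (l n)
  have hκn : 0 ≤ κ ^ n := by positivity
  have h4 : (step B R)^[n] x - (l n, h.centre.1 (l n)) =
      (a n - l n, (((step B R)^[n] x).2 - h.centre.1 (a n))
        + (h.centre.1 (a n) - h.centre.1 (l n))) := by
    ext
    · rfl
    · simp
  rw [h4, Prod.norm_mk]
  refine max_le ?_ ((norm_add_le _ _).trans ?_)
  · rw [Real.norm_eq_abs]
    nlinarith [mul_nonneg hd0 hκn]
  · change ‖((step B R)^[n] x).2 - h.centre.1 ((step B R)^[n] x).1‖ + _ ≤ _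
    linarith

/-- Two orbits on the graph stay at least (1 - ε)^n |α - β| apart, which is incompatible with a
faster rate of approach `r < 1 - ε` unless the orbits coincide. -/
theorem phase_unique (h : IsSmall B R lam ε b) {r : ℝ} (hr : r < 1 - ε) (hr0 : 0 ≤ r) {α β c : ℝ}
    (hab : ∀ n : ℕ, ‖(step B R)^[n] (α, h.centre.1 α)
      - (step B R)^[n] (β, h.centre.1 β)‖ ≤ c * r ^ n) : α = β := by
  have hε : 0 < 1 - ε := by linarith [h.eps_le]
  have h1 : ∀ n : ℕ, (1 - ε) ^ n * |α - β| ≤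
      |(base R h.centre.1)^[n] α - (base R h.centre.1)^[n] β| := by
    intro n
    induction n with
    | zero => simp
    | succ n ih =>
      rw [Function.iterate_succ_apply', Function.iterate_succ_apply', pow_succ', mul_assoc]
      exact (mul_le_mul_of_nonneg_left ih hε.le).trans (h.base_expand h.centre.2 _ _)
  have h2 : ∀ n : ℕ, |α - β| ≤ c * (r / (1 - ε)) ^ n := by
    intro n
    have h3 := hab n
    rw [h.iterate_step_centre, h.iterate_step_centre, norm_graph_sub h.centre.2] at h3
    have h4 := (h1 n).trans h3
    rw [div_pow, ← mul_div_assoc, le_div_iff₀ (by positivity)]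
    linarith
  have h3 : Tendsto (fun n : ℕ => c * (r / (1 - ε)) ^ n) atTop (𝓝 (c * 0)) :=
    (tendsto_pow_atTop_nhds_zero_of_lt_one (by positivity)
      ((div_lt_one hε).mpr hr)).const_mul c
  rw [mul_zero] at h3
  exact sub_eq_zero.mp (abs_nonpos_iff.mp (ge_of_tendsto' h3 h2))

end IsSmall

end CentreMap

/-! ### Mild solutions of semilinear equations -/

namespace Mild

open Filter Topology

section FixedPoint

variable {X Z : Type*} [NormedAddCommGroup X] [NormedSpace ℝ X] [NormedAddCommGroup Z]
  [NormedSpace ℝ Z]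

/-- First order expansion of `F` with derivative `A` and remainder of order `1 + θ`. -/
def Expansion (F : X → Z) (A : X → X →L[ℝ] Z) (c θ : ℝ) : Prop :=
  ∀ x y, ‖F y - F x - A x (y - x)‖ ≤ c * ‖y - x‖ ^ (1 + θ)

/-- An expansion that is uniform in the base point forces its derivative to be Hölder continuous: on
an increment `k` the difference `A y - A x` is a combination of three remainders, based at `x` and
`y`. -/
theorem Expansion.deriv_sub_le {F : X → Z} {A : X → X →L[ℝ] Z} {c θ : ℝ} (hc : 0 ≤ c)
    (hθ : 0 < θ) (hθ1 : θ ≤ 1) (h : Expansion F A c θ) (x y : X) :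
    ‖A y - A x‖ ≤ 12 * c * ‖y - x‖ ^ θ := by
  rcases eq_or_ne x y with rfl | hne
  · simp [Real.zero_rpow hθ.ne']
  set r := ‖y - x‖ with hr
  have hr0 : 0 < r := norm_pos_iff.mpr (sub_ne_zero.mpr hne.symm)
  have hrp : r ^ (1 + θ) = r ^ θ * r := by
    rw [add_comm, Real.rpow_add hr0, Real.rpow_one]
  -- It suffices to test increments with r/2 ≤ ‖k‖ < r. There the three remainders are at most 4, 1
  -- and 1 times c r^{1+θ}, and r ≤ 2‖k‖ turns the sum 6 into 12.
  refine ContinuousLinearMap.opNorm_le_of_shell' (ε := r) (c := (1 / 2 : ℝ)) hr0 (by positivity)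
    (by norm_num) fun k hk1 hk2 => ?_
  have h1 := h y (y + k)
  have h2 := h x (y + k)
  have h3 := h x y
  rw [add_sub_cancel_left] at h1
  have hk0 : ‖k‖ ^ (1 + θ) ≤ r ^ (1 + θ) :=
    Real.rpow_le_rpow (norm_nonneg _) hk2.le (by linarith)
  have hk3 : ‖y + k - x‖ ^ (1 + θ) ≤ 4 * r ^ (1 + θ) := by
    have : ‖y + k - x‖ ≤ 2 * r := by
      rw [show y + k - x = (y - x) + k by abel]
      refine (norm_add_le _ _).trans ?_
      linarith
    calc ‖y + k - x‖ ^ (1 + θ) ≤ (2 * r) ^ (1 + θ) :=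
          Real.rpow_le_rpow (norm_nonneg _) this (by linarith)
      _ = 2 ^ (1 + θ) * r ^ (1 + θ) := Real.mul_rpow (by norm_num) hr0.le
      _ ≤ 2 ^ (2 : ℝ) * r ^ (1 + θ) :=
          mul_le_mul_of_nonneg_right
            (Real.rpow_le_rpow_of_exponent_le (by norm_num) (by linarith)) (by positivity)
      _ = 4 * r ^ (1 + θ) := by norm_num
  have e : (A y - A x) k = (F (y + k) - F x - A x (y + k - x)) - (F (y + k) - F y - A y k)
      - (F y - F x - A x (y - x)) := by
    rw [show y + k - x = (y - x) + k by abel, map_add, sub_apply]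
    abel
  rw [e]
  have h4 := norm_sub_le ((F (y + k) - F x - A x (y + k - x)) - (F (y + k) - F y - A y k))
    (F y - F x - A x (y - x))
  have h5 := norm_sub_le (F (y + k) - F x - A x (y + k - x)) (F (y + k) - F y - A y k)
  have h6 : c * ‖k‖ ^ (1 + θ) ≤ c * r ^ (1 + θ) := mul_le_mul_of_nonneg_left hk0 hc
  have h7 : c * ‖y + k - x‖ ^ (1 + θ) ≤ c * (4 * r ^ (1 + θ)) :=
    mul_le_mul_of_nonneg_left hk3 hc
  have h8 : 0 ≤ c * r ^ θ := by positivity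
  have hk4 : r ≤ 2 * ‖k‖ := by
    norm_num at hk1
    linarith
  have h9 : c * r ^ (1 + θ) ≤ c * r ^ θ * (2 * ‖k‖) := by
    rw [hrp, ← mul_assoc]
    exact mul_le_mul_of_nonneg_left hk4 h8
  linarith

theorem Expansion.continuous_deriv {F : X → Z} {A : X → X →L[ℝ] Z} {c θ : ℝ} (hc : 0 ≤ c)
    (hθ : 0 < θ) (hθ1 : θ ≤ 1) (h : Expansion F A c θ) : Continuous A := by
  rw [continuous_iff_continuousAt]
  intro x
  rw [ContinuousAt, tendsto_iff_norm_sub_tendsto_zero]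
  refine squeeze_zero (fun _ => norm_nonneg _) (fun y => h.deriv_sub_le hc hθ hθ1 x y) ?_
  have : Continuous fun y : X => 12 * c * ‖y - x‖ ^ θ :=
    ((continuous_id.sub continuous_const).norm.rpow_const fun _ => Or.inr hθ.le).const_mul _
  simpa [Real.zero_rpow hθ.ne'] using this.tendsto x

variable {S : X →L[ℝ] Z} {F : Z → Z}

theorem contracting_affine (hF : ∀ u v, ‖F u - F v‖ ≤ 1 / 2 * ‖u - v‖) (x : X) :
    ContractingWith (1 / 2 : ℝ≥0) fun v => S x + F v := by
  refine ⟨by norm_num [← NNReal.coe_lt_coe], LipschitzWith.of_dist_le_mul fun u v => ?_⟩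
  rw [dist_add_left, dist_eq_norm, dist_eq_norm]
  simpa using hF u v

variable [CompleteSpace Z]

/-- The solution of `v = S x + F v` for a contraction `F`. -/
noncomputable def solve (hF : ∀ u v, ‖F u - F v‖ ≤ 1 / 2 * ‖u - v‖) (x : X) : Z :=
  (contracting_affine (S := S) hF x).fixedPoint

variable (hF : ∀ u v, ‖F u - F v‖ ≤ 1 / 2 * ‖u - v‖)

theorem solve_eq (x : X) : solve (S := S) hF x = S x + F (solve (S := S) hF x) :=
  ((contracting_affine (S := S) hF x).fixedPoint_isFixedPt).symm

theorem eq_solve {x : X} {v : Z} (hv : v = S x + F v) : v = solve (S := S) hF x :=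
  (contracting_affine (S := S) hF x).fixedPoint_unique hv.symm

theorem solve_lip (x y : X) :
    ‖solve (S := S) hF x - solve (S := S) hF y‖ ≤ 2 * ‖S‖ * ‖x - y‖ := by
  have h1 : solve (S := S) hF x - solve (S := S) hF y =
      S (x - y) + (F (solve (S := S) hF x) - F (solve (S := S) hF y)) := by
    conv_lhs => rw [solve_eq hF x, solve_eq hF y]
    rw [map_sub]
    abel
  have h2 := norm_add_le (S (x - y)) (F (solve (S := S) hF x) - F (solve (S := S) hF y))
  rw [← h1] at h2
  have h3 := hF (solve (S := S) hF x) (solve (S := S) hF y)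
  have h4 := S.le_opNorm (x - y)
  linarith

/-- The candidate derivative is the Neumann inverse (1 - A)⁻¹ S. The deviation r = V y - V x - D(y -
x) solves r = A r + (remainder of F), so ‖A‖ ≤ 1/2 bounds it by twice that remainder, and
`solve_lip` expresses the remainder through ‖y - x‖. -/
theorem solve_expansion {A : Z → Z →L[ℝ] Z} {η : ℝ} (hA : ∀ u, ‖A u‖ ≤ η) (hη : η ≤ 1 / 2)
    {c θ : ℝ} (hc : 0 ≤ c) (hθ : 0 ≤ θ) (hE : Expansion F A c θ) :
    ∃ D : X → X →L[ℝ] Z, (∀ x, D x = S + (A (solve (S := S) hF x)).comp (D x)) ∧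
      (∀ x, ‖D x‖ ≤ 2 * ‖S‖) ∧
      Expansion (solve (S := S) hF) D (2 * c * (2 * ‖S‖) ^ (1 + θ)) θ := by
  have hA1 : ∀ u, ‖A u‖ < 1 := fun u => (hA u).trans_lt (by linarith)
  let D : X → X →L[ℝ] Z := fun x =>
    ((Units.oneSub (A (solve (S := S) hF x)) (hA1 _))⁻¹ : (Z →L[ℝ] Z)ˣ).1.comp S
  have hD : ∀ x, D x = S + (A (solve (S := S) hF x)).comp (D x) := by
    intro x
    have h1 := (Units.oneSub (A (solve (S := S) hF x)) (hA1 _)).mul_inv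
    rw [Units.val_oneSub, sub_mul, one_mul, sub_eq_iff_eq_add] at h1
    have h2 := congrArg (fun T : Z →L[ℝ] Z => T.comp S) h1
    simp only [ContinuousLinearMap.add_comp] at h2
    exact h2
  have hDn : ∀ x, ‖D x‖ ≤ 2 * ‖S‖ := by
    intro x
    have h1 := norm_add_le S ((A (solve (S := S) hF x)).comp (D x))
    rw [← hD x] at h1
    have h2 := (A (solve (S := S) hF x)).opNorm_comp_le (D x)
    have h3 := hA (solve (S := S) hF x)
    nlinarith [norm_nonneg (D x), norm_nonneg (A (solve (S := S) hF x))]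
  refine ⟨D, hD, hDn, fun x y => ?_⟩
  set V := solve (S := S) hF with hV
  set r := V y - V x - D x (y - x) with hr
  have h1 : r = A (V x) r + (F (V y) - F (V x) - A (V x) (V y - V x)) := by
    have e1 : V y - V x = S (y - x) + (F (V y) - F (V x)) := by
      conv_lhs => rw [hV, solve_eq hF x, solve_eq hF y]
      rw [map_sub]
      abel
    have e2 : D x (y - x) = S (y - x) + A (V x) (D x (y - x)) := by
      conv_lhs => rw [hD x]
      rfl
    have e3 : A (V x) r = A (V x) (V y - V x) - A (V x) (D x (y - x)) := by
      rw [hr, map_sub]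
    rw [e3]
    conv_lhs => rw [hr, e1, e2]
    abel
  have h2 := norm_add_le (A (V x) r) (F (V y) - F (V x) - A (V x) (V y - V x))
  rw [← h1] at h2
  have h3 := hE (V x) (V y)
  have h4 : ‖A (V x) r‖ ≤ 1 / 2 * ‖r‖ :=
    ((A (V x)).le_opNorm r).trans
      (mul_le_mul_of_nonneg_right ((hA _).trans hη) (norm_nonneg r))
  have h5 : ‖V y - V x‖ ^ (1 + θ) ≤ (2 * ‖S‖) ^ (1 + θ) * ‖y - x‖ ^ (1 + θ) := by
    rw [← Real.mul_rpow (by positivity) (norm_nonneg _)]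
    exact Real.rpow_le_rpow (norm_nonneg _) (solve_lip hF y x) (by linarith)
  have h6 := mul_le_mul_of_nonneg_left h5 hc
  linarith

end FixedPoint

end Mild

/-! ### Smoothing semigroups and the Duhamel integral -/

namespace Mild

open Filter Topology

variable {X Y : Type*} [NormedAddCommGroup X] [NormedSpace ℝ X] [NormedAddCommGroup Y]
  [NormedSpace ℝ Y]

/-- `S` is a strongly continuous semigroup on `X`, and `U σ : Y → X`, `σ > 0`, a compatible
family of smoothing operators with an integrable singularity at `σ = 0`. -/
structure IsSmoothing (S : ℝ → X →L[ℝ] X) (U : ℝ → Y →L[ℝ] X) (γ : ℝ) : Prop where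
  zero : S 0 = ContinuousLinearMap.id ℝ X
  add : ∀ s t, 0 ≤ s → 0 ≤ t → S (s + t) = (S s).comp (S t)
  cont : ∀ x, ContinuousOn (fun τ => S τ x) (Ici 0)
  bdd : ∀ T, 0 < T → ∃ C, 0 ≤ C ∧ ∀ τ, 0 ≤ τ → τ ≤ T → ‖S τ‖ ≤ C
  comp : ∀ s t, 0 ≤ s → 0 < t → U (s + t) = (S s).comp (U t)
  gamma_lt : γ < 1
  bound : ∀ T, 0 < T → ∃ C, 0 ≤ C ∧ ∀ σ, 0 < σ → σ ≤ T → ‖U σ‖ ≤ C * σ ^ (-γ)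

namespace IsSmoothing

variable {S : ℝ → X →L[ℝ] X} {U : ℝ → Y →L[ℝ] X} {γ : ℝ}

/-- Near σ one writes U t = S (t - σ/2) U (σ/2), so the strong continuity of `S` passes to `U` away
from zero. -/
theorem continuousOn_smoothing (h : IsSmoothing S U γ) (y : Y) :
    ContinuousOn (fun σ => U σ y) (Ioi 0) := by
  intro σ hσ
  have hσ0 : 0 < σ := hσ
  have h1 : ContinuousAt (fun t => S t (U (σ / 2) y)) (σ - σ / 2) :=
    (h.cont (U (σ / 2) y)).continuousAt (Ici_mem_nhds (by linarith))
  have h2 : ContinuousAt (fun t => S (t - σ / 2) (U (σ / 2) y)) σ :=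
    ContinuousAt.comp (f := fun t : ℝ => t - σ / 2) (x := σ) h1
      (continuousAt_id.sub continuousAt_const)
  refine (h2.congr ?_).continuousWithinAt
  filter_upwards [Ioi_mem_nhds (by linarith : σ / 2 < σ)] with t ht
  have ht' : σ / 2 < t := ht
  have := h.comp (t - σ / 2) (σ / 2) (by linarith) (by linarith)
  rw [sub_add_cancel] at this
  rw [this]
  rfl

/-- Strong continuity does not by itself control a moving argument. The norms of `U` are bounded
near the positive time r t by a continuous power, and this handles `U (r t') (y t' - y t)`; the
horizon 2 r t covers all nearby times. -/
theorem continuousOn_smoothing_apply (h : IsSmoothing S U γ) {s : Set ℝ} {r : ℝ → ℝ}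
    (hr : ContinuousOn r s) (hpos : ∀ t ∈ s, 0 < r t) {y : ℝ → Y} (hy : ContinuousOn y s) :
    ContinuousOn (fun t => U (r t) (y t)) s := by
  intro t ht
  have h1 : ContinuousWithinAt (fun t' => U (r t') (y t)) s t :=
    ContinuousWithinAt.comp (t := Ioi 0) (h.continuousOn_smoothing (y t) (r t) (hpos t ht))
      (hr t ht) hpos
  obtain ⟨C, hC0, hC⟩ := h.bound (2 * r t) (by linarith [hpos t ht])
  have h2 : Tendsto (fun t' => (C * (r t') ^ (-γ)) * ‖y t' - y t‖) (𝓝[s] t) (𝓝 0) := by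
    have k1 : Tendsto (fun t' => C * (r t') ^ (-γ)) (𝓝[s] t) (𝓝 (C * (r t) ^ (-γ))) :=
      (((hr t ht).tendsto.rpow_const (Or.inl (hpos t ht).ne'))).const_mul C
    have k2 : Tendsto (fun t' => ‖y t' - y t‖) (𝓝[s] t) (𝓝 0) :=
      tendsto_iff_norm_sub_tendsto_zero.mp (hy t ht)
    simpa using k1.mul k2
  have h3 : Tendsto (fun t' => U (r t') (y t' - y t)) (𝓝[s] t) (𝓝 0) := by
    refine squeeze_zero_norm' ?_ h2
    have hev : ∀ᶠ t' in 𝓝[s] t, r t' < 2 * r t :=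
      (hr t ht).eventually (Iio_mem_nhds (by linarith [hpos t ht]))
    filter_upwards [hev, self_mem_nhdsWithin] with t' h1 h2
    exact ((U (r t')).le_opNorm _).trans
      (mul_le_mul_of_nonneg_right (hC _ (hpos t' h2) h1.le) (norm_nonneg _))
  have h4 := h3.add h1.tendsto
  rw [zero_add] at h4
  refine h4.congr fun t' => ?_
  rw [← map_add, sub_add_cancel]

/-- The Duhamel integral. -/
noncomputable def duhamel (U : ℝ → Y →L[ℝ] X) (y : ℝ → Y) (τ : ℝ) : X :=
  ∫ s in (0 : ℝ)..τ, U (τ - s) (y s)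

/-- In this form the singularity sits at s = 0 for every τ, so one integrable majorant serves all τ
simultaneously. -/
theorem duhamel_eq (U : ℝ → Y →L[ℝ] X) (y : ℝ → Y) (τ : ℝ) :
    duhamel U y τ = ∫ s in (0 : ℝ)..τ, U s (y (τ - s)) := by
  have := intervalIntegral.integral_comp_sub_left (a := 0) (b := τ)
    (fun s => U s (y (τ - s))) τ
  simpa [duhamel] using this

theorem duhamel_congr {y y' : ℝ → Y} {τ : ℝ} (hτ : 0 ≤ τ) (hy : EqOn y y' (Icc 0 τ)) :
    duhamel U y τ = duhamel U y' τ := by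
  refine intervalIntegral.integral_congr fun s hs => ?_
  rw [uIcc_of_le hτ] at hs
  rw [hy hs]

theorem aestronglyMeasurable_conv (h : IsSmoothing S U γ) {y : ℝ → Y} {τ : ℝ}
    (hy : ContinuousOn y (Icc 0 τ)) :
    AEStronglyMeasurable (fun s => U s (y (τ - s))) (volume.restrict (Ioc 0 τ)) := by
  refine ContinuousOn.aestronglyMeasurable
    (h.continuousOn_smoothing_apply continuousOn_id (fun t ht => ht.1) ?_) measurableSet_Ioc
  refine hy.comp (continuousOn_const.sub continuousOn_id) fun s hs => ?_
  exact ⟨by linarith [hs.2], by linarith [hs.1]⟩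

theorem norm_conv_le {C M T : ℝ} (hC : ∀ σ, 0 < σ → σ ≤ T → ‖U σ‖ ≤ C * σ ^ (-γ))
    {y : Y} (hy : ‖y‖ ≤ M) {σ : ℝ} (h0 : 0 < σ) (hT : σ ≤ T) :
    ‖U σ y‖ ≤ C * M * σ ^ (-γ) := by
  have h1 := hC σ h0 hT
  calc ‖U σ y‖ ≤ ‖U σ‖ * ‖y‖ := (U σ).le_opNorm y
    _ ≤ (C * σ ^ (-γ)) * M := mul_le_mul h1 hy (norm_nonneg _) ((norm_nonneg _).trans h1)
    _ = _ := by ring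

theorem intervalIntegrable_rpow_neg (h : IsSmoothing S U γ) (c a b : ℝ) :
    IntervalIntegrable (fun σ : ℝ => c * σ ^ (-γ)) volume a b :=
  (intervalIntegral.intervalIntegrable_rpow' (by linarith [h.gamma_lt])).const_mul c

theorem intervalIntegrable_conv (h : IsSmoothing S U γ) {y : ℝ → Y} {τ : ℝ} (hτ : 0 ≤ τ)
    (hy : ContinuousOn y (Icc 0 τ)) :
    IntervalIntegrable (fun s => U s (y (τ - s))) volume 0 τ := by
  rcases hτ.eq_or_lt with rfl | hτ
  · simp
  obtain ⟨C, hC0, hC⟩ := h.bound τ hτ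
  obtain ⟨M, hM⟩ := isCompact_Icc.exists_bound_of_continuousOn hy
  refine (h.intervalIntegrable_rpow_neg (C * M) 0 τ).mono_fun' ?_ ?_
  · rw [uIoc_of_le hτ.le]
    exact h.aestronglyMeasurable_conv hy
  · rw [uIoc_of_le hτ.le]
    filter_upwards [ae_restrict_mem measurableSet_Ioc] with s hs
    exact norm_conv_le hC (hM _ ⟨by linarith [hs.2], by linarith [hs.1]⟩) hs.1 hs.2

theorem intervalIntegrable_duhamel (h : IsSmoothing S U γ) {y : ℝ → Y} {τ : ℝ} (hτ : 0 ≤ τ)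
    (hy : ContinuousOn y (Icc 0 τ)) :
    IntervalIntegrable (fun s => U (τ - s) (y s)) volume 0 τ := by
  have := ((h.intervalIntegrable_conv hτ hy).comp_sub_left τ).symm
  simpa using this

theorem norm_duhamel_le (h : IsSmoothing S U γ) {C M T : ℝ} (hC0 : 0 ≤ C) (hM : 0 ≤ M)
    (hC : ∀ σ, 0 < σ → σ ≤ T → ‖U σ‖ ≤ C * σ ^ (-γ)) {y : ℝ → Y} {τ : ℝ} (hτ : 0 ≤ τ)
    (hτT : τ ≤ T) (hy : ∀ s ∈ Icc 0 τ, ‖y s‖ ≤ M) :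
    ‖duhamel U y τ‖ ≤ C * (T ^ (1 - γ) / (1 - γ)) * M := by
  have hγ := h.gamma_lt
  rw [duhamel_eq]
  refine (intervalIntegral.norm_integral_le_of_norm_le hτ ?_
    (h.intervalIntegrable_rpow_neg (C * M) 0 τ)).trans ?_
  · refine Eventually.of_forall fun s hs => ?_
    exact norm_conv_le hC (hy _ ⟨by linarith [hs.2], by linarith [hs.1]⟩) hs.1 (hs.2.trans hτT)
  · rw [intervalIntegral.integral_const_mul, integral_rpow (Or.inl (by linarith)),
      Real.zero_rpow (by linarith), sub_zero, show -γ + 1 = 1 - γ by ring]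
    have h1 : τ ^ (1 - γ) / (1 - γ) ≤ T ^ (1 - γ) / (1 - γ) :=
      div_le_div_of_nonneg_right (Real.rpow_le_rpow hτ hτT (by linarith)) (by linarith)
    calc C * M * (τ ^ (1 - γ) / (1 - γ)) ≤ C * M * (T ^ (1 - γ) / (1 - γ)) :=
          mul_le_mul_of_nonneg_left h1 (by positivity)
      _ = _ := by ring

theorem continuousOn_duhamel (h : IsSmoothing S U γ) {y : ℝ → Y} {T : ℝ}
    (hy : ContinuousOn y (Icc 0 T)) : ContinuousOn (duhamel U y) (Icc 0 T) := by
  rcases le_or_gt T 0 with hT | hT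
  · rcases hT.lt_or_eq with hT | rfl
    · rw [Icc_eq_empty (by linarith)]
      exact continuousOn_empty _
    · rw [Icc_self]
      exact continuousOn_singleton _ _
  obtain ⟨C, hC0, hC⟩ := h.bound T hT
  obtain ⟨M, hM⟩ := isCompact_Icc.exists_bound_of_continuousOn hy
  -- Extending the integrand by zero makes the domain of integration independent of τ, as dominated
  -- convergence requires. For fixed s the extension can jump only at τ = s, so the exceptional s
  -- form a null set.
  let Φ : ℝ → ℝ → X := fun τ => (Ioc 0 τ).indicator fun s => U s (y (τ - s))
  have heq : ∀ τ ∈ Icc 0 T, duhamel U y τ = ∫ s in (0 : ℝ)..T, Φ τ s := by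
    intro τ hτ
    rw [duhamel_eq, intervalIntegral.integral_of_le hτ.1, intervalIntegral.integral_of_le hT.le,
      setIntegral_indicator measurableSet_Ioc, Ioc_inter_Ioc]
    simp [hτ.2]
  intro τ hτ
  refine ContinuousWithinAt.congr (f := fun τ => ∫ s in (0 : ℝ)..T, Φ τ s) ?_ heq (heq τ hτ)
  refine intervalIntegral.continuousWithinAt_of_dominated_interval
    (bound := fun s => C * M * s ^ (-γ)) ?_ ?_ (h.intervalIntegrable_rpow_neg (C * M) 0 T) ?_
  · filter_upwards [self_mem_nhdsWithin] with t ht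
    refine AEStronglyMeasurable.mono_measure ?_ Measure.restrict_le_self
    rw [aestronglyMeasurable_indicator_iff measurableSet_Ioc]
    exact h.aestronglyMeasurable_conv (hy.mono (Icc_subset_Icc_right ht.2))
  · filter_upwards [self_mem_nhdsWithin] with t ht
    refine Eventually.of_forall fun s hs => ?_
    rw [uIoc_of_le hT.le] at hs
    by_cases hst : s ∈ Ioc 0 t
    · simp only [Φ, indicator_of_mem hst]
      exact norm_conv_le hC (hM _ ⟨by linarith [hst.2], by linarith [hst.1, ht.2]⟩) hs.1 hs.2
    · simp only [Φ, indicator_of_notMem hst, norm_zero]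
      have hM0 : 0 ≤ M := (norm_nonneg _).trans (hM 0 ⟨le_rfl, hT.le⟩)
      have := Real.rpow_nonneg hs.1.le (-γ)
      positivity
  · have hne : ∀ᵐ s : ℝ, s ≠ τ := by simp [ae_iff]
    filter_upwards [hne] with s hs hsT
    rw [uIoc_of_le hT.le] at hsT
    rcases lt_or_gt_of_ne hs with hlt | hgt
    · have hmem : Ioi s ∈ 𝓝[Icc 0 T] τ := mem_nhdsWithin_of_mem_nhds (Ioi_mem_nhds hlt)
      have k1 : ContinuousWithinAt (fun t => U s (y (t - s))) (Icc 0 T ∩ Ioi s) τ := by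
        refine (U s).continuous.continuousAt.comp_continuousWithinAt ?_
        refine ContinuousWithinAt.comp (t := Icc 0 T)
          (hy (τ - s) ⟨by linarith, by linarith [hτ.2, hsT.1]⟩)
          (continuousWithinAt_id.sub continuousWithinAt_const) fun t ht => ?_
        have : s < t := ht.2
        exact ⟨by linarith, by linarith [ht.1.2, hsT.1]⟩
      rw [continuousWithinAt_inter' hmem] at k1
      refine k1.congr_of_eventuallyEq ?_ ?_
      · filter_upwards [hmem] with t ht
        exact indicator_of_mem (show s ∈ Ioc 0 t from ⟨hsT.1, le_of_lt ht⟩)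
          fun s => U s (y (t - s))
      · exact indicator_of_mem (show s ∈ Ioc 0 τ from ⟨hsT.1, hlt.le⟩)
          fun s => U s (y (τ - s))
    · have hmem : Iio s ∈ 𝓝[Icc 0 T] τ := mem_nhdsWithin_of_mem_nhds (Iio_mem_nhds hgt)
      refine (continuousWithinAt_const (b := (0 : X))).congr_of_eventuallyEq ?_ ?_
      · filter_upwards [hmem] with t ht
        exact indicator_of_notMem (fun hc => absurd hc.2 (not_le.mpr ht)) _
      · exact indicator_of_notMem (fun hc => absurd hc.2 (not_le.mpr hgt)) _

/-- The cocycle identity behind restarting and gluing: the history up to time b is transported by `S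
σ`, the remainder is a fresh Duhamel integral. -/
theorem duhamel_add (h : IsSmoothing S U γ) [CompleteSpace X] {y : ℝ → Y} {b σ : ℝ} (hb : 0 ≤ b)
    (hσ : 0 ≤ σ) (hy : ContinuousOn y (Icc 0 (b + σ))) :
    duhamel U y (b + σ) = S σ (duhamel U y b) + duhamel U (fun s => y (b + s)) σ := by
  have hi := h.intervalIntegrable_duhamel (add_nonneg hb hσ) hy
  have hi1 : IntervalIntegrable (fun s => U (b + σ - s) (y s)) volume 0 b :=
    hi.mono_set (by rw [uIcc_of_le hb, uIcc_of_le (by linarith)]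
                    exact Icc_subset_Icc_right (by linarith))
  have hi2 : IntervalIntegrable (fun s => U (b + σ - s) (y s)) volume b (b + σ) :=
    hi.mono_set (by rw [uIcc_of_le (by linarith), uIcc_of_le (by linarith)]
                    exact Icc_subset_Icc_left hb)
  have h1 : duhamel U y (b + σ) = (∫ s in (0 : ℝ)..b, U (b + σ - s) (y s))
      + ∫ s in b..(b + σ), U (b + σ - s) (y s) :=
    (intervalIntegral.integral_add_adjacent_intervals hi1 hi2).symm
  have h2 : ∫ s in (0 : ℝ)..b, U (b + σ - s) (y s) = S σ (duhamel U y b) := by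
    rw [duhamel, ← ContinuousLinearMap.intervalIntegral_comp_comm _
      (h.intervalIntegrable_duhamel hb (hy.mono (Icc_subset_Icc_right (by linarith))))]
    refine intervalIntegral.integral_congr_ae ?_
    -- The relation between `U` and `S` is assumed only at positive times, so the endpoint s = b has
    -- to be discarded.
    have hne : ∀ᵐ s : ℝ, s ≠ b := by simp [ae_iff]
    filter_upwards [hne] with s hs hsb
    rw [uIoc_of_le hb] at hsb
    have : s < b := lt_of_le_of_ne hsb.2 hs
    rw [show b + σ - s = σ + (b - s) by ring, h.comp σ (b - s) hσ (by linarith)]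
    rfl
  have h3 : ∫ s in b..(b + σ), U (b + σ - s) (y s) = duhamel U (fun s => y (b + s)) σ := by
    have := intervalIntegral.integral_comp_add_left (a := 0) (b := σ)
      (fun s => U (b + σ - s) (y s)) b
    rw [add_zero] at this
    rw [← this, duhamel]
    refine intervalIntegral.integral_congr fun s _ => ?_
    rw [add_sub_add_left_eq_sub]
  rw [h1, h2, h3]

end IsSmoothing

end Mild

/-! ### Local mild solutions and their dependence on the data -/

namespace Mild

open Filter Topology IsSmoothing

theorem continuous_of_lip {X Y : Type*} [NormedAddCommGroup X] [NormedAddCommGroup Y]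
    {F : X → Y} {ε : ℝ} (h : ∀ x y, ‖F x - F y‖ ≤ ε * ‖x - y‖) :
    Continuous F := by
  rw [continuous_iff_continuousAt]
  intro x
  rw [ContinuousAt, tendsto_iff_norm_sub_tendsto_zero]
  refine squeeze_zero (fun _ => norm_nonneg _) (fun y => h y x) ?_
  have : Continuous fun y : X => ε * ‖y - x‖ := by fun_prop
  simpa using this.tendsto x

variable {X Y : Type*} [NormedAddCommGroup X] [NormedSpace ℝ X] [NormedAddCommGroup Y]
  [NormedSpace ℝ Y]

/-- Bounded, globally Lipschitz and differentiable nonlinearities, with vanishing linear part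
at the origin. -/
structure IsNonlinearity (F : X → Y) (DF : X → X →L[ℝ] Y) (ε b c θ : ℝ) : Prop where
  lip : ∀ x y, ‖F x - F y‖ ≤ ε * ‖x - y‖
  bdd : ∀ x, ‖F x‖ ≤ b
  deriv_le : ∀ x, ‖DF x‖ ≤ ε
  expansion : Expansion F DF c θ
  zero : F 0 = 0
  deriv_zero : DF 0 = 0
  nonneg : 0 ≤ c
  pos : 0 < θ
  le_one : θ ≤ 1

namespace IsNonlinearity

variable {F : X → Y} {DF : X → X →L[ℝ] Y} {ε b c θ : ℝ}

theorem continuous (hF : IsNonlinearity F DF ε b c θ) : Continuous F := continuous_of_lip hF.lip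

theorem eps_nonneg (hF : IsNonlinearity F DF ε b c θ) : 0 ≤ ε :=
  (norm_nonneg _).trans (hF.deriv_le 0)

theorem bound_nonneg (hF : IsNonlinearity F DF ε b c θ) : 0 ≤ b :=
  (norm_nonneg _).trans (hF.bdd 0)

/-- The superposition operator on continuous paths is a nonlinearity with the same constants. -/
theorem superposition {I : Type*} [TopologicalSpace I] [CompactSpace I]
    (hF : IsNonlinearity F DF ε b c θ) :
    ∃ (G : C(I, X) → C(I, Y)) (DG : C(I, X) → C(I, X) →L[ℝ] C(I, Y)),
      (∀ v t, G v t = F (v t)) ∧ IsNonlinearity G DG ε b c θ := by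
  -- Continuity of the derivative is not a hypothesis but follows from the expansion; it is needed
  -- for t ↦ DF (v t) (k t) to be a continuous path.
  have hDF : Continuous DF := hF.expansion.continuous_deriv hF.nonneg hF.pos hF.le_one
  let G : C(I, X) → C(I, Y) := fun v => ⟨fun t => F (v t), hF.continuous.comp v.continuous⟩
  let D : C(I, X) → C(I, X) → C(I, Y) := fun v k =>
    ⟨fun t => DF (v t) (k t), (hDF.comp v.continuous).clm_apply k.continuous⟩
  have hD : ∀ v k, ‖D v k‖ ≤ ε * ‖k‖ := fun v k => by
    rw [ContinuousMap.norm_le _ (mul_nonneg hF.eps_nonneg (norm_nonneg k))]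
    intro t
    exact ((DF (v t)).le_opNorm _).trans (mul_le_mul (hF.deriv_le _) (k.norm_coe_le_norm t)
      (norm_nonneg _) hF.eps_nonneg)
  let DG : C(I, X) → C(I, X) →L[ℝ] C(I, Y) := fun v =>
    LinearMap.mkContinuous
      { toFun := D v
        map_add' := fun k l => by ext t; simp [D]
        map_smul' := fun a k => by ext t; simp [D] } ε (hD v)
  refine ⟨G, DG, fun _ _ => rfl, ?_, ?_, ?_, ?_, ?_, ?_, hF.nonneg, hF.pos, hF.le_one⟩
  · intro v u
    rw [ContinuousMap.norm_le _ (mul_nonneg hF.eps_nonneg (norm_nonneg _))]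
    intro t
    exact (hF.lip (v t) (u t)).trans
      (mul_le_mul_of_nonneg_left ((v - u).norm_coe_le_norm t) hF.eps_nonneg)
  · intro v
    rw [ContinuousMap.norm_le _ hF.bound_nonneg]
    exact fun t => hF.bdd _
  · intro v
    exact LinearMap.mkContinuous_norm_le _ hF.eps_nonneg _
  · intro v u
    rw [ContinuousMap.norm_le _ (mul_nonneg hF.nonneg (by positivity))]
    intro t
    refine (hF.expansion (v t) (u t)).trans (mul_le_mul_of_nonneg_left ?_ hF.nonneg)
    exact Real.rpow_le_rpow (norm_nonneg _) ((u - v).norm_coe_le_norm t) (by linarith [hF.pos])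
  · ext t
    exact hF.zero
  · ext k t
    change DF 0 (k t) = 0
    rw [hF.deriv_zero]
    rfl

end IsNonlinearity

/-- `v` is a mild solution on `[0, T]` with initial value `x`. -/
def IsMildOn (S : ℝ → X →L[ℝ] X) (U : ℝ → Y →L[ℝ] X) (F : X → Y) (T : ℝ) (x : X)
    (v : ℝ → X) : Prop :=
  ContinuousOn v (Icc 0 T) ∧ ∀ τ ∈ Icc 0 T, v τ = S τ x - duhamel U (fun s => F (v s)) τ

/-- `v` is a global mild solution with initial value `x`. -/
def IsMild (S : ℝ → X →L[ℝ] X) (U : ℝ → Y →L[ℝ] X) (F : X → Y) (x : X) (v : ℝ → X) : Prop :=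
  ContinuousOn v (Ici 0) ∧ ∀ τ, 0 ≤ τ → v τ = S τ x - duhamel U (fun s => F (v s)) τ

variable {S : ℝ → X →L[ℝ] X} {U : ℝ → Y →L[ℝ] X} {γ : ℝ}

/-- With the free evolution and the Duhamel term both realised as bounded operators into C([0,T],
X), the mild equation takes the abstract form v = P x + K (G v) treated by `solve`, and
differentiability in the data comes from `solve_expansion`. -/
theorem IsSmoothing.exists_free (h : IsSmoothing S U γ) {T M : ℝ} (hM0 : 0 ≤ M)
    (hM : ∀ τ, 0 ≤ τ → τ ≤ T → ‖S τ‖ ≤ M) :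
    ∃ P : X →L[ℝ] C(Icc (0 : ℝ) T, X), (∀ x t, P x t = S t x) ∧ ‖P‖ ≤ M := by
  let P : X → C(Icc (0 : ℝ) T, X) := fun x =>
    ⟨fun t => S t x, by
      refine ((h.cont x).mono fun t ht => ?_).domRestrict
      exact ht.1⟩
  have hP : ∀ x, ‖P x‖ ≤ M * ‖x‖ := fun x => by
    rw [ContinuousMap.norm_le _ (by positivity)]
    exact fun t => ((S t).le_opNorm x).trans
      (mul_le_mul_of_nonneg_right (hM t t.2.1 t.2.2) (norm_nonneg x))
  exact ⟨LinearMap.mkContinuous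
    { toFun := P
      map_add' := fun k l => by ext t; exact map_add (S t) k l
      map_smul' := fun a k => by ext t; exact map_smul (S t) a k } M hP, fun _ _ => rfl,
    LinearMap.mkContinuous_norm_le _ hM0 _⟩

theorem IsSmoothing.exists_duhamel (h : IsSmoothing S U γ) {T C : ℝ} (hT : 0 ≤ T) (hC0 : 0 ≤ C)
    (hC : ∀ σ, 0 < σ → σ ≤ T → ‖U σ‖ ≤ C * σ ^ (-γ)) :
    ∃ K : C(Icc (0 : ℝ) T, Y) →L[ℝ] C(Icc (0 : ℝ) T, X),
      (∀ y t, K y t = duhamel U (IccExtend hT y) t) ∧ ‖K‖ ≤ C * (T ^ (1 - γ) / (1 - γ)) := by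
  have hγ := h.gamma_lt
  have hc : ∀ y : C(Icc (0 : ℝ) T, Y), Continuous (IccExtend hT y) := fun y =>
    y.continuous.Icc_extend'
  let K : C(Icc (0 : ℝ) T, Y) → C(Icc (0 : ℝ) T, X) := fun y =>
    ⟨fun t => duhamel U (IccExtend hT y) t,
      (h.continuousOn_duhamel (hc y).continuousOn).domRestrict⟩
  have hK0 : 0 ≤ C * (T ^ (1 - γ) / (1 - γ)) :=
    mul_nonneg hC0 (div_nonneg (Real.rpow_nonneg hT _) (by linarith))
  have hK : ∀ y, ‖K y‖ ≤ C * (T ^ (1 - γ) / (1 - γ)) * ‖y‖ := fun y => by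
    rw [ContinuousMap.norm_le _ (mul_nonneg hK0 (norm_nonneg _))]
    exact fun t => h.norm_duhamel_le hC0 (norm_nonneg _) hC t.2.1 t.2.2 fun s _ =>
      y.norm_coe_le_norm _
  refine ⟨LinearMap.mkContinuous
    { toFun := K
      map_add' := fun k l => ?_
      map_smul' := fun a k => ?_ } _ hK, fun _ _ => rfl,
    LinearMap.mkContinuous_norm_le _ hK0 _⟩
  · ext t
    change duhamel U _ _ = duhamel U _ _ + duhamel U _ _
    simp only [duhamel]
    rw [← intervalIntegral.integral_add
      (h.intervalIntegrable_duhamel t.2.1 (hc k).continuousOn)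
      (h.intervalIntegrable_duhamel t.2.1 (hc l).continuousOn)]
    refine intervalIntegral.integral_congr fun s _ => ?_
    rw [← map_add]
    rfl
  · ext t
    change duhamel U _ _ = a • duhamel U _ _
    simp only [duhamel]
    rw [← intervalIntegral.integral_smul]
    refine intervalIntegral.integral_congr fun s _ => ?_
    rw [← map_smul]
    rfl

variable {F : X → Y} {DF : X → X →L[ℝ] Y} {ε b c θ : ℝ}

/-- Local solvability, with Lipschitz and differentiable dependence on the initial value. -/
theorem IsSmoothing.exists_local [CompleteSpace X] (h : IsSmoothing S U γ)
    (hF : IsNonlinearity F DF ε b c θ) {T M C : ℝ} (hT : 0 ≤ T) (hM0 : 0 ≤ M)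
    (hM : ∀ τ, 0 ≤ τ → τ ≤ T → ‖S τ‖ ≤ M) (hC0 : 0 ≤ C)
    (hC : ∀ σ, 0 < σ → σ ≤ T → ‖U σ‖ ≤ C * σ ^ (-γ))
    (hsmall : C * (T ^ (1 - γ) / (1 - γ)) * ε ≤ 1 / 2) :
    ∃ V : X → ℝ → X, (∀ x, IsMildOn S U F T x (V x)) ∧
      (∀ x v, IsMildOn S U F T x v → ∀ τ ∈ Icc 0 T, v τ = V x τ) ∧
      (∀ x y, ∀ τ ∈ Icc 0 T, ‖V x τ - V y τ‖ ≤ 2 * M * ‖x - y‖) ∧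
      (∀ x y, ‖(V x T - S T x) - (V y T - S T y)‖ ≤
        C * (T ^ (1 - γ) / (1 - γ)) * ε * (2 * M) * ‖x - y‖) ∧
      V 0 T = 0 ∧
      ∃ (c' : ℝ) (A : X → X →L[ℝ] X), 0 ≤ c' ∧ A 0 = 0 ∧
        (∀ x, ‖A x‖ ≤ C * (T ^ (1 - γ) / (1 - γ)) * ε * (2 * M)) ∧
        Expansion (fun x => V x T - S T x) A c' θ := by
  set k := C * (T ^ (1 - γ) / (1 - γ)) with hk
  have hγ := h.gamma_lt
  have hk0 : 0 ≤ k := mul_nonneg hC0 (div_nonneg (Real.rpow_nonneg hT _) (by linarith))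
  have hε := hF.eps_nonneg
  obtain ⟨P, hP, hPn⟩ := h.exists_free hM0 hM
  obtain ⟨K, hK, hKn⟩ : ∃ K : C(Icc (0 : ℝ) T, Y) →L[ℝ] C(Icc (0 : ℝ) T, X),
      (∀ y t, K y t = -duhamel U (IccExtend hT y) t) ∧ ‖K‖ ≤ k := by
    obtain ⟨K, hK, hKn⟩ := h.exists_duhamel hT hC0 hC
    exact ⟨-K, fun y t => congrArg Neg.neg (hK y t), (norm_neg K).le.trans hKn⟩
  obtain ⟨G, DG, hG, hGN⟩ := hF.superposition (I := Icc (0 : ℝ) T)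
  let Φ : C(Icc (0 : ℝ) T, X) → C(Icc (0 : ℝ) T, X) := fun v => K (G v)
  have hKle : ∀ y, ‖K y‖ ≤ k * ‖y‖ := fun y =>
    (K.le_opNorm y).trans (mul_le_mul_of_nonneg_right hKn (norm_nonneg y))
  have hΦk : ∀ u v, ‖Φ u - Φ v‖ ≤ k * ε * ‖u - v‖ := by
    intro u v
    have e : Φ u - Φ v = K (G u - G v) := (map_sub K _ _).symm
    rw [e, mul_assoc]
    exact (hKle _).trans (mul_le_mul_of_nonneg_left (hGN.lip u v) hk0)
  have hΦ : ∀ u v, ‖Φ u - Φ v‖ ≤ 1 / 2 * ‖u - v‖ := fun u v =>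
    (hΦk u v).trans (mul_le_mul_of_nonneg_right hsmall (norm_nonneg _))
  let A : C(Icc (0 : ℝ) T, X) → C(Icc (0 : ℝ) T, X) →L[ℝ] C(Icc (0 : ℝ) T, X) :=
    fun v => K.comp (DG v)
  have hA : ∀ v, ‖A v‖ ≤ k * ε := fun v =>
    (K.opNorm_comp_le _).trans
      (mul_le_mul hKn (hGN.deriv_le v) (norm_nonneg _) hk0)
  have hE : Expansion Φ A (k * c) θ := by
    intro u v
    have e : Φ v - Φ u - A u (v - u) = K (G v - G u - DG u (v - u)) := by
      rw [map_sub K, map_sub K]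
      rfl
    rw [e, mul_assoc]
    exact (hKle _).trans (mul_le_mul_of_nonneg_left (hGN.expansion u v) hk0)
  obtain ⟨D, hD, hDn, hDE⟩ := solve_expansion (S := P) hΦ hA hsmall
    (mul_nonneg hk0 hF.nonneg) hF.pos.le hE
  set W := solve (S := P) hΦ with hW
  have hPM : 2 * ‖P‖ ≤ 2 * M := by linarith
  let tT : Icc (0 : ℝ) T := ⟨T, hT, le_rfl⟩
  let V : X → ℝ → X := fun x => IccExtend hT (W x)
  have hVW : ∀ x, ∀ τ, ∀ hτ : τ ∈ Icc 0 T, V x τ = W x ⟨τ, hτ⟩ := fun x τ hτ =>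
    IccExtend_of_mem hT _ hτ
  have hmild : ∀ x, IsMildOn S U F T x (V x) := by
    intro x
    refine ⟨(W x).continuous.Icc_extend'.continuousOn, fun τ hτ => ?_⟩
    rw [hVW x τ hτ, hW, solve_eq hΦ x, ← hW]
    simp only [Φ, ContinuousMap.add_apply, hP, hK, ← sub_eq_add_neg]
    congr 1
    refine duhamel_congr hτ.1 fun s hs => ?_
    have hs' : s ∈ Icc 0 T := ⟨hs.1, hs.2.trans hτ.2⟩
    rw [IccExtend_of_mem hT _ hs', hG, hVW x s hs']
  have huniq : ∀ x v, IsMildOn S U F T x v → ∀ τ ∈ Icc 0 T, v τ = V x τ := by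
    intro x v hv τ hτ
    let v' : C(Icc (0 : ℝ) T, X) := ⟨fun t => v t, hv.1.domRestrict⟩
    have h1 : v' = P x + Φ v' := by
      ext t
      simp only [Φ, ContinuousMap.add_apply, hP, hK, ← sub_eq_add_neg]
      change v t = _
      rw [hv.2 t t.2]
      congr 1
      refine duhamel_congr t.2.1 fun s hs => ?_
      have hs' : s ∈ Icc 0 T := ⟨hs.1, hs.2.trans t.2.2⟩
      rw [IccExtend_of_mem hT _ hs', hG]
      rfl
    have h2 := eq_solve hΦ h1
    rw [hVW x τ hτ, hW, ← h2]
    rfl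
  have hVlip : ∀ x y, ‖W x - W y‖ ≤ 2 * M * ‖x - y‖ := fun x y =>
    (solve_lip hΦ x y).trans (mul_le_mul_of_nonneg_right hPM (norm_nonneg _))
  -- The deviation from the linear flow is exactly the Duhamel term, so its Lipschitz constant
  -- inherits the small factor kε rather than merely being bounded.
  have hVT : ∀ x, V x T - S T x = Φ (W x) tT := by
    intro x
    have h1 : W x = P x + Φ (W x) := solve_eq hΦ x
    have h2 := congrArg (fun u : C(Icc (0 : ℝ) T, X) => u tT) h1
    simp only [ContinuousMap.add_apply, hP] at h2
    rw [hVW x T ⟨hT, le_rfl⟩]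
    exact sub_eq_of_eq_add' h2
  have hW0 : W 0 = 0 := by
    refine (eq_solve hΦ ?_).symm
    simp [Φ, hGN.zero]
  refine ⟨V, hmild, huniq, ?_, ?_, ?_, 2 * (k * c) * (2 * ‖P‖) ^ (1 + θ),
    fun x => (ContinuousMap.evalCLM ℝ tT).comp (D x - P), ?_, ?_, ?_, ?_⟩
  · intro x y τ hτ
    rw [hVW x τ hτ, hVW y τ hτ]
    exact ((W x - W y).norm_coe_le_norm ⟨τ, hτ⟩).trans (hVlip x y)
  · intro x y
    rw [hVT, hVT]
    calc ‖Φ (W x) tT - Φ (W y) tT‖ ≤ ‖Φ (W x) - Φ (W y)‖ :=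
          (Φ (W x) - Φ (W y)).norm_coe_le_norm tT
      _ ≤ k * ε * ‖W x - W y‖ := hΦk _ _
      _ ≤ k * ε * (2 * M * ‖x - y‖) :=
          mul_le_mul_of_nonneg_left (hVlip x y) (mul_nonneg hk0 hε)
      _ = _ := by ring
  · rw [hVW 0 T ⟨hT, le_rfl⟩, hW0]
    rfl
  · have := hF.nonneg
    positivity
  · have h1 := hD 0
    rw [hW0] at h1
    have h2 : A 0 = 0 := by simp [A, hGN.deriv_zero]
    rw [h2, ContinuousLinearMap.zero_comp, add_zero] at h1
    simp [h1]
  · intro x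
    -- The free part drops out of the linearised equation as well, so the derivative of the
    -- deviation also carries the factor kε.
    have h1 : D x - P = (A (W x)).comp (D x) := sub_eq_of_eq_add' (hD x)
    refine ContinuousLinearMap.opNorm_le_bound _ (by positivity) fun z => ?_
    rw [ContinuousLinearMap.comp_apply, ContinuousMap.evalCLM_apply, h1]
    refine (ContinuousMap.norm_coe_le_norm _ _).trans ?_
    refine (ContinuousLinearMap.le_opNorm _ _).trans
      (mul_le_mul_of_nonneg_right ?_ (norm_nonneg _))
    refine ((A (W x)).opNorm_comp_le (D x)).trans ?_
    exact mul_le_mul (hA _) ((hDn x).trans hPM) (norm_nonneg _) (mul_nonneg hk0 hε)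
  · intro x y
    have e : V y T - S T y - (V x T - S T x)
        - ((ContinuousMap.evalCLM ℝ tT).comp (D x - P)) (y - x)
        = (W y - W x - D x (y - x)) tT := by
      rw [ContinuousLinearMap.comp_apply, ContinuousMap.evalCLM_apply,
        hVW x T ⟨hT, le_rfl⟩, hVW y T ⟨hT, le_rfl⟩]
      simp only [sub_apply, ContinuousMap.sub_apply, hP, map_sub]
      abel
    rw [e]
    exact (ContinuousMap.norm_coe_le_norm _ _).trans (hDE x y)

end Mild

/-! ### Global solutions and the semiflow -/

namespace Mild

open Filter Topology IsSmoothing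

variable {X Y : Type*} [NormedAddCommGroup X] [NormedSpace ℝ X] [NormedAddCommGroup Y]
  [NormedSpace ℝ Y]

variable {S : ℝ → X →L[ℝ] X} {U : ℝ → Y →L[ℝ] X} {γ : ℝ} {F : X → Y}

theorem IsMildOn.mono {T T' : ℝ} {x : X} {v : ℝ → X} (h : IsMildOn S U F T x v) (hT : T' ≤ T) :
    IsMildOn S U F T' x v :=
  ⟨h.1.mono (Icc_subset_Icc_right hT), fun τ hτ => h.2 τ ⟨hτ.1, hτ.2.trans hT⟩⟩

theorem IsMildOn.congr {T : ℝ} {x : X} {v u : ℝ → X} (h : IsMildOn S U F T x v)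
    (huv : EqOn u v (Icc 0 T)) : IsMildOn S U F T x u := by
  refine ⟨h.1.congr huv, fun τ hτ => ?_⟩
  rw [huv hτ, h.2 τ hτ]
  congr 1
  refine duhamel_congr hτ.1 fun s hs => ?_
  rw [huv ⟨hs.1, hs.2.trans hτ.2⟩]

theorem IsMild.on {x : X} {v : ℝ → X} (h : IsMild S U F x v) (T : ℝ) : IsMildOn S U F T x v :=
  ⟨h.1.mono fun _ ht => ht.1, fun τ hτ => h.2 τ hτ.1⟩

theorem isMild_of_forall_on {x : X} {v : ℝ → X} {T : ℝ} (hT : 0 < T)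
    (h : ∀ n : ℕ, IsMildOn S U F (n * T) x v) : IsMild S U F x v := by
  have hn : ∀ τ : ℝ, ∃ n : ℕ, τ < n * T := fun τ => by
    obtain ⟨n, hn⟩ := exists_nat_gt (τ / T)
    exact ⟨n, (div_lt_iff₀ hT).mp hn⟩
  refine ⟨fun τ hτ => ?_, fun τ hτ => ?_⟩
  · obtain ⟨n, hn⟩ := hn τ
    have h1 := (h n).1 τ ⟨hτ, hn.le⟩
    rw [← Ici_inter_Iic, continuousWithinAt_inter (Iic_mem_nhds hn)] at h1
    exact h1
  · obtain ⟨n, hn⟩ := hn τ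
    exact (h n).2 τ ⟨hτ, hn.le⟩

section

variable [CompleteSpace X]

theorem IsMildOn.shift (h : IsSmoothing S U γ) (hF : Continuous F)
    {b d : ℝ} (hb : 0 ≤ b) (hd : 0 ≤ d) {x : X} {v : ℝ → X}
    (hv : IsMildOn S U F (b + d) x v) : IsMildOn S U F d (v b) fun s => v (b + s) := by
  refine ⟨hv.1.comp (continuousOn_const.add continuousOn_id) fun s hs =>
    ⟨add_nonneg hb hs.1, by linarith [hs.2]⟩, fun τ hτ => ?_⟩
  have hd := h.duhamel_add hb hτ.1 (y := fun s => F (v s)) (hF.comp_continuousOn (hv.1.mono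
      (Icc_subset_Icc_right (by linarith [hτ.2]))))
  dsimp only
  rw [hv.2 (b + τ) ⟨add_nonneg hb hτ.1, by linarith [hτ.2]⟩, hv.2 b ⟨hb, by linarith⟩,
    hd, add_comm b τ, h.add τ b hτ.1 hb, map_sub]
  rw [ContinuousLinearMap.comp_apply]
  abel

theorem IsMildOn.concat (h : IsSmoothing S U γ) (hF : Continuous F)
    {b d : ℝ} (hb : 0 ≤ b) (hd : 0 ≤ d) {x : X} {v u : ℝ → X}
    (hv : IsMildOn S U F b x v) (hu : IsMildOn S U F d (v b) u) :
    ∃ w, IsMildOn S U F (b + d) x w := by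
  let w : ℝ → X := fun t => if t ≤ b then v t else u (t - b)
  have hu0 : u 0 = v b := by
    have := hu.2 0 ⟨le_rfl, hd⟩
    rw [this, h.zero]
    simp [duhamel]
  have hwv : EqOn w v (Icc 0 b) := fun t ht => if_pos ht.2
  have hwu : EqOn w (fun t => u (t - b)) (Icc b (b + d)) := by
    intro t ht
    rcases ht.1.eq_or_lt with rfl | hlt
    · simp [w, hu0]
    · exact if_neg (not_le.mpr hlt)
  have hcw : ContinuousOn w (Icc 0 (b + d)) := by
    rw [← Icc_union_Icc_eq_Icc hb (by linarith : b ≤ b + d)]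
    refine (hv.1.congr hwv).union_of_isClosed (ContinuousOn.congr ?_ hwu) isClosed_Icc
      isClosed_Icc
    exact hu.1.comp (continuousOn_id.sub continuousOn_const) fun s hs =>
      ⟨by simpa using hs.1, by linarith [hs.2]⟩
  have hwb := hv.congr hwv
  refine ⟨w, hcw, fun τ hτ => ?_⟩
  rcases le_or_gt τ b with hle | hlt
  · exact hwb.2 τ ⟨hτ.1, hle⟩
  · obtain ⟨σ, rfl⟩ : ∃ σ, τ = b + σ := ⟨τ - b, by ring⟩
    have hσ : 0 ≤ σ := by linarith
    have hσd : σ ≤ d := by linarith [hτ.2]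
    have e1 : w (b + σ) = u σ := by
      rw [hwu ⟨by linarith, by linarith⟩]
      simp
    have e2 : EqOn (fun s => F (w (b + s))) (fun s => F (u s)) (Icc 0 σ) := by
      intro s hs
      have : w (b + s) = u s := by
        rw [hwu ⟨by linarith [hs.1], by linarith [hs.2]⟩]
        simp
      simp only [this]
    have e3 : w b = v b := hwv ⟨hb, le_rfl⟩
    rw [h.duhamel_add hb hσ (y := fun s => F (w s)) (hF.comp_continuousOn (hcw.mono
      (Icc_subset_Icc_right (by linarith)))), duhamel_congr hσ e2, e1, hu.2 σ ⟨hσ, hσd⟩, ← e3,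
      hwb.2 b ⟨hb, le_rfl⟩, add_comm b σ, h.add σ b hσ hb, map_sub, ContinuousLinearMap.comp_apply]
    abel

/-- Local existence holds on an interval whose length does not depend on the initial value, so steps
of length `T` can be concatenated indefinitely; uniqueness propagates step by step after shifting
time. -/
theorem existsUnique_global (h : IsSmoothing S U γ) (hF : Continuous F)
    {T : ℝ} (hT : 0 < T) {V : X → ℝ → X}
    (hV : ∀ x, IsMildOn S U F T x (V x))
    (hVu : ∀ x v, IsMildOn S U F T x v → ∀ τ ∈ Icc 0 T, v τ = V x τ) :
    ∃ φ : ℝ → X → X, (∀ x, IsMild S U F x fun τ => φ τ x) ∧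
      ∀ x v, IsMild S U F x v → ∀ τ, 0 ≤ τ → v τ = φ τ x := by
  have hex : ∀ n : ℕ, ∀ x, ∃ v, IsMildOn S U F (n * T) x v := by
    intro n
    induction n with
    | zero => exact fun x => ⟨V x, (hV x).mono (by simpa using hT.le)⟩
    | succ n ih =>
      intro x
      obtain ⟨v, hv⟩ := ih x
      have := hv.concat h hF (by positivity) hT.le (hV (v (n * T)))
      rwa [← add_one_mul, ← Nat.cast_succ] at this
  have huni : ∀ n : ℕ, ∀ x v u, IsMildOn S U F (n * T) x v → IsMildOn S U F (n * T) x u →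
      ∀ τ ∈ Icc 0 (n * T), v τ = u τ := by
    intro n
    induction n with
    | zero =>
      intro x v u hv hu τ hτ
      rw [hv.2 τ hτ, hu.2 τ hτ]
      have : τ = 0 := by simpa using hτ
      simp [this, duhamel]
    | succ n ih =>
      intro x v u hv hu τ hτ
      have hT1 : ((n + 1 : ℕ) : ℝ) * T = T + n * T := by push_cast; ring
      rw [hT1] at hv hu hτ
      have hn : 0 ≤ (n : ℝ) * T := by positivity
      have hvT := hVu x v (hv.mono (by linarith))
      have huT := hVu x u (hu.mono (by linarith))
      rcases le_or_gt τ T with hle | hlt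
      · rw [hvT τ ⟨hτ.1, hle⟩, huT τ ⟨hτ.1, hle⟩]
      · have hvs := hv.shift h hF hT.le hn
        have hus := hu.shift h hF hT.le hn
        rw [hvT T ⟨hT.le, le_rfl⟩] at hvs
        rw [huT T ⟨hT.le, le_rfl⟩] at hus
        have := ih _ _ _ hvs hus (τ - T) ⟨by linarith, by linarith [hτ.2]⟩
        simpa using this
  choose v hv using hex
  have hceil : ∀ τ : ℝ, 0 ≤ τ → τ ≤ (⌈τ / T⌉₊ : ℝ) * T := fun τ _ =>
    (div_le_iff₀ hT).mp (Nat.le_ceil _)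
  -- The global solution reads off, at time τ, a solution on n steps with n = ⌈τ/T⌉. By uniqueness
  -- all longer ones agree with it, so the pieces are consistent.
  have hglob : ∀ x, IsMild S U F x fun τ => v ⌈τ / T⌉₊ x τ := by
    intro x
    refine isMild_of_forall_on hT fun n => (hv n x).congr fun τ hτ => ?_
    have hle : ⌈τ / T⌉₊ ≤ n := Nat.ceil_le.mpr ((div_le_iff₀ hT).mpr hτ.2)
    refine huni ⌈τ / T⌉₊ x _ _ (hv _ x) ((hv n x).mono ?_) τ ⟨hτ.1, hceil τ hτ.1⟩
    exact mul_le_mul_of_nonneg_right (by exact_mod_cast hle) hT.le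
  refine ⟨fun τ x => v ⌈τ / T⌉₊ x τ, hglob, fun x u hu τ hτ => ?_⟩
  exact huni ⌈τ / T⌉₊ x _ _ (hu.on _) ((hglob x).on _) τ ⟨hτ, hceil τ hτ⟩

theorem IsMild.shift (h : IsSmoothing S U γ) (hF : Continuous F)
    {x : X} {v : ℝ → X} (hv : IsMild S U F x v) {b : ℝ} (hb : 0 ≤ b) :
    IsMild S U F (v b) fun s => v (b + s) := by
  refine isMild_of_forall_on one_pos fun n => ?_
  exact IsMildOn.shift h hF hb (by positivity) (hv.on _)

end

variable {DF : X → X →L[ℝ] Y} {ε b c θ : ℝ}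

/-- The semiflow of a semilinear equation with small nonlinearity, and its time-`T` map. -/
theorem exists_semiflow [CompleteSpace X] (h : IsSmoothing S U γ)
    (hF : IsNonlinearity F DF ε b c θ) {T M C : ℝ} (hT : 0 < T) (hM0 : 0 ≤ M)
    (hM : ∀ τ, 0 ≤ τ → τ ≤ T → ‖S τ‖ ≤ M) (hC0 : 0 ≤ C)
    (hC : ∀ σ, 0 < σ → σ ≤ T → ‖U σ‖ ≤ C * σ ^ (-γ))
    (hsmall : C * (T ^ (1 - γ) / (1 - γ)) * ε ≤ 1 / 2) :
    ∃ φ : ℝ → X → X, (∀ x, IsMild S U F x fun τ => φ τ x) ∧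
      (∀ x v, IsMild S U F x v → ∀ τ, 0 ≤ τ → v τ = φ τ x) ∧
      (∀ s t, 0 ≤ s → 0 ≤ t → ∀ x, φ (s + t) x = φ s (φ t x)) ∧
      (∀ τ, 0 ≤ τ → ∃ d, ∀ x, ‖φ τ x - S τ x‖ ≤ d) ∧
      (∀ x y, ∀ τ ∈ Icc 0 T, ‖φ τ x - φ τ y‖ ≤ 2 * M * ‖x - y‖) ∧
      (∀ x y, ‖(φ T x - S T x) - (φ T y - S T y)‖ ≤
        C * (T ^ (1 - γ) / (1 - γ)) * ε * (2 * M) * ‖x - y‖) ∧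
      φ T 0 = 0 ∧
      ∃ (c' : ℝ) (A : X → X →L[ℝ] X), 0 ≤ c' ∧ A 0 = 0 ∧
        (∀ x, ‖A x‖ ≤ C * (T ^ (1 - γ) / (1 - γ)) * ε * (2 * M)) ∧
        Expansion (fun x => φ T x - S T x) A c' θ := by
  obtain ⟨V, hV, hVu, hVlip, hVR, hV0, hVE⟩ := h.exists_local hF hT.le hM0 hM hC0 hC hsmall
  obtain ⟨φ, hφ, hφu⟩ := existsUnique_global h hF.continuous hT hV hVu
  have hφV : ∀ x, ∀ τ ∈ Icc 0 T, φ τ x = V x τ := fun x => hVu x _ ((hφ x).on T)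
  have hTT : T ∈ Icc 0 T := ⟨hT.le, le_rfl⟩
  have hφT : ∀ x, φ T x = V x T := fun x => hφV x T hTT
  refine ⟨φ, hφ, hφu, ?_, ?_, ?_, ?_, ?_, ?_⟩
  · intro s t hs ht x
    have := hφu (φ t x) _ ((hφ x).shift h hF.continuous ht) s hs
    rw [add_comm, this]
  · intro τ hτ
    -- Here τ may exceed `T`, so a separate bound for `U` is taken; the horizon τ + 1 stays positive
    -- at τ = 0. Boundedness of `F` makes the estimate uniform in `x`.
    obtain ⟨C', hC'0, hC'⟩ := h.bound (τ + 1) (by linarith)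
    refine ⟨C' * ((τ + 1) ^ (1 - γ) / (1 - γ)) * b, fun x => ?_⟩
    have hx : φ τ x = _ := (hφ x).2 τ hτ
    rw [hx, sub_sub_cancel_left, norm_neg]
    exact h.norm_duhamel_le hC'0 hF.bound_nonneg hC' hτ (by linarith) fun s _ => hF.bdd _
  · intro x y τ hτ
    rw [hφV x τ hτ, hφV y τ hτ]
    exact hVlip x y τ hτ
  · intro x y
    rw [hφT, hφT]
    exact hVR x y
  · rw [hφT, hV0]
  · simpa only [hφT] using hVE

end Mild

/-! ### Integral operators on the weighted spaces -/

namespace ViscousHJ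

open Filter Topology
open scoped ENNReal

/-- The Schur–Young bound for a positive kernel from `L^p` to `L^2`. The exponents are
`1/r = 1/2 + a`, `1/p = 1/2 + b`, `a + b = 1/2`. -/
theorem lintegral_kernel_sq_le {α β : Type*} [MeasurableSpace α] [MeasurableSpace β]
    {μ : Measure α} {ν : Measure β} [SFinite μ] [SFinite ν] {J : α → β → ℝ≥0∞}
    (hJ : Measurable (Function.uncurry J)) {f : β → ℝ≥0∞} (hf : AEMeasurable f ν)
    {a b p r : ℝ} (ha : 0 ≤ a) (hb : 0 ≤ b) (hab : a + b = 1 / 2) (hr : r * (1 / 2 + a) = 1)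
    (hp : p * (1 / 2 + b) = 1) {A₁ A₂ : ℝ≥0∞} (h₁ : ∀ x, ∫⁻ y, J x y ^ r ∂ν ≤ A₁)
    (h₂ : ∀ y, ∫⁻ x, J x y ^ r ∂μ ≤ A₂) :
    ∫⁻ x, (∫⁻ y, J x y * f y ∂ν) ^ 2 ∂μ ≤
      A₁ ^ (2 * a) * A₂ * (∫⁻ y, f y ^ p ∂ν) ^ (2 / p) := by
  have hr0 : 0 ≤ r := by nlinarith
  have hp0 : 0 < p := by nlinarith
  have hJx : ∀ x, Measurable (J x) := fun x => hJ.comp measurable_prodMk_left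
  set M := ∫⁻ y, f y ^ p ∂ν with hM
  have hin : ∀ x, (∫⁻ y, J x y * f y ∂ν) ^ 2 ≤
      (∫⁻ y, J x y ^ r * f y ^ p ∂ν) * (A₁ ^ (2 * a) * M ^ (2 * b)) := by
    intro x
    -- The splitting is J f = (J^r f^p)^{1/2} · ((J^r)^{2a} (f^p)^{2b})^{1/2}, consistent because
    -- r(1/2 + a) = 1 = p(1/2 + b). Cauchy–Schwarz separates the two factors, and Hölder with
    -- weights 2a + 2b = 1 treats the second.
    have e : ∀ y, J x y * f y = (J x y ^ r * f y ^ p) ^ (1 / 2 : ℝ) *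
        (((J x y ^ r) ^ (2 * a) * (f y ^ p) ^ (2 * b)) ^ (1 / 2 : ℝ)) := by
      intro y
      have e1 : J x y = (J x y ^ r) ^ (1 / 2 : ℝ) * ((J x y ^ r) ^ (2 * a)) ^ (1 / 2 : ℝ) := by
        rw [← ENNReal.rpow_mul, ← ENNReal.rpow_mul, ← ENNReal.rpow_mul,
          ← ENNReal.rpow_add_of_nonneg _ _ (by positivity) (by positivity)]
        rw [show r * (1 / 2) + r * (2 * a * (1 / 2)) = 1 by linarith, ENNReal.rpow_one]
      have e2 : f y = (f y ^ p) ^ (1 / 2 : ℝ) * ((f y ^ p) ^ (2 * b)) ^ (1 / 2 : ℝ) := by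
        rw [← ENNReal.rpow_mul, ← ENNReal.rpow_mul, ← ENNReal.rpow_mul,
          ← ENNReal.rpow_add_of_nonneg _ _ (by positivity) (by positivity)]
        rw [show p * (1 / 2) + p * (2 * b * (1 / 2)) = 1 by linarith, ENNReal.rpow_one]
      rw [ENNReal.mul_rpow_of_nonneg _ _ (by norm_num : (0 : ℝ) ≤ 1 / 2),
        ENNReal.mul_rpow_of_nonneg _ _ (by norm_num : (0 : ℝ) ≤ 1 / 2)]
      conv_lhs => rw [e1, e2]
      ring
    have hm1 : AEMeasurable (fun y => J x y ^ r * f y ^ p) ν :=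
      ((hJx x).pow_const r).aemeasurable.mul (hf.pow_const p)
    have hm2 : AEMeasurable (fun y => (J x y ^ r) ^ (2 * a) * (f y ^ p) ^ (2 * b)) ν :=
      (((hJx x).pow_const r).pow_const _).aemeasurable.mul ((hf.pow_const p).pow_const _)
    have k1 : ∫⁻ y, J x y * f y ∂ν ≤ (∫⁻ y, J x y ^ r * f y ^ p ∂ν) ^ (1 / 2 : ℝ) *
        (∫⁻ y, (J x y ^ r) ^ (2 * a) * (f y ^ p) ^ (2 * b) ∂ν) ^ (1 / 2 : ℝ) := by
      simp_rw [e]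
      exact ENNReal.lintegral_mul_norm_pow_le hm1 hm2 (by norm_num) (by norm_num) (by norm_num)
    have k2 : ∫⁻ y, (J x y ^ r) ^ (2 * a) * (f y ^ p) ^ (2 * b) ∂ν ≤
        A₁ ^ (2 * a) * M ^ (2 * b) := by
      refine (ENNReal.lintegral_mul_norm_pow_le ((hJx x).pow_const r).aemeasurable
        (hf.pow_const p) (by positivity) (by positivity) (by linarith)).trans ?_
      gcongr
      exact h₁ x
    calc (∫⁻ y, J x y * f y ∂ν) ^ 2
        ≤ ((∫⁻ y, J x y ^ r * f y ^ p ∂ν) ^ (1 / 2 : ℝ) *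
          (A₁ ^ (2 * a) * M ^ (2 * b)) ^ (1 / 2 : ℝ)) ^ 2 := by
          gcongr
          exact k1.trans (by gcongr)
      _ = _ := by
          rw [← ENNReal.rpow_two, ← ENNReal.mul_rpow_of_nonneg _ _ (by norm_num : (0 : ℝ) ≤ 1 / 2),
            ← ENNReal.rpow_mul]
          norm_num
  -- Only the first factor still depends on both variables; Tonelli integrates it in x first, where
  -- the second kernel bound applies.
  have hswap : ∫⁻ x, ∫⁻ y, J x y ^ r * f y ^ p ∂ν ∂μ ≤ A₂ * M := by
    rw [lintegral_lintegral_swap]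
    · have : ∀ y, ∫⁻ x, J x y ^ r * f y ^ p ∂μ ≤ A₂ * f y ^ p := fun y => by
        have hm : Measurable fun x => J x y ^ r := (hJ.comp measurable_prodMk_right).pow_const r
        rw [lintegral_mul_const _ hm]
        gcongr
        exact h₂ y
      refine (lintegral_mono this).trans ?_
      rw [lintegral_const_mul'' _ (hf.pow_const p)]
    · exact ((hJ.pow_const r).aemeasurable).mul ((hf.pow_const p).comp_snd)
  calc ∫⁻ x, (∫⁻ y, J x y * f y ∂ν) ^ 2 ∂μ
      ≤ ∫⁻ x, (∫⁻ y, J x y ^ r * f y ^ p ∂ν) * (A₁ ^ (2 * a) * M ^ (2 * b)) ∂μ :=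
        lintegral_mono hin
    _ = (∫⁻ x, (∫⁻ y, J x y ^ r * f y ^ p ∂ν) ∂μ) * (A₁ ^ (2 * a) * M ^ (2 * b)) := by
        refine lintegral_mul_const'' _ ?_
        exact (((hJ.pow_const r).aemeasurable).mul ((hf.pow_const p).comp_snd)).lintegral_prod_right'
    _ ≤ A₂ * M * (A₁ ^ (2 * a) * M ^ (2 * b)) := by gcongr
    _ = A₁ ^ (2 * a) * A₂ * M ^ (2 / p) := by
        have : M ^ (2 / p) = M * M ^ (2 * b) := by
          conv_rhs => rw [← ENNReal.rpow_one M, ← ENNReal.rpow_mul,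
            ← ENNReal.rpow_add_of_nonneg _ _ (by positivity) (by positivity)]
          congr 1
          field_simp
          linarith
        rw [this]
        ring

variable {N : ℕ} {m : ℝ}

/-- The weight `1 + |ξ|^{2m}`. -/
noncomputable def weight (m : ℝ) (ξ : Eu N) : ℝ := 1 + ‖ξ‖ ^ (2 * m)

theorem one_le_weight (m : ℝ) (ξ : Eu N) : 1 ≤ weight m ξ := by
  have : (0 : ℝ) ≤ ‖ξ‖ ^ (2 * m) := by positivity
  simp only [weight]
  linarith

theorem weight_pos (m : ℝ) (ξ : Eu N) : 0 < weight m ξ := zero_lt_one.trans_le (one_le_weight m ξ)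

theorem measurable_weight (m : ℝ) : Measurable (weight (N := N) m) := by
  unfold weight
  fun_prop

theorem weightedMeasure_eq (N : ℕ) (m : ℝ) : weightedMeasure N m =
    (volume : Measure (Eu N)).withDensity fun ξ => ENNReal.ofReal (weight m ξ) := rfl

theorem lintegral_weighted {f : Eu N → ℝ≥0∞} (hf : AEMeasurable f volume) :
    ∫⁻ ξ, f ξ ∂(weightedMeasure N m) = ∫⁻ ξ, ENNReal.ofReal (weight m ξ) * f ξ := by
  rw [weightedMeasure_eq, lintegral_withDensity_eq_lintegral_mul₀
    (measurable_weight m).ennreal_ofReal.aemeasurable hf]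
  rfl

theorem weighted_absolutelyContinuous : weightedMeasure N m ≪ (volume : Measure (Eu N)) :=
  withDensity_absolutelyContinuous _ _

theorem volume_absolutelyContinuous : (volume : Measure (Eu N)) ≪ weightedMeasure N m :=
  Measure.absolutelyContinuous_of_le (volume_le_weightedMeasure N m)

theorem ae_weighted_iff {P : Eu N → Prop} :
    (∀ᵐ ξ ∂(weightedMeasure N m), P ξ) ↔ ∀ᵐ ξ, P ξ :=
  ⟨fun h => volume_absolutelyContinuous.ae_le h, fun h => weighted_absolutelyContinuous.ae_le h⟩

theorem aestronglyMeasurable_weighted {G : Type*} [TopologicalSpace G] {f : Eu N → G}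
    (hf : AEStronglyMeasurable f volume) : AEStronglyMeasurable f (weightedMeasure N m) :=
  hf.mono_ac weighted_absolutelyContinuous

/-- The positive kernel `k` defines an operator from `L^p_m` to `L²_m` of norm at most `A`. -/
def KernelBound (m : ℝ) (k : Eu N → Eu N → ℝ≥0∞) (p : ℝ) (A : ℝ≥0∞) : Prop :=
  ∀ f : Eu N → ℝ≥0∞, AEMeasurable f volume →
    ∫⁻ ξ, (∫⁻ y, k ξ y * f y) ^ 2 ∂(weightedMeasure N m) ≤
      A ^ 2 * (∫⁻ y, f y ^ p ∂(weightedMeasure N m)) ^ (2 / p)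

theorem KernelBound.mono {k k' : Eu N → Eu N → ℝ≥0∞} {p : ℝ} {A A' : ℝ≥0∞}
    (h : KernelBound m k p A) (hk : ∀ ξ y, k' ξ y ≤ k ξ y) (hA : A ≤ A') :
    KernelBound m k' p A' := by
  intro f hf
  refine le_trans ?_ ((h f hf).trans ?_)
  · gcongr with ξ y
    exact hk ξ y
  · gcongr

/-- Minkowski's inequality in the weighted L² space. It is used for the kernel on mass-free
functions, which is split into a near and a far part. -/
theorem KernelBound.add {k k' : Eu N → Eu N → ℝ≥0∞} (hk : Measurable (Function.uncurry k))
    (hk' : Measurable (Function.uncurry k')) {p : ℝ} {A A' : ℝ≥0∞}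
    (h : KernelBound m k p A) (h' : KernelBound m k' p A') :
    KernelBound m (fun ξ y => k ξ y + k' ξ y) p (A + A') := by
  intro f hf
  set M := (∫⁻ y, f y ^ p ∂(weightedMeasure N m)) ^ (1 / p) with hM
  have hM2 : (∫⁻ y, f y ^ p ∂(weightedMeasure N m)) ^ (2 / p) = M ^ 2 := by
    rw [hM, ← ENNReal.rpow_two, ← ENNReal.rpow_mul]
    congr 1
    ring
  have hm : ∀ k : Eu N → Eu N → ℝ≥0∞, Measurable (Function.uncurry k) →
      AEMeasurable (fun ξ => ∫⁻ y, k ξ y * f y) (weightedMeasure N m) := fun k hk =>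
    ((hk.aemeasurable.mul hf.comp_snd).lintegral_prod_right').mono_ac
      weighted_absolutelyContinuous
  have hroot : ∀ {k : Eu N → Eu N → ℝ≥0∞} {A : ℝ≥0∞}, KernelBound m k p A →
      (∫⁻ ξ, (∫⁻ y, k ξ y * f y) ^ (2 : ℝ) ∂(weightedMeasure N m)) ^ (1 / 2 : ℝ) ≤ A * M := by
    intro k A hk
    have := hk f hf
    rw [hM2, ← mul_pow] at this
    simp_rw [ENNReal.rpow_two]
    calc _ ≤ ((A * M) ^ 2) ^ (1 / 2 : ℝ) := by gcongr
      _ = A * M := by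
        rw [← ENNReal.rpow_two, ← ENNReal.rpow_mul]
        norm_num
  have key := ENNReal.lintegral_Lp_add_le (hm k hk) (hm k' hk') (p := 2) (by norm_num)
  have h1 := key.trans (add_le_add (hroot h) (hroot h'))
  rw [← add_mul] at h1
  have e : ∀ ξ, ∫⁻ y, (k ξ y + k' ξ y) * f y = (∫⁻ y, k ξ y * f y) + ∫⁻ y, k' ξ y * f y := by
    intro ξ
    simp_rw [add_mul]
    exact lintegral_add_left' ((hk.comp measurable_prodMk_left).aemeasurable.mul hf) _
  rw [hM2, ← mul_pow]
  simp_rw [e]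
  calc _ = ((∫⁻ ξ, ((∫⁻ y, k ξ y * f y) + ∫⁻ y, k' ξ y * f y) ^ (2 : ℝ)
        ∂(weightedMeasure N m)) ^ (1 / 2 : ℝ)) ^ 2 := by
        rw [← ENNReal.rpow_two, ← ENNReal.rpow_mul]
        norm_num
    _ ≤ _ := by gcongr; exact h1

/-- The Schur–Young bound in the weighted spaces. -/
theorem kernelBound_of_schur {k J : Eu N → Eu N → ℝ≥0∞}
    (hk : Measurable (Function.uncurry k)) (hJ : Measurable (Function.uncurry J))
    (hkJ : ∀ ξ y, ENNReal.ofReal (√(weight m ξ)) * k ξ y ≤ ENNReal.ofReal (√(weight m y)) * J ξ y)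
    {a b p r : ℝ} (ha : 0 ≤ a) (hb : 0 ≤ b) (hab : a + b = 1 / 2) (hr : r * (1 / 2 + a) = 1)
    (hp : p * (1 / 2 + b) = 1) {A₁ A₂ A : ℝ≥0∞} (h₁ : ∀ x, ∫⁻ y, J x y ^ r ≤ A₁)
    (h₂ : ∀ y, ∫⁻ x, J x y ^ r ≤ A₂) (hA : A₁ ^ (2 * a) * A₂ ≤ A ^ 2) :
    KernelBound m k p A := by
  intro f hf
  have hp0 : 0 < p := by nlinarith
  have hp2 : 1 / 2 ≤ 1 / p := by
    rw [one_div, one_div, inv_le_inv₀ (by norm_num) hp0]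
    nlinarith
  have hw := measurable_weight (N := N) m
  -- The unweighted bound is applied to w^{1/p} f, whose L^p norm is the weighted norm of f. Moving
  -- √w through the kernel yields √w f only, which is enough because p ≤ 2 and w ≥ 1 give √w ≤
  -- w^{1/p}.
  have hF : AEMeasurable (fun y => ENNReal.ofReal (weight m y) ^ (1 / p) * f y) volume :=
    (hw.ennreal_ofReal.pow_const _).aemeasurable.mul hf
  have h1 := lintegral_kernel_sq_le (μ := volume) (ν := volume) hJ hF ha hb hab hr hp h₁ h₂
  have e1 : ∫⁻ y, (ENNReal.ofReal (weight m y) ^ (1 / p) * f y) ^ p =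
      ∫⁻ y, f y ^ p ∂(weightedMeasure N m) := by
    rw [lintegral_weighted (hf.pow_const p)]
    refine lintegral_congr fun y => ?_
    rw [ENNReal.mul_rpow_of_nonneg _ _ hp0.le, ← ENNReal.rpow_mul, one_div_mul_cancel hp0.ne',
      ENNReal.rpow_one]
  rw [e1] at h1
  have hm : AEMeasurable (fun ξ => (∫⁻ y, k ξ y * f y) ^ 2) volume :=
    ((hk.aemeasurable.mul hf.comp_snd).lintegral_prod_right').pow_const 2
  rw [lintegral_weighted hm]
  refine le_trans (lintegral_mono fun ξ => ?_) (h1.trans (by gcongr))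
  have e2 : ENNReal.ofReal (weight m ξ) = ENNReal.ofReal (√(weight m ξ)) ^ 2 := by
    rw [← ENNReal.ofReal_pow (Real.sqrt_nonneg _), Real.sq_sqrt (weight_pos m ξ).le]
  dsimp only
  rw [e2, ← mul_pow]
  gcongr
  have hmk : AEMeasurable (fun y => k ξ y * f y) volume :=
    (hk.comp measurable_prodMk_left).aemeasurable.mul hf
  rw [← lintegral_const_mul'' _ hmk]
  refine lintegral_mono fun y => ?_
  dsimp only
  rw [← mul_assoc]
  refine (mul_le_mul_left (hkJ ξ y) (f y)).trans ?_
  have e3 : ENNReal.ofReal (√(weight m y)) ≤ ENNReal.ofReal (weight m y) ^ (1 / p) := by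
    rw [ENNReal.ofReal_rpow_of_pos (weight_pos m y)]
    refine ENNReal.ofReal_le_ofReal ?_
    rw [Real.sqrt_eq_rpow]
    exact Real.rpow_le_rpow_of_exponent_le (one_le_weight m y) hp2
  calc _ ≤ ENNReal.ofReal (weight m y) ^ (1 / p) * J ξ y * f y := by gcongr
    _ = _ := by ring

/-- Kernels dominated by a product. -/
theorem kernelBound_of_le_mul {k : Eu N → Eu N → ℝ≥0∞} {u v : Eu N → ℝ≥0∞}
    (hu : Measurable u) (hv : Measurable v) (hk : ∀ ξ y, k ξ y ≤ u ξ * v y) {A : ℝ≥0∞}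
    (hA : (∫⁻ ξ, u ξ ^ 2 ∂(weightedMeasure N m)) *
      (∫⁻ y, (ENNReal.ofReal (weight m y))⁻¹ * v y ^ 2) ≤ A ^ 2) :
    KernelBound m k 2 A := by
  intro f hf
  have hw := measurable_weight (N := N) m
  have h1 : (∫⁻ y, v y * f y) ^ 2 ≤ (∫⁻ y, (ENNReal.ofReal (weight m y))⁻¹ * v y ^ 2) *
      ∫⁻ y, ENNReal.ofReal (weight m y) * f y ^ 2 := by
    have e : ∀ y, v y * f y = ((ENNReal.ofReal (weight m y))⁻¹ * v y ^ 2) ^ (1 / 2 : ℝ) *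
        (ENNReal.ofReal (weight m y) * f y ^ 2) ^ (1 / 2 : ℝ) := by
      intro y
      have hne : ENNReal.ofReal (weight m y) ≠ 0 := by
        simpa using weight_pos m y
      rw [← ENNReal.mul_rpow_of_nonneg _ _ (by norm_num : (0 : ℝ) ≤ 1 / 2)]
      have : (ENNReal.ofReal (weight m y))⁻¹ * v y ^ 2 * (ENNReal.ofReal (weight m y) * f y ^ 2)
          = (v y * f y) ^ 2 := by
        calc _ = ((ENNReal.ofReal (weight m y))⁻¹ * ENNReal.ofReal (weight m y))
              * (v y ^ 2 * f y ^ 2) := by ring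
          _ = _ := by rw [ENNReal.inv_mul_cancel hne ENNReal.ofReal_ne_top]; ring
      rw [this, ← ENNReal.rpow_two, ← ENNReal.rpow_mul]
      norm_num
    have hm1 : AEMeasurable (fun y => (ENNReal.ofReal (weight m y))⁻¹ * v y ^ 2) volume :=
      (hw.ennreal_ofReal.inv.mul (hv.pow_const 2)).aemeasurable
    have hm2 : AEMeasurable (fun y => ENNReal.ofReal (weight m y) * f y ^ 2) volume :=
      hw.ennreal_ofReal.aemeasurable.mul (hf.pow_const 2)
    have := ENNReal.lintegral_mul_norm_pow_le hm1 hm2 (p := 1 / 2) (q := 1 / 2) (by norm_num)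
      (by norm_num) (by norm_num)
    simp_rw [← e] at this
    calc _ ≤ _ := pow_le_pow_left' this 2
      _ = _ := by
        rw [← ENNReal.mul_rpow_of_nonneg _ _ (by norm_num : (0 : ℝ) ≤ 1 / 2),
          ← ENNReal.rpow_two, ← ENNReal.rpow_mul]
        norm_num
  have h2 : ∀ ξ, (∫⁻ y, k ξ y * f y) ^ 2 ≤ u ξ ^ 2 * (∫⁻ y, v y * f y) ^ 2 := by
    intro ξ
    have hmv : AEMeasurable (fun y => v y * f y) volume := hv.aemeasurable.mul hf
    rw [← mul_pow, ← lintegral_const_mul'' _ hmv]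
    refine pow_le_pow_left' (lintegral_mono fun y => ?_) 2
    dsimp only
    rw [← mul_assoc]
    gcongr
    exact hk ξ y
  refine (lintegral_mono h2).trans ?_
  rw [lintegral_mul_const _ (hu.pow_const 2)]
  have e3 : ∫⁻ y, f y ^ (2 : ℝ) ∂(weightedMeasure N m) =
      ∫⁻ y, ENNReal.ofReal (weight m y) * f y ^ 2 := by
    rw [lintegral_weighted (hf.pow_const _)]
    simp_rw [ENNReal.rpow_two]
  rw [e3, div_self (two_ne_zero), ENNReal.rpow_one]
  calc _ ≤ (∫⁻ ξ, u ξ ^ 2 ∂(weightedMeasure N m)) *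
        ((∫⁻ y, (ENNReal.ofReal (weight m y))⁻¹ * v y ^ 2) *
          ∫⁻ y, ENNReal.ofReal (weight m y) * f y ^ 2) := by gcongr
    _ ≤ _ := by
      rw [← mul_assoc]
      gcongr

end ViscousHJ

/-! ### Bounded operators from kernel bounds -/

namespace ViscousHJ

open Filter Topology
open scoped ENNReal

theorem aestronglyMeasurable_volume {N : ℕ} {m : ℝ} {E : Type*} [NormedAddCommGroup E]
    {p : ℝ≥0∞} (f : Lp E p (weightedMeasure N m)) :
    AEStronglyMeasurable f (volume : Measure (Eu N)) :=
  (Lp.aestronglyMeasurable f).mono_ac volume_absolutelyContinuous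

variable {N : ℕ} {m : ℝ} {E G : Type*} [NormedAddCommGroup E] [NormedSpace ℝ E]
  [NormedAddCommGroup G] [NormedSpace ℝ G]

theorem aestronglyMeasurable_kernel_apply {K : Eu N → Eu N → E →L[ℝ] G}
    (hK : Continuous (Function.uncurry K)) {f : Eu N → E}
    (hf : AEStronglyMeasurable f volume) :
    AEStronglyMeasurable (fun z : Eu N × Eu N => K z.1 z.2 (f z.2)) (volume.prod volume) :=
  (ContinuousLinearMap.id ℝ (E →L[ℝ] G)).aestronglyMeasurable_comp₂
    hK.aestronglyMeasurable hf.comp_snd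

/-- A finite weighted square integral forces the inner integral to be finite almost everywhere. This
is what makes the pointwise formula for the operator meaningful. -/
theorem KernelBound.lintegral_lt_top {k : Eu N → Eu N → ℝ≥0∞}
    (hk : Measurable (Function.uncurry k)) {p : ℝ} {A : ℝ≥0∞} (hA : A ≠ ⊤)
    (h : KernelBound m k p A) (hp : 0 < p) {f : Eu N → ℝ≥0∞} (hf : AEMeasurable f volume)
    (hf' : ∫⁻ y, f y ^ p ∂(weightedMeasure N m) ≠ ⊤) :
    ∀ᵐ ξ, ∫⁻ y, k ξ y * f y < ⊤ := by
  have h1 : ∫⁻ ξ, (∫⁻ y, k ξ y * f y) ^ 2 ∂(weightedMeasure N m) ≠ ⊤ := by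
    refine ne_top_of_le_ne_top ?_ (h f hf)
    exact ENNReal.mul_ne_top (ENNReal.pow_ne_top hA)
      (ENNReal.rpow_ne_top_of_nonneg (by positivity) hf')
  have hm : AEMeasurable (fun ξ => (∫⁻ y, k ξ y * f y) ^ 2) (weightedMeasure N m) :=
    (((hk.aemeasurable.mul hf.comp_snd).lintegral_prod_right').pow_const 2).mono_ac
      weighted_absolutelyContinuous
  have h2 := ae_lt_top' hm h1
  rw [ae_weighted_iff] at h2
  filter_upwards [h2] with ξ hξ
  by_contra hc
  rw [not_lt, top_le_iff] at hc
  simp [hc] at hξ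

/-- The integral operator with kernel `K`. -/
theorem KernelBound.exists_operator {p : ℝ≥0∞} [hp1 : Fact (1 ≤ p)] (hp : p ≠ ⊤)
    {K : Eu N → Eu N → E →L[ℝ] G} (hK : Continuous (Function.uncurry K)) {A : ℝ≥0}
    (h : KernelBound m (fun ξ y => ‖K ξ y‖ₑ) p.toReal A) :
    (∀ f : Lp E p (weightedMeasure N m), ∀ᵐ ξ, Integrable fun y => K ξ y (f y)) ∧
    ∃ L : Lp E p (weightedMeasure N m) →L[ℝ] Lp G 2 (weightedMeasure N m),
      (∀ f, L f =ᵐ[volume] fun ξ => ∫ y, K ξ y (f y)) ∧ ‖L‖ ≤ A := by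
  have hp0 : p ≠ 0 := (zero_lt_one.trans_le hp1.1).ne'
  have hpr : 0 < p.toReal := ENNReal.toReal_pos hp0 hp
  have hKm : Measurable (Function.uncurry fun ξ y => ‖K ξ y‖ₑ) := by
    have : Continuous fun z : Eu N × Eu N => ‖K z.1 z.2‖ₑ := hK.enorm
    exact this.measurable
  have hfin : ∀ f : Lp E p (weightedMeasure N m),
      (∫⁻ y, ‖f y‖ₑ ^ p.toReal ∂(weightedMeasure N m)) ^ (1 / p.toReal)
        = eLpNorm f p (weightedMeasure N m) := fun f =>
    (eLpNorm_eq_lintegral_rpow_enorm_toReal hp0 hp).symm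
  have hfin' : ∀ f : Lp E p (weightedMeasure N m),
      ∫⁻ y, ‖f y‖ₑ ^ p.toReal ∂(weightedMeasure N m) ≠ ⊤ := fun f hc => by
    have := hfin f
    rw [hc, ENNReal.top_rpow_of_pos (by positivity)] at this
    exact (Lp.eLpNorm_ne_top f) this.symm
  have hfm : ∀ f : Lp E p (weightedMeasure N m), AEMeasurable (fun y => ‖f y‖ₑ) volume :=
    fun f => (aestronglyMeasurable_volume f).enorm
  have hInt : ∀ f : Lp E p (weightedMeasure N m),
      ∀ᵐ ξ, Integrable fun y => K ξ y (f y) := by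
    intro f
    filter_upwards [h.lintegral_lt_top hKm ENNReal.coe_ne_top hpr (hfm f) (hfin' f)] with ξ hξ
    refine ⟨?_, ?_⟩
    · have hc : Continuous fun y => K ξ y := hK.comp (by fun_prop : Continuous fun y => (ξ, y))
      exact (ContinuousLinearMap.id ℝ (E →L[ℝ] G)).aestronglyMeasurable_comp₂
        hc.aestronglyMeasurable (aestronglyMeasurable_volume f)
    · refine lt_of_le_of_lt (lintegral_mono fun y => ?_) hξ
      exact (K ξ y).le_opENorm (f y)
  let Φ : Lp E p (weightedMeasure N m) → Eu N → G := fun f ξ => ∫ y, K ξ y (f y)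
  have hΦm : ∀ f, AEStronglyMeasurable (Φ f) (weightedMeasure N m) := fun f =>
    aestronglyMeasurable_weighted
      (aestronglyMeasurable_kernel_apply hK (aestronglyMeasurable_volume f)).integral_prod_right'
  have hΦn : ∀ f, eLpNorm (Φ f) 2 (weightedMeasure N m) ≤
      A * eLpNorm f p (weightedMeasure N m) := by
    intro f
    rw [eLpNorm_eq_lintegral_rpow_enorm_toReal (by norm_num) (by norm_num), ← hfin f]
    have h1 : ∫⁻ ξ, ‖Φ f ξ‖ₑ ^ (2 : ℝ≥0∞).toReal ∂(weightedMeasure N m) ≤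
        (A * (∫⁻ y, ‖f y‖ₑ ^ p.toReal ∂(weightedMeasure N m)) ^ (1 / p.toReal)) ^ (2 : ℝ) := by
      rw [ENNReal.mul_rpow_of_nonneg _ _ (by norm_num), ENNReal.rpow_two, ← ENNReal.rpow_mul,
        show 1 / p.toReal * 2 = 2 / p.toReal by ring]
      refine le_trans (lintegral_mono fun ξ => ?_) (h _ (hfm f))
      rw [ENNReal.toReal_ofNat, ENNReal.rpow_two]
      gcongr
      refine (enorm_integral_le_lintegral_enorm _).trans (lintegral_mono fun y => ?_)
      exact (K ξ y).le_opENorm (f y)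
    calc _ ≤ ((A * (∫⁻ y, ‖f y‖ₑ ^ p.toReal ∂(weightedMeasure N m)) ^ (1 / p.toReal))
          ^ (2 : ℝ)) ^ (1 / (2 : ℝ≥0∞).toReal) := by gcongr
      _ = _ := by
        rw [← ENNReal.rpow_mul]
        norm_num
  have hΦL : ∀ f, MemLp (Φ f) 2 (weightedMeasure N m) := fun f =>
    ⟨hΦm f, (hΦn f).trans_lt (ENNReal.mul_lt_top ENNReal.coe_lt_top (Lp.eLpNorm_lt_top f))⟩
  refine ⟨hInt, LinearMap.mkContinuous
    { toFun := fun f => (hΦL f).toLp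
      map_add' := fun f g => ?_
      map_smul' := fun c f => ?_ } A fun f => ?_, fun f => ?_, ?_⟩
  · rw [← MemLp.toLp_add, MemLp.toLp_eq_toLp_iff]
    refine weighted_absolutelyContinuous.ae_le ?_
    filter_upwards [hInt f, hInt g] with ξ h1 h2
    simp only [Φ, Pi.add_apply]
    rw [← integral_add h1 h2]
    refine integral_congr_ae ?_
    filter_upwards [volume_absolutelyContinuous.ae_le (Lp.coeFn_add f g)] with y hy
    rw [hy, Pi.add_apply, map_add]
  · rw [RingHom.id_apply, ← MemLp.toLp_const_smul, MemLp.toLp_eq_toLp_iff]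
    refine Eventually.of_forall fun ξ => ?_
    simp only [Φ, Pi.smul_apply]
    rw [← integral_smul]
    refine integral_congr_ae ?_
    filter_upwards [volume_absolutelyContinuous.ae_le (Lp.coeFn_smul c f)] with y hy
    rw [hy, Pi.smul_apply, map_smul]
  · change ‖(hΦL f).toLp‖ ≤ A * ‖f‖
    rw [Lp.norm_toLp, Lp.norm_def]
    refine ENNReal.toReal_le_of_le_ofReal (by positivity) ((hΦn f).trans ?_)
    rw [ENNReal.ofReal_mul A.coe_nonneg, ENNReal.ofReal_toReal (Lp.eLpNorm_ne_top f),
      ENNReal.ofReal_coe_nnreal]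
  · exact ae_weighted_iff.mp (hΦL f).coeFn_toLp
  · exact LinearMap.mkContinuous_norm_le _ A.2 _

end ViscousHJ

/-! ### The heat kernel -/

namespace ViscousHJ

open Filter Topology
open scoped ENNReal

variable {N : ℕ} {m : ℝ}

theorem integral_exp_neg_mul_norm_sq {b : ℝ} (hb : 0 < b) :
    ∫ x : Eu N, Real.exp (-b * ‖x‖ ^ 2) = (Real.pi / b) ^ ((N : ℝ) / 2) := by
  simpa using GaussianFourier.integral_rexp_neg_mul_sq_norm (V := Eu N) hb

theorem integrable_exp_neg_mul_norm_sq {b : ℝ} (hb : 0 < b) :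
    Integrable fun x : Eu N => Real.exp (-b * ‖x‖ ^ 2) := by
  refine Integrable.of_integral_ne_zero ?_
  rw [integral_exp_neg_mul_norm_sq hb]
  have := Real.pi_pos
  positivity

theorem heatKernel_eq {a : ℝ} (ha : 0 < a) (x : Eu N) : heatKernel N a x =
    (4 * Real.pi * a) ^ (-((N : ℝ) / 2)) * Real.exp (-(1 / (4 * a)) * ‖x‖ ^ 2) := by
  have hpi := Real.pi_pos
  have e : -‖(√a)⁻¹ • x‖ ^ 2 / 4 = -(1 / (4 * a)) * ‖x‖ ^ 2 := by
    rw [norm_smul, mul_pow, norm_inv, Real.norm_eq_abs, inv_pow, sq_abs, Real.sq_sqrt ha.le]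
    field_simp
  simp only [heatKernel, gaussian, e]
  rw [Real.mul_rpow (by positivity : 0 ≤ 4 * Real.pi) ha.le]
  ring

theorem heatKernel_pos {a : ℝ} (ha : 0 < a) (x : Eu N) : 0 < heatKernel N a x := by
  have hpi := Real.pi_pos
  rw [heatKernel_eq ha]
  positivity

theorem continuous_heatKernel (a : ℝ) : Continuous (heatKernel N a) := by
  unfold heatKernel
  exact continuous_const.mul ((continuous_gaussian N).comp (continuous_const_smul _))

theorem integrable_heatKernel {a : ℝ} (ha : 0 < a) : Integrable (heatKernel N a) := by
  have := (integrable_exp_neg_mul_norm_sq (N := N) (b := 1 / (4 * a)) (by positivity)).const_mul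
    ((4 * Real.pi * a) ^ (-((N : ℝ) / 2)))
  exact this.congr (Eventually.of_forall fun x => (heatKernel_eq ha x).symm)

theorem integral_heatKernel {a : ℝ} (ha : 0 < a) : ∫ x : Eu N, heatKernel N a x = 1 := by
  have hpi := Real.pi_pos
  simp_rw [heatKernel_eq ha]
  rw [integral_const_mul, integral_exp_neg_mul_norm_sq (by positivity)]
  rw [show Real.pi / (1 / (4 * a)) = 4 * Real.pi * a by field_simp,
    ← Real.rpow_add (by positivity)]
  simp

theorem heatKernel_smul {a r : ℝ} (ha : 0 < a) (hr : 0 < r) (x : Eu N) :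
    heatKernel N a (r • x) = (r ^ N)⁻¹ * heatKernel N (a / r ^ 2) x := by
  have hpi := Real.pi_pos
  rw [heatKernel_eq ha, heatKernel_eq (by positivity), norm_smul, Real.norm_of_nonneg hr.le]
  have e : (4 * Real.pi * (a / r ^ 2)) ^ (-((N : ℝ) / 2)) =
      (4 * Real.pi * a) ^ (-((N : ℝ) / 2)) * r ^ N := by
    rw [show 4 * Real.pi * (a / r ^ 2) = (4 * Real.pi * a) * (r ^ 2)⁻¹ by field_simp,
      Real.mul_rpow (by positivity) (by positivity)]
    congr 1
    rw [Real.inv_rpow (by positivity), ← Real.rpow_neg (by positivity), neg_neg,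
      ← Real.rpow_natCast r 2, ← Real.rpow_mul hr.le, ← Real.rpow_natCast r N]
    congr 1
    push_cast
    ring
  rw [e]
  have hrN : r ^ N ≠ 0 := by positivity
  have e2 : -(1 / (4 * a)) * (r * ‖x‖) ^ 2 = -(1 / (4 * (a / r ^ 2))) * ‖x‖ ^ 2 := by
    field_simp
  rw [e2]
  field_simp

/-- Completing the square in z. The second factor on the right is a normalised Gaussian in z, so
integrating it out gives the convolution law at once. -/
theorem heatKernel_mul_heatKernel {a b : ℝ} (ha : 0 < a) (hb : 0 < b) (x z : Eu N) :
    heatKernel N a (x - z) * heatKernel N b z =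
      heatKernel N (a + b) x * heatKernel N (a * b / (a + b)) (z - (b / (a + b)) • x) := by
  have hpi := Real.pi_pos
  rw [heatKernel_eq ha, heatKernel_eq hb, heatKernel_eq (by positivity),
    heatKernel_eq (by positivity)]
  have e1 : (4 * Real.pi * a) ^ (-((N : ℝ) / 2)) * (4 * Real.pi * b) ^ (-((N : ℝ) / 2)) =
      (4 * Real.pi * (a + b)) ^ (-((N : ℝ) / 2)) *
        (4 * Real.pi * (a * b / (a + b))) ^ (-((N : ℝ) / 2)) := by
    rw [← Real.mul_rpow (by positivity) (by positivity),
      ← Real.mul_rpow (by positivity) (by positivity)]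
    congr 1
    field_simp
  have e2 : -(1 / (4 * a)) * ‖x - z‖ ^ 2 + -(1 / (4 * b)) * ‖z‖ ^ 2 =
      -(1 / (4 * (a + b))) * ‖x‖ ^ 2
        + -(1 / (4 * (a * b / (a + b)))) * ‖z - (b / (a + b)) • x‖ ^ 2 := by
    rw [norm_sub_sq_real, norm_sub_sq_real, norm_smul, inner_smul_right,
      Real.norm_of_nonneg (by positivity), real_inner_comm x z]
    field_simp
    ring
  have e3 := congrArg Real.exp e2
  rw [Real.exp_add, Real.exp_add] at e3
  calc _ = ((4 * Real.pi * a) ^ (-((N : ℝ) / 2)) * (4 * Real.pi * b) ^ (-((N : ℝ) / 2))) *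
        (Real.exp (-(1 / (4 * a)) * ‖x - z‖ ^ 2) * Real.exp (-(1 / (4 * b)) * ‖z‖ ^ 2)) := by ring
    _ = _ := by
      rw [e1, e3]
      ring

theorem integral_heatKernel_conv {a b : ℝ} (ha : 0 < a) (hb : 0 < b) (x : Eu N) :
    ∫ z, heatKernel N a (x - z) * heatKernel N b z = heatKernel N (a + b) x := by
  simp_rw [heatKernel_mul_heatKernel ha hb]
  rw [integral_const_mul, integral_sub_right_eq_self (heatKernel N (a * b / (a + b))),
    integral_heatKernel (by positivity), mul_one]

theorem one_sub_exp_neg_pos {τ : ℝ} (hτ : 0 < τ) : 0 < 1 - Real.exp (-τ) := by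
  have : Real.exp (-τ) < 1 := by simpa using hτ
  linarith

/-- In this form the kernel is an ordinary heat kernel at the bounded time 1 - e^{-τ} < 1, evaluated
after contracting y by e^{-τ/2}. All later estimates, for short and long times, start from here. -/
theorem kernelL_eq {τ : ℝ} (hτ : 0 < τ) (ξ y : Eu N) :
    kernelL N τ ξ y = heatKernel N (1 - Real.exp (-τ)) (ξ - Real.exp (-(τ / 2)) • y) := by
  have h1 : 0 < Real.exp τ - 1 := by
    have : 1 < Real.exp τ := by simpa using hτ
    linarith
  have e1 : Real.exp (τ / 2) • ξ - y = Real.exp (τ / 2) • (ξ - Real.exp (-(τ / 2)) • y) := by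
    rw [smul_sub, smul_smul, ← Real.exp_add]
    simp
  rw [kernelL, e1, heatKernel_smul h1 (Real.exp_pos _)]
  have e2 : Real.exp ((N : ℝ) * τ / 2) = Real.exp (τ / 2) ^ N := by
    rw [← Real.exp_nat_mul]
    congr 1
    ring
  have e3 : (Real.exp τ - 1) / Real.exp (τ / 2) ^ 2 = 1 - Real.exp (-τ) := by
    rw [← Real.exp_nat_mul, show ((2 : ℕ) : ℝ) * (τ / 2) = τ by push_cast; ring, Real.exp_neg]
    field_simp
  rw [e2, e3, ← mul_assoc, mul_inv_cancel₀ (by positivity), one_mul]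

theorem kernelL_pos {τ : ℝ} (hτ : 0 < τ) (ξ y : Eu N) : 0 < kernelL N τ ξ y := by
  rw [kernelL_eq hτ]
  exact heatKernel_pos (one_sub_exp_neg_pos hτ) _

theorem continuous_kernelL (τ : ℝ) :
    Continuous fun z : Eu N × Eu N => kernelL N τ z.1 z.2 := by
  unfold kernelL
  exact continuous_const.mul ((continuous_heatKernel _).comp (by fun_prop))

theorem integral_kernelL_left {τ : ℝ} (hτ : 0 < τ) (y : Eu N) : ∫ ξ, kernelL N τ ξ y = 1 := by
  simp_rw [kernelL_eq hτ]
  rw [integral_sub_right_eq_self (heatKernel N (1 - Real.exp (-τ))),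
    integral_heatKernel (one_sub_exp_neg_pos hτ)]

/-- The Chapman–Kolmogorov identity. -/
theorem integral_kernelL_mul_kernelL {s t : ℝ} (hs : 0 < s) (ht : 0 < t) (ξ y : Eu N) :
    ∫ z, kernelL N s ξ z * kernelL N t z y = kernelL N (s + t) ξ y := by
  have has := one_sub_exp_neg_pos hs
  have hat := one_sub_exp_neg_pos ht
  have hes := Real.exp_pos (s / 2)
  simp_rw [kernelL_eq hs, kernelL_eq ht, kernelL_eq (add_pos hs ht)]
  set r := Real.exp (s / 2) with hr
  have hrinv : Real.exp (-(s / 2)) = r⁻¹ := by rw [hr, Real.exp_neg]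
  -- The substitution z ↦ e^{s/2} z removes the dilation in the first factor, turning the integral
  -- into a convolution of two heat kernels centred at e^{-(s+t)/2} y.
  have e1 : ∀ z : Eu N, heatKernel N (1 - Real.exp (-s)) (ξ - Real.exp (-(s / 2)) • (r • z)) *
      heatKernel N (1 - Real.exp (-t)) (r • z - Real.exp (-(t / 2)) • y) =
      (r ^ N)⁻¹ * (heatKernel N (1 - Real.exp (-s)) ((ξ - Real.exp (-((s + t) / 2)) • y)
        - (z - Real.exp (-((s + t) / 2)) • y)) *
        heatKernel N ((1 - Real.exp (-t)) / r ^ 2) (z - Real.exp (-((s + t) / 2)) • y)) := by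
    intro z
    have k1 : r • z - Real.exp (-(t / 2)) • y = r • (z - Real.exp (-((s + t) / 2)) • y) := by
      rw [smul_sub, smul_smul, hr, ← Real.exp_add]
      congr 3
      ring
    rw [k1, heatKernel_smul hat hes, hrinv, smul_smul, inv_mul_cancel₀ hes.ne', one_smul,
      sub_sub_sub_cancel_right]
    ring
  have e2 := Measure.integral_comp_smul (μ := (volume : Measure (Eu N)))
    (fun z => heatKernel N (1 - Real.exp (-s)) (ξ - Real.exp (-(s / 2)) • z) *
      heatKernel N (1 - Real.exp (-t)) (z - Real.exp (-(t / 2)) • y)) r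
  simp_rw [e1] at e2
  rw [integral_const_mul, integral_sub_right_eq_self (fun z =>
    heatKernel N (1 - Real.exp (-s)) ((ξ - Real.exp (-((s + t) / 2)) • y) - z) *
        heatKernel N ((1 - Real.exp (-t)) / r ^ 2) z),
    integral_heatKernel_conv has (by positivity)] at e2
  have e3 : (1 - Real.exp (-s)) + (1 - Real.exp (-t)) / r ^ 2 = 1 - Real.exp (-(s + t)) := by
    have : r ^ 2 = Real.exp s := by
      rw [hr, ← Real.exp_nat_mul]
      congr 1
      push_cast
      ring
    rw [this, neg_add, Real.exp_add, Real.exp_neg s]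
    field_simp
    ring
  rw [e3] at e2
  have hfin : Module.finrank ℝ (Eu N) = N := by simp
  rw [hfin, abs_of_pos (by positivity), smul_eq_mul] at e2
  exact (mul_left_cancel₀ (by positivity) e2).symm

/-! #### Weighted bounds -/

/-- From s ≤ e^s and sm ≤ 4m² + s²/16, the latter being (s - 8m)² ≥ 0. A polynomial weight thus
costs only a small fraction of a Gaussian. -/
theorem rpow_le_exp {s : ℝ} (hm : 0 ≤ m) (hs : 0 ≤ s) :
    s ^ m ≤ Real.exp (4 * m ^ 2) * Real.exp (s ^ 2 / 16) := by
  have h1 : s ≤ Real.exp s := by linarith [Real.add_one_le_exp s]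
  calc s ^ m ≤ Real.exp s ^ m := Real.rpow_le_rpow hs h1 hm
    _ = Real.exp (s * m) := by rw [← Real.exp_mul]
    _ ≤ Real.exp (4 * m ^ 2 + s ^ 2 / 16) := by
        apply Real.exp_le_exp.mpr
        nlinarith [sq_nonneg (s - 8 * m)]
    _ = _ := Real.exp_add _ _

theorem sqrt_weight_le (m : ℝ) (ξ : Eu N) : √(weight m ξ) ≤ 1 + ‖ξ‖ ^ m := by
  have h : 0 ≤ ‖ξ‖ ^ m := by positivity
  rw [Real.sqrt_le_left (by positivity), weight, mul_comm 2 m, Real.rpow_mul (norm_nonneg _),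
    Real.rpow_two]
  nlinarith

theorem le_sqrt_weight (m : ℝ) (ξ : Eu N) : 1 + ‖ξ‖ ^ m ≤ 2 * √(weight m ξ) := by
  have h : 0 ≤ ‖ξ‖ ^ m := by positivity
  have h2 : weight m ξ = 1 + (‖ξ‖ ^ m) ^ 2 := by
    rw [weight, mul_comm 2 m, Real.rpow_mul (norm_nonneg _), Real.rpow_two]
  have h1 : (1 + ‖ξ‖ ^ m) / 2 ≤ √(weight m ξ) := by
    refine Real.le_sqrt_of_sq_le ?_
    rw [h2]
    nlinarith [sq_nonneg (‖ξ‖ ^ m - 1)]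
  linarith

theorem one_add_rpow_norm_add_le (hm : 0 ≤ m) (x η : Eu N) :
    1 + ‖x + η‖ ^ m ≤ 2 ^ m * (1 + ‖x‖ ^ m) * (1 + ‖η‖ ^ m) := by
  have hx : 0 ≤ ‖x‖ ^ m := by positivity
  have hη : 0 ≤ ‖η‖ ^ m := by positivity
  have h2 : (1 : ℝ) ≤ 2 ^ m := Real.one_le_rpow (by norm_num) hm
  have h1 : ‖x + η‖ ^ m ≤ 2 ^ m * (‖x‖ ^ m + ‖η‖ ^ m) := by
    have k : ‖x + η‖ ≤ 2 * max ‖x‖ ‖η‖ := by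
      have := norm_add_le x η
      have := le_max_left ‖x‖ ‖η‖
      have := le_max_right ‖x‖ ‖η‖
      linarith
    calc ‖x + η‖ ^ m ≤ (2 * max ‖x‖ ‖η‖) ^ m := Real.rpow_le_rpow (norm_nonneg _) k hm
      _ = 2 ^ m * (max ‖x‖ ‖η‖) ^ m := Real.mul_rpow (by norm_num) (by positivity)
      _ ≤ 2 ^ m * (‖x‖ ^ m + ‖η‖ ^ m) := by
        gcongr
        rcases max_choice ‖x‖ ‖η‖ with h | h <;> rw [h] <;> linarith
  nlinarith [mul_nonneg hx hη, mul_nonneg (by linarith : (0 : ℝ) ≤ 2 ^ m - 1) hx,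
    mul_nonneg (by linarith : (0 : ℝ) ≤ 2 ^ m) (mul_nonneg hx hη)]

/-- Moving the weight through a Gaussian. -/
theorem sqrt_weight_mul_exp_le (hm : 0 ≤ m) {a : ℝ} (ha : 0 < a) (ha1 : a ≤ 1) (x η : Eu N) :
    √(weight m (x + η)) * Real.exp (-(1 / (16 * a)) * ‖x‖ ^ 2) ≤
      2 ^ m * (1 + Real.exp (4 * m ^ 2)) * (1 + ‖η‖ ^ m) := by
  have h1 := (sqrt_weight_le m (x + η)).trans (one_add_rpow_norm_add_le hm x η)
  have h2 : (1 + ‖x‖ ^ m) * Real.exp (-(1 / (16 * a)) * ‖x‖ ^ 2) ≤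
      1 + Real.exp (4 * m ^ 2) := by
    have k1 : Real.exp (-(1 / (16 * a)) * ‖x‖ ^ 2) ≤ Real.exp (-(‖x‖ ^ 2 / 16)) := by
      apply Real.exp_le_exp.mpr
      have : 1 / 16 ≤ 1 / (16 * a) := one_div_le_one_div_of_le (by positivity) (by linarith)
      nlinarith [sq_nonneg ‖x‖]
    have k2 : Real.exp (-(‖x‖ ^ 2 / 16)) ≤ 1 := Real.exp_le_one_iff.mpr (neg_nonpos.mpr (by positivity))
    have k3 := rpow_le_exp hm (norm_nonneg x)
    have k4 : Real.exp (‖x‖ ^ 2 / 16) * Real.exp (-(‖x‖ ^ 2 / 16)) = 1 := by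
      rw [← Real.exp_add]; simp
    calc (1 + ‖x‖ ^ m) * Real.exp (-(1 / (16 * a)) * ‖x‖ ^ 2)
        ≤ (1 + ‖x‖ ^ m) * Real.exp (-(‖x‖ ^ 2 / 16)) := by gcongr
      _ = Real.exp (-(‖x‖ ^ 2 / 16)) + ‖x‖ ^ m * Real.exp (-(‖x‖ ^ 2 / 16)) := by ring
      _ ≤ 1 + Real.exp (4 * m ^ 2) * Real.exp (‖x‖ ^ 2 / 16) * Real.exp (-(‖x‖ ^ 2 / 16)) := by
        gcongr
      _ = _ := by rw [mul_assoc, k4, mul_one]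
  have h3 : 0 < Real.exp (-(1 / (16 * a)) * ‖x‖ ^ 2) := Real.exp_pos _
  have h4 : 0 ≤ 1 + ‖η‖ ^ m := by positivity
  calc _ ≤ (2 ^ m * (1 + ‖x‖ ^ m) * (1 + ‖η‖ ^ m)) * Real.exp (-(1 / (16 * a)) * ‖x‖ ^ 2) := by
        gcongr
    _ = 2 ^ m * ((1 + ‖x‖ ^ m) * Real.exp (-(1 / (16 * a)) * ‖x‖ ^ 2)) * (1 + ‖η‖ ^ m) := by ring
    _ ≤ _ := by gcongr

/-- The factor |x|/(2a) produced by differentiating the kernel costs a^{-1/2} and a fraction of the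
Gaussian; after clearing denominators the inequality is (|x| - 4√a)² ≥ 0. -/
theorem norm_div_le_exp {a : ℝ} (ha : 0 < a) (x : Eu N) :
    ‖x‖ / (2 * a) ≤ a ^ (-(1 / 2) : ℝ) * Real.exp (1 / (16 * a) * ‖x‖ ^ 2) := by
  have hs : a ^ (-(1 / 2) : ℝ) = (√a)⁻¹ := by
    rw [Real.rpow_neg ha.le, Real.sqrt_eq_rpow]
  have hs0 : 0 < √a := Real.sqrt_pos.mpr ha
  have h1 := Real.add_one_le_exp (1 / (16 * a) * ‖x‖ ^ 2)
  have h2 : ‖x‖ / (2 * a) ≤ (√a)⁻¹ * (1 / (16 * a) * ‖x‖ ^ 2 + 1) := by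
    obtain ⟨s, hs1, rfl⟩ : ∃ s : ℝ, 0 < s ∧ a = s ^ 2 := ⟨√a, hs0, (Real.sq_sqrt ha.le).symm⟩
    rw [Real.sqrt_sq hs1.le, div_le_iff₀ (by positivity)]
    have : s⁻¹ * (1 / (16 * s ^ 2) * ‖x‖ ^ 2 + 1) * (2 * s ^ 2) = ‖x‖ ^ 2 / (8 * s) + 2 * s := by
      field_simp
      ring
    rw [this, div_add' _ _ _ (by positivity), le_div_iff₀ (by positivity)]
    nlinarith [sq_nonneg (‖x‖ - 4 * s)]
  rw [hs]
  refine h2.trans ?_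
  gcongr

end ViscousHJ

/-! ### From pointwise Gaussian bounds to operator bounds -/

namespace ViscousHJ

open Filter Topology
open scoped ENNReal

variable {N : ℕ} {m : ℝ}

/-- A Gaussian bound on a kernel yields a bound for the integral operator. -/
theorem exists_kernelBound_of_gaussian (N : ℕ) (m : ℝ) {a b p r : ℝ} (ha : 0 ≤ a) (hb : 0 ≤ b)
    (hab : a + b = 1 / 2) (hr : r * (1 / 2 + a) = 1) (hp : p * (1 / 2 + b) = 1) :
    ∃ C : ℝ, 0 ≤ C ∧ ∀ (τ D : ℝ), 0 < τ → 0 ≤ D → ∀ k : Eu N → Eu N → ℝ,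
      Measurable (Function.uncurry k) →
      (∀ ξ y, √(weight m ξ) * k ξ y ≤ √(weight m y) * (D * (1 - Real.exp (-τ)) ^ (-((N : ℝ) / 2)) *
        Real.exp (-(1 / (8 * (1 - Real.exp (-τ)))) * ‖ξ - Real.exp (-(τ / 2)) • y‖ ^ 2))) →
      KernelBound m (fun ξ y => ENNReal.ofReal (k ξ y)) p
        (ENNReal.ofReal (C * D * Real.exp (N * τ / 4) *
          (1 - Real.exp (-τ)) ^ (-((N : ℝ) / 2 * b)))) := by
  have hpi := Real.pi_pos
  have hr0 : 0 < r := by nlinarith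
  refine ⟨(8 * Real.pi / r) ^ ((N : ℝ) / 2 * (1 / r)), by positivity, fun τ D hτ hD k hk hkJ => ?_⟩
  have hα := one_sub_exp_neg_pos hτ
  set α := 1 - Real.exp (-τ) with hαd
  set q := D * α ^ (-((N : ℝ) / 2)) with hq
  have hq0 : 0 ≤ q := by positivity
  let g : Eu N → ℝ := fun x => q * Real.exp (-(1 / (8 * α)) * ‖x‖ ^ 2)
  have hg0 : ∀ x, 0 ≤ g x := fun x => by positivity
  have hgc : Continuous g := by fun_prop
  set I := q ^ r * (8 * Real.pi * α / r) ^ ((N : ℝ) / 2) with hI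
  have hgr : ∀ x, g x ^ r = q ^ r * Real.exp (-(r / (8 * α)) * ‖x‖ ^ 2) := by
    intro x
    rw [Real.mul_rpow hq0 (Real.exp_pos _).le, ← Real.exp_mul]
    congr 2
    ring
  have hInt : Integrable fun x => g x ^ r := by
    simp_rw [hgr]
    exact (integrable_exp_neg_mul_norm_sq (by positivity)).const_mul _
  have hgi : ∫ x, g x ^ r = I := by
    simp_rw [hgr]
    rw [integral_const_mul, integral_exp_neg_mul_norm_sq (by positivity)]
    congr 2
    field_simp
  have hli : ∫⁻ x, ENNReal.ofReal (g x) ^ r = ENNReal.ofReal I := by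
    rw [← hgi, ofReal_integral_eq_lintegral_ofReal hInt
      (Eventually.of_forall fun x => Real.rpow_nonneg (hg0 x) r)]
    refine lintegral_congr fun x => ?_
    rw [ENNReal.ofReal_rpow_of_nonneg (hg0 x) hr0.le]
  have hgm : Measurable fun x => ENNReal.ofReal (g x) ^ r :=
    hgc.measurable.ennreal_ofReal.pow_const r
  set c := Real.exp (-(τ / 2)) with hc
  have hc0 : 0 < c := Real.exp_pos _
  -- Integration in ξ is translation invariant, while integration in y undoes the dilation by c =
  -- e^{-τ/2} and costs c^{-N} = e^{Nτ/2}. This asymmetry is the only source of growth in τ.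
  have h2 : ∀ y : Eu N, ∫⁻ ξ, ENNReal.ofReal (g (ξ - c • y)) ^ r ≤ ENNReal.ofReal I := fun y => by
    rw [lintegral_sub_right_eq_self (fun x => ENNReal.ofReal (g x) ^ r), hli]
  have h1 : ∀ ξ : Eu N, ∫⁻ y, ENNReal.ofReal (g (ξ - c • y)) ^ r ≤
      ENNReal.ofReal (Real.exp (N * τ / 2) * I) := fun ξ => by
    have e1 := Measure.integral_comp_smul (μ := (volume : Measure (Eu N)))
      (fun y => g (ξ - y) ^ r) c
    rw [integral_sub_left_eq_self (fun y => g y ^ r), hgi] at e1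
    have e2 : Integrable fun y => g (ξ - c • y) ^ r :=
      (hInt.comp_sub_left ξ).comp_smul hc0.ne'
    have e3 : ∫⁻ y, ENNReal.ofReal (g (ξ - c • y)) ^ r =
        ENNReal.ofReal (∫ y, g (ξ - c • y) ^ r) := by
      rw [ofReal_integral_eq_lintegral_ofReal e2
        (Eventually.of_forall fun x => Real.rpow_nonneg (hg0 _) r)]
      refine lintegral_congr fun x => ?_
      rw [ENNReal.ofReal_rpow_of_nonneg (hg0 _) hr0.le]
    have hfin : Module.finrank ℝ (Eu N) = N := by simp
    rw [e3, e1, hfin, abs_of_pos (by positivity), smul_eq_mul]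
    refine ENNReal.ofReal_le_ofReal (le_of_eq ?_)
    rw [hc, ← Real.exp_nat_mul, ← Real.exp_neg]
    congr 2
    ring
  refine kernelBound_of_schur (k := fun ξ y => ENNReal.ofReal (k ξ y)) (J := fun ξ y => ENNReal.ofReal (g (ξ - c • y)))
    hk.ennreal_ofReal ?_ ?_ ha hb hab hr hp h1 h2 ?_
  · have : Continuous fun z : Eu N × Eu N => g (z.1 - c • z.2) := hgc.comp (by fun_prop)
    exact this.measurable.ennreal_ofReal
  · intro ξ y
    rw [← ENNReal.ofReal_mul (Real.sqrt_nonneg _), ← ENNReal.ofReal_mul (Real.sqrt_nonneg _)]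
    exact ENNReal.ofReal_le_ofReal (hkJ ξ y)
  · have hI0 : 0 ≤ I := by positivity
    rw [ENNReal.ofReal_rpow_of_nonneg (by positivity) (by positivity),
      ← ENNReal.ofReal_mul (by positivity), ← ENNReal.ofReal_pow (by positivity)]
    refine ENNReal.ofReal_le_ofReal ?_
    have hr1 : 1 / r = 1 / 2 + a := by field_simp; linarith
    -- Since 1/r = 1/2 + a = 1 - b, the prefactor α^{-N/2} and the factor α^{N/(2r)} from the
    -- Gaussian integral combine to α^{-Nb/2}.
    have e1 : I ^ (1 / r) = D * ((8 * Real.pi / r) ^ ((N : ℝ) / 2 * (1 / r)) *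
        α ^ (-((N : ℝ) / 2 * b))) := by
      rw [hI, Real.mul_rpow (by positivity) (by positivity), ← Real.rpow_mul hq0,
        mul_one_div_cancel hr0.ne', Real.rpow_one, ← Real.rpow_mul (by positivity),
        show 8 * Real.pi * α / r = 8 * Real.pi / r * α by ring,
        Real.mul_rpow (by positivity) hα.le, hq]
      have : α ^ (-((N : ℝ) / 2 * b)) = α ^ (-((N : ℝ) / 2)) * α ^ ((N : ℝ) / 2 * (1 / r)) := by
        rw [← Real.rpow_add hα, hr1]
        congr 1
        rw [show b = 1 / 2 - a by linarith]
        ring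
      rw [this]
      ring
    have e2 : I ^ (2 * a) * I = (I ^ (1 / r)) ^ 2 := by
      rw [← Real.rpow_natCast, ← Real.rpow_mul hI0]
      conv_lhs => rw [← Real.rpow_one I, ← Real.rpow_mul hI0]
      rw [← Real.rpow_add_of_nonneg hI0 (by positivity) (by positivity), hr1]
      congr 1
      push_cast
      ring
    rw [Real.mul_rpow (Real.exp_pos _).le hI0, mul_assoc, e2, e1]
    have e3 : Real.exp (N * τ / 2) ^ (2 * a) ≤ Real.exp (N * τ / 4) ^ 2 := by
      rw [← Real.exp_mul, ← Real.exp_nat_mul]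
      apply Real.exp_le_exp.mpr
      have : (0 : ℝ) ≤ N * τ := by positivity
      push_cast
      nlinarith
    calc _ ≤ Real.exp (N * τ / 4) ^ 2 * (D * ((8 * Real.pi / r) ^ ((N : ℝ) / 2 * (1 / r)) *
        α ^ (-((N : ℝ) / 2 * b)))) ^ 2 := by gcongr
      _ = _ := by ring

end ViscousHJ

/-! ### The gradient kernel and weighted pointwise bounds -/

namespace ViscousHJ

open Filter Topology
open scoped ENNReal

variable {N : ℕ} {m : ℝ}

theorem hasFDerivAt_heatKernel {a : ℝ} (ha : 0 < a) (x : Eu N) :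
    HasFDerivAt (heatKernel N a) ((-(1 / (2 * a)) * heatKernel N a x) • innerSL ℝ x) x := by
  have h := ((hasStrictFDerivAt_norm_sq x).hasFDerivAt.const_mul (-(1 / (4 * a)))).exp.const_mul
    ((4 * Real.pi * a) ^ (-((N : ℝ) / 2)))
  have e : heatKernel N a = fun y : Eu N =>
      (4 * Real.pi * a) ^ (-((N : ℝ) / 2)) * Real.exp (-(1 / (4 * a)) * ‖y‖ ^ 2) :=
    funext fun y => heatKernel_eq ha y
  rw [e]
  refine h.congr_fderiv ?_
  ext z
  simp
  field_simp
  ring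

theorem contDiff_heatKernel {a : ℝ} (ha : 0 < a) : ContDiff ℝ ∞ (heatKernel N a) := by
  have e : heatKernel N a = fun y : Eu N =>
      (4 * Real.pi * a) ^ (-((N : ℝ) / 2)) * Real.exp (-(1 / (4 * a)) * ‖y‖ ^ 2) :=
    funext fun y => heatKernel_eq ha y
  rw [e]
  exact contDiff_const.mul ((contDiff_const.mul (contDiff_norm_sq ℝ)).exp)

/-- The gradient in `ξ` of the kernel of `e^{τ𝓛}`. -/
noncomputable def gradKernelL (N : ℕ) (τ : ℝ) (ξ y : Eu N) : Eu N :=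
  (-(1 / (2 * (1 - Real.exp (-τ)))) * kernelL N τ ξ y) • (ξ - Real.exp (-(τ / 2)) • y)

theorem continuous_gradKernelL (τ : ℝ) :
    Continuous fun z : Eu N × Eu N => gradKernelL N τ z.1 z.2 := by
  unfold gradKernelL
  have := continuous_kernelL (N := N) τ
  fun_prop

theorem hasFDerivAt_kernelL_left {τ : ℝ} (hτ : 0 < τ) (ξ y : Eu N) :
    HasFDerivAt (fun ξ => kernelL N τ ξ y) (innerSL ℝ (gradKernelL N τ ξ y)) ξ := by
  have e : (fun ξ => kernelL N τ ξ y) = fun ξ =>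
      heatKernel N (1 - Real.exp (-τ)) (ξ - Real.exp (-(τ / 2)) • y) :=
    funext fun ξ => kernelL_eq hτ ξ y
  rw [e]
  have h := (hasFDerivAt_heatKernel (one_sub_exp_neg_pos hτ)
    (ξ - Real.exp (-(τ / 2)) • y)).comp ξ ((hasFDerivAt_id ξ).sub_const _)
  refine h.congr_fderiv ?_
  ext z
  simp [gradKernelL, kernelL_eq hτ]

/-- The kernel depends on ξ - e^{-τ/2} y only, so its two gradients are proportional. This lets a
derivative in ξ be moved onto the function on which the kernel acts. -/
theorem hasFDerivAt_kernelL_right {τ : ℝ} (hτ : 0 < τ) (ξ y : Eu N) :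
    HasFDerivAt (fun y => kernelL N τ ξ y)
      ((-Real.exp (-(τ / 2))) • innerSL ℝ (gradKernelL N τ ξ y)) y := by
  have e : (fun y => kernelL N τ ξ y) = fun y =>
      heatKernel N (1 - Real.exp (-τ)) (ξ - Real.exp (-(τ / 2)) • y) :=
    funext fun y => kernelL_eq hτ ξ y
  rw [e]
  have h0 : HasFDerivAt (fun y : Eu N => ξ - Real.exp (-(τ / 2)) • y)
      (-(Real.exp (-(τ / 2)) • ContinuousLinearMap.id ℝ (Eu N))) y :=
    ((hasFDerivAt_id y).const_smul (Real.exp (-(τ / 2)))).const_sub ξ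
  have h := (hasFDerivAt_heatKernel (one_sub_exp_neg_pos hτ)
    (ξ - Real.exp (-(τ / 2)) • y)).comp y h0
  refine h.congr_fderiv ?_
  ext z
  simp [gradKernelL, kernelL_eq hτ]

theorem contDiff_kernelL_right {τ : ℝ} (hτ : 0 < τ) (ξ : Eu N) :
    ContDiff ℝ ∞ fun y => kernelL N τ ξ y := by
  have e : (fun y => kernelL N τ ξ y) = fun y =>
      heatKernel N (1 - Real.exp (-τ)) (ξ - Real.exp (-(τ / 2)) • y) :=
    funext fun y => kernelL_eq hτ ξ y
  rw [e]
  exact (contDiff_heatKernel (one_sub_exp_neg_pos hτ)).comp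
    (contDiff_const.sub (contDiff_id.const_smul (Real.exp (-(τ / 2)))))

theorem norm_gradKernelL {τ : ℝ} (hτ : 0 < τ) (ξ y : Eu N) : ‖gradKernelL N τ ξ y‖ =
    ‖ξ - Real.exp (-(τ / 2)) • y‖ / (2 * (1 - Real.exp (-τ))) * kernelL N τ ξ y := by
  have h1 := one_sub_exp_neg_pos hτ
  have h2 := kernelL_pos hτ ξ y
  rw [gradKernelL, norm_smul, norm_mul, norm_neg, Real.norm_of_nonneg (by positivity),
    Real.norm_of_nonneg h2.le]
  ring

theorem heatKernel_le {a : ℝ} (ha : 0 < a) (x : Eu N) : heatKernel N a x ≤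
    a ^ (-((N : ℝ) / 2)) * Real.exp (-(1 / (4 * a)) * ‖x‖ ^ 2) := by
  have hpi := Real.pi_gt_three
  rw [heatKernel_eq ha]
  gcongr ?_ * _
  refine Real.rpow_le_rpow_of_nonpos ha (by nlinarith) ?_
  have : (0 : ℝ) ≤ N := by positivity
  linarith

/-- The constant in the weighted Gaussian bounds. -/
noncomputable def weightConst (m : ℝ) : ℝ := 2 ^ m * (1 + Real.exp (4 * m ^ 2)) * 2

theorem weightConst_nonneg (m : ℝ) : 0 ≤ weightConst m := by
  unfold weightConst
  positivity

theorem sqrt_weight_mul_exp_le_sqrt_weight (hm : 0 ≤ m) {a : ℝ} (ha : 0 < a) (ha1 : a ≤ 1)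
    (ξ η y : Eu N) (hη : ‖η‖ ≤ ‖y‖) :
    √(weight m ξ) * Real.exp (-(1 / (16 * a)) * ‖ξ - η‖ ^ 2) ≤
      weightConst m * √(weight m y) := by
  have h1 := sqrt_weight_mul_exp_le hm ha ha1 (ξ - η) η
  rw [sub_add_cancel] at h1
  have h2 : 1 + ‖η‖ ^ m ≤ 2 * √(weight m y) :=
    (add_le_add le_rfl (Real.rpow_le_rpow (norm_nonneg _) hη hm)).trans (le_sqrt_weight m y)
  refine h1.trans ?_
  rw [weightConst, mul_assoc (2 ^ m * (1 + Real.exp (4 * m ^ 2)))]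
  gcongr

/-- The Gaussian exponent 1/4 is shared out as 1/8 + 1/16 + 1/16: the first part feeds the
Schur–Young bound, the second absorbs the weight, and the third absorbs the factor |x|/(2a) of the
gradient kernel. -/
theorem exp_split (a s : ℝ) : Real.exp (-(1 / (4 * a)) * s) =
    Real.exp (-(1 / (8 * a)) * s) * Real.exp (-(1 / (16 * a)) * s) *
      Real.exp (-(1 / (16 * a)) * s) := by
  rw [← Real.exp_add, ← Real.exp_add]
  congr 1
  ring

theorem norm_exp_smul_le {τ : ℝ} (hτ : 0 ≤ τ) (y : Eu N) : ‖Real.exp (-(τ / 2)) • y‖ ≤ ‖y‖ := by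
  rw [norm_smul, Real.norm_of_nonneg (Real.exp_pos _).le]
  have : Real.exp (-(τ / 2)) ≤ 1 := Real.exp_le_one_iff.mpr (by linarith)
  nlinarith [norm_nonneg y]

theorem sqrt_weight_mul_kernelL_le (hm : 0 ≤ m) {τ : ℝ} (hτ : 0 < τ) (ξ y : Eu N) :
    √(weight m ξ) * kernelL N τ ξ y ≤ √(weight m y) *
      (weightConst m * (1 - Real.exp (-τ)) ^ (-((N : ℝ) / 2)) *
        Real.exp (-(1 / (8 * (1 - Real.exp (-τ)))) * ‖ξ - Real.exp (-(τ / 2)) • y‖ ^ 2)) := by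
  have ha := one_sub_exp_neg_pos hτ
  have ha1 : 1 - Real.exp (-τ) ≤ 1 := by linarith [Real.exp_pos (-τ)]
  have h1 := sqrt_weight_mul_exp_le_sqrt_weight hm ha ha1 ξ _ y (norm_exp_smul_le hτ.le y)
  rw [kernelL_eq hτ]
  set a := 1 - Real.exp (-τ)
  set x := ξ - Real.exp (-(τ / 2)) • y
  have h2 := heatKernel_le ha x
  rw [exp_split] at h2
  have h3 : Real.exp (-(1 / (16 * a)) * ‖x‖ ^ 2) ≤ 1 :=
    Real.exp_le_one_iff.mpr (by rw [neg_mul]; exact neg_nonpos.mpr (by positivity))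
  calc √(weight m ξ) * heatKernel N a x
      ≤ √(weight m ξ) * (a ^ (-((N : ℝ) / 2)) * (Real.exp (-(1 / (8 * a)) * ‖x‖ ^ 2) *
        Real.exp (-(1 / (16 * a)) * ‖x‖ ^ 2) * 1)) := by
        refine mul_le_mul_of_nonneg_left (h2.trans ?_) (Real.sqrt_nonneg _)
        gcongr
    _ = a ^ (-((N : ℝ) / 2)) * Real.exp (-(1 / (8 * a)) * ‖x‖ ^ 2) *
        (√(weight m ξ) * Real.exp (-(1 / (16 * a)) * ‖x‖ ^ 2)) := by ring
    _ ≤ a ^ (-((N : ℝ) / 2)) * Real.exp (-(1 / (8 * a)) * ‖x‖ ^ 2) *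
        (weightConst m * √(weight m y)) := by gcongr
    _ = _ := by ring

theorem sqrt_weight_mul_gradKernelL_le (hm : 0 ≤ m) {τ : ℝ} (hτ : 0 < τ) (ξ y : Eu N) :
    √(weight m ξ) * ‖gradKernelL N τ ξ y‖ ≤ √(weight m y) *
      (weightConst m * (1 - Real.exp (-τ)) ^ (-(1 / 2) : ℝ) *
        (1 - Real.exp (-τ)) ^ (-((N : ℝ) / 2)) *
        Real.exp (-(1 / (8 * (1 - Real.exp (-τ)))) * ‖ξ - Real.exp (-(τ / 2)) • y‖ ^ 2)) := by
  have ha := one_sub_exp_neg_pos hτ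
  have ha1 : 1 - Real.exp (-τ) ≤ 1 := by linarith [Real.exp_pos (-τ)]
  have h1 := sqrt_weight_mul_exp_le_sqrt_weight hm ha ha1 ξ _ y (norm_exp_smul_le hτ.le y)
  rw [norm_gradKernelL hτ, kernelL_eq hτ]
  set a := 1 - Real.exp (-τ)
  set x := ξ - Real.exp (-(τ / 2)) • y
  have h2 := heatKernel_le ha x
  rw [exp_split] at h2
  have h3 := norm_div_le_exp ha x
  have h4 : Real.exp (1 / (16 * a) * ‖x‖ ^ 2) * Real.exp (-(1 / (16 * a)) * ‖x‖ ^ 2) = 1 := by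
    rw [← Real.exp_add]
    simp
  have h5 := heatKernel_pos ha x
  calc √(weight m ξ) * (‖x‖ / (2 * a) * heatKernel N a x)
      ≤ √(weight m ξ) * ((a ^ (-(1 / 2) : ℝ) * Real.exp (1 / (16 * a) * ‖x‖ ^ 2)) *
        (a ^ (-((N : ℝ) / 2)) * (Real.exp (-(1 / (8 * a)) * ‖x‖ ^ 2) *
        Real.exp (-(1 / (16 * a)) * ‖x‖ ^ 2) * Real.exp (-(1 / (16 * a)) * ‖x‖ ^ 2)))) := by
        refine mul_le_mul_of_nonneg_left (mul_le_mul h3 h2 h5.le (by positivity))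
          (Real.sqrt_nonneg _)
    _ = a ^ (-(1 / 2) : ℝ) * a ^ (-((N : ℝ) / 2)) * Real.exp (-(1 / (8 * a)) * ‖x‖ ^ 2) *
        (Real.exp (1 / (16 * a) * ‖x‖ ^ 2) * Real.exp (-(1 / (16 * a)) * ‖x‖ ^ 2)) *
        (√(weight m ξ) * Real.exp (-(1 / (16 * a)) * ‖x‖ ^ 2)) := by ring
    _ ≤ a ^ (-(1 / 2) : ℝ) * a ^ (-((N : ℝ) / 2)) * Real.exp (-(1 / (8 * a)) * ‖x‖ ^ 2) *
        1 * (weightConst m * √(weight m y)) := by rw [h4]; gcongr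
    _ = _ := by ring

/-- `p` is the exponent with `1/p = 1/2 + b`. -/
structure IsExponent (p : ℝ≥0∞) (b : ℝ) : Prop where
  nonneg : 0 ≤ b
  le_half : b ≤ 1 / 2
  eq : p = ENNReal.ofReal (1 / (1 / 2 + b))

theorem isExponent_two : IsExponent 2 0 := ⟨le_rfl, by norm_num, by norm_num⟩

theorem IsExponent.toReal_mul {p : ℝ≥0∞} {b : ℝ} (h : IsExponent p b) :
    p.toReal * (1 / 2 + b) = 1 := by
  have := h.nonneg
  rw [h.eq, ENNReal.toReal_ofReal (by positivity)]
  field_simp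

theorem IsExponent.ne_top {p : ℝ≥0∞} {b : ℝ} (h : IsExponent p b) : p ≠ ⊤ := by
  rw [h.eq]
  exact ENNReal.ofReal_ne_top

theorem IsExponent.one_le {p : ℝ≥0∞} {b : ℝ} (h : IsExponent p b) : 1 ≤ p := by
  rw [h.eq, ← ENNReal.ofReal_one]
  refine ENNReal.ofReal_le_ofReal ?_
  have := h.nonneg
  rw [le_div_iff₀ (by positivity)]
  linarith [h.le_half]

theorem mul_exp_neg_le {τ T : ℝ} (hτ : 0 < τ) (hT : τ ≤ T) :
    τ * Real.exp (-T) ≤ 1 - Real.exp (-τ) := by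
  have h1 := Real.add_one_le_exp τ
  have h2 : Real.exp (-T) ≤ Real.exp (-τ) := Real.exp_le_exp.mpr (by linarith)
  have h3 : Real.exp τ * Real.exp (-τ) = 1 := by rw [← Real.exp_add]; simp
  nlinarith [Real.exp_pos (-τ), Real.exp_pos (-T)]

theorem one_sub_exp_rpow_le {τ T δ : ℝ} (hτ : 0 < τ) (hT : τ ≤ T) (hδ : 0 ≤ δ) :
    (1 - Real.exp (-τ)) ^ (-δ) ≤ Real.exp (T * δ) * τ ^ (-δ) := by
  have h1 := Real.rpow_le_rpow_of_nonpos (by positivity) (mul_exp_neg_le hτ hT)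
    (by linarith : -δ ≤ 0)
  refine h1.trans (le_of_eq ?_)
  rw [Real.mul_rpow hτ.le (Real.exp_pos _).le, ← Real.exp_mul, mul_comm]
  congr 2
  ring

/-- The exponents are a = 1/2 - b and r = 1/(1 - b). The singularity τ^{-Nb/2} is the usual L^p–L²
loss of the heat flow, and the gradient costs a further τ^{-1/2}. -/
theorem exists_kernelBounds (N : ℕ) (hm : 0 ≤ m) {p : ℝ≥0∞} {b : ℝ} (hp : IsExponent p b)
    (T : ℝ) : ∃ C : ℝ, 0 ≤ C ∧ ∀ τ, 0 < τ → τ ≤ T →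
      KernelBound m (fun ξ y => ‖kernelL N τ ξ y‖ₑ) p.toReal
        (ENNReal.ofReal (C * τ ^ (-((N : ℝ) / 2 * b)))) ∧
      KernelBound m (fun ξ y => ‖gradKernelL N τ ξ y‖ₑ) p.toReal
        (ENNReal.ofReal (C * τ ^ (-(1 / 2 + (N : ℝ) / 2 * b)))) := by
  have hb := hp.nonneg
  have hb2 := hp.le_half
  obtain ⟨C, hC0, hC⟩ := exists_kernelBound_of_gaussian N m (a := 1 / 2 - b) (b := b)
    (p := p.toReal) (r := 1 / (1 - b)) (by linarith) hb (by ring)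
    (by have : 1 - b ≠ 0 := by linarith
        field_simp; ring) hp.toReal_mul
  have hw := weightConst_nonneg m
  have hNb : (0 : ℝ) ≤ (N : ℝ) / 2 * b := by positivity
  refine ⟨C * weightConst m * Real.exp (N * |T| / 4) *
    (Real.exp (T * ((N : ℝ) / 2 * b)) + Real.exp (T * (1 / 2 + (N : ℝ) / 2 * b))),
    by positivity, fun τ hτ hT => ⟨?_, ?_⟩⟩
  · have h1 := hC τ (weightConst m) hτ hw (fun ξ y => kernelL N τ ξ y)
      (continuous_kernelL τ).measurable (fun ξ y => sqrt_weight_mul_kernelL_le hm hτ ξ y)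
    refine h1.mono (fun ξ y => ?_) (ENNReal.ofReal_le_ofReal ?_)
    · rw [Real.enorm_eq_ofReal (kernelL_pos hτ ξ y).le]
    · have ha := one_sub_exp_neg_pos hτ
      have h2 := one_sub_exp_rpow_le hτ hT hNb
      have h3 : Real.exp (N * τ / 4) ≤ Real.exp (N * |T| / 4) := by
        apply Real.exp_le_exp.mpr
        have := hT.trans (le_abs_self T)
        gcongr
      calc _ ≤ C * weightConst m * Real.exp (N * |T| / 4) *
            (Real.exp (T * ((N : ℝ) / 2 * b)) * τ ^ (-((N : ℝ) / 2 * b))) := by gcongr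
        _ = C * weightConst m * Real.exp (N * |T| / 4) *
            (Real.exp (T * ((N : ℝ) / 2 * b)) + 0) * τ ^ (-((N : ℝ) / 2 * b)) := by ring
        _ ≤ _ := by gcongr; positivity
  · have ha := one_sub_exp_neg_pos hτ
    have h1 := hC τ (weightConst m * (1 - Real.exp (-τ)) ^ (-(1 / 2) : ℝ)) hτ (by positivity)
      (fun ξ y => ‖gradKernelL N τ ξ y‖)
      (continuous_gradKernelL τ).norm.measurable
      (fun ξ y => sqrt_weight_mul_gradKernelL_le hm hτ ξ y)
    refine h1.mono (fun ξ y => ?_) (ENNReal.ofReal_le_ofReal ?_)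
    · rw [ofReal_norm]
    · have h2 := one_sub_exp_rpow_le hτ hT (by positivity : 0 ≤ 1 / 2 + (N : ℝ) / 2 * b)
      have h3 : Real.exp (N * τ / 4) ≤ Real.exp (N * |T| / 4) := by
        apply Real.exp_le_exp.mpr
        have := hT.trans (le_abs_self T)
        gcongr
      have h4 : (1 - Real.exp (-τ)) ^ (-(1 / 2) : ℝ) * (1 - Real.exp (-τ)) ^ (-((N : ℝ) / 2 * b)) =
          (1 - Real.exp (-τ)) ^ (-(1 / 2 + (N : ℝ) / 2 * b)) := by
        rw [← Real.rpow_add ha]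
        congr 1
        ring
      calc _ = C * weightConst m * Real.exp (N * τ / 4) * ((1 - Real.exp (-τ)) ^ (-(1 / 2) : ℝ) *
            (1 - Real.exp (-τ)) ^ (-((N : ℝ) / 2 * b))) := by ring
        _ ≤ C * weightConst m * Real.exp (N * |T| / 4) *
            (Real.exp (T * (1 / 2 + (N : ℝ) / 2 * b)) * τ ^ (-(1 / 2 + (N : ℝ) / 2 * b))) := by
            rw [h4]; gcongr
        _ = C * weightConst m * Real.exp (N * |T| / 4) *
            (0 + Real.exp (T * (1 / 2 + (N : ℝ) / 2 * b))) * τ ^ (-(1 / 2 + (N : ℝ) / 2 * b)) := by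
            ring
        _ ≤ _ := by gcongr; positivity

end ViscousHJ

/-! ### Duality, Fubini and the operator-valued kernels -/

namespace ViscousHJ

open Filter Topology
open scoped ENNReal

variable {N : ℕ} {m : ℝ}

/-- `ψ` is square integrable against the inverse weight, so that it pairs with `L²_m`. -/
def IsDual (m : ℝ) (ψ : Eu N → ℝ) : Prop :=
  AEStronglyMeasurable ψ volume ∧ ∫⁻ ξ, (ENNReal.ofReal (weight m ξ))⁻¹ * ‖ψ ξ‖ₑ ^ 2 ≠ ⊤

theorem isDual_of_memLp {ψ : Eu N → ℝ} (h : MemLp ψ 2 volume) : IsDual m ψ := by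
  refine ⟨h.1, ne_top_of_le_ne_top ?_ (lintegral_mono fun ξ => ?_) (b := ∫⁻ ξ, ‖ψ ξ‖ₑ ^ 2)⟩
  · have := (eLpNorm_lt_top_iff_lintegral_rpow_enorm_lt_top (p := 2) (by norm_num)
      (by norm_num)).mp h.2
    simpa using this.ne
  · refine mul_le_of_le_one_left' ?_
    rw [ENNReal.inv_le_one, ← ENNReal.ofReal_one]
    exact ENNReal.ofReal_le_ofReal (one_le_weight m ξ)

/-- Pointwise ψf ≤ w⁻¹ψ² + w f²: the first term dominates when ψ ≥ w f, the second otherwise. Both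
have finite integral. -/
theorem IsDual.lintegral_mul_lt_top {ψ : Eu N → ℝ} (hψ : IsDual m ψ) {f : Eu N → ℝ≥0∞}
    (hf : AEMeasurable f volume) (hf2 : ∫⁻ ξ, f ξ ^ 2 ∂(weightedMeasure N m) ≠ ⊤) :
    ∫⁻ ξ, ‖ψ ξ‖ₑ * f ξ < ⊤ := by
  have hw0 : ∀ ξ : Eu N, ENNReal.ofReal (weight m ξ) ≠ 0 := fun ξ => by
    simpa using weight_pos m ξ
  have hwm : AEMeasurable (fun ξ : Eu N => ENNReal.ofReal (weight m ξ)) volume :=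
    (measurable_weight m).ennreal_ofReal.aemeasurable
  rw [lintegral_weighted (hf.pow_const 2)] at hf2
  have hsum : ∫⁻ ξ, ((ENNReal.ofReal (weight m ξ))⁻¹ * ‖ψ ξ‖ₑ ^ 2 +
      ENNReal.ofReal (weight m ξ) * f ξ ^ 2) < ⊤ := by
    have hm1 : AEMeasurable (fun ξ => (ENNReal.ofReal (weight m ξ))⁻¹ * ‖ψ ξ‖ₑ ^ 2) volume :=
      hwm.inv.mul (hψ.1.enorm.pow_const 2)
    rw [lintegral_add_left' hm1]
    exact ENNReal.add_lt_top.mpr ⟨hψ.2.lt_top, hf2.lt_top⟩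
  refine lt_of_le_of_lt (lintegral_mono fun ξ => ?_) hsum
  set w := ENNReal.ofReal (weight m ξ) with hw
  have hwt : w ≠ ⊤ := ENNReal.ofReal_ne_top
  rcases le_total (‖ψ ξ‖ₑ) (w * f ξ) with h | h
  · refine le_add_left ?_
    calc ‖ψ ξ‖ₑ * f ξ ≤ w * f ξ * f ξ := by gcongr
      _ = w * f ξ ^ 2 := by ring
  · refine le_add_right ?_
    calc ‖ψ ξ‖ₑ * f ξ = w⁻¹ * (‖ψ ξ‖ₑ * (w * f ξ)) := by
          rw [mul_left_comm, ← mul_assoc w⁻¹, ENNReal.inv_mul_cancel (hw0 ξ) hwt, one_mul]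
      _ ≤ w⁻¹ * (‖ψ ξ‖ₑ * ‖ψ ξ‖ₑ) := by gcongr
      _ = w⁻¹ * ‖ψ ξ‖ₑ ^ 2 := by rw [sq]

theorem IsDual.integrable_smul {E : Type*} [NormedAddCommGroup E] [NormedSpace ℝ E]
    {ψ : Eu N → ℝ} (hψ : IsDual m ψ) (f : Lp E 2 (weightedMeasure N m)) :
    Integrable fun ξ => ψ ξ • f ξ := by
  refine ⟨hψ.1.smul (aestronglyMeasurable_volume f), ?_⟩
  have h := (eLpNorm_lt_top_iff_lintegral_rpow_enorm_lt_top (p := 2) (by norm_num)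
      (by norm_num)).mp (Lp.eLpNorm_lt_top f)
  have := hψ.lintegral_mul_lt_top (aestronglyMeasurable_volume f).enorm (by simpa using h.ne)
  refine lt_of_le_of_lt (lintegral_mono fun ξ => ?_) this
  rw [enorm_smul]

section Fubini

variable {E G : Type*} [NormedAddCommGroup E] [NormedSpace ℝ E]
  [NormedAddCommGroup G] [NormedSpace ℝ G] {p : ℝ≥0∞}

/-- The kernel bound concerns absolute values, so the iterated integral of norms is finite. This is
the hypothesis of Fubini's theorem wherever the order of integration is exchanged below. -/
theorem KernelBound.integrable_prod [hp1 : Fact (1 ≤ p)] (hp : p ≠ ⊤)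
    {K : Eu N → Eu N → E →L[ℝ] G} (hK : Continuous (Function.uncurry K)) {A : ℝ≥0}
    (h : KernelBound m (fun ξ y => ‖K ξ y‖ₑ) p.toReal A) (f : Lp E p (weightedMeasure N m))
    {ψ : Eu N → ℝ} (hψ : IsDual m ψ) :
    Integrable (fun z : Eu N × Eu N => ψ z.1 • K z.1 z.2 (f z.2)) (volume.prod volume) := by
  have hp0 : p ≠ 0 := (zero_lt_one.trans_le hp1.1).ne'
  have hpr : 0 < p.toReal := ENNReal.toReal_pos hp0 hp
  have hKm : Measurable (Function.uncurry fun ξ y => ‖K ξ y‖ₑ) := by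
    have : Continuous fun z : Eu N × Eu N => ‖K z.1 z.2‖ₑ := hK.enorm
    exact this.measurable
  have hfm : AEMeasurable (fun y => ‖f y‖ₑ) volume := (aestronglyMeasurable_volume f).enorm
  have hf' : ∫⁻ y, ‖f y‖ₑ ^ p.toReal ∂(weightedMeasure N m) ≠ ⊤ :=
    ((eLpNorm_lt_top_iff_lintegral_rpow_enorm_lt_top hp0 hp).mp (Lp.eLpNorm_lt_top f)).ne
  have hHm : AEMeasurable (fun ξ => ∫⁻ y, ‖K ξ y‖ₑ * ‖f y‖ₑ) volume :=
    (hKm.aemeasurable.mul hfm.comp_snd).lintegral_prod_right'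
  have h1 : ∫⁻ ξ, (∫⁻ y, ‖K ξ y‖ₑ * ‖f y‖ₑ) ^ 2 ∂(weightedMeasure N m) ≠ ⊤ :=
    ne_top_of_le_ne_top (ENNReal.mul_ne_top (ENNReal.pow_ne_top ENNReal.coe_ne_top)
      (ENNReal.rpow_ne_top_of_nonneg (by positivity) hf')) (h _ hfm)
  have hmeas : AEStronglyMeasurable (fun z : Eu N × Eu N => ψ z.1 • K z.1 z.2 (f z.2))
      (volume.prod volume) :=
    hψ.1.comp_fst.smul (aestronglyMeasurable_kernel_apply hK (aestronglyMeasurable_volume f))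
  refine ⟨hmeas, ?_⟩
  rw [hasFiniteIntegral_iff_enorm, lintegral_prod _ hmeas.enorm]
  refine lt_of_le_of_lt (lintegral_mono fun ξ => ?_) (hψ.lintegral_mul_lt_top hHm h1)
  rw [← lintegral_const_mul' _ _ enorm_ne_top]
  refine lintegral_mono fun y => ?_
  rw [enorm_smul]
  gcongr
  exact (K ξ y).le_opENorm (f y)

theorem KernelBound.integral_swap [hp1 : Fact (1 ≤ p)] (hp : p ≠ ⊤)
    {K : Eu N → Eu N → E →L[ℝ] G} (hK : Continuous (Function.uncurry K)) {A : ℝ≥0}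
    (h : KernelBound m (fun ξ y => ‖K ξ y‖ₑ) p.toReal A) (f : Lp E p (weightedMeasure N m))
    {ψ : Eu N → ℝ} (hψ : IsDual m ψ) :
    ∫ ξ, ψ ξ • ∫ y, K ξ y (f y) = ∫ y, ∫ ξ, ψ ξ • K ξ y (f y) := by
  rw [← integral_integral_swap (h.integrable_prod hp hK f hψ)]
  simp_rw [integral_smul]

end Fubini

section Operators

variable {E : Type*} [NormedAddCommGroup E] [NormedSpace ℝ E] {p : ℝ≥0∞} {b : ℝ}

/-- The kernel of `e^{τ𝓛}` acting on `E`-valued functions. -/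
noncomputable def kernelClm (N : ℕ) (E : Type*) [NormedAddCommGroup E] [NormedSpace ℝ E]
    (τ : ℝ) (ξ y : Eu N) : E →L[ℝ] E := kernelL N τ ξ y • ContinuousLinearMap.id ℝ E

/-- The kernel of `∇ e^{τ𝓛}`. -/
noncomputable def gradKernelClm (N : ℕ) (τ : ℝ) (ξ y : Eu N) : ℝ →L[ℝ] Eu N :=
  ContinuousLinearMap.toSpanSingleton ℝ (gradKernelL N τ ξ y)

@[simp]
theorem kernelClm_apply (τ : ℝ) (ξ y : Eu N) (x : E) :
    kernelClm N E τ ξ y x = kernelL N τ ξ y • x := rfl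

@[simp]
theorem gradKernelClm_apply (τ : ℝ) (ξ y : Eu N) (c : ℝ) :
    gradKernelClm N τ ξ y c = c • gradKernelL N τ ξ y := by
  simp [gradKernelClm]

theorem continuous_kernelClm (τ : ℝ) :
    Continuous (Function.uncurry (kernelClm N E τ)) := by
  have := continuous_kernelL (N := N) τ
  exact this.smul continuous_const

theorem continuous_gradKernelClm (τ : ℝ) :
    Continuous (Function.uncurry (gradKernelClm N τ)) := by
  have := continuous_gradKernelL (N := N) τ
  exact (ContinuousLinearMap.toSpanSingletonLE ℝ ℝ (Eu N)).continuous_of_finiteDimensional.comp this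

theorem exists_operatorBounds (N : ℕ) (E : Type*) [NormedAddCommGroup E] [NormedSpace ℝ E]
    (hm : 0 ≤ m) (hp : IsExponent p b) (T : ℝ) :
    ∃ C : ℝ, 0 ≤ C ∧ ∀ τ, 0 < τ → τ ≤ T →
      KernelBound m (fun ξ y => ‖kernelClm N E τ ξ y‖ₑ) p.toReal
        (C * τ ^ (-((N : ℝ) / 2 * b))).toNNReal ∧
      KernelBound m (fun ξ y => ‖gradKernelClm N τ ξ y‖ₑ) p.toReal
        (C * τ ^ (-(1 / 2 + (N : ℝ) / 2 * b))).toNNReal := by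
  obtain ⟨C, hC0, hC⟩ := exists_kernelBounds (m := m) N hm hp T
  refine ⟨C, hC0, fun τ hτ hT => ⟨(hC τ hτ hT).1.mono (fun ξ y => ?_) le_rfl,
    (hC τ hτ hT).2.mono (fun ξ y => ?_) le_rfl⟩⟩
  · refine enorm_le_iff_norm_le.mpr ?_
    rw [kernelClm, norm_smul]
    exact mul_le_of_le_one_right (norm_nonneg _) ContinuousLinearMap.norm_id_le
  · refine enorm_le_iff_norm_le.mpr ?_
    rw [gradKernelClm, ContinuousLinearMap.norm_toSpanSingleton]

end Operators

end ViscousHJ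

/-! ### The weak gradient of the smoothed function -/

namespace ViscousHJ

open Filter Topology
open scoped ENNReal

variable {N : ℕ} {m : ℝ}

theorem continuous_kernelL_left (τ : ℝ) (y : Eu N) : Continuous fun ξ => kernelL N τ ξ y :=
  Continuous.comp (g := fun z : Eu N × Eu N => kernelL N τ z.1 z.2) (f := fun ξ => (ξ, y))
    (continuous_kernelL τ) (by fun_prop)

theorem continuous_kernelL_right (τ : ℝ) (ξ : Eu N) : Continuous fun y => kernelL N τ ξ y :=
  Continuous.comp (g := fun z : Eu N × Eu N => kernelL N τ z.1 z.2) (f := fun y => (ξ, y))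
    (continuous_kernelL τ) (by fun_prop)

theorem continuous_gradKernelL_left (τ : ℝ) (y : Eu N) :
    Continuous fun ξ => gradKernelL N τ ξ y :=
  Continuous.comp (g := fun z : Eu N × Eu N => gradKernelL N τ z.1 z.2) (f := fun ξ => (ξ, y))
    (continuous_gradKernelL τ) (by fun_prop)

theorem continuous_gradKernelL_right (τ : ℝ) (ξ : Eu N) :
    Continuous fun y => gradKernelL N τ ξ y :=
  Continuous.comp (g := fun z : Eu N × Eu N => gradKernelL N τ z.1 z.2) (f := fun y => (ξ, y))
    (continuous_gradKernelL τ) (by fun_prop)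

theorem integral_kernelL_mul_fderiv {τ : ℝ} (hτ : 0 < τ) {ψ : Eu N → ℝ} (hψ : ContDiff ℝ ∞ ψ)
    (hc : HasCompactSupport ψ) (e y : Eu N) : ∫ ξ, kernelL N τ ξ y * fderiv ℝ ψ ξ e =
      -∫ ξ, inner ℝ (gradKernelL N τ ξ y) e * ψ ξ := by
  have hd := continuous_fderiv_test hψ e
  have hdc : HasCompactSupport fun ξ => fderiv ℝ ψ ξ e := hc.fderiv_apply ℝ e
  have hcont := continuous_gradKernelL_left τ y
  have hcont' := continuous_kernelL_left τ y
  have hfd : ∀ ξ, fderiv ℝ (fun ξ => kernelL N τ ξ y) ξ e =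
      inner ℝ (gradKernelL N τ ξ y) e := fun ξ => by
    rw [(hasFDerivAt_kernelL_left hτ ξ y).fderiv, innerSL_apply_apply]
  have hci : Continuous fun ξ => inner ℝ (gradKernelL N τ ξ y) e :=
    hcont.inner continuous_const
  have key := integral_mul_fderiv_eq_neg_fderiv_mul_of_integrable (μ := volume)
    (f := fun ξ => kernelL N τ ξ y) (g := ψ) (v := e)
    (by simp only [hfd]; exact (hci.mul hψ.continuous).integrable_of_hasCompactSupport hc.mul_left)
    ((hcont'.mul hd).integrable_of_hasCompactSupport hdc.mul_left)
    ((hcont'.mul hψ.continuous).integrable_of_hasCompactSupport hc.mul_left)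
    (fun x _ => (hasFDerivAt_kernelL_left hτ x y).differentiableAt)
    (fun x _ => (hψ.differentiable (by simp)).differentiableAt)
  rw [key]
  simp only [hfd]

/-- After exchanging the order of integration, the identity reduces to classical integration by
parts in ξ for fixed y, where the kernel is smooth and the test function has compact support. -/
theorem isWeakGradient_kernel {p : ℝ≥0∞} {b : ℝ} [Fact (1 ≤ p)] (hm : 0 ≤ m)
    (hp : IsExponent p b) {τ : ℝ} (hτ : 0 < τ) (f : Lp ℝ p (weightedMeasure N m)) :
    IsWeakGradient (fun ξ => ∫ y, kernelL N τ ξ y * f y)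
      (fun ξ => ∫ y, f y • gradKernelL N τ ξ y) := by
  intro ψ hψ hc e
  obtain ⟨C, -, hC⟩ := exists_operatorBounds (m := m) N ℝ hm hp τ
  obtain ⟨h1, h2⟩ := hC τ hτ le_rfl
  have hd := continuous_fderiv_test hψ e
  have hdc : HasCompactSupport fun ξ => fderiv ℝ ψ ξ e := hc.fderiv_apply ℝ e
  have hψd : IsDual m ψ := isDual_of_memLp (memLp_test hψ.continuous hc)
  have hψd' : IsDual m fun ξ => fderiv ℝ ψ ξ e := isDual_of_memLp (memLp_test hd hdc)
  have e1 := h1.integral_swap hp.ne_top (continuous_kernelClm τ) f hψd'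
  have e2 := h2.integral_swap hp.ne_top (continuous_gradKernelClm τ) f hψd
  have i2 := h2.integrable_prod hp.ne_top (continuous_gradKernelClm τ) f hψd
  have i3 : Integrable fun ξ => ψ ξ • ∫ y, gradKernelClm N τ ξ y (f y) := by
    have := i2.integral_prod_left
    simpa only [integral_smul] using this
  have e3 : ∫ ξ, inner ℝ (∫ y, f y • gradKernelL N τ ξ y) e * ψ ξ =
      inner ℝ e (∫ ξ, ψ ξ • ∫ y, gradKernelClm N τ ξ y (f y)) := by
    rw [← integral_inner i3]
    refine integral_congr_ae (Eventually.of_forall fun ξ => ?_)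
    simp only [gradKernelClm_apply, inner_smul_right, real_inner_comm]
    ring
  have hcont := fun y : Eu N => continuous_gradKernelL_left τ y
  have parts := fun y => integral_kernelL_mul_fderiv hτ hψ hc e y
  have e4 : inner ℝ e (∫ y, ∫ ξ, ψ ξ • gradKernelClm N τ ξ y (f y)) =
      ∫ y, f y * ∫ ξ, inner ℝ (gradKernelL N τ ξ y) e * ψ ξ := by
    rw [← integral_inner i2.integral_prod_right]
    refine integral_congr_ae (Eventually.of_forall fun y => ?_)
    have hi : Integrable fun ξ => ψ ξ • gradKernelL N τ ξ y :=
      (hψ.continuous.smul (hcont y)).integrable_of_hasCompactSupport hc.smul_right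
    simp only [gradKernelClm_apply]
    simp_rw [smul_comm (ψ _) (f y)]
    rw [integral_smul, inner_smul_right, ← integral_inner hi]
    congr 1
    refine integral_congr_ae (Eventually.of_forall fun ξ => ?_)
    simp only [inner_smul_right, real_inner_comm]
    ring
  rw [e3, e2, e4, ← integral_neg]
  have e5 : ∫ ξ, (∫ y, kernelL N τ ξ y * f y) * fderiv ℝ ψ ξ e =
      ∫ ξ, fderiv ℝ ψ ξ e • ∫ y, kernelClm N ℝ τ ξ y (f y) := by
    simp only [kernelClm_apply, smul_eq_mul, mul_comm]
  rw [e5, e1]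
  refine integral_congr_ae (Eventually.of_forall fun y => ?_)
  simp only
  rw [← mul_neg, ← parts, ← integral_const_mul]
  refine integral_congr_ae (Eventually.of_forall fun ξ => ?_)
  simp only [kernelClm_apply, smul_eq_mul]
  ring

end ViscousHJ

/-! ### The Hilbert space structure of H¹_m and integration by parts -/

namespace ViscousHJ

open Filter Topology
open scoped ENNReal

variable {N : ℕ} {m : ℝ}

/-- Pairing with a function in the dual weighted space is continuous on `L²_m`. -/
theorem IsDual.exists_pairing {E : Type*} [NormedAddCommGroup E] [InnerProductSpace ℝ E]
    {ψ : Eu N → ℝ} (hψ : IsDual m ψ) (e : E) :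
    ∃ L : Lp E 2 (weightedMeasure N m) →L[ℝ] ℝ, ∀ u, L u = ∫ ξ, inner ℝ (u ξ) e * ψ ξ := by
  have hwm : AEMeasurable (fun ξ : Eu N => (weight m ξ)⁻¹) volume :=
    (measurable_weight m).inv.aemeasurable
  have hmeas : AEStronglyMeasurable (fun ξ => ((weight m ξ)⁻¹ * ψ ξ) • e) volume :=
    (hwm.aestronglyMeasurable.mul hψ.1).smul_const e
  -- The functional is represented by w⁻¹ψe: the density w of the weighted inner product restores
  -- the unweighted pairing.
  have hL : MemLp (fun ξ => ((weight m ξ)⁻¹ * ψ ξ) • e) 2 (weightedMeasure N m) := by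
    refine ⟨aestronglyMeasurable_weighted hmeas, ?_⟩
    rw [eLpNorm_lt_top_iff_lintegral_rpow_enorm_lt_top (by norm_num) (by norm_num),
      lintegral_weighted (hmeas.enorm.pow_const _)]
    have h1 : ∀ ξ : Eu N, ENNReal.ofReal (weight m ξ) *
        ‖((weight m ξ)⁻¹ * ψ ξ) • e‖ₑ ^ (2 : ℝ≥0∞).toReal =
        ((ENNReal.ofReal (weight m ξ))⁻¹ * ‖ψ ξ‖ₑ ^ 2) * ‖e‖ₑ ^ 2 := by
      intro ξ
      have hw := weight_pos m ξ
      rw [ENNReal.toReal_ofNat, ENNReal.rpow_two, enorm_smul, enorm_mul,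
        Real.enorm_eq_ofReal (inv_pos.mpr hw).le, ENNReal.ofReal_inv_of_pos hw, mul_pow, mul_pow]
      set w := ENNReal.ofReal (weight m ξ)
      have hw0 : w ≠ 0 := by simpa [w] using hw
      have hwt : w ≠ ⊤ := ENNReal.ofReal_ne_top
      rw [sq w⁻¹, ← mul_assoc, ← mul_assoc, ← mul_assoc, ENNReal.mul_inv_cancel hw0 hwt, one_mul]
    simp_rw [h1]
    have hm1 : AEMeasurable (fun ξ => (ENNReal.ofReal (weight m ξ))⁻¹ * ‖ψ ξ‖ₑ ^ 2) volume :=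
      (measurable_weight m).ennreal_ofReal.inv.aemeasurable.mul (hψ.1.enorm.pow_const 2)
    rw [lintegral_mul_const'' _ hm1]
    exact ENNReal.mul_lt_top hψ.2.lt_top (by simp)
  refine ⟨innerSL ℝ hL.toLp, fun u => ?_⟩
  rw [innerSL_apply_apply, L2.inner_def]
  refine (integral_withDensity_eq_integral_toReal_smul (measurable_weight m).ennreal_ofReal
    (Eventually.of_forall fun _ => ENNReal.ofReal_lt_top) _).trans ?_
  refine integral_congr_ae ?_
  filter_upwards [ae_volume hL.coeFn_toLp] with ξ hξ
  have hw := weight_pos m ξ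
  rw [ENNReal.toReal_ofReal hw.le, hξ, smul_eq_mul, inner_smul_left,
    real_inner_comm]
  simp only [conj_trivial]
  field_simp

/-- For each test function, the defining identity equates two continuous linear functionals of the
pair (v, ∇v), so the space is an intersection of closed sets. -/
theorem isClosed_H1m : IsClosed (H1m N m : Set (WithLp 2 (L2m N m × L2mVec N m))) := by
  have h : (H1m N m : Set (WithLp 2 (L2m N m × L2mVec N m))) =
      ⋂ (ψ : Eu N → ℝ) (_ : ContDiff ℝ ∞ ψ) (_ : HasCompactSupport ψ) (e : Eu N),
        {v | ∫ ξ, v.fst ξ * fderiv ℝ ψ ξ e = -∫ ξ, inner ℝ (v.snd ξ) e * ψ ξ} := by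
    ext v
    simp only [mem_iInter]
    rfl
  rw [h]
  refine isClosed_iInter fun ψ => isClosed_iInter fun hψ => isClosed_iInter fun hc =>
    isClosed_iInter fun e => ?_
  have hd := continuous_fderiv_test hψ e
  have hdc : HasCompactSupport fun ξ => fderiv ℝ ψ ξ e := hc.fderiv_apply ℝ e
  obtain ⟨L₁, h₁⟩ := (isDual_of_memLp (m := m) (memLp_test hd hdc)).exists_pairing (1 : ℝ)
  obtain ⟨L₂, h₂⟩ := (isDual_of_memLp (m := m) (memLp_test hψ.continuous hc)).exists_pairing e
  have e1 : ∀ v : WithLp 2 (L2m N m × L2mVec N m),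
      ∫ ξ, v.fst ξ * fderiv ℝ ψ ξ e = L₁ v.fst := fun v => by
    rw [h₁]
    simp
  have c1 : Continuous fun v : WithLp 2 (L2m N m × L2mVec N m) => L₁ v.fst :=
    L₁.continuous.comp (WithLp.prod_continuous_ofLp 2 _ _).fst
  have c2 : Continuous fun v : WithLp 2 (L2m N m × L2mVec N m) => L₂ v.snd :=
    L₂.continuous.comp (WithLp.prod_continuous_ofLp 2 _ _).snd
  simp only [e1, ← h₂]
  exact isClosed_eq c1 c2.neg

instance : CompleteSpace (H1m N m) := isClosed_H1m.completeSpace_coe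

theorem IsWeakGradient.congr {u u' : Eu N → ℝ} {g g' : Eu N → Eu N} (h : IsWeakGradient u g)
    (hu : u' =ᵐ[volume] u) (hg : g' =ᵐ[volume] g) : IsWeakGradient u' g' := by
  intro ψ hψ hc e
  have e1 : ∫ ξ, u' ξ * fderiv ℝ ψ ξ e = ∫ ξ, u ξ * fderiv ℝ ψ ξ e := by
    refine integral_congr_ae ?_
    filter_upwards [hu] with ξ hξ
    rw [hξ]
  have e2 : ∫ ξ, inner ℝ (g' ξ) e * ψ ξ = ∫ ξ, inner ℝ (g ξ) e * ψ ξ := by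
    refine integral_congr_ae ?_
    filter_upwards [hg] with ξ hξ
    rw [hξ]
  rw [e1, e2]
  exact h ψ hψ hc e

theorem H1m.isWeakGradient (v : H1m N m) : IsWeakGradient (H1m.toFun v) (H1m.grad v) := v.2

theorem ae_eq_of_inner_eq {g g' : Eu N → Eu N}
    (h : ∀ e : Eu N, ∀ᵐ ξ, inner ℝ (g ξ) e = (inner ℝ (g' ξ) e : ℝ)) : g =ᵐ[volume] g' := by
  have h1 : ∀ᵐ ξ, ∀ i : Fin N, inner ℝ (g ξ) (EuclideanSpace.single i 1) =
      (inner ℝ (g' ξ) (EuclideanSpace.single i 1) : ℝ) := ae_all_iff.mpr fun i => h _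
  filter_upwards [h1] with ξ hξ
  ext i
  simpa [EuclideanSpace.inner_single_right] using hξ i

/-- An element of `H¹_m` is determined by its underlying function. -/
theorem H1m.ext_toFun {v w : H1m N m} (h : H1m.toFun v =ᵐ[volume] H1m.toFun w) : v = w := by
  have h1 : v.1.fst = w.1.fst := Lp.ext (ae_weighted_iff.mpr h)
  have h2 : H1m.grad v =ᵐ[volume] H1m.grad w := by
    refine ae_eq_of_inner_eq fun e => ?_
    have hl : ∀ v : H1m N m, LocallyIntegrable (fun ξ => (inner ℝ (H1m.grad v ξ) e : ℝ)) := fun v =>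
      ((memLp_volume v.1.snd).inner_const e).locallyIntegrable (by norm_num)
    refine ae_eq_of_integral_contDiff_smul_eq (hl v) (hl w) fun ψ hψ hc => ?_
    have k1 := H1m.isWeakGradient v ψ hψ hc e
    have k2 := H1m.isWeakGradient w ψ hψ hc e
    have k3 : ∫ ξ, H1m.toFun v ξ * fderiv ℝ ψ ξ e = ∫ ξ, H1m.toFun w ξ * fderiv ℝ ψ ξ e := by
      refine integral_congr_ae ?_
      filter_upwards [h] with ξ hξ
      rw [hξ]
    simp only [smul_eq_mul, mul_comm (ψ _)]
    linarith
  have h3 : v.1.snd = w.1.snd := Lp.ext (ae_weighted_iff.mpr h2)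
  refine Subtype.ext ?_
  refine (WithLp.equiv 2 _).injective ?_
  exact Prod.ext h1 h3

theorem H1m.norm_sq (v : H1m N m) : ‖v‖ ^ 2 = ‖v.1.fst‖ ^ 2 + ‖v.1.snd‖ ^ 2 :=
  WithLp.prod_norm_sq_eq_of_L2 v.1

theorem H1m.norm_le (v : H1m N m) : ‖v‖ ≤ ‖v.1.fst‖ + ‖v.1.snd‖ := by
  refine abs_le_of_sq_le_sq' ?_ (by positivity) |>.2
  rw [H1m.norm_sq v]
  nlinarith [mul_nonneg (norm_nonneg v.1.fst) (norm_nonneg v.1.snd)]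

theorem H1m.norm_fst_le (v : H1m N m) : ‖v.1.fst‖ ≤ ‖v‖ := by
  refine abs_le_of_sq_le_sq' ?_ (by positivity) |>.2
  rw [H1m.norm_sq v]
  nlinarith [sq_nonneg ‖v.1.snd‖]

theorem H1m.norm_snd_le (v : H1m N m) : ‖v.1.snd‖ ≤ ‖v‖ := by
  refine abs_le_of_sq_le_sq' ?_ (by positivity) |>.2
  rw [H1m.norm_sq v]
  nlinarith [sq_nonneg ‖v.1.fst‖]

/-- The inclusion of `H¹_m` into `L²_m`. -/
noncomputable def fstL (N : ℕ) (m : ℝ) : H1m N m →L[ℝ] L2m N m :=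
  LinearMap.mkContinuous
    { toFun := fun v => v.1.fst
      map_add' := fun _ _ => rfl
      map_smul' := fun _ _ => rfl } 1 fun v =>
    (H1m.norm_fst_le v).trans (one_mul _).ge

/-- The gradient as an operator from `H¹_m` to `L²_m`. -/
noncomputable def sndL (N : ℕ) (m : ℝ) : H1m N m →L[ℝ] L2mVec N m :=
  LinearMap.mkContinuous
    { toFun := fun v => v.1.snd
      map_add' := fun _ _ => rfl
      map_smul' := fun _ _ => rfl } 1 fun v =>
    (H1m.norm_snd_le v).trans (one_mul _).ge

@[simp]
theorem fstL_apply (v : H1m N m) : fstL N m v = v.1.fst := rfl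

@[simp]
theorem sndL_apply (v : H1m N m) : sndL N m v = v.1.snd := rfl

theorem memLp_exp_affine {b s : ℝ} (hb : 0 < b) (hs : s ≠ 0) (ξ : Eu N) {q : ℝ≥0∞} (hq : q ≠ 0) :
    MemLp (fun y : Eu N => Real.exp (-b * ‖ξ - s • y‖ ^ 2)) q volume := by
  have hc : Continuous fun y : Eu N => Real.exp (-b * ‖ξ - s • y‖ ^ 2) := by fun_prop
  rcases eq_or_ne q ⊤ with rfl | hq'
  · refine memLp_top_of_bound hc.aestronglyMeasurable 1 (Eventually.of_forall fun y => ?_)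
    rw [Real.norm_of_nonneg (Real.exp_pos _).le, Real.exp_le_one_iff, neg_mul, neg_nonpos]
    positivity
  rw [← integrable_norm_rpow_iff hc.aestronglyMeasurable hq hq']
  have hq0 := ENNReal.toReal_pos hq hq'
  have h1 := (integrable_exp_neg_mul_norm_sq (N := N) (b := q.toReal * b) (by positivity))
  have h2 := (h1.comp_sub_left ξ).comp_smul hs
  refine h2.congr (Eventually.of_forall fun y => ?_)
  simp only
  rw [Real.norm_of_nonneg (Real.exp_pos _).le, ← Real.exp_mul]
  congr 1
  ring

theorem memLp_kernelL_right {τ : ℝ} (hτ : 0 < τ) (ξ : Eu N) {q : ℝ≥0∞} (hq : q ≠ 0) :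
    MemLp (fun y => kernelL N τ ξ y) q volume := by
  have ha := one_sub_exp_neg_pos hτ
  refine ((memLp_exp_affine (N := N) (b := 1 / (4 * (1 - Real.exp (-τ)))) (by positivity)
    (Real.exp_pos (-(τ / 2))).ne' ξ hq).const_mul
      ((1 - Real.exp (-τ)) ^ (-((N : ℝ) / 2)))).mono
    (continuous_kernelL_right τ ξ).aestronglyMeasurable (Eventually.of_forall fun y => ?_)
  rw [Real.norm_of_nonneg (kernelL_pos hτ ξ y).le, kernelL_eq hτ]
  exact (heatKernel_le ha _).trans (le_abs_self _)

theorem memLp_gradKernelL_right {τ : ℝ} (hτ : 0 < τ) (ξ : Eu N) :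
    MemLp (fun y => gradKernelL N τ ξ y) 2 volume := by
  have ha := one_sub_exp_neg_pos hτ
  refine ((memLp_exp_affine (N := N) (b := 1 / (8 * (1 - Real.exp (-τ)))) (by positivity)
    (Real.exp_pos (-(τ / 2))).ne' ξ two_ne_zero).const_mul ((1 - Real.exp (-τ)) ^ (-(1 / 2) : ℝ) *
      (1 - Real.exp (-τ)) ^ (-((N : ℝ) / 2)))).mono
    (continuous_gradKernelL_right τ ξ).aestronglyMeasurable (Eventually.of_forall fun y => ?_)
  rw [norm_gradKernelL hτ, kernelL_eq hτ]
  set a := 1 - Real.exp (-τ)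
  set x := ξ - Real.exp (-(τ / 2)) • y
  refine le_trans ?_ (le_abs_self _)
  have h2 := heatKernel_le ha x
  rw [exp_split] at h2
  have h3 := norm_div_le_exp ha x
  have h4 : Real.exp (1 / (16 * a) * ‖x‖ ^ 2) * Real.exp (-(1 / (16 * a)) * ‖x‖ ^ 2) = 1 := by
    rw [← Real.exp_add]
    simp
  have h5 : Real.exp (-(1 / (16 * a)) * ‖x‖ ^ 2) ≤ 1 :=
    Real.exp_le_one_iff.mpr (by rw [neg_mul]; exact neg_nonpos.mpr (by positivity))
  calc _ ≤ (a ^ (-(1 / 2) : ℝ) * Real.exp (1 / (16 * a) * ‖x‖ ^ 2)) *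
        (a ^ (-((N : ℝ) / 2)) * (Real.exp (-(1 / (8 * a)) * ‖x‖ ^ 2) *
        Real.exp (-(1 / (16 * a)) * ‖x‖ ^ 2) * Real.exp (-(1 / (16 * a)) * ‖x‖ ^ 2))) :=
        mul_le_mul h3 h2 (heatKernel_pos ha x).le (by positivity)
    _ = a ^ (-(1 / 2) : ℝ) * a ^ (-((N : ℝ) / 2)) * Real.exp (-(1 / (8 * a)) * ‖x‖ ^ 2) *
        (Real.exp (1 / (16 * a) * ‖x‖ ^ 2) * Real.exp (-(1 / (16 * a)) * ‖x‖ ^ 2)) *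
        Real.exp (-(1 / (16 * a)) * ‖x‖ ^ 2) := by ring
    _ ≤ a ^ (-(1 / 2) : ℝ) * a ^ (-((N : ℝ) / 2)) * Real.exp (-(1 / (8 * a)) * ‖x‖ ^ 2) *
        1 * 1 := by rw [h4]; gcongr
    _ = _ := by ring

/-- The defining identity of the weak gradient extends to smooth square integrable functions
with square integrable derivative. -/
theorem H1m.integral_mul_fderiv (v : H1m N m) {ψ : Eu N → ℝ} (hψ : ContDiff ℝ ∞ ψ)
    (h2 : MemLp ψ 2 volume) (e : Eu N) (h2' : MemLp (fun ξ => fderiv ℝ ψ ξ e) 2 volume) :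
    ∫ ξ, H1m.toFun v ξ * fderiv ℝ ψ ξ e = -∫ ξ, inner ℝ (H1m.grad v ξ) e * ψ ξ := by
  -- The test function is multiplied by the bump c(r_n ξ) with r_n → 0. The derivative of the bump
  -- is O(r_n), so its contribution vanishes in the limit, and r_n ≤ 1 provides a common majorant.
  let c : ContDiffBump (0 : Eu N) := ⟨1, 2, one_pos, one_lt_two⟩
  have hcd : ContDiff ℝ ∞ c := c.contDiff
  have hcdc : Continuous (fderiv ℝ c) := hcd.continuous_fderiv (by simp)
  obtain ⟨M, hM⟩ := hcdc.bounded_above_of_compact_support (c.hasCompactSupport.fderiv ℝ)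
  have hM0 : 0 ≤ M := (norm_nonneg _).trans (hM 0)
  let r : ℕ → ℝ := fun n => 1 / ((n : ℝ) + 1)
  have hr0 : ∀ n, 0 < r n := fun n => by positivity
  have hr1 : ∀ n, r n ≤ 1 := fun n => by
    rw [div_le_one (by positivity)]
    linarith [(by positivity : (0 : ℝ) ≤ n)]
  have hr : Tendsto r atTop (𝓝 0) := tendsto_one_div_add_atTop_nhds_zero_nat
  let cn : ℕ → Eu N → ℝ := fun n ξ => c (r n • ξ)
  have hcn : ∀ n, ContDiff ℝ ∞ (cn n) := fun n => hcd.comp (contDiff_id.const_smul (r n))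
  have hcn1 : ∀ n ξ, |cn n ξ| ≤ 1 := fun n ξ => by
    rw [abs_of_nonneg c.nonneg]
    exact c.le_one
  have hlin : ∀ n (ξ : Eu N), HasFDerivAt (fun ξ : Eu N => r n • ξ)
      (r n • ContinuousLinearMap.id ℝ (Eu N)) ξ := fun n ξ => (hasFDerivAt_id ξ).const_smul (r n)
  have hcnd : ∀ n ξ, fderiv ℝ (cn n) ξ e = r n * fderiv ℝ c (r n • ξ) e := by
    intro n ξ
    have h1 : HasFDerivAt (cn n)
        ((fderiv ℝ c (r n • ξ)).comp (r n • ContinuousLinearMap.id ℝ (Eu N))) ξ :=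
      ((hcd.differentiable (by simp)) (r n • ξ)).hasFDerivAt.comp ξ (hlin n ξ)
    rw [h1.fderiv]
    simp
  have hcnd1 : ∀ n ξ, |fderiv ℝ (cn n) ξ e| ≤ r n * (M * ‖e‖) := by
    intro n ξ
    rw [hcnd, abs_mul, abs_of_pos (hr0 n)]
    gcongr
    exact ((fderiv ℝ c (r n • ξ)).le_opNorm e).trans (by gcongr; exact hM _)
  have hcs : ∀ n, HasCompactSupport (cn n) := fun n =>
    c.hasCompactSupport.comp_smul (hr0 n).ne'
  have hcl : ∀ ξ, Tendsto (fun n => cn n ξ) atTop (𝓝 1) := by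
    intro ξ
    have h1 : Tendsto (fun n => r n • ξ) atTop (𝓝 0) := by
      simpa using hr.smul_const ξ
    have h2 := (hcd.continuous.tendsto 0).comp h1
    rwa [c.one_of_mem_closedBall (by simp [c.rIn_pos.le])] at h2
  have hdl : ∀ ξ, Tendsto (fun n => fderiv ℝ (cn n) ξ e) atTop (𝓝 0) := by
    intro ξ
    refine squeeze_zero_norm (fun n => hcnd1 n ξ) ?_
    simpa using hr.mul_const (M * ‖e‖)
  have hfd : ∀ n ξ, fderiv ℝ (fun ξ => ψ ξ * cn n ξ) ξ e =
      ψ ξ * fderiv ℝ (cn n) ξ e + cn n ξ * fderiv ℝ ψ ξ e := by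
    intro n ξ
    rw [fderiv_fun_mul ((hψ.differentiable (by simp)) ξ) (((hcn n).differentiable (by simp)) ξ)]
    simp
  have hid : ∀ n, ∫ ξ, H1m.toFun v ξ * (ψ ξ * fderiv ℝ (cn n) ξ e + cn n ξ * fderiv ℝ ψ ξ e) =
      -∫ ξ, inner ℝ (H1m.grad v ξ) e * (ψ ξ * cn n ξ) := by
    intro n
    have := H1m.isWeakGradient v (fun ξ => ψ ξ * cn n ξ) (hψ.mul (hcn n)) (hcs n).mul_left e
    simpa only [hfd] using this
  have hv2 : MemLp (H1m.toFun v) 2 volume := memLp_volume v.1.fst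
  have hg2 : MemLp (fun ξ => (inner ℝ (H1m.grad v ξ) e : ℝ)) 2 volume :=
    (memLp_volume v.1.snd).inner_const e
  have hde := continuous_fderiv_test hψ e
  have t1 : Tendsto (fun n => ∫ ξ, H1m.toFun v ξ *
      (ψ ξ * fderiv ℝ (cn n) ξ e + cn n ξ * fderiv ℝ ψ ξ e)) atTop
      (𝓝 (∫ ξ, H1m.toFun v ξ * fderiv ℝ ψ ξ e)) := by
    refine tendsto_integral_of_dominated_convergence
      (fun ξ => ‖H1m.toFun v ξ * ψ ξ‖ * (M * ‖e‖) + ‖H1m.toFun v ξ * fderiv ℝ ψ ξ e‖) ?_ ?_ ?_ ?_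
    · intro n
      exact hv2.1.mul ((hψ.continuous.mul (continuous_fderiv_test (hcn n) e)).add
        ((hcn n).continuous.mul hde)).aestronglyMeasurable
    · exact ((hv2.integrable_mul h2).norm.mul_const _).add (hv2.integrable_mul h2').norm
    · refine fun n => Eventually.of_forall fun ξ => ?_
      have k1 : |fderiv ℝ (cn n) ξ e| ≤ M * ‖e‖ := (hcnd1 n ξ).trans
        (mul_le_of_le_one_left (by positivity) (hr1 n))
      rw [mul_add]
      refine (norm_add_le _ _).trans (add_le_add ?_ ?_)
      · rw [← mul_assoc, norm_mul (_ * _)]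
        gcongr
        exact k1
      · rw [mul_left_comm, norm_mul (cn n ξ)]
        exact mul_le_of_le_one_left (norm_nonneg _) (hcn1 n ξ)
    · refine Eventually.of_forall fun ξ => ?_
      have := (((hdl ξ).const_mul (ψ ξ)).add ((hcl ξ).mul_const (fderiv ℝ ψ ξ e))).const_mul
        (H1m.toFun v ξ)
      simpa using this
  have t2 : Tendsto (fun n => ∫ ξ, inner ℝ (H1m.grad v ξ) e * (ψ ξ * cn n ξ)) atTop
      (𝓝 (∫ ξ, inner ℝ (H1m.grad v ξ) e * ψ ξ)) := by
    refine tendsto_integral_of_dominated_convergence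
      (fun ξ => ‖inner ℝ (H1m.grad v ξ) e * ψ ξ‖) ?_ ?_ ?_ ?_
    · intro n
      exact hg2.1.mul (hψ.continuous.mul (hcn n).continuous).aestronglyMeasurable
    · exact (hg2.integrable_mul h2).norm
    · refine fun n => Eventually.of_forall fun ξ => ?_
      rw [← mul_assoc, norm_mul (_ * _)]
      exact mul_le_of_le_one_right (norm_nonneg _) (hcn1 n ξ)
    · refine Eventually.of_forall fun ξ => ?_
      have := ((hcl ξ).const_mul (ψ ξ)).const_mul (inner ℝ (H1m.grad v ξ) e)
      simpa using this
  refine tendsto_nhds_unique t1 ?_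
  simp only [hid]
  exact t2.neg

/-- This is the commutation ∇e^{τ𝓛}v = e^{τ/2} e^{τ𝓛}∇v. On H¹_m it replaces the singular gradient
bound τ^{-1/2} by an L² bound for the kernel itself, so the semigroup is bounded up to τ = 0. -/
theorem H1m.integral_smul_gradKernelL (v : H1m N m) {τ : ℝ} (hτ : 0 < τ) (ξ : Eu N) :
    ∫ y, H1m.toFun v y • gradKernelL N τ ξ y =
      Real.exp (τ / 2) • ∫ y, kernelL N τ ξ y • H1m.grad v y := by
  have hk := memLp_kernelL_right hτ ξ (q := 2) two_ne_zero
  have hgk := memLp_gradKernelL_right hτ ξ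
  have hv2 : MemLp (H1m.toFun v) 2 volume := memLp_volume v.1.fst
  have hg2 : MemLp (H1m.grad v) 2 volume := memLp_volume v.1.snd
  have i1 : Integrable fun y => H1m.toFun v y • gradKernelL N τ ξ y :=
    memLp_one_iff_integrable.mp (hgk.smul hv2)
  have i2 : Integrable fun y => kernelL N τ ξ y • H1m.grad v y :=
    memLp_one_iff_integrable.mp (hg2.smul hk)
  refine ext_inner_left ℝ fun e => ?_
  rw [inner_smul_right, ← integral_inner i1, ← integral_inner i2]
  have hfd : ∀ y, fderiv ℝ (fun y => kernelL N τ ξ y) y e =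
      -Real.exp (-(τ / 2)) * inner ℝ (gradKernelL N τ ξ y) e := fun y => by
    rw [(hasFDerivAt_kernelL_right hτ ξ y).fderiv]
    simp
  have key := H1m.integral_mul_fderiv v (contDiff_kernelL_right hτ ξ) hk e (by
    simp only [hfd]
    exact (hgk.inner_const e).const_mul _)
  simp only [hfd] at key
  have e1 : ∫ y, H1m.toFun v y * (-Real.exp (-(τ / 2)) * inner ℝ (gradKernelL N τ ξ y) e) =
      -Real.exp (-(τ / 2)) * ∫ y, inner ℝ e (H1m.toFun v y • gradKernelL N τ ξ y) := by
    rw [← integral_const_mul]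
    refine integral_congr_ae (Eventually.of_forall fun y => ?_)
    simp only [inner_smul_right, real_inner_comm]
    ring
  have e2 : ∫ y, inner ℝ (H1m.grad v y) e * kernelL N τ ξ y =
      ∫ y, inner ℝ e (kernelL N τ ξ y • H1m.grad v y) := by
    refine integral_congr_ae (Eventually.of_forall fun y => ?_)
    simp only [inner_smul_right, real_inner_comm]
    ring
  rw [e1, e2] at key
  have hee : Real.exp (τ / 2) * Real.exp (-(τ / 2)) = 1 := by rw [← Real.exp_add]; simp
  linear_combination (-Real.exp (τ / 2)) * key - (∫ y, inner ℝ e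
    (H1m.toFun v y • gradKernelL N τ ξ y)) * hee

end ViscousHJ

/-! ### The operators e^{τ𝓛} and their semigroup law -/

namespace ViscousHJ

open Filter Topology
open scoped ENNReal

variable {N : ℕ} {m : ℝ} {p : ℝ≥0∞} {b : ℝ} [Fact (1 ≤ p)]

theorem exists_smoothing (hm : 0 ≤ m) (hp : IsExponent p b) {τ : ℝ} (hτ : 0 < τ) {A B : ℝ≥0}
    (hA : KernelBound m (fun ξ y => ‖kernelClm N ℝ τ ξ y‖ₑ) p.toReal A)
    (hB : KernelBound m (fun ξ y => ‖gradKernelClm N τ ξ y‖ₑ) p.toReal B) :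
    ∃ U : Lp ℝ p (weightedMeasure N m) →L[ℝ] H1m N m,
      (∀ f, H1m.toFun (U f) =ᵐ[volume] fun ξ => ∫ y, kernelL N τ ξ y * f y) ∧
      (∀ f, H1m.grad (U f) =ᵐ[volume] fun ξ => ∫ y, f y • gradKernelL N τ ξ y) ∧
      ‖U‖ ≤ A + B := by
  obtain ⟨-, V, hV, hVA⟩ := hA.exists_operator hp.ne_top (continuous_kernelClm τ)
  obtain ⟨-, D, hD, hDB⟩ := hB.exists_operator hp.ne_top (continuous_gradKernelClm τ)
  simp only [kernelClm_apply, smul_eq_mul] at hV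
  simp only [gradKernelClm_apply] at hD
  have hmem : ∀ f, WithLp.toLp 2 (V f, D f) ∈ H1m N m := fun f =>
    (isWeakGradient_kernel hm hp hτ f).congr (hV f) (hD f)
  refine ⟨LinearMap.mkContinuous
    { toFun := fun f => ⟨WithLp.toLp 2 (V f, D f), hmem f⟩
      map_add' := fun f g => Subtype.ext (by simp [← WithLp.toLp_add])
      map_smul' := fun c f => Subtype.ext (by simp [← WithLp.toLp_smul]) } (A + B) fun f => ?_,
    hV, hD, LinearMap.mkContinuous_norm_le _ (by positivity) _⟩
  refine (H1m.norm_le _).trans ?_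
  rw [add_mul]
  exact add_le_add (V.le_of_opNorm_le hVA f) (D.le_of_opNorm_le hDB f)

open Classical in
/-- The operator `e^{τ𝓛}`, `τ > 0`, from `L^p_m` to `H¹_m`. -/
noncomputable def smoothing (N : ℕ) (m : ℝ) (p : ℝ≥0∞) [Fact (1 ≤ p)] (τ : ℝ) :
    Lp ℝ p (weightedMeasure N m) →L[ℝ] H1m N m :=
  if h : ∃ U : Lp ℝ p (weightedMeasure N m) →L[ℝ] H1m N m,
      ∀ f, H1m.toFun (U f) =ᵐ[volume] fun ξ => ∫ y, kernelL N τ ξ y * f y then h.choose else 0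

theorem toFun_smoothing (hm : 0 ≤ m) (hp : IsExponent p b) {τ : ℝ} (hτ : 0 < τ)
    (f : Lp ℝ p (weightedMeasure N m)) :
    H1m.toFun (smoothing N m p τ f) =ᵐ[volume] fun ξ => ∫ y, kernelL N τ ξ y * f y := by
  obtain ⟨C, -, hC⟩ := exists_operatorBounds (m := m) N ℝ hm hp τ
  obtain ⟨U, hU, -⟩ := exists_smoothing hm hp hτ (hC τ hτ le_rfl).1 (hC τ hτ le_rfl).2
  have h : ∃ U : Lp ℝ p (weightedMeasure N m) →L[ℝ] H1m N m,
      ∀ f, H1m.toFun (U f) =ᵐ[volume] fun ξ => ∫ y, kernelL N τ ξ y * f y := ⟨U, hU⟩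
  rw [smoothing, dif_pos h]
  exact h.choose_spec f

/-- An element of H¹_m is determined by its underlying function, so the operator fixed by a choice
coincides with any other having the same integral formula; norm bounds can be read from whichever
representative is convenient. -/
theorem eq_smoothing (hm : 0 ≤ m) (hp : IsExponent p b) {τ : ℝ} (hτ : 0 < τ)
    {U : Lp ℝ p (weightedMeasure N m) →L[ℝ] H1m N m}
    (hU : ∀ f, H1m.toFun (U f) =ᵐ[volume] fun ξ => ∫ y, kernelL N τ ξ y * f y) :
    smoothing N m p τ = U :=
  ContinuousLinearMap.ext fun f =>
    H1m.ext_toFun ((toFun_smoothing hm hp hτ f).trans (hU f).symm)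

theorem grad_smoothing (hm : 0 ≤ m) (hp : IsExponent p b) {τ : ℝ} (hτ : 0 < τ)
    (f : Lp ℝ p (weightedMeasure N m)) :
    H1m.grad (smoothing N m p τ f) =ᵐ[volume] fun ξ => ∫ y, f y • gradKernelL N τ ξ y := by
  obtain ⟨C, -, hC⟩ := exists_operatorBounds (m := m) N ℝ hm hp τ
  obtain ⟨U, hU, hU', -⟩ := exists_smoothing hm hp hτ (hC τ hτ le_rfl).1 (hC τ hτ le_rfl).2
  rw [eq_smoothing hm hp hτ hU]
  exact hU' f

theorem exists_norm_smoothing_le (N : ℕ) (hm : 0 ≤ m) (hp : IsExponent p b) (T : ℝ) :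
    ∃ C : ℝ, 0 ≤ C ∧ ∀ τ, 0 < τ → τ ≤ T →
      ‖smoothing N m p τ‖ ≤ C * τ ^ (-(1 / 2 + (N : ℝ) / 2 * b)) := by
  obtain ⟨C, hC0, hC⟩ := exists_operatorBounds (m := m) N ℝ hm hp T
  -- The L² component has the weaker singularity. Writing it as τ^{1/2} times the stronger power,
  -- with τ ≤ T, merges both components under one exponent.
  refine ⟨C * (T ^ (1 / 2 : ℝ) + 1) * 1, ?_, fun τ hτ hT => ?_⟩
  · rcases le_or_gt 0 T with h | h
    · positivity
    · have : 0 ≤ T ^ (1 / 2 : ℝ) := by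
        rw [← Real.sqrt_eq_rpow]
        exact Real.sqrt_nonneg _
      positivity
  · obtain ⟨U, hU, -, hUn⟩ := exists_smoothing hm hp hτ (hC τ hτ hT).1 (hC τ hτ hT).2
    rw [eq_smoothing hm hp hτ hU]
    refine hUn.trans ?_
    rw [Real.coe_toNNReal _ (by positivity), Real.coe_toNNReal _ (by positivity)]
    have e : τ ^ (-((N : ℝ) / 2 * b)) =
        τ ^ (1 / 2 : ℝ) * τ ^ (-(1 / 2 + (N : ℝ) / 2 * b)) := by
      rw [← Real.rpow_add hτ]
      congr 1
      ring
    have h1 : τ ^ (1 / 2 : ℝ) ≤ T ^ (1 / 2 : ℝ) := Real.rpow_le_rpow hτ.le hT (by norm_num)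
    rw [e]
    calc _ ≤ C * (T ^ (1 / 2 : ℝ) * τ ^ (-(1 / 2 + (N : ℝ) / 2 * b))) +
          C * τ ^ (-(1 / 2 + (N : ℝ) / 2 * b)) := by gcongr
      _ = _ := by ring

theorem exists_heatOp (N : ℕ) (E : Type*) [NormedAddCommGroup E] [NormedSpace ℝ E]
    (hm : 0 ≤ m) (T : ℝ) : ∃ C : ℝ, 0 ≤ C ∧ ∀ τ, 0 < τ → τ ≤ T →
      ∃ P : Lp E 2 (weightedMeasure N m) →L[ℝ] Lp E 2 (weightedMeasure N m),
        (∀ f, P f =ᵐ[volume] fun ξ => ∫ y, kernelL N τ ξ y • f y) ∧ ‖P‖ ≤ C := by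
  obtain ⟨C, hC0, hC⟩ := exists_operatorBounds (m := m) N E hm isExponent_two T
  refine ⟨C, hC0, fun τ hτ hT => ?_⟩
  obtain ⟨-, P, hP, hPA⟩ :=
    (hC τ hτ hT).1.exists_operator isExponent_two.ne_top (continuous_kernelClm τ)
  refine ⟨P, hP, hPA.trans ?_⟩
  simp [hC0]

open Classical in
/-- The operator `e^{τ𝓛}`, `τ > 0`, on `E`-valued `L²_m` functions. -/
noncomputable def heatOp (N : ℕ) (m : ℝ) (E : Type*) [NormedAddCommGroup E] [NormedSpace ℝ E]
    (τ : ℝ) : Lp E 2 (weightedMeasure N m) →L[ℝ] Lp E 2 (weightedMeasure N m) :=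
  if h : ∃ P : Lp E 2 (weightedMeasure N m) →L[ℝ] Lp E 2 (weightedMeasure N m),
      ∀ f, P f =ᵐ[volume] fun ξ => ∫ y, kernelL N τ ξ y • f y then h.choose else 0

section HeatOp

variable {E : Type*} [NormedAddCommGroup E] [NormedSpace ℝ E]

theorem coeFn_heatOp (hm : 0 ≤ m) {τ : ℝ} (hτ : 0 < τ) (f : Lp E 2 (weightedMeasure N m)) :
    heatOp N m E τ f =ᵐ[volume] fun ξ => ∫ y, kernelL N τ ξ y • f y := by
  obtain ⟨C, -, hC⟩ := exists_heatOp (m := m) N E hm τ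
  obtain ⟨P, hP, -⟩ := hC τ hτ le_rfl
  have h : ∃ P : Lp E 2 (weightedMeasure N m) →L[ℝ] Lp E 2 (weightedMeasure N m),
      ∀ f, P f =ᵐ[volume] fun ξ => ∫ y, kernelL N τ ξ y • f y := ⟨P, hP⟩
  rw [heatOp, dif_pos h]
  exact h.choose_spec f

theorem eq_heatOp (hm : 0 ≤ m) {τ : ℝ} (hτ : 0 < τ)
    {P : Lp E 2 (weightedMeasure N m) →L[ℝ] Lp E 2 (weightedMeasure N m)}
    (hP : ∀ f, P f =ᵐ[volume] fun ξ => ∫ y, kernelL N τ ξ y • f y) : heatOp N m E τ = P :=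
  ContinuousLinearMap.ext fun f =>
    Lp.ext (ae_weighted_iff.mpr ((coeFn_heatOp hm hτ f).trans (hP f).symm))

theorem exists_norm_heatOp_le (N : ℕ) (E : Type*) [NormedAddCommGroup E] [NormedSpace ℝ E]
    (hm : 0 ≤ m) (T : ℝ) : ∃ C : ℝ, 0 ≤ C ∧ ∀ τ, 0 < τ → τ ≤ T → ‖heatOp N m E τ‖ ≤ C := by
  obtain ⟨C, hC0, hC⟩ := exists_heatOp (m := m) N E hm T
  refine ⟨C, hC0, fun τ hτ hT => ?_⟩
  obtain ⟨P, hP, hPC⟩ := hC τ hτ hT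
  rwa [eq_heatOp hm hτ hP]

end HeatOp

/-- The semigroup `e^{τ𝓛}`, `τ ≥ 0`, on `H¹_m`. -/
noncomputable def linearFlow (N : ℕ) (m : ℝ) (τ : ℝ) : H1m N m →L[ℝ] H1m N m :=
  if 0 < τ then (smoothing N m 2 τ).comp (fstL N m) else ContinuousLinearMap.id ℝ (H1m N m)

theorem linearFlow_zero : linearFlow N m 0 = ContinuousLinearMap.id ℝ (H1m N m) :=
  if_neg (lt_irrefl 0)

theorem linearFlow_of_pos {τ : ℝ} (hτ : 0 < τ) (v : H1m N m) :
    linearFlow N m τ v = smoothing N m 2 τ v.1.fst := by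
  rw [linearFlow, if_pos hτ]
  rfl

theorem toFun_linearFlow (hm : 0 ≤ m) {τ : ℝ} (hτ : 0 ≤ τ) (v : H1m N m) :
    H1m.toFun (linearFlow N m τ v) =ᵐ[volume] semigroupL N τ (H1m.toFun v) := by
  rcases hτ.eq_or_lt with rfl | hτ
  · rw [linearFlow_zero]
    exact Eventually.of_forall fun ξ => by simp [semigroupL]
  · rw [linearFlow_of_pos hτ]
    filter_upwards [toFun_smoothing hm isExponent_two hτ v.1.fst] with ξ hξ
    rw [hξ, semigroupL, if_pos hτ]
    rfl

theorem fst_linearFlow (hm : 0 ≤ m) {τ : ℝ} (hτ : 0 < τ) (v : H1m N m) :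
    (linearFlow N m τ v).1.fst = heatOp N m ℝ τ v.1.fst := by
  refine Lp.ext (ae_weighted_iff.mpr ?_)
  rw [linearFlow_of_pos hτ]
  exact (toFun_smoothing hm isExponent_two hτ v.1.fst).trans (coeFn_heatOp hm hτ v.1.fst).symm

theorem snd_linearFlow (hm : 0 ≤ m) {τ : ℝ} (hτ : 0 < τ) (v : H1m N m) :
    (linearFlow N m τ v).1.snd = Real.exp (τ / 2) • heatOp N m (Eu N) τ v.1.snd := by
  refine Lp.ext (ae_weighted_iff.mpr ?_)
  rw [linearFlow_of_pos hτ]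
  filter_upwards [grad_smoothing hm isExponent_two hτ v.1.fst, coeFn_heatOp hm hτ v.1.snd,
    ae_volume (Lp.coeFn_smul (Real.exp (τ / 2)) (heatOp N m (Eu N) τ v.1.snd))] with ξ h1 h2 h3
  rw [h3, Pi.smul_apply, h2]
  exact h1.trans (H1m.integral_smul_gradKernelL v hτ ξ)

/-- Both components are governed by the L²_m bound of the kernel, which has no singularity at b = 0;
the gradient component only picks up e^{τ/2} from the commutation identity. -/
theorem exists_norm_linearFlow_le (N : ℕ) (hm : 0 ≤ m) (T : ℝ) :
    ∃ C : ℝ, 0 ≤ C ∧ ∀ τ, 0 ≤ τ → τ ≤ T → ‖linearFlow N m τ‖ ≤ C := by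
  obtain ⟨C₁, h10, h1⟩ := exists_norm_heatOp_le (m := m) N ℝ hm T
  obtain ⟨C₂, h20, h2⟩ := exists_norm_heatOp_le (m := m) N (Eu N) hm T
  refine ⟨1 + (C₁ + Real.exp (T / 2) * C₂), by positivity, fun τ hτ hT => ?_⟩
  rcases hτ.eq_or_lt with rfl | hτ
  · rw [linearFlow_zero]
    refine ContinuousLinearMap.norm_id_le.trans ?_
    linarith [(by positivity : 0 ≤ C₁ + Real.exp (T / 2) * C₂)]
  · refine ContinuousLinearMap.opNorm_le_bound _ (by positivity) fun v => ?_
    refine (H1m.norm_le _).trans ?_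
    rw [fst_linearFlow hm hτ, snd_linearFlow hm hτ, norm_smul,
      Real.norm_of_nonneg (Real.exp_pos _).le]
    have k1 := ((heatOp N m ℝ τ).le_of_opNorm_le (h1 τ hτ hT) v.1.fst).trans
      (mul_le_mul_of_nonneg_left (H1m.norm_fst_le v) h10)
    have k2 := ((heatOp N m (Eu N) τ).le_of_opNorm_le (h2 τ hτ hT) v.1.snd).trans
      (mul_le_mul_of_nonneg_left (H1m.norm_snd_le v) h20)
    have k3 : Real.exp (τ / 2) ≤ Real.exp (T / 2) := Real.exp_le_exp.mpr (by linarith)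
    calc _ ≤ C₁ * ‖v‖ + Real.exp (T / 2) * (C₂ * ‖v‖) :=
          add_le_add k1 (mul_le_mul k3 k2 (norm_nonneg _) (Real.exp_pos _).le)
      _ ≤ _ := by nlinarith [norm_nonneg v]

/-- The pointwise formula for the kernel at time s is tested against the operator at time t; Fubini
followed by the Chapman–Kolmogorov identity identifies the composition. -/
theorem smoothing_add (hm : 0 ≤ m) (hp : IsExponent p b) {s t : ℝ} (hs : 0 < s) (ht : 0 < t) :
    smoothing N m p (s + t) = (linearFlow N m s).comp (smoothing N m p t) := by
  refine eq_smoothing hm hp (add_pos hs ht) fun f => ?_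
  obtain ⟨C, -, hC⟩ := exists_operatorBounds (m := m) N ℝ hm hp t
  have hK := (hC t ht le_rfl).1
  filter_upwards [toFun_linearFlow hm hs.le (smoothing N m p t f)] with ξ hξ
  rw [ContinuousLinearMap.comp_apply, hξ, semigroupL, if_pos hs]
  have e1 : ∫ y, kernelL N s ξ y * H1m.toFun (smoothing N m p t f) y =
      ∫ y, kernelL N s ξ y * ∫ z, kernelL N t y z * f z := by
    refine integral_congr_ae ?_
    filter_upwards [toFun_smoothing hm hp ht f] with y hy
    rw [hy]
  have e2 := hK.integral_swap hp.ne_top (continuous_kernelClm t) f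
    (isDual_of_memLp (memLp_kernelL_right hs ξ two_ne_zero))
  simp only [kernelClm_apply, smul_eq_mul] at e2
  rw [e1, e2]
  refine integral_congr_ae (Eventually.of_forall fun z => ?_)
  simp only
  rw [← integral_kernelL_mul_kernelL hs ht, ← integral_mul_const]
  simp only [mul_assoc]

theorem linearFlow_comp_smoothing (hm : 0 ≤ m) (hp : IsExponent p b) (s t : ℝ) (hs : 0 ≤ s)
    (ht : 0 < t) : smoothing N m p (s + t) = (linearFlow N m s).comp (smoothing N m p t) := by
  rcases hs.eq_or_lt with rfl | hs
  · rw [linearFlow_zero, zero_add, ContinuousLinearMap.id_comp]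
  · exact smoothing_add hm hp hs ht

theorem linearFlow_add (hm : 0 ≤ m) (s t : ℝ) (hs : 0 ≤ s) (ht : 0 ≤ t) :
    linearFlow N m (s + t) = (linearFlow N m s).comp (linearFlow N m t) := by
  rcases ht.eq_or_lt with rfl | ht
  · rw [linearFlow_zero, add_zero, ContinuousLinearMap.comp_id]
  · ext1 v
    rw [linearFlow_of_pos (by linarith), linearFlow_comp_smoothing hm isExponent_two s t hs ht,
      ContinuousLinearMap.comp_apply, ContinuousLinearMap.comp_apply, linearFlow_of_pos ht]

end ViscousHJ

/-! ### Invariance of the Gaussian and strong continuity -/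

namespace ViscousHJ

open Filter Topology
open scoped ENNReal

variable {N : ℕ} {m : ℝ}

theorem heatKernel_one (x : Eu N) : heatKernel N 1 x = gaussian N x := by
  simp [heatKernel]

theorem gaussian_pos (x : Eu N) : 0 < gaussian N x := by
  rw [← heatKernel_one]
  exact heatKernel_pos one_pos x

/-- Change of variables in the integral defining `e^{τ𝓛}`. -/
theorem integral_kernelL_smul {E : Type*} [NormedAddCommGroup E] [NormedSpace ℝ E] {τ : ℝ}
    (hτ : 0 < τ) (ξ : Eu N) (f : Eu N → E) :
    ∫ y, kernelL N τ ξ y • f y = Real.exp (τ / 2) ^ N • ∫ z, gaussian N z •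
      f (Real.exp (τ / 2) • (ξ - √(1 - Real.exp (-τ)) • z)) := by
  have ha := one_sub_exp_neg_pos hτ
  set a := 1 - Real.exp (-τ) with hadef
  set s := Real.exp (τ / 2) with hs
  have hs0 : 0 < s := Real.exp_pos _
  have hsi : Real.exp (-(τ / 2)) = s⁻¹ := Real.exp_neg _
  have hra : 0 < √a := Real.sqrt_pos.mpr ha
  simp_rw [kernelL_eq hτ, ← hadef, hsi]
  have h1 := Measure.integral_comp_smul_of_nonneg volume
    (fun x : Eu N => heatKernel N a (ξ - x) • f (s • x)) s⁻¹ (hR := by positivity)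
  simp only [smul_inv_smul₀ hs0.ne'] at h1
  rw [h1, ← integral_sub_left_eq_self (fun x => heatKernel N a (ξ - x) • f (s • x)) volume ξ]
  simp only [sub_sub_cancel]
  have h2 := Measure.integral_comp_smul_of_nonneg volume
    (fun x : Eu N => heatKernel N a x • f (s • (ξ - x))) (√a) (hR := hra.le)
  have h3 : ∀ z : Eu N, heatKernel N a (√a • z) = (√a ^ N)⁻¹ * gaussian N z := fun z => by
    rw [heatKernel_smul ha hra, Real.sq_sqrt ha.le, div_self ha.ne', heatKernel_one]
  simp only [h3, mul_smul, integral_smul] at h2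
  rw [finrank_euclideanSpace, Fintype.card_fin] at h2 ⊢
  rw [smul_right_injective E (by positivity : (√a ^ N)⁻¹ ≠ 0) h2, inv_pow, inv_inv]

/-- The Gaussian is invariant under the semigroup. -/
theorem integral_kernelL_mul_gaussian {τ : ℝ} (hτ : 0 < τ) (ξ : Eu N) :
    ∫ y, kernelL N τ ξ y * gaussian N y = gaussian N ξ := by
  have ha := one_sub_exp_neg_pos hτ
  set a := 1 - Real.exp (-τ) with hadef
  set s := Real.exp (-(τ / 2)) with hs
  have hs0 : 0 < s := Real.exp_pos _
  have hs2 : s ^ 2 = Real.exp (-τ) := by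
    rw [hs, sq, ← Real.exp_add]
    congr 1
    ring
  simp_rw [kernelL_eq hτ, ← hadef]
  have h1 := Measure.integral_comp_smul_of_nonneg volume
    (fun x : Eu N => heatKernel N a (ξ - x) * gaussian N (s⁻¹ • x)) s (hR := hs0.le)
  simp only [inv_smul_smul₀ hs0.ne'] at h1
  rw [h1]
  have h2 : ∀ x : Eu N, gaussian N (s⁻¹ • x) = s ^ N * heatKernel N (s ^ 2) x := fun x => by
    rw [← heatKernel_one, heatKernel_smul one_pos (by positivity)]
    simp
  simp only [h2]
  have h3 : ∀ x : Eu N, heatKernel N a (ξ - x) * (s ^ N * heatKernel N (s ^ 2) x) =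
      s ^ N * (heatKernel N a (ξ - x) * heatKernel N (s ^ 2) x) := fun x => by ring
  simp only [h3]
  rw [integral_const_mul, integral_heatKernel_conv ha (by positivity), finrank_euclideanSpace,
    Fintype.card_fin, smul_eq_mul, ← mul_assoc, inv_mul_cancel₀ (by positivity), one_mul,
    hs2, hadef, sub_add_cancel, heatKernel_one]

theorem isLocallyFiniteMeasure_weighted (hm : 0 ≤ m) :
    IsLocallyFiniteMeasure (weightedMeasure N m) := by
  refine IsLocallyFiniteMeasure.withDensity_ofReal ?_
  exact continuous_const.add (continuous_norm.rpow_const fun _ => Or.inr (by positivity))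

section StrongContinuity

variable {E : Type*} [NormedAddCommGroup E] [NormedSpace ℝ E]

/-- A Gaussian majorant is preserved by the semigroup, whose kernel is positive and fixes G. This
gives, for a dense class, a square integrable majorant independent of τ. -/
theorem exists_norm_le_gaussian {f : Eu N → E} (hf : Continuous f) (hc : HasCompactSupport f) :
    ∃ M : ℝ, 0 ≤ M ∧ ∀ y, ‖f y‖ ≤ M * gaussian N y := by
  have h1 : Continuous fun y => (gaussian N y)⁻¹ • f y :=
    ((continuous_gaussian N).inv₀ fun y => (gaussian_pos y).ne').smul hf
  obtain ⟨M, hM⟩ := h1.bounded_above_of_compact_support hc.smul_left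
  refine ⟨M, (norm_nonneg _).trans (hM 0), fun y => ?_⟩
  have := hM y
  rw [norm_smul, norm_inv, Real.norm_of_nonneg (gaussian_pos y).le,
    inv_mul_le_iff₀ (gaussian_pos y)] at this
  linarith

theorem integrable_kernelL_mul_gaussian {τ : ℝ} (hτ : 0 < τ) (ξ : Eu N) :
    Integrable fun y => kernelL N τ ξ y * gaussian N y := by
  refine Integrable.of_integral_ne_zero ?_
  rw [integral_kernelL_mul_gaussian hτ]
  exact (gaussian_pos ξ).ne'

theorem norm_integral_kernelL_le {f : Eu N → E} {M : ℝ} (hM : ∀ y, ‖f y‖ ≤ M * gaussian N y)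
    {τ : ℝ} (hτ : 0 < τ) (ξ : Eu N) : ‖∫ y, kernelL N τ ξ y • f y‖ ≤ M * gaussian N ξ := by
  rw [← integral_kernelL_mul_gaussian hτ, ← integral_const_mul]
  refine norm_integral_le_of_norm_le ((integrable_kernelL_mul_gaussian hτ ξ).const_mul M)
    (Eventually.of_forall fun y => ?_)
  have hk := kernelL_pos hτ ξ y
  rw [norm_smul, Real.norm_of_nonneg hk.le]
  nlinarith [hM y]

/-- After the change of variables the Gaussian no longer depends on τ, and the argument of `f` tends
to ξ; dominated convergence applies because `f` is bounded. -/
theorem tendsto_integral_kernelL [CompleteSpace E] {f : Eu N → E} (hf : Continuous f) {M : ℝ}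
    (hM : ∀ y, ‖f y‖ ≤ M * gaussian N y) (ξ : Eu N) :
    Tendsto (fun τ => ∫ y, kernelL N τ ξ y • f y) (𝓝[>] 0) (𝓝 (f ξ)) := by
  have hG1 : ∫ z, gaussian N z = 1 := by
    simp_rw [← heatKernel_one]
    exact integral_heatKernel one_pos
  have hGi : Integrable (gaussian N) := by
    simp_rw [← funext (heatKernel_one (N := N))]
    exact integrable_heatKernel one_pos
  have hGb : ∀ y : Eu N, gaussian N y ≤ gaussian N 0 := fun y => by
    simp only [gaussian]
    gcongr
    simp
  have hM0 : 0 ≤ M := by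
    by_contra h
    have := (norm_nonneg _).trans (hM 0)
    nlinarith [gaussian_pos (N := N) 0]
  have hfb : ∀ y, ‖f y‖ ≤ M * gaussian N 0 := fun y => (hM y).trans (by gcongr; exact hGb y)
  have key : Tendsto (fun τ : ℝ => Real.exp (τ / 2) ^ N • ∫ z, gaussian N z •
      f (Real.exp (τ / 2) • (ξ - √(1 - Real.exp (-τ)) • z))) (𝓝[>] 0)
      (𝓝 (Real.exp (0 / 2) ^ N • ∫ z, gaussian N z • f ξ)) := by
    refine Tendsto.smul ?_ ?_
    · exact ((by fun_prop : Continuous fun τ : ℝ => Real.exp (τ / 2) ^ N).tendsto 0).mono_left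
        nhdsWithin_le_nhds
    · refine tendsto_integral_filter_of_dominated_convergence
        (fun z => gaussian N z * (M * gaussian N 0)) ?_ ?_ (hGi.mul_const _) ?_
      · refine Eventually.of_forall fun τ => ?_
        have := continuous_gaussian N
        exact (by fun_prop : Continuous fun z : Eu N => gaussian N z •
          f (Real.exp (τ / 2) • (ξ - √(1 - Real.exp (-τ)) • z))).aestronglyMeasurable
      · refine Eventually.of_forall fun τ => Eventually.of_forall fun z => ?_
        rw [norm_smul, Real.norm_of_nonneg (gaussian_pos z).le]
        exact mul_le_mul_of_nonneg_left (hfb _) (gaussian_pos z).le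
      · refine Eventually.of_forall fun z => ?_
        have hc : Continuous fun τ : ℝ => gaussian N z •
            f (Real.exp (τ / 2) • (ξ - √(1 - Real.exp (-τ)) • z)) := by fun_prop
        have := (hc.tendsto 0).mono_left (nhdsWithin_le_nhds (s := Ioi 0))
        simpa using this
  rw [integral_smul_const, hG1] at key
  simp only [zero_div, Real.exp_zero, one_pow, one_smul] at key
  refine key.congr' ?_
  filter_upwards [self_mem_nhdsWithin] with τ hτ
  exact (integral_kernelL_smul hτ ξ f).symm

theorem tendsto_heatOp_of_continuous [CompleteSpace E] (hm : 0 ≤ m) {f : Eu N → E}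
    (hf : Continuous f) (hc : HasCompactSupport f) (hf2 : MemLp f 2 (weightedMeasure N m)) :
    Tendsto (fun τ => heatOp N m E τ hf2.toLp) (𝓝[>] 0) (𝓝 hf2.toLp) := by
  obtain ⟨M, hM0, hM⟩ := exists_norm_le_gaussian hf hc
  rw [Lp.tendsto_Lp_iff_tendsto_eLpNorm]
  have hcoe : ∀ τ : ℝ, 0 < τ → heatOp N m E τ hf2.toLp =ᵐ[weightedMeasure N m]
      fun ξ => ∫ y, kernelL N τ ξ y • f y := by
    intro τ hτ
    refine ae_weighted_iff.mpr ?_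
    filter_upwards [coeFn_heatOp hm hτ hf2.toLp] with ξ hξ
    rw [hξ]
    refine integral_congr_ae ?_
    filter_upwards [ae_volume hf2.coeFn_toLp] with y hy
    rw [hy]
  have hpos : ∀ᶠ τ : ℝ in 𝓝[>] 0, 0 < τ := self_mem_nhdsWithin
  have h1 : Tendsto (fun τ => ∫⁻ ξ, ‖(∫ y, kernelL N τ ξ y • f y) - f ξ‖ₑ ^ (2 : ℝ)
      ∂(weightedMeasure N m)) (𝓝[>] 0) (𝓝 (∫⁻ _, 0 ∂(weightedMeasure N m))) := by
    refine tendsto_lintegral_filter_of_dominated_convergence'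
      (fun ξ => ‖2 * M * gaussian N ξ‖ₑ ^ (2 : ℝ)) ?_ ?_ ?_ ?_
    · filter_upwards [hpos] with τ hτ
      exact (((Lp.aestronglyMeasurable _).congr (hcoe τ hτ)).sub hf2.1).enorm.pow_const _
    · filter_upwards [hpos] with τ hτ
      refine Eventually.of_forall fun ξ => ?_
      have hb : ‖(∫ y, kernelL N τ ξ y • f y) - f ξ‖ₑ ≤ ‖2 * M * gaussian N ξ‖ₑ := by
        refine enorm_le_iff_norm_le.mpr ?_
        have h0 := gaussian_pos ξ
        rw [Real.norm_of_nonneg (by positivity)]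
        refine (norm_sub_le _ _).trans ?_
        linarith [norm_integral_kernelL_le hM hτ ξ, hM ξ]
      gcongr
    · have := (memLp_gaussian N hm).const_mul (2 * M)
      have := (eLpNorm_lt_top_iff_lintegral_rpow_enorm_lt_top (by norm_num) (by norm_num)).mp this.2
      simpa using this.ne
    · refine Eventually.of_forall fun ξ => ?_
      have h2 := ((tendsto_integral_kernelL hf hM ξ).sub_const (f ξ)).enorm.ennrpow_const 2
      simpa using h2
  have h3 := h1.ennrpow_const (1 / 2 : ℝ)
  simp only [lintegral_zero] at h3
  rw [ENNReal.zero_rpow_of_pos (by norm_num)] at h3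
  refine h3.congr' ?_
  filter_upwards [hpos] with τ hτ
  rw [eLpNorm_eq_lintegral_rpow_enorm_toReal (by norm_num) (by norm_num)]
  simp only [ENNReal.toReal_ofNat]
  congr 1
  refine lintegral_congr_ae ?_
  filter_upwards [hcoe τ hτ] with ξ hξ
  rw [Pi.sub_apply, hξ]

/-- Density of continuous functions with compact support, combined with the uniform norm bound on
(0, 1]. The tolerance δ = ε/(2(C + 2)) covers three error terms of sizes Cδ, δ and δ. -/
theorem tendsto_heatOp [CompleteSpace E] (hm : 0 ≤ m) (f : Lp E 2 (weightedMeasure N m)) :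
    Tendsto (fun τ => heatOp N m E τ f) (𝓝[>] 0) (𝓝 f) := by
  have := isLocallyFiniteMeasure_weighted (N := N) hm
  obtain ⟨C, hC0, hC⟩ := exists_norm_heatOp_le (m := m) N E hm 1
  rw [Metric.tendsto_nhds]
  intro ε hε
  set δ := ε / (2 * (C + 2)) with hδ
  have hδ0 : 0 < δ := by positivity
  obtain ⟨g, hgc, hgn, hg, hg2⟩ := (Lp.memLp f).exists_hasCompactSupport_eLpNorm_sub_le
    (by norm_num) (ENNReal.ofReal_pos.mpr hδ0).ne'
  have hfg : ‖f - hg2.toLp‖ ≤ δ := by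
    have e : f - hg2.toLp = ((Lp.memLp f).sub hg2).toLp := by
      rw [MemLp.toLp_sub (Lp.memLp f) hg2, Lp.toLp_coeFn]
    rw [e, Lp.norm_toLp]
    exact ENNReal.toReal_le_of_le_ofReal hδ0.le hgn
  have h1 := (Metric.tendsto_nhds.mp (tendsto_heatOp_of_continuous hm hg hgc hg2)) δ hδ0
  have h2 : ∀ᶠ τ : ℝ in 𝓝[>] 0, τ ∈ Ioc 0 1 := Ioc_mem_nhdsGT one_pos
  filter_upwards [h1, h2] with τ k1 k2
  rw [dist_eq_norm] at k1 ⊢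
  have e : heatOp N m E τ f - f = heatOp N m E τ (f - hg2.toLp) +
      (heatOp N m E τ hg2.toLp - hg2.toLp) - (f - hg2.toLp) := by
    rw [map_sub]
    abel
  have k3 := (heatOp N m E τ).le_of_opNorm_le (hC τ k2.1 k2.2) (f - hg2.toLp)
  have k4 : C * ‖f - hg2.toLp‖ ≤ C * δ := by gcongr
  rw [e]
  refine (norm_sub_le _ _).trans_lt ?_
  have k5 := norm_add_le (heatOp N m E τ (f - hg2.toLp)) (heatOp N m E τ hg2.toLp - hg2.toLp)
  have k6 : (C + 2) * δ = ε / 2 := by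
    rw [hδ]
    field_simp
  nlinarith

end StrongContinuity

theorem tendsto_linearFlow (hm : 0 ≤ m) (v : H1m N m) :
    Tendsto (fun τ => linearFlow N m τ v) (𝓝[>] 0) (𝓝 v) := by
  rw [tendsto_iff_norm_sub_tendsto_zero]
  have h1 := tendsto_iff_norm_sub_tendsto_zero.mp (tendsto_heatOp hm v.1.fst)
  have h2 : Tendsto (fun τ : ℝ => Real.exp (τ / 2) • heatOp N m (Eu N) τ v.1.snd) (𝓝[>] 0)
      (𝓝 v.1.snd) := by
    have k : Tendsto (fun τ : ℝ => Real.exp (τ / 2)) (𝓝[>] 0) (𝓝 1) := by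
      have := (by fun_prop : Continuous fun τ : ℝ => Real.exp (τ / 2)).tendsto 0
      simpa using this.mono_left (nhdsWithin_le_nhds (s := Ioi 0))
    simpa using k.smul (tendsto_heatOp hm v.1.snd)
  have h3 := h1.add (tendsto_iff_norm_sub_tendsto_zero.mp h2)
  rw [add_zero] at h3
  refine squeeze_zero' (Eventually.of_forall fun _ => norm_nonneg _) ?_ h3
  filter_upwards [self_mem_nhdsWithin] with τ hτ
  refine (H1m.norm_le _).trans (le_of_eq ?_)
  rw [← fst_linearFlow hm hτ, ← snd_linearFlow hm hτ]
  rfl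

/-- Continuity from both sides follows from right continuity at zero: for s ≤ r the difference at r
and s is the flow at s applied to the flow at r - s minus the identity, and the norms are locally
bounded. -/
theorem continuousOn_linearFlow (hm : 0 ≤ m) (v : H1m N m) :
    ContinuousOn (fun τ => linearFlow N m τ v) (Ici 0) := by
  have h0 : Tendsto (fun h => ‖linearFlow N m h v - v‖) (𝓝[≥] 0) (𝓝 0) := by
    have h1 := tendsto_iff_norm_sub_tendsto_zero.mp (tendsto_linearFlow hm v)
    rw [← Ioi_insert, nhdsWithin_insert]
    refine Tendsto.sup ?_ h1
    refine (tendsto_pure_nhds _ _).trans_eq ?_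
    simp [linearFlow_zero]
  intro t ht
  have ht0 : 0 ≤ t := ht
  obtain ⟨C, hC0, hC⟩ := exists_norm_linearFlow_le (m := m) N hm (t + 1)
  have key : ∀ s r : ℝ, 0 ≤ s → s ≤ r → s ≤ t + 1 →
      ‖linearFlow N m r v - linearFlow N m s v‖ ≤ C * ‖linearFlow N m (r - s) v - v‖ := by
    intro s r hs hsr hst
    have e : linearFlow N m r v - linearFlow N m s v =
        linearFlow N m s (linearFlow N m (r - s) v - v) := by
      have := linearFlow_add (N := N) hm s (r - s) hs (by linarith)
      rw [add_sub_cancel] at this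
      rw [map_sub, this]
      rfl
    rw [e]
    exact (linearFlow N m s).le_of_opNorm_le (hC s hs hst) _
  have habs : Tendsto (fun s : ℝ => |s - t|) (𝓝 t) (𝓝[≥] 0) := by
    refine tendsto_nhdsWithin_iff.mpr ⟨?_, Eventually.of_forall fun s => mem_Ici.mpr (abs_nonneg _)⟩
    have := ((by fun_prop : Continuous fun s : ℝ => |s - t|).tendsto t)
    simpa using this
  have hlim := ((h0.comp habs).const_mul C).mono_left (nhdsWithin_le_nhds (s := Ici 0))
  rw [mul_zero] at hlim
  refine tendsto_iff_norm_sub_tendsto_zero.mpr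
    (squeeze_zero' (Eventually.of_forall fun _ => norm_nonneg _) ?_ hlim)
  have hlt : ∀ᶠ s in 𝓝[Ici 0] t, s < t + 1 :=
    nhdsWithin_le_nhds (Iio_mem_nhds (by linarith))
  filter_upwards [self_mem_nhdsWithin, hlt] with s hs hst
  rcases le_total s t with h | h
  · rw [norm_sub_rev]
    simpa [abs_of_nonpos (sub_nonpos.mpr h)] using key s t hs h hst.le
  · simpa [abs_of_nonneg (sub_nonneg.mpr h)] using key t s ht0 h (by linarith)

end ViscousHJ

/-! ### The dual weight and the conserved mass -/

namespace ViscousHJ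

open Filter Topology
open scoped ENNReal

variable {N : ℕ} {m : ℝ}

/-- The integrand decays like |ξ|^{2s - 2m}, integrable at infinity because 2m - 2s > N. The case s
= 0 makes the mass continuous; positive s supplies the moment that produces decay. -/
theorem isDual_norm_rpow {s : ℝ} (hs : 0 ≤ s) (hm : s + (N : ℝ) / 2 < m) :
    IsDual m (fun y : Eu N => ‖y‖ ^ s) := by
  have hN : (0 : ℝ) ≤ N := by positivity
  have hm0 : 0 ≤ m := by linarith
  have hc : Continuous fun y : Eu N => ‖y‖ ^ s :=
    continuous_norm.rpow_const fun _ => Or.inr hs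
  refine ⟨hc.aestronglyMeasurable, ?_⟩
  have h1 : Integrable fun ξ : Eu N => 2 ^ (2 * m) * (1 + ‖ξ‖) ^ (-(2 * m - 2 * s)) :=
    (integrable_one_add_norm (by simp; linarith)).const_mul _
  refine ne_top_of_le_ne_top h1.2.ne (lintegral_mono fun ξ => ?_)
  have hw := weight_pos m ξ
  have hn := norm_nonneg ξ
  have h0 : 0 ≤ ‖ξ‖ ^ s := by positivity
  rw [← ENNReal.ofReal_inv_of_pos hw, Real.enorm_eq_ofReal h0, Real.enorm_eq_ofReal (by positivity),
    ← ENNReal.ofReal_pow h0, ← ENNReal.ofReal_mul (by positivity)]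
  refine ENNReal.ofReal_le_ofReal ?_
  have h2 : (1 + ‖ξ‖) ^ (2 * m) ≤ 2 ^ (2 * m) * weight m ξ := by
    have k : 1 + ‖ξ‖ ≤ 2 * max 1 ‖ξ‖ := by
      linarith [le_max_left 1 ‖ξ‖, le_max_right 1 ‖ξ‖]
    calc (1 + ‖ξ‖) ^ (2 * m) ≤ (2 * max 1 ‖ξ‖) ^ (2 * m) :=
          Real.rpow_le_rpow (by positivity) k (by positivity)
      _ = 2 ^ (2 * m) * (max 1 ‖ξ‖) ^ (2 * m) := Real.mul_rpow (by norm_num) (by positivity)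
      _ ≤ 2 ^ (2 * m) * weight m ξ := by
          gcongr
          rcases le_total 1 ‖ξ‖ with h | h
          · rw [max_eq_right h, weight]
            linarith
          · rw [max_eq_left h, Real.one_rpow]
            exact one_le_weight m ξ
  have h3 : (‖ξ‖ ^ s) ^ 2 ≤ (1 + ‖ξ‖) ^ (2 * s) := by
    rw [← Real.rpow_natCast, ← Real.rpow_mul hn, mul_comm s]
    exact Real.rpow_le_rpow hn (by linarith) (by positivity)
  have h4 : (1 + ‖ξ‖) ^ (-(2 * m - 2 * s)) = (1 + ‖ξ‖) ^ (2 * s) / (1 + ‖ξ‖) ^ (2 * m) := by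
    rw [← Real.rpow_sub (by positivity)]
    congr 1
    ring
  beta_reduce
  rw [h4, inv_mul_le_iff₀ hw, ← mul_div_assoc, ← mul_div_assoc, le_div_iff₀ (by positivity)]
  calc (‖ξ‖ ^ s) ^ 2 * (1 + ‖ξ‖) ^ (2 * m) ≤
        (1 + ‖ξ‖) ^ (2 * s) * (2 ^ (2 * m) * weight m ξ) := by gcongr
    _ = _ := by ring

theorem isDual_one (hm : (N : ℝ) / 2 < m) : IsDual m (fun _ : Eu N => (1 : ℝ)) := by
  simpa using isDual_norm_rpow (N := N) (le_refl (0 : ℝ)) (by simpa using hm)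

section Mass

theorem exists_mass (hm : (N : ℝ) / 2 < m) :
    ∃ L : H1m N m →L[ℝ] ℝ, ∀ v, L v = ∫ ξ, H1m.toFun v ξ := by
  obtain ⟨L, hL⟩ := (isDual_one hm).exists_pairing (1 : ℝ)
  refine ⟨L.comp (fstL N m), fun v => ?_⟩
  rw [ContinuousLinearMap.comp_apply, hL]
  simp [H1m.toFun]

/-- The total mass `v ↦ ∫ v`. -/
noncomputable def mass (hm : (N : ℝ) / 2 < m) : H1m N m →L[ℝ] ℝ := (exists_mass hm).choose

theorem mass_apply (hm : (N : ℝ) / 2 < m) (v : H1m N m) :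
    mass hm v = ∫ ξ, H1m.toFun v ξ := (exists_mass hm).choose_spec v

theorem integrable_toFun (hm : (N : ℝ) / 2 < m) (v : H1m N m) : Integrable (H1m.toFun v) := by
  have h := (isDual_one hm).integrable_smul v.1.fst
  simp only [one_smul] at h
  exact h

theorem mem_Es_iff (hm : (N : ℝ) / 2 < m) {v : H1m N m} : v ∈ Es N m ↔ mass hm v = 0 := by
  rw [mass_apply]
  exact ⟨fun h => h.2, fun h => ⟨integrable_toFun hm v, h⟩⟩

theorem mass_linearFlow (hm : (N : ℝ) / 2 < m) {τ : ℝ} (hτ : 0 ≤ τ) (v : H1m N m) :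
    mass hm (linearFlow N m τ v) = mass hm v := by
  have hm0 := nonneg_of_half_lt hm
  rcases hτ.eq_or_lt with rfl | hτ
  · rw [linearFlow_zero]
    rfl
  · obtain ⟨C, -, hC⟩ := exists_operatorBounds (m := m) N ℝ hm0 isExponent_two τ
    have e := (hC τ hτ le_rfl).1.integral_swap isExponent_two.ne_top (continuous_kernelClm τ)
      v.1.fst (isDual_one hm)
    simp only [kernelClm_apply, smul_eq_mul, one_mul] at e
    rw [mass_apply, mass_apply, linearFlow_of_pos hτ,
      integral_congr_ae (toFun_smoothing hm0 isExponent_two hτ v.1.fst), e]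
    refine integral_congr_ae (Eventually.of_forall fun y => ?_)
    simp only
    rw [integral_mul_const, integral_kernelL_left hτ, one_mul]
    rfl

theorem toFun_gaussianH1m (hm : (N : ℝ) / 2 < m) :
    H1m.toFun (gaussianH1m N m hm) =ᵐ[volume] gaussian N :=
  ae_volume (memLp_gaussian N (nonneg_of_half_lt hm)).coeFn_toLp

theorem mass_gaussianH1m (hm : (N : ℝ) / 2 < m) : mass hm (gaussianH1m N m hm) = 1 := by
  rw [mass_apply, integral_congr_ae (toFun_gaussianH1m hm)]
  simp_rw [← heatKernel_one]
  exact integral_heatKernel one_pos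

theorem linearFlow_gaussianH1m (hm : (N : ℝ) / 2 < m) {τ : ℝ} (hτ : 0 ≤ τ) :
    linearFlow N m τ (gaussianH1m N m hm) = gaussianH1m N m hm := by
  rcases hτ.eq_or_lt with rfl | hτ
  · rw [linearFlow_zero]
    rfl
  · refine H1m.ext_toFun ?_
    filter_upwards [toFun_linearFlow (nonneg_of_half_lt hm) hτ.le (gaussianH1m N m hm),
      toFun_gaussianH1m hm] with ξ h1 h2
    rw [h1, h2, semigroupL, if_pos hτ, ← integral_kernelL_mul_gaussian hτ]
    refine integral_congr_ae ?_
    filter_upwards [toFun_gaussianH1m hm] with y hy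
    rw [hy]

end Mass

/-! ### Decay on mass-free functions -/

section Decay

theorem abs_exp_neg_sub_exp_neg_le (A B : ℝ) :
    |Real.exp (-A) - Real.exp (-B)| ≤ |A - B| * (Real.exp (-A) + Real.exp (-B)) := by
  have key : ∀ A B : ℝ, A ≤ B →
      |Real.exp (-A) - Real.exp (-B)| ≤ |A - B| * (Real.exp (-A) + Real.exp (-B)) := by
    intro A B h
    have h1 : Real.exp (-B) ≤ Real.exp (-A) := Real.exp_le_exp.mpr (by linarith)
    have h2 := Real.add_one_le_exp (A - B)
    have h3 : Real.exp (-B) = Real.exp (-A) * Real.exp (A - B) := by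
      rw [← Real.exp_add]
      congr 1
      ring
    rw [abs_of_nonneg (by linarith), abs_of_nonpos (by linarith)]
    have h4 := Real.exp_pos (-A)
    have h5 := Real.exp_pos (-B)
    nlinarith
  rcases le_total A B with h | h
  · exact key A B h
  · have := key B A h
    rwa [abs_sub_comm, abs_sub_comm B A, add_comm (Real.exp (-B))] at this

/-- For a in [1/2, 1] the kernel is uniformly smooth, so a shift by η changes it by O(|η|) times a
Gaussian. The constants come from ½·33·(3 + 1) = 66, and from 3/32 = 1/8 - 1/32 after absorbing the
factor 2r + 1. -/
theorem abs_heatKernel_sub_le {a : ℝ} (ha : 1 / 2 ≤ a) (ha1 : a ≤ 1) (ξ η : Eu N)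
    (hη : ‖η‖ ≤ 1) : |heatKernel N a (ξ - η) - heatKernel N a ξ| ≤
      66 * Real.exp (-(3 / 32) * ‖ξ‖ ^ 2) * ‖η‖ := by
  have ha0 : 0 < a := by linarith
  have hpi := Real.pi_gt_three
  set c := (4 * Real.pi * a) ^ (-((N : ℝ) / 2)) with hc
  have hc0 : 0 ≤ c := by positivity
  have hc1 : c ≤ 1 := Real.rpow_le_one_of_one_le_of_nonpos (by nlinarith)
    (by linarith [(by positivity : (0 : ℝ) ≤ N)])
  rw [heatKernel_eq ha0, heatKernel_eq ha0, ← hc, ← mul_sub, abs_mul, abs_of_nonneg hc0,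
    neg_mul, neg_mul]
  refine (mul_le_of_le_one_left (abs_nonneg _) hc1).trans
    ((abs_exp_neg_sub_exp_neg_le _ _).trans ?_)
  set r := ‖ξ‖ with hr
  have hr0 : 0 ≤ r := norm_nonneg ξ
  have hη0 := norm_nonneg η
  have hinv : 1 / (4 * a) ≤ 1 / 2 := by
    rw [div_le_div_iff₀ (by positivity) (by norm_num)]
    linarith
  have hinv' : 1 / 4 ≤ 1 / (4 * a) := by
    rw [div_le_div_iff₀ (by norm_num) (by positivity)]
    linarith
  have t1 : ‖ξ - η‖ ≤ r + ‖η‖ := norm_sub_le _ _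
  have t2 : r ≤ ‖ξ - η‖ + ‖η‖ := by
    have := norm_add_le (ξ - η) η
    rwa [sub_add_cancel] at this
  have hd0 := norm_nonneg (ξ - η)
  have k1 : |1 / (4 * a) * ‖ξ - η‖ ^ 2 - 1 / (4 * a) * r ^ 2| ≤ 1 / 2 * (‖η‖ * (2 * r + 1)) := by
    rw [← mul_sub, abs_mul, abs_of_pos (by positivity)]
    refine mul_le_mul hinv ?_ (abs_nonneg _) (by norm_num)
    rw [abs_le]
    constructor <;> nlinarith
  have k2 : Real.exp (-(1 / (4 * a) * ‖ξ - η‖ ^ 2)) ≤ 3 * Real.exp (-(1 / 8) * r ^ 2) := by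
    have h3 : Real.exp 1 ≤ 3 := by linarith [Real.exp_one_lt_d9]
    have h4 : Real.exp (-(1 / (4 * a) * ‖ξ - η‖ ^ 2)) ≤ Real.exp (1 + -(1 / 8) * r ^ 2) := by
      apply Real.exp_le_exp.mpr
      have : 1 / 4 * ‖ξ - η‖ ^ 2 ≤ 1 / (4 * a) * ‖ξ - η‖ ^ 2 := by gcongr
      nlinarith [sq_nonneg (‖ξ - η‖ - ‖η‖)]
    rw [Real.exp_add] at h4
    exact h4.trans (by gcongr)
  have k3 : Real.exp (-(1 / (4 * a) * r ^ 2)) ≤ Real.exp (-(1 / 8) * r ^ 2) := by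
    apply Real.exp_le_exp.mpr
    nlinarith [sq_nonneg r]
  have k4 : 2 * r + 1 ≤ 33 * Real.exp (1 / 32 * r ^ 2) := by
    nlinarith [Real.add_one_le_exp (1 / 32 * r ^ 2), sq_nonneg (r - 32)]
  have k5 : Real.exp (-(3 / 32) * r ^ 2) =
      Real.exp (1 / 32 * r ^ 2) * Real.exp (-(1 / 8) * r ^ 2) := by
    rw [← Real.exp_add]
    congr 1
    ring
  calc _ ≤ 1 / 2 * (‖η‖ * (33 * Real.exp (1 / 32 * r ^ 2))) *
        (3 * Real.exp (-(1 / 8) * r ^ 2) + Real.exp (-(1 / 8) * r ^ 2)) :=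
        mul_le_mul (k1.trans (by gcongr)) (add_le_add k2 k3) (by positivity) (by positivity)
    _ = _ := by
        rw [k5]
        ring

theorem half_le_one_sub_exp_neg {τ : ℝ} (hτ : 1 ≤ τ) : 1 / 2 ≤ 1 - Real.exp (-τ) := by
  have h1 : Real.exp (-τ) ≤ Real.exp (-1) := Real.exp_le_exp.mpr (by linarith)
  have h2 : Real.exp (-1) ≤ 1 / 2 := by
    rw [Real.exp_neg, inv_le_comm₀ (Real.exp_pos _) (by norm_num)]
    linarith [Real.add_one_le_exp 1]
  linarith

/-- Splitting of the kernel on functions with vanishing mass. -/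
theorem abs_kernelL_sub_le {τ s : ℝ} (hτ : 1 ≤ τ) (hs0 : 0 ≤ s) (hs1 : s ≤ 1) (ξ y : Eu N) :
    |kernelL N τ ξ y - kernelL N τ ξ 0| ≤
      66 * Real.exp (-(3 / 32) * ‖ξ‖ ^ 2) * (Real.exp (-(s * τ / 2)) * ‖y‖ ^ s) +
      {y : Eu N | 1 < ‖Real.exp (-(τ / 2)) • y‖}.indicator (fun y => kernelL N τ ξ y) y := by
  have hτ0 : 0 < τ := by linarith
  have ha := half_le_one_sub_exp_neg hτ
  have ha1 : 1 - Real.exp (-τ) ≤ 1 := by linarith [Real.exp_pos (-τ)]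
  set η := Real.exp (-(τ / 2)) • y with hη
  have hpow : ‖η‖ ^ s = Real.exp (-(s * τ / 2)) * ‖y‖ ^ s := by
    rw [hη, norm_smul, Real.norm_of_nonneg (Real.exp_pos _).le,
      Real.mul_rpow (Real.exp_pos _).le (norm_nonneg _), ← Real.exp_mul]
    congr 2
    ring
  rw [← hpow]
  have hpi := Real.pi_gt_three
  -- Inside the unit ball the Lipschitz bound applies and ‖η‖ ≤ ‖η‖^s because s ≤ 1. Outside, the
  -- kernel at y is kept as it stands, and the kernel at 0 is absorbed using ‖η‖^s ≥ 1.
  rcases le_or_gt ‖η‖ 1 with h | h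
  · rw [indicator_of_notMem (by simpa [hη] using h), add_zero, kernelL_eq hτ0, kernelL_eq hτ0,
      smul_zero, sub_zero]
    refine (abs_heatKernel_sub_le ha ha1 ξ η h).trans ?_
    gcongr
    calc ‖η‖ = ‖η‖ ^ (1 : ℝ) := (Real.rpow_one _).symm
      _ ≤ ‖η‖ ^ s := Real.rpow_le_rpow_of_exponent_ge' (norm_nonneg _) h hs0 hs1
  · rw [indicator_of_mem (by simpa [hη] using h)]
    have h1 := kernelL_pos hτ0 ξ y
    have h2 := kernelL_pos hτ0 ξ 0
    have h3 : kernelL N τ ξ 0 ≤ 66 * Real.exp (-(3 / 32) * ‖ξ‖ ^ 2) * ‖η‖ ^ s := by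
      have k1 : (1 : ℝ) ≤ ‖η‖ ^ s := Real.one_le_rpow h.le hs0
      have k2 : kernelL N τ ξ 0 ≤ Real.exp (-(3 / 32) * ‖ξ‖ ^ 2) := by
        rw [kernelL_eq hτ0, smul_zero, sub_zero, heatKernel_eq (by linarith)]
        set a := 1 - Real.exp (-τ)
        have hc1 : (4 * Real.pi * a) ^ (-((N : ℝ) / 2)) ≤ 1 :=
          Real.rpow_le_one_of_one_le_of_nonpos (by nlinarith)
            (by linarith [(by positivity : (0 : ℝ) ≤ N)])
        refine (mul_le_of_le_one_left (Real.exp_pos _).le hc1).trans (Real.exp_le_exp.mpr ?_)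
        have hinv' : 1 / 4 ≤ 1 / (4 * a) := by
          rw [div_le_div_iff₀ (by norm_num) (by linarith)]
          linarith
        nlinarith [sq_nonneg ‖ξ‖]
      have k3 := Real.exp_pos (-(3 / 32) * ‖ξ‖ ^ 2)
      nlinarith
    rw [abs_le]
    constructor <;> linarith

theorem lintegral_exp_sq_weighted_ne_top (hm : 0 ≤ m) :
    ∫⁻ ξ : Eu N, ENNReal.ofReal (66 * Real.exp (-(3 / 32) * ‖ξ‖ ^ 2)) ^ 2
      ∂(weightedMeasure N m) ≠ ⊤ := by
  have hmeas : Measurable fun ξ : Eu N => ENNReal.ofReal (66 * Real.exp (-(3 / 32) * ‖ξ‖ ^ 2)) := by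
    fun_prop
  rw [lintegral_weighted (hmeas.pow_const 2).aemeasurable]
  set D := 2 ^ m * (1 + Real.exp (4 * m ^ 2)) * 2 with hD
  have hD0 : 0 ≤ D := by positivity
  have h1 := (integrable_exp_neg_mul_norm_sq (N := N) (b := 1 / 16) (by norm_num)).const_mul
    ((66 * D) ^ 2)
  refine ne_top_of_le_ne_top h1.2.ne (lintegral_mono fun ξ => ?_)
  have hw := weight_pos m ξ
  rw [Real.enorm_eq_ofReal (by positivity), ← ENNReal.ofReal_pow (by positivity),
    ← ENNReal.ofReal_mul hw.le]
  refine ENNReal.ofReal_le_ofReal ?_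
  have h2 := sqrt_weight_mul_exp_le hm one_pos le_rfl ξ 0
  rw [add_zero, norm_zero] at h2
  have h3 : √(weight m ξ) * Real.exp (-(1 / 16) * ‖ξ‖ ^ 2) ≤ D := by
    have : (0 : ℝ) ^ m ≤ 1 := Real.rpow_le_one le_rfl zero_le_one hm
    rw [mul_one] at h2
    refine h2.trans ?_
    rw [hD]
    gcongr
    linarith
  have e1 : Real.exp (-(3 / 32) * ‖ξ‖ ^ 2) =
      Real.exp (-(1 / 16) * ‖ξ‖ ^ 2) * Real.exp (-(1 / 32) * ‖ξ‖ ^ 2) := by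
    rw [← Real.exp_add]
    congr 1
    ring
  have e2 : Real.exp (-(1 / 16) * ‖ξ‖ ^ 2) =
      Real.exp (-(1 / 32) * ‖ξ‖ ^ 2) ^ 2 := by
    rw [← Real.exp_nat_mul]
    congr 1
    push_cast
    ring
  calc weight m ξ * (66 * Real.exp (-(3 / 32) * ‖ξ‖ ^ 2)) ^ 2
      = (66 * (√(weight m ξ) * Real.exp (-(1 / 16) * ‖ξ‖ ^ 2))) ^ 2 *
        Real.exp (-(1 / 32) * ‖ξ‖ ^ 2) ^ 2 := by
        rw [e1, mul_pow, mul_pow, mul_pow, mul_pow, Real.sq_sqrt hw.le]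
        ring
    _ ≤ (66 * D) ^ 2 * Real.exp (-(1 / 32) * ‖ξ‖ ^ 2) ^ 2 := by gcongr
    _ = _ := by beta_reduce; rw [e2]

/-- The near part is dominated by a product kernel with factor e^{-sτ/2}, whose y-factor |y|^s is
dual to the weight since s < m - N/2. The far part lives where |y| > e^{τ/2}, and there the weight
itself supplies the decay. -/
theorem exists_kernelBound_sub (hm : 0 ≤ m) {s : ℝ} (hs0 : 0 ≤ s) (hs1 : s ≤ 1)
    (hsm : s + (N : ℝ) / 2 < m) : ∃ C : ℝ, 0 ≤ C ∧ ∀ τ, 1 ≤ τ →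
      KernelBound m (fun ξ y => ‖kernelL N τ ξ y - kernelL N τ ξ 0‖ₑ) 2
        (ENNReal.ofReal (C * Real.exp (-(s * τ / 2)))) := by
  obtain ⟨C₁, hC₁0, hC₁⟩ := exists_kernelBound_of_gaussian N m (a := 1 / 2) (b := 0) (p := 2)
    (r := 1) (by norm_num) le_rfl (by norm_num) (by norm_num) (by norm_num)
  set I := ∫⁻ y : Eu N, (ENNReal.ofReal (weight m y))⁻¹ * ‖‖y‖ ^ s‖ₑ ^ 2 with hI
  have hIt : I ≠ ⊤ := (isDual_norm_rpow hs0 hsm).2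
  set J := ∫⁻ ξ : Eu N, ENNReal.ofReal (66 * Real.exp (-(3 / 32) * ‖ξ‖ ^ 2)) ^ 2
      ∂(weightedMeasure N m) with hJ
  have hJt : J ≠ ⊤ := lintegral_exp_sq_weighted_ne_top hm
  set C₂ := √(J * I).toReal with hC₂
  have hw := weightConst_nonneg m
  refine ⟨C₂ + C₁ * weightConst m, by positivity, fun τ hτ => ?_⟩
  have hτ0 : 0 < τ := by linarith
  have ha := one_sub_exp_neg_pos hτ0
  have ha1 : 1 - Real.exp (-τ) ≤ 1 := by linarith [Real.exp_pos (-τ)]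
  set S := {y : Eu N | 1 < ‖Real.exp (-(τ / 2)) • y‖} with hS
  have hSm : MeasurableSet S := measurableSet_lt measurable_const (by fun_prop)
  have hkc := continuous_kernelL (N := N) τ
  have m1 : Measurable fun ξ : Eu N => ENNReal.ofReal (66 * Real.exp (-(3 / 32) * ‖ξ‖ ^ 2)) := by
    fun_prop
  have m2 : Measurable fun y : Eu N => ENNReal.ofReal (Real.exp (-(s * τ / 2)) * ‖y‖ ^ s) := by
    fun_prop
  have m3 : Measurable (Function.uncurry fun ξ y => S.indicator (fun y => kernelL N τ ξ y) y) := by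
    have e : (Function.uncurry fun ξ y => S.indicator (fun y => kernelL N τ ξ y) y) =
        (univ ×ˢ S).indicator fun z : Eu N × Eu N => kernelL N τ z.1 z.2 := by
      ext z
      by_cases hz : z.2 ∈ S <;> simp [Function.uncurry, indicator, hz]
    rw [e]
    exact hkc.measurable.indicator (MeasurableSet.univ.prod hSm)
  have b1 : KernelBound m (fun ξ y : Eu N => ENNReal.ofReal (66 * Real.exp (-(3 / 32) * ‖ξ‖ ^ 2)) *
      ENNReal.ofReal (Real.exp (-(s * τ / 2)) * ‖y‖ ^ s)) 2
      (ENNReal.ofReal (C₂ * Real.exp (-(s * τ / 2)))) := by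
    refine kernelBound_of_le_mul m1 m2 (fun ξ y => le_rfl) ?_
    have e1 : ∫⁻ y : Eu N, (ENNReal.ofReal (weight m y))⁻¹ *
        ENNReal.ofReal (Real.exp (-(s * τ / 2)) * ‖y‖ ^ s) ^ 2 =
        I * ENNReal.ofReal (Real.exp (-(s * τ / 2))) ^ 2 := by
      have hm1 : AEMeasurable (fun y : Eu N => (ENNReal.ofReal (weight m y))⁻¹ * ‖‖y‖ ^ s‖ₑ ^ 2)
          volume := ((measurable_weight m).ennreal_ofReal.inv.mul
            (((by fun_prop : Measurable fun y : Eu N => ‖y‖ ^ s).enorm).pow_const 2)).aemeasurable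
      rw [hI, ← lintegral_mul_const'' _ hm1]
      refine lintegral_congr fun y => ?_
      have : 0 ≤ ‖y‖ ^ s := by positivity
      rw [ENNReal.ofReal_mul (Real.exp_pos _).le, Real.enorm_eq_ofReal this]
      ring
    rw [e1, ← mul_assoc, ENNReal.ofReal_mul (by positivity), mul_pow]
    gcongr
    rw [hC₂, ← ENNReal.ofReal_pow (Real.sqrt_nonneg _), Real.sq_sqrt ENNReal.toReal_nonneg,
      ENNReal.ofReal_toReal (ENNReal.mul_ne_top hJt hIt)]
  have b2 : KernelBound m (fun ξ y => ENNReal.ofReal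
      (S.indicator (fun y => kernelL N τ ξ y) y)) 2
      (ENNReal.ofReal (C₁ * weightConst m * Real.exp (-(s * τ / 2)))) := by
    -- On the far region the weight at y exceeds that at e^{-τ/2}y by a factor giving e^{-mτ/2}. The
    -- Schur bound costs e^{Nτ/4}, and -m/2 + N/4 ≤ -s/2 is the condition s ≤ m - N/2.
    have h1 := hC₁ τ (weightConst m * Real.exp (-(m * τ / 2))) hτ0 (by positivity)
      (fun ξ y => S.indicator (fun y => kernelL N τ ξ y) y) m3 ?_
    · refine h1.mono (fun ξ y => le_rfl) (ENNReal.ofReal_le_ofReal ?_)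
      rw [mul_zero, neg_zero, Real.rpow_zero, mul_one]
      have h2 : Real.exp (-(m * τ / 2)) * Real.exp (N * τ / 4) ≤ Real.exp (-(s * τ / 2)) := by
        rw [← Real.exp_add]
        apply Real.exp_le_exp.mpr
        nlinarith
      calc _ = C₁ * weightConst m * (Real.exp (-(m * τ / 2)) * Real.exp (N * τ / 4)) := by ring
        _ ≤ _ := by gcongr
    · intro ξ y
      by_cases hy : y ∈ S
      · rw [indicator_of_mem hy, kernelL_eq hτ0]
        have hy1 : 1 < ‖Real.exp (-(τ / 2)) • y‖ := hy
        set η := Real.exp (-(τ / 2)) • y with hη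
        set a := 1 - Real.exp (-τ)
        have k1 := sqrt_weight_mul_exp_le hm ha ha1 (ξ - η) η
        rw [sub_add_cancel] at k1
        have k2 : 1 + ‖η‖ ^ m ≤ 2 * (Real.exp (-(m * τ / 2)) * √(weight m y)) := by
          have j1 : (1 : ℝ) ≤ ‖η‖ ^ m := Real.one_le_rpow hy1.le hm
          have j2 : ‖η‖ ^ m = Real.exp (-(m * τ / 2)) * ‖y‖ ^ m := by
            rw [hη, norm_smul, Real.norm_of_nonneg (Real.exp_pos _).le,
              Real.mul_rpow (Real.exp_pos _).le (norm_nonneg _), ← Real.exp_mul]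
            congr 2
            ring
          have j3 : ‖y‖ ^ m ≤ √(weight m y) := by
            refine Real.le_sqrt_of_sq_le ?_
            rw [weight, mul_comm 2 m, Real.rpow_mul (norm_nonneg _), Real.rpow_two]
            linarith
          have j4 : ‖η‖ ^ m ≤ Real.exp (-(m * τ / 2)) * √(weight m y) := by
            rw [j2]
            gcongr
          linarith
        have k3 : √(weight m ξ) * Real.exp (-(1 / (16 * a)) * ‖ξ - η‖ ^ 2) ≤
            weightConst m * (Real.exp (-(m * τ / 2)) * √(weight m y)) := by
          refine k1.trans ?_
          rw [weightConst, mul_assoc (2 ^ m * (1 + Real.exp (4 * m ^ 2))) 2]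
          gcongr
        have k4 := heatKernel_le ha (ξ - η)
        rw [exp_split] at k4
        have k5 : Real.exp (-(1 / (16 * a)) * ‖ξ - η‖ ^ 2) ≤ 1 :=
          Real.exp_le_one_iff.mpr (by rw [neg_mul]; exact neg_nonpos.mpr (by positivity))
        calc √(weight m ξ) * heatKernel N a (ξ - η)
            ≤ √(weight m ξ) * (a ^ (-((N : ℝ) / 2)) * (Real.exp (-(1 / (8 * a)) * ‖ξ - η‖ ^ 2) *
              Real.exp (-(1 / (16 * a)) * ‖ξ - η‖ ^ 2) * 1)) := by
              refine mul_le_mul_of_nonneg_left (k4.trans ?_) (Real.sqrt_nonneg _)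
              gcongr
          _ = a ^ (-((N : ℝ) / 2)) * Real.exp (-(1 / (8 * a)) * ‖ξ - η‖ ^ 2) *
              (√(weight m ξ) * Real.exp (-(1 / (16 * a)) * ‖ξ - η‖ ^ 2)) := by ring
          _ ≤ a ^ (-((N : ℝ) / 2)) * Real.exp (-(1 / (8 * a)) * ‖ξ - η‖ ^ 2) *
              (weightConst m * (Real.exp (-(m * τ / 2)) * √(weight m y))) := by gcongr
          _ = _ := by ring
      · rw [indicator_of_notMem hy, mul_zero]
        positivity
  have b3 := KernelBound.add (by fun_prop) m3.ennreal_ofReal b1 b2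
  refine b3.mono (fun ξ y => ?_) (le_of_eq ?_)
  · have hk0 : 0 ≤ S.indicator (fun y => kernelL N τ ξ y) y :=
      indicator_nonneg (fun y _ => (kernelL_pos hτ0 ξ y).le) y
    rw [← ENNReal.ofReal_mul (by positivity), ← ENNReal.ofReal_add (by positivity) hk0,
      ← ofReal_norm]
    exact ENNReal.ofReal_le_ofReal (abs_kernelL_sub_le hτ hs0 hs1 ξ y)
  · rw [← ENNReal.ofReal_add (by positivity) (by positivity)]
    congr 1
    ring

/-- Decay of the semigroup on functions with vanishing mass. -/
theorem exists_norm_linearFlow_Es_le (hm : (N : ℝ) / 2 < m) {s : ℝ} (hs0 : 0 ≤ s) (hs1 : s ≤ 1)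
    (hsm : s + (N : ℝ) / 2 < m) : ∃ C : ℝ, 0 ≤ C ∧ ∀ τ, 2 ≤ τ → ∀ v ∈ Es N m,
      ‖linearFlow N m τ v‖ ≤ C * Real.exp (-(s * τ / 2)) * ‖v‖ := by
  have hm0 := nonneg_of_half_lt hm
  obtain ⟨C, hC0, hC⟩ := exists_kernelBound_sub hm0 hs0 hs1 hsm
  have key : ∀ τ, 1 ≤ τ → ∀ v ∈ Es N m,
      ‖(linearFlow N m τ v).1.fst‖ ≤ C * Real.exp (-(s * τ / 2)) * ‖v‖ := by
    intro τ hτ v hv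
    have hτ0 : 0 < τ := by linarith
    let K : Eu N → Eu N → ℝ →L[ℝ] ℝ := fun ξ y =>
      (kernelL N τ ξ y - kernelL N τ ξ 0) • ContinuousLinearMap.id ℝ ℝ
    have hKc : Continuous (Function.uncurry K) := by
      have h1 := continuous_kernelL (N := N) τ
      have h2 : Continuous fun z : Eu N × Eu N => kernelL N τ z.1 0 :=
        (continuous_kernelL_left τ 0).comp continuous_fst
      exact (h1.sub h2).smul continuous_const
    have hKb : KernelBound m (fun ξ y => ‖K ξ y‖ₑ) (2 : ℝ≥0∞).toReal
        (C * Real.exp (-(s * τ / 2))).toNNReal := by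
      refine (hC τ hτ).mono (fun ξ y => enorm_le_iff_norm_le.mpr ?_) le_rfl
      simp only [K]
      rw [norm_smul]
      exact mul_le_of_le_one_right (norm_nonneg _) ContinuousLinearMap.norm_id_le
    obtain ⟨-, L, hL, hLn⟩ := hKb.exists_operator (by norm_num) hKc
    have e : (linearFlow N m τ v).1.fst = L v.1.fst := by
      refine Lp.ext (ae_weighted_iff.mpr ?_)
      filter_upwards [toFun_linearFlow hm0 hτ0.le v, hL v.1.fst] with ξ h1 h2
      rw [h2]
      refine h1.trans ?_
      rw [semigroupL, if_pos hτ0]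
      have i1 : Integrable fun y => kernelL N τ ξ y * H1m.toFun v y :=
        (memLp_kernelL_right hτ0 ξ two_ne_zero).integrable_mul (memLp_volume v.1.fst)
      have i2 : Integrable fun y => kernelL N τ ξ 0 * H1m.toFun v y := hv.1.const_mul _
      -- Vanishing mass enters here: subtracting the kernel at y = 0 does not change the integral.
      have e1 : ∫ y, K ξ y (v.1.fst y) =
          ∫ y, (kernelL N τ ξ y * H1m.toFun v y - kernelL N τ ξ 0 * H1m.toFun v y) := by
        refine integral_congr_ae (Eventually.of_forall fun y => ?_)
        simp [K, sub_mul, H1m.toFun]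
      rw [e1, integral_sub i1 i2, integral_const_mul, hv.2, mul_zero, sub_zero]
    rw [e]
    refine (L.le_of_opNorm_le hLn _).trans ?_
    rw [Real.coe_toNNReal _ (by positivity)]
    gcongr
    exact H1m.norm_fst_le v
  -- The L² decay is used up to time τ - 1, and the last unit of time smooths from L²_m to H¹_m; the
  -- lost unit of decay is the factor e^{s/2}, and τ ≥ 2 leaves at least one unit for the decay
  -- estimate.
  refine ⟨‖smoothing N m 2 1‖ * C * Real.exp (s / 2), by positivity, fun τ hτ v hv => ?_⟩
  have h1 := linearFlow_add (N := N) hm0 1 (τ - 1) zero_le_one (by linarith)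
  rw [add_sub_cancel] at h1
  rw [h1, ContinuousLinearMap.comp_apply, linearFlow_of_pos one_pos]
  refine ((smoothing N m 2 1).le_opNorm _).trans ?_
  have h2 := key (τ - 1) (by linarith) v hv
  calc _ ≤ ‖smoothing N m 2 1‖ * (C * Real.exp (-(s * (τ - 1) / 2)) * ‖v‖) := by gcongr
    _ = _ := by
      have : Real.exp (-(s * (τ - 1) / 2)) = Real.exp (s / 2) * Real.exp (-(s * τ / 2)) := by
        rw [← Real.exp_add]
        congr 1
        ring
      rw [this]
      ring

end Decay

end ViscousHJ

/-! ### The map |·|^q on vectors and on L² -/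

namespace ViscousHJ

open Filter Topology
open scoped ENNReal

section Pointwise

/-- The upper bound is Bernoulli's inequality for r. The lower bound applies Bernoulli to the
complementary exponent 1 - r and uses (1 + t)^r (1 + t)^{1-r} = 1 + t. -/
theorem abs_rpow_one_add_sub_le {r t : ℝ} (hr0 : 0 ≤ r) (hr1 : r ≤ 1) (ht : -1 < t) :
    |(1 + t) ^ r - 1 - r * t| ≤ t ^ 2 := by
  have hu : 0 < 1 + t := by linarith
  have h1 := rpow_one_add_le_one_add_mul_self ht.le hr0 hr1
  have h2 := rpow_one_add_le_one_add_mul_self ht.le (sub_nonneg.mpr hr1) (sub_le_self 1 hr0)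
  have h3 : (1 + t) ^ r * (1 + t) ^ (1 - r) = 1 + t := by
    rw [← Real.rpow_add hu, add_sub_cancel, Real.rpow_one]
  have h4 : 0 < (1 + t) ^ r := by positivity
  set u := (1 + t) ^ r
  have h5 : 1 + t ≤ u * (1 + (1 - r) * t) := by
    rw [← h3]
    gcongr
  have h6 : 0 < 1 + (1 - r) * t := by nlinarith
  have h7 : (1 + t) * (1 - (1 - r) * t) ≤ u := by
    rw [← mul_le_mul_iff_left₀ h6]
    refine le_trans ?_ h5
    nlinarith [mul_nonneg hu.le (sq_nonneg ((1 - r) * t))]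
  rw [abs_le]
  constructor <;> nlinarith [sq_nonneg t]

variable {V : Type*} [NormedAddCommGroup V] [InnerProductSpace ℝ V]

theorem norm_rpow_mul_inner_le (q : ℝ) (a k : V) :
    |‖a‖ ^ (q - 2) * inner ℝ a k| ≤ ‖a‖ ^ (q - 1) * ‖k‖ := by
  rcases eq_or_ne a 0 with rfl | ha
  · simp only [inner_zero_left, mul_zero, abs_zero]
    positivity
  · have h0 : 0 < ‖a‖ := norm_pos_iff.mpr ha
    have e : ‖a‖ ^ (q - 1) = ‖a‖ ^ (q - 2) * ‖a‖ := by
      rw [← Real.rpow_add_one h0.ne']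
      congr 1
      ring
    rw [abs_mul, abs_of_nonneg (by positivity), e, mul_assoc]
    gcongr
    exact abs_real_inner_le_norm a k

/-- If |h| > |a|, every term is at most a multiple of |h|^q. Otherwise divide by |a|: with |b|² =
|a|²(1 + t) and |t| ≤ 3s, s = |h|/|a|, the scalar estimate for the exponent q/2 gives 9s², and the
quadratic part of t adds s². Finally s² ≤ s^q because s ≤ 1 and q ≤ 2; hence the constant 10. -/
theorem abs_norm_rpow_sub_le {q : ℝ} (hq : 1 < q) (hq2 : q ≤ 2) (a b : V) :
    |‖b‖ ^ q - ‖a‖ ^ q - q * (‖a‖ ^ (q - 2) * inner ℝ a (b - a))| ≤ 10 * ‖b - a‖ ^ q := by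
  set h := b - a with hh
  have hb : b = a + h := by rw [hh]; abel
  have hh0 := norm_nonneg h
  have ha0 := norm_nonneg a
  rcases lt_or_ge ‖a‖ ‖h‖ with hlt | hge
  · have hpos : 0 < ‖h‖ := ha0.trans_lt hlt
    have h1 : ‖b‖ ^ q ≤ 4 * ‖h‖ ^ q := by
      have k1 : ‖b‖ ≤ 2 * ‖h‖ := by
        rw [hb]
        linarith [norm_add_le a h]
      calc ‖b‖ ^ q ≤ (2 * ‖h‖) ^ q := Real.rpow_le_rpow (norm_nonneg _) k1 (by linarith)
        _ = 2 ^ q * ‖h‖ ^ q := Real.mul_rpow (by norm_num) hh0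
        _ ≤ 2 ^ (2 : ℝ) * ‖h‖ ^ q := by
            gcongr
            norm_num
        _ = 4 * ‖h‖ ^ q := by norm_num
    have h2 : ‖a‖ ^ q ≤ ‖h‖ ^ q := Real.rpow_le_rpow ha0 hlt.le (by linarith)
    have h3 : ‖a‖ ^ (q - 1) * ‖h‖ ≤ ‖h‖ ^ q := by
      calc ‖a‖ ^ (q - 1) * ‖h‖ ≤ ‖h‖ ^ (q - 1) * ‖h‖ := by
            gcongr
        _ = ‖h‖ ^ q := by rw [← Real.rpow_add_one hpos.ne', sub_add_cancel]
    have h4 := (norm_rpow_mul_inner_le q a h).trans h3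
    have h5 : 0 ≤ ‖b‖ ^ q := by positivity
    have h6 : 0 ≤ ‖a‖ ^ q := by positivity
    rw [abs_le] at h4 ⊢
    constructor <;> nlinarith [h4.1, h4.2]
  · rcases eq_or_lt_of_le ha0 with h0 | hpos
    · have hz : h = 0 := by
        rw [← norm_eq_zero]
        linarith
      have hz' : a = 0 := by rw [← norm_eq_zero]; exact h0.symm
      rw [hb, hz, hz']
      simp [Real.zero_rpow (by linarith : q ≠ 0)]
    set s := ‖h‖ / ‖a‖ with hs
    have hs0 : 0 ≤ s := by positivity
    have hs1 : s ≤ 1 := by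
      rw [hs, div_le_one hpos]
      exact hge
    have hhs : ‖h‖ = s * ‖a‖ := by
      rw [hs]
      field_simp
    set i := inner ℝ a h with hi
    have hib : |i| ≤ ‖a‖ * ‖h‖ := abs_real_inner_le_norm a h
    set t := (2 * i + ‖h‖ ^ 2) / ‖a‖ ^ 2 with ht
    have hb2 : ‖b‖ ^ 2 = ‖a‖ ^ 2 * (1 + t) := by
      rw [hb, norm_add_sq_real, ht]
      field_simp
      ring
    have htab : |t| ≤ 3 * s := by
      rw [ht, abs_div, abs_of_pos (by positivity : 0 < ‖a‖ ^ 2), div_le_iff₀ (by positivity)]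
      rw [hhs] at hib ⊢
      have k : s ^ 2 * ‖a‖ ^ 2 ≤ s * ‖a‖ ^ 2 := by nlinarith [sq_nonneg ‖a‖]
      rw [abs_le] at hib ⊢
      constructor <;> nlinarith [hib.1, hib.2, mul_nonneg hs0 (sq_nonneg ‖a‖)]
    -- At b = 0 one has t = -1, outside the range of the scalar estimate. There h = -a, and the
    -- expression equals (q - 1)|a|^q.
    rcases eq_or_ne b 0 with hb0 | hb0
    · have hha : h = -a := by rw [hh, hb0, zero_sub]
      have e1 : i = -‖a‖ ^ 2 := by rw [hi, hha, inner_neg_right, real_inner_self_eq_norm_sq]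
      have e2 : ‖a‖ ^ (q - 2) * i = -‖a‖ ^ q := by
        rw [e1, mul_neg, ← Real.rpow_natCast, ← Real.rpow_add hpos]
        congr 2
        push_cast
        ring
      rw [e2, hb0, norm_zero, Real.zero_rpow (by linarith), hha, norm_neg]
      have : 0 ≤ ‖a‖ ^ q := by positivity
      rw [abs_le]
      constructor <;> nlinarith
    have hbpos : 0 < ‖b‖ := norm_pos_iff.mpr hb0
    have ht1 : -1 < t := by
      have : 0 < ‖a‖ ^ 2 * (1 + t) := by rw [← hb2]; positivity
      have := pos_of_mul_pos_right this (by positivity)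
      linarith
    have key := abs_rpow_one_add_sub_le (r := q / 2) (by linarith) (by linarith) ht1
    have hbq : ‖b‖ ^ q = ‖a‖ ^ q * (1 + t) ^ (q / 2) := by
      have e1 : ∀ x : ℝ, 0 ≤ x → x ^ q = (x ^ 2) ^ (q / 2) := fun x hx => by
        rw [← Real.rpow_natCast, ← Real.rpow_mul hx]
        congr 1
        push_cast
        ring
      rw [e1 _ (norm_nonneg b), e1 _ ha0, hb2, Real.mul_rpow (by positivity) (by linarith)]
    have haq : ‖a‖ ^ (q - 2) = ‖a‖ ^ q / ‖a‖ ^ 2 := by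
      rw [Real.rpow_sub hpos, Real.rpow_two]
    have hid : ‖b‖ ^ q - ‖a‖ ^ q - q * (‖a‖ ^ (q - 2) * i) =
        ‖a‖ ^ q * ((1 + t) ^ (q / 2) - 1 - q / 2 * t) + ‖a‖ ^ q * (q / 2 * s ^ 2) := by
      rw [hbq, haq, ht, hs]
      field_simp
      ring
    have hs2 : s ^ 2 ≤ s ^ q := by
      rw [← Real.rpow_two]
      exact Real.rpow_le_rpow_of_exponent_ge' hs0 hs1 (by linarith) hq2
    have hhq : ‖h‖ ^ q = s ^ q * ‖a‖ ^ q := by rw [hhs, Real.mul_rpow hs0 ha0]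
    have ht2 : t ^ 2 ≤ 9 * s ^ 2 := by
      have := pow_le_pow_left₀ (abs_nonneg t) htab 2
      rw [sq_abs] at this
      linarith
    have haq0 : 0 ≤ ‖a‖ ^ q := by positivity
    rw [hid]
    refine (abs_add_le _ _).trans ?_
    rw [abs_mul, abs_mul, abs_of_nonneg haq0,
      abs_of_nonneg (by positivity : 0 ≤ q / 2 * s ^ 2), ← mul_add, hhq]
    calc ‖a‖ ^ q * (|(1 + t) ^ (q / 2) - 1 - q / 2 * t| + q / 2 * s ^ 2)
        ≤ ‖a‖ ^ q * (9 * s ^ 2 + 1 * s ^ 2) := by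
          gcongr
          · exact key.trans ht2
          · linarith
      _ ≤ ‖a‖ ^ q * (10 * s ^ q) := by
          gcongr
          linarith
      _ = _ := by ring

end Pointwise

section Superposition

variable {α : Type*} [MeasurableSpace α] {μ : Measure α} {V : Type*} [NormedAddCommGroup V]
  [InnerProductSpace ℝ V]

/-- The superposition operator `g ↦ |g|^q` from `L²` to `L^{2/q}` and its derivative. -/
theorem exists_superposition {q : ℝ} (hq : 1 < q) (hq2 : q ≤ 2) {p : ℝ≥0∞} [Fact (1 ≤ p)]
    (hp : p = ENNReal.ofReal (2 / q)) :
    ∃ (Φ : Lp V 2 μ → Lp ℝ p μ) (DΦ : Lp V 2 μ → Lp V 2 μ →L[ℝ] Lp ℝ p μ),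
      (∀ g, Φ g =ᵐ[μ] fun x => ‖g x‖ ^ q) ∧ (∀ g, ‖Φ g‖ = ‖g‖ ^ q) ∧
      (∀ g, ‖DΦ g‖ ≤ q * ‖g‖ ^ (q - 1)) ∧
      ∀ g h, ‖Φ h - Φ g - DΦ g (h - g)‖ ≤ 10 * ‖h - g‖ ^ q := by
  have hq0 : 0 < q := by linarith
  have hpq : p * ENNReal.ofReal q = 2 := by
    rw [hp, ← ENNReal.ofReal_mul (by positivity), div_mul_cancel₀ _ hq0.ne']
    norm_num
  have hn : ∀ g : Lp V 2 μ, eLpNorm (fun x => ‖g x‖ ^ q) p μ = ENNReal.ofReal (‖g‖ ^ q) := by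
    intro g
    rw [eLpNorm_norm_rpow _ hq0, hpq, Lp.norm_def,
      ← ENNReal.ofReal_rpow_of_nonneg ENNReal.toReal_nonneg hq0.le,
      ENNReal.ofReal_toReal (Lp.eLpNorm_ne_top g)]
  have hm : ∀ g : Lp V 2 μ, MemLp (fun x => ‖g x‖ ^ q) p μ := fun g =>
    ⟨((Lp.aestronglyMeasurable g).norm.aemeasurable.pow_const q).aestronglyMeasurable,
      by rw [hn]; exact ENNReal.ofReal_lt_top⟩
  -- The derivative is a product of |g|^{q-1} in L^{2/(q-1)} and an L² function; Hölder puts it in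
  -- L^{2/q}, as (q - 1)/2 + 1/2 = q/2.
  let p₁ : ℝ≥0∞ := ENNReal.ofReal (2 / (q - 1))
  have hq1 : 0 < q - 1 := by linarith
  have hp₁q : p₁ * ENNReal.ofReal (q - 1) = 2 := by
    rw [← ENNReal.ofReal_mul (by positivity), div_mul_cancel₀ _ hq1.ne']
    norm_num
  have hn₁ : ∀ g : Lp V 2 μ,
      eLpNorm (fun x => ‖g x‖ ^ (q - 1)) p₁ μ = ENNReal.ofReal (‖g‖ ^ (q - 1)) := by
    intro g
    rw [eLpNorm_norm_rpow _ hq1, hp₁q, Lp.norm_def,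
      ← ENNReal.ofReal_rpow_of_nonneg ENNReal.toReal_nonneg hq1.le,
      ENNReal.ofReal_toReal (Lp.eLpNorm_ne_top g)]
  have hH : ENNReal.HolderTriple p₁ 2 p := by
    refine ⟨?_⟩
    rw [hp, ← ENNReal.ofReal_inv_of_pos (by positivity), ← ENNReal.ofReal_inv_of_pos (by positivity),
      show (2 : ℝ≥0∞) = ENNReal.ofReal 2 by norm_num, ← ENNReal.ofReal_inv_of_pos (by norm_num),
      ← ENNReal.ofReal_add (by positivity) (by norm_num)]
    congr 1
    field_simp
    ring
  let d : Lp V 2 μ → Lp V 2 μ → α → ℝ := fun g k x => q * (‖g x‖ ^ (q - 2) * inner ℝ (g x) (k x))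
  have hdm : ∀ g k, AEStronglyMeasurable (d g k) μ := fun g k =>
    ((((Lp.aestronglyMeasurable g).norm.aemeasurable.pow_const
      (q - 2)).aestronglyMeasurable).mul
      ((Lp.aestronglyMeasurable g).inner (Lp.aestronglyMeasurable k))).const_mul q
  have hdn : ∀ g k, eLpNorm (d g k) p μ ≤ ENNReal.ofReal (q * ‖g‖ ^ (q - 1) * ‖k‖) := by
    intro g k
    have h1 : eLpNorm (d g k) p μ ≤
        eLpNorm (q • ((fun x => ‖g x‖ ^ (q - 1)) • fun x => ‖k x‖)) p μ := by
      refine eLpNorm_mono fun x => ?_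
      simp only [Pi.smul_apply, smul_eq_mul, norm_mul, d]
      rw [← norm_mul (‖g x‖ ^ (q - 2))]
      gcongr
      rw [Pi.mul_apply, Real.norm_of_nonneg (by positivity : 0 ≤ ‖g x‖ ^ (q - 1) * ‖k x‖)]
      exact norm_rpow_mul_inner_le q _ _
    refine h1.trans ?_
    rw [eLpNorm_const_smul, mul_assoc, ENNReal.ofReal_mul hq0.le, Real.enorm_eq_ofReal hq0.le,
      ENNReal.ofReal_mul (by positivity), ← hn₁ g, Lp.norm_def,
      ENNReal.ofReal_toReal (Lp.eLpNorm_ne_top k), ← eLpNorm_norm k]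
    gcongr
    exact eLpNorm_smul_le_mul_eLpNorm (Lp.aestronglyMeasurable k).norm
      ((Lp.aestronglyMeasurable g).norm.aemeasurable.pow_const _).aestronglyMeasurable
  have hdL : ∀ g k, MemLp (d g k) p μ := fun g k =>
    ⟨hdm g k, (hdn g k).trans_lt ENNReal.ofReal_lt_top⟩
  let DΦ : Lp V 2 μ → Lp V 2 μ →L[ℝ] Lp ℝ p μ := fun g => LinearMap.mkContinuous
    { toFun := fun k => (hdL g k).toLp
      map_add' := fun k k' => by
        rw [← MemLp.toLp_add, MemLp.toLp_eq_toLp_iff]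
        filter_upwards [Lp.coeFn_add k k'] with x hx
        simp only [d, hx, Pi.add_apply, inner_add_right]
        ring
      map_smul' := fun c k => by
        rw [RingHom.id_apply, ← MemLp.toLp_const_smul, MemLp.toLp_eq_toLp_iff]
        filter_upwards [Lp.coeFn_smul c k] with x hx
        simp only [d, hx, Pi.smul_apply, inner_smul_right, smul_eq_mul]
        ring } (q * ‖g‖ ^ (q - 1)) fun k => by
      change ‖(hdL g k).toLp‖ ≤ _
      rw [Lp.norm_toLp]
      exact ENNReal.toReal_le_of_le_ofReal (by positivity) (hdn g k)
  refine ⟨fun g => (hm g).toLp, DΦ, fun g => (hm g).coeFn_toLp, fun g => ?_,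
    fun g => LinearMap.mkContinuous_norm_le _ (by positivity) _, fun g h => ?_⟩
  · rw [Lp.norm_toLp, hn, ENNReal.toReal_ofReal (by positivity)]
  · have e : (hm h).toLp - (hm g).toLp - DΦ g (h - g) =
        (((hm h).sub (hm g)).sub (hdL g (h - g))).toLp := by
      rw [MemLp.toLp_sub ((hm h).sub (hm g)) (hdL g (h - g)), MemLp.toLp_sub (hm h) (hm g)]
      rfl
    rw [e, Lp.norm_toLp]
    refine ENNReal.toReal_le_of_le_ofReal (by positivity) ?_
    rw [ENNReal.ofReal_mul (by norm_num), ← hn]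
    have hae : ∀ᵐ x ∂μ, ‖((fun x => ‖h x‖ ^ q) - (fun x => ‖g x‖ ^ q) - d g (h - g)) x‖ ≤
        10 * ‖‖(h - g) x‖ ^ q‖ := by
      filter_upwards [Lp.coeFn_sub h g] with x hx
      rw [Real.norm_of_nonneg (by positivity : 0 ≤ ‖(h - g) x‖ ^ q)]
      simp only [Pi.sub_apply, d, hx]
      exact abs_norm_rpow_sub_le hq hq2 (g x) (h x)
    exact eLpNorm_le_mul_eLpNorm_of_ae_le_mul hae p

end Superposition

end ViscousHJ

/-! ### Truncation of a superlinear map -/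

namespace Mild

open Filter Topology

variable {X Y Z : Type*} [NormedAddCommGroup X] [NormedAddCommGroup Y] [NormedSpace ℝ Y]
  [NormedAddCommGroup Z] [NormedSpace ℝ Z]

theorem Expansion.hasFDerivAt [NormedSpace ℝ X] {F : X → Y} {A : X → X →L[ℝ] Y} {c θ : ℝ}
    (hθ : 0 < θ) (h : Expansion F A c θ) (x : X) : HasFDerivAt F (A x) x := by
  have h1 : (fun y => F y - F x - A x (y - x)) =O[𝓝 x] fun y => ‖y - x‖ ^ (1 + θ) := by
    refine Asymptotics.IsBigO.of_bound c (Eventually.of_forall fun y => ?_)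
    rw [Real.norm_of_nonneg (by positivity : 0 ≤ ‖y - x‖ ^ (1 + θ))]
    exact h x y
  refine HasFDerivAt.of_isLittleO (h1.trans_isLittleO ?_)
  have h2 : (fun y => ‖y - x‖ ^ θ * ‖y - x‖) =o[𝓝 x] fun y => 1 * ‖y - x‖ := by
    refine Asymptotics.IsLittleO.mul_isBigO ?_ (Asymptotics.isBigO_refl _ _)
    rw [Asymptotics.isLittleO_one_iff]
    have : Continuous fun y => ‖y - x‖ ^ θ :=
      (continuous_id.sub continuous_const).norm.rpow_const fun _ => Or.inr hθ.le
    simpa [Real.zero_rpow hθ.ne'] using this.tendsto x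
  refine (h2.congr_left fun y => ?_).trans_isBigO ?_
  · rcases eq_or_ne y x with rfl | hne
    · simp [Real.zero_rpow (by positivity : (1 + θ) ≠ 0)]
    · rw [add_comm 1 θ, Real.rpow_add_one (norm_ne_zero_iff.mpr (sub_ne_zero.mpr hne))]
  · simp only [one_mul]
    exact (Asymptotics.isBigO_refl _ _).norm_left

theorem Expansion.lip [NormedSpace ℝ X] {F : X → Y} {A : X → X →L[ℝ] Y} {c θ ε : ℝ}
    (hθ : 0 < θ) (h : Expansion F A c θ) (hA : ∀ x, ‖A x‖ ≤ ε) (x y : X) :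
    ‖F x - F y‖ ≤ ε * ‖x - y‖ :=
  convex_univ.norm_image_sub_le_of_norm_hasFDerivWithin_le
    (fun z _ => (h.hasFDerivAt hθ z).hasFDerivWithinAt) (fun z _ => hA z) (mem_univ y) (mem_univ x)

/-- Smooth cut-off functions on the half line, supported in `[0, 4]`. -/
structure IsProfile (g g' : ℝ → ℝ) (L : ℝ) : Prop where
  abs_le : ∀ r, 0 ≤ r → |g r| ≤ 1
  eq_zero : ∀ r, 4 ≤ r → g r = 0
  deriv_eq_zero : ∀ r, 4 ≤ r → g' r = 0
  deriv_le : ∀ r, |g' r| ≤ L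
  lip : ∀ r s, 0 ≤ r → 0 ≤ s → |g s - g r| ≤ L * |s - r|
  expansion : ∀ r s, 0 ≤ r → 0 ≤ s → |g s - g r - g' r * (s - r)| ≤ L * (s - r) ^ 2

variable [InnerProductSpace ℝ X]

/-- The derivative of `v ↦ g(‖v‖² / ρ²) Φ(D v)`. -/
noncomputable def truncDeriv (g g' : ℝ → ℝ) (ρ : ℝ) (D : X →L[ℝ] Z) (Φ : Z → Y)
    (DΦ : Z → Z →L[ℝ] Y) (v : X) : X →L[ℝ] Y :=
  g (‖v‖ ^ 2 / ρ ^ 2) • (DΦ (D v)).comp D +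
    (g' (‖v‖ ^ 2 / ρ ^ 2) * (2 / ρ ^ 2)) • (innerSL ℝ v).smulRight (Φ (D v))

set_option maxHeartbeats 1000000 in
-- The cut-off vanishes for ‖v‖ ≥ P = 2ρ, and on the ball of radius P one has ‖Φ‖ ≤ P^{1+θ} and ‖DΦ‖
-- ≤ 2P^θ. Differentiating the cut-off costs L·(2/ρ²)·P, and (2/ρ²)·P·P^{1+θ} = 8P^θ gives the
-- second part of the Lipschitz constant. The Lipschitz bound follows from that on the derivative by
-- the mean value inequality. The constant `c` of the expansion may depend on ρ in any way, since
-- only the order 1 + θ matters.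
theorem isNonlinearity_truncation {g g' : ℝ → ℝ} {L : ℝ} (hg : IsProfile g g' L) {ρ : ℝ}
    (hρ : 0 < ρ) {D : X →L[ℝ] Z} (hD : ∀ v, ‖D v‖ ≤ ‖v‖) {Φ : Z → Y} {DΦ : Z → Z →L[ℝ] Y}
    {θ : ℝ} (hθ : 0 < θ) (hθ1 : θ ≤ 1) (hΦ : ∀ z, ‖Φ z‖ ≤ ‖z‖ ^ (1 + θ))
    (hDΦ : ∀ z, ‖DΦ z‖ ≤ 2 * ‖z‖ ^ θ)
    (hE : ∀ z z', ‖Φ z' - Φ z - DΦ z (z' - z)‖ ≤ 10 * ‖z' - z‖ ^ (1 + θ)) :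
    ∃ c, IsNonlinearity (fun v => g (‖v‖ ^ 2 / ρ ^ 2) • Φ (D v)) (truncDeriv g g' ρ D Φ DΦ)
      ((2 + 8 * L) * (2 * ρ) ^ θ) ((2 * ρ) ^ (1 + θ)) c θ := by
  have hL0 : 0 ≤ L := (abs_nonneg _).trans (hg.deriv_le 0)
  have hΦ0 : Φ 0 = 0 := by
    have := hΦ 0
    rw [norm_zero, Real.zero_rpow (by positivity)] at this
    exact norm_le_zero_iff.mp this
  have hDΦ0 : DΦ 0 = 0 := by
    have := hDΦ 0
    rw [norm_zero, Real.zero_rpow hθ.ne', mul_zero] at this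
    exact norm_le_zero_iff.mp this
  set P := 2 * ρ with hP
  have hP0 : 0 < P := by positivity
  have hA0 : ∀ v : X, 0 ≤ ‖v‖ ^ 2 / ρ ^ 2 := fun v => by positivity
  have hfar : ∀ v : X, P ≤ ‖v‖ → 4 ≤ ‖v‖ ^ 2 / ρ ^ 2 := fun v hv => by
    rw [le_div_iff₀ (by positivity)]
    nlinarith
  have hPow : P ^ (1 + θ) = P * P ^ θ := by rw [add_comm, Real.rpow_add_one hP0.ne', mul_comm]
  have hΦP : ∀ v : X, ‖v‖ ≤ P → ‖Φ (D v)‖ ≤ P ^ (1 + θ) := fun v hv =>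
    (hΦ _).trans (Real.rpow_le_rpow (norm_nonneg _) ((hD v).trans hv) (by positivity))
  have hDΦP : ∀ v : X, ‖v‖ ≤ P → ‖DΦ (D v)‖ ≤ 2 * P ^ θ := fun v hv =>
    (hDΦ _).trans (by gcongr; exact (hD v).trans hv)
  have hDn : ‖D‖ ≤ 1 := D.opNorm_le_bound zero_le_one fun v => by simpa using hD v
  have hderiv : ∀ v, ‖truncDeriv g g' ρ D Φ DΦ v‖ ≤ (2 + 8 * L) * P ^ θ := by
    intro v
    rcases le_total P ‖v‖ with h | h
    · rw [truncDeriv, hg.eq_zero _ (hfar v h), hg.deriv_eq_zero _ (hfar v h)]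
      simp only [zero_smul, zero_mul, add_zero, norm_zero]
      positivity
    · refine (norm_add_le _ _).trans ?_
      rw [norm_smul, norm_smul, norm_mul, ContinuousLinearMap.norm_smulRight_apply, innerSL_apply_norm,
        Real.norm_of_nonneg (by positivity : 0 ≤ 2 / ρ ^ 2)]
      have h1 : ‖(DΦ (D v)).comp D‖ ≤ 2 * P ^ θ * 1 :=
        ((DΦ (D v)).opNorm_comp_le D).trans (by gcongr; exact hDΦP v h)
      have h2 : ‖g (‖v‖ ^ 2 / ρ ^ 2)‖ * ‖(DΦ (D v)).comp D‖ ≤ 1 * (2 * P ^ θ * 1) := by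
        gcongr
        exact hg.abs_le _ (hA0 v)
      have h3 : ‖g' (‖v‖ ^ 2 / ρ ^ 2)‖ * (2 / ρ ^ 2) * (‖v‖ * ‖Φ (D v)‖) ≤
          L * (2 / ρ ^ 2) * (P * P ^ (1 + θ)) := by
        gcongr
        · exact hg.deriv_le _
        · exact hΦP v h
      have h4 : L * (2 / ρ ^ 2) * (P * P ^ (1 + θ)) = 8 * L * P ^ θ := by
        rw [hPow, hP]
        field_simp
        ring
      linarith
  -- constants of the expansion
  set C₁ := L * ((2 * P + 1) / ρ ^ 2) ^ 2 + L / ρ ^ 2 with hC₁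
  set C₂ := 2 + L * (2 / ρ ^ 2) * P with hC₂
  set C₃ := L * ((2 * P + 1) / ρ ^ 2) * (2 * P ^ θ + 10) with hC₃
  set C₄ := 2 * (2 * P ^ θ + 10) with hC₄
  have hC₁0 : 0 ≤ C₁ := by positivity
  have hC₂0 : 0 ≤ C₂ := by positivity
  have hC₃0 : 0 ≤ C₃ := by positivity
  have hC₄0 : 0 ≤ C₄ := by positivity
  have hpow_small : ∀ n : ℝ, 0 ≤ n → n ≤ 1 → n ^ 2 ≤ n ^ (1 + θ) := fun n h0 h1 => by
    rw [← Real.rpow_two]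
    exact Real.rpow_le_rpow_of_exponent_ge' h0 h1 (by linarith) (by linarith)
  have hpow_small' : ∀ n : ℝ, 0 ≤ n → n ≤ 1 → n ^ (1 + θ) ≤ n := fun n h0 h1 => by
    calc n ^ (1 + θ) ≤ n ^ (1 : ℝ) :=
          Real.rpow_le_rpow_of_exponent_ge' h0 h1 (by linarith) (by linarith)
      _ = n := Real.rpow_one n
  have hpow_large : ∀ n : ℝ, 1 ≤ n → n ≤ n ^ (1 + θ) := fun n h1 => by
    calc n = n ^ (1 : ℝ) := (Real.rpow_one n).symm
      _ ≤ n ^ (1 + θ) := Real.rpow_le_rpow_of_exponent_le h1 (by linarith)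
  have hgdiff : ∀ v w : X, |g (‖w‖ ^ 2 / ρ ^ 2) - g (‖v‖ ^ 2 / ρ ^ 2)| ≤ 2 := fun v w => by
    have h1 := hg.abs_le _ (hA0 v)
    have h2 := hg.abs_le _ (hA0 w)
    rw [abs_le] at h1 h2 ⊢
    constructor <;> linarith [h1.1, h1.2, h2.1, h2.2]
  have hAB : ∀ v w : X, (‖v‖ ≤ P ∨ ‖w‖ ≤ P) → |‖w‖ ^ 2 / ρ ^ 2 - ‖v‖ ^ 2 / ρ ^ 2| ≤
      ‖w - v‖ * (2 * P + ‖w - v‖) / ρ ^ 2 := by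
    intro v w hvw
    rw [← sub_div, abs_div, abs_of_pos (by positivity : 0 < ρ ^ 2)]
    gcongr
    have h1 := abs_norm_sub_norm_le w v
    have h2 : ‖w‖ + ‖v‖ ≤ 2 * P + ‖w - v‖ := by
      rw [abs_le] at h1
      rcases hvw with h | h <;> linarith [h1.1, h1.2]
    rw [sq_sub_sq, abs_mul, abs_of_nonneg (by positivity : 0 ≤ ‖w‖ + ‖v‖), mul_comm]
    gcongr
  -- Below increment size one, quadratic errors are absorbed by n² ≤ n^{1+θ}; above it, bounded and
  -- linear terms are absorbed by 1 ≤ n ≤ n^{1+θ}. At least one of the two points has to lie in the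
  -- ball, since otherwise the squared norms are uncontrolled.
  have hκ : ∀ v w : X, (‖v‖ ≤ P ∨ ‖w‖ ≤ P) → |g (‖w‖ ^ 2 / ρ ^ 2) - g (‖v‖ ^ 2 / ρ ^ 2) -
      g' (‖v‖ ^ 2 / ρ ^ 2) * (2 / ρ ^ 2) * inner ℝ v (w - v)| ≤
      (C₁ + C₂) * ‖w - v‖ ^ (1 + θ) := by
    intro v w hvw
    set n := ‖w - v‖ with hn
    have hn0 : 0 ≤ n := norm_nonneg _
    have hnθ : 0 ≤ n ^ (1 + θ) := by positivity
    rcases le_total n 1 with h1 | h1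
    · have e : g (‖w‖ ^ 2 / ρ ^ 2) - g (‖v‖ ^ 2 / ρ ^ 2) -
          g' (‖v‖ ^ 2 / ρ ^ 2) * (2 / ρ ^ 2) * inner ℝ v (w - v) =
          (g (‖w‖ ^ 2 / ρ ^ 2) - g (‖v‖ ^ 2 / ρ ^ 2) -
            g' (‖v‖ ^ 2 / ρ ^ 2) * (‖w‖ ^ 2 / ρ ^ 2 - ‖v‖ ^ 2 / ρ ^ 2)) +
          g' (‖v‖ ^ 2 / ρ ^ 2) * (n ^ 2 / ρ ^ 2) := by
        have : ‖w‖ ^ 2 = ‖v‖ ^ 2 + 2 * inner ℝ v (w - v) + n ^ 2 := by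
          rw [hn, ← norm_add_sq_real, add_sub_cancel]
        rw [this]
        field_simp
        ring
      rw [e]
      refine (abs_add_le _ _).trans ?_
      have k1 := hg.expansion _ _ (hA0 v) (hA0 w)
      have k2 : (‖w‖ ^ 2 / ρ ^ 2 - ‖v‖ ^ 2 / ρ ^ 2) ^ 2 ≤ (n * ((2 * P + 1) / ρ ^ 2)) ^ 2 := by
        rw [← sq_abs]
        refine pow_le_pow_left₀ (abs_nonneg _) ((hAB v w hvw).trans ?_) 2
        rw [mul_div_assoc]
        gcongr
      have k3 : |g' (‖v‖ ^ 2 / ρ ^ 2) * (n ^ 2 / ρ ^ 2)| ≤ L * (n ^ 2 / ρ ^ 2) := by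
        rw [abs_mul, abs_of_nonneg (by positivity : 0 ≤ n ^ 2 / ρ ^ 2)]
        gcongr
        exact hg.deriv_le _
      calc _ ≤ L * (n * ((2 * P + 1) / ρ ^ 2)) ^ 2 + L * (n ^ 2 / ρ ^ 2) :=
            add_le_add (k1.trans (by gcongr)) k3
        _ = C₁ * n ^ 2 := by
            rw [hC₁]
            ring
        _ ≤ C₁ * n ^ (1 + θ) := by gcongr; exact hpow_small n hn0 h1
        _ ≤ _ := by nlinarith
    · have k1 : |g' (‖v‖ ^ 2 / ρ ^ 2) * (2 / ρ ^ 2) * inner ℝ v (w - v)| ≤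
          L * (2 / ρ ^ 2) * P * n := by
        rcases le_total P ‖v‖ with h | h
        · rw [hg.deriv_eq_zero _ (hfar v h)]
          simp only [zero_mul, abs_zero]
          positivity
        · rw [abs_mul, abs_mul, abs_of_nonneg (by positivity : 0 ≤ 2 / ρ ^ 2), mul_assoc _ P]
          gcongr
          · exact hg.deriv_le _
          · exact (abs_real_inner_le_norm _ _).trans (by gcongr)
      calc _ ≤ 2 + L * (2 / ρ ^ 2) * P * n := (abs_sub _ _).trans (add_le_add (hgdiff v w) k1)
        _ ≤ C₂ * n := by rw [hC₂]; nlinarith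
        _ ≤ C₂ * n ^ (1 + θ) := by gcongr; exact hpow_large n h1
        _ ≤ _ := by nlinarith
  have hprod : ∀ v w : X, ‖v‖ ≤ P →
      |g (‖w‖ ^ 2 / ρ ^ 2) - g (‖v‖ ^ 2 / ρ ^ 2)| * ‖Φ (D w) - Φ (D v)‖ ≤
      (C₃ + C₄) * ‖w - v‖ ^ (1 + θ) := by
    intro v w hv
    have hDwv : ‖D w - D v‖ ≤ ‖w - v‖ := by
      rw [← map_sub]
      exact hD _
    set n := ‖w - v‖ with hn
    have hn0 : 0 ≤ n := norm_nonneg _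
    have hnθ : 0 ≤ n ^ (1 + θ) := by positivity
    have k1 : ‖Φ (D w) - Φ (D v)‖ ≤ 2 * P ^ θ * n + 10 * n ^ (1 + θ) := by
      have j1 := (hE (D v) (D w)).trans (mul_le_mul_of_nonneg_left
        (Real.rpow_le_rpow (norm_nonneg _) hDwv (by positivity : 0 ≤ 1 + θ)) (by norm_num))
      have j2 : ‖DΦ (D v) (D w - D v)‖ ≤ 2 * P ^ θ * n :=
        ((DΦ (D v)).le_opNorm _).trans (by gcongr; exact hDΦP v hv)
      have j3 := norm_add_le (Φ (D w) - Φ (D v) - DΦ (D v) (D w - D v)) (DΦ (D v) (D w - D v))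
      rw [sub_add_cancel] at j3
      linarith
    rcases le_total n 1 with h1 | h1
    · have k2 : |g (‖w‖ ^ 2 / ρ ^ 2) - g (‖v‖ ^ 2 / ρ ^ 2)| ≤ L * (n * ((2 * P + 1) / ρ ^ 2)) := by
        refine (hg.lip _ _ (hA0 v) (hA0 w)).trans ?_
        gcongr
        refine (hAB v w (Or.inl hv)).trans ?_
        rw [mul_div_assoc]
        gcongr
      have k3 : ‖Φ (D w) - Φ (D v)‖ ≤ (2 * P ^ θ + 10) * n := by
        linarith [hpow_small' n hn0 h1]
      calc _ ≤ L * (n * ((2 * P + 1) / ρ ^ 2)) * ((2 * P ^ θ + 10) * n) := by gcongr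
        _ = C₃ * n ^ 2 := by
            rw [hC₃]
            ring
        _ ≤ C₃ * n ^ (1 + θ) := by gcongr; exact hpow_small n hn0 h1
        _ ≤ _ := by nlinarith
    · have k3 : ‖Φ (D w) - Φ (D v)‖ ≤ (2 * P ^ θ + 10) * n ^ (1 + θ) := by
        have : 2 * P ^ θ * n ≤ 2 * P ^ θ * n ^ (1 + θ) := by gcongr; exact hpow_large n h1
        linarith
      calc _ ≤ 2 * ((2 * P ^ θ + 10) * n ^ (1 + θ)) := by gcongr; exact hgdiff v w
        _ = C₄ * n ^ (1 + θ) := by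
            rw [hC₄]
            ring
        _ ≤ _ := by nlinarith
  have hexp : Expansion (fun v => g (‖v‖ ^ 2 / ρ ^ 2) • Φ (D v)) (truncDeriv g g' ρ D Φ DΦ)
      (10 + (C₁ + C₂) * P ^ (1 + θ) + (C₃ + C₄)) θ := by
    intro v w
    have hnθ : 0 ≤ ‖w - v‖ ^ (1 + θ) := by positivity
    have hPθ : 0 ≤ P ^ (1 + θ) := by positivity
    -- If the base point lies outside the ball, function and derivative vanish there, and only the
    -- value at `w` has to be estimated. Inside, the remainder splits into those of Φ and of the
    -- cut-off, and the product of the two increments.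
    rcases le_total P ‖v‖ with h | h
    · have e0 : truncDeriv g g' ρ D Φ DΦ v = 0 := by
        rw [truncDeriv, hg.eq_zero _ (hfar v h), hg.deriv_eq_zero _ (hfar v h)]
        simp
      simp only [e0, zero_apply, sub_zero, hg.eq_zero _ (hfar v h), zero_smul]
      rcases le_total P ‖w‖ with h' | h'
      · rw [hg.eq_zero _ (hfar w h'), zero_smul, norm_zero]
        positivity
      · have k1 := hκ v w (Or.inr h')
        rw [hg.eq_zero _ (hfar v h), hg.deriv_eq_zero _ (hfar v h), zero_mul, zero_mul, sub_zero,
          sub_zero] at k1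
        rw [norm_smul]
        calc _ ≤ (C₁ + C₂) * ‖w - v‖ ^ (1 + θ) * P ^ (1 + θ) := by
              gcongr
              · exact k1
              · exact hΦP w h'
          _ ≤ _ := by nlinarith [mul_nonneg hC₃0 hnθ, mul_nonneg hC₄0 hnθ]
    · have e : g (‖w‖ ^ 2 / ρ ^ 2) • Φ (D w) - g (‖v‖ ^ 2 / ρ ^ 2) • Φ (D v) -
          truncDeriv g g' ρ D Φ DΦ v (w - v) =
          g (‖v‖ ^ 2 / ρ ^ 2) • (Φ (D w) - Φ (D v) - DΦ (D v) (D w - D v)) +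
          (g (‖w‖ ^ 2 / ρ ^ 2) - g (‖v‖ ^ 2 / ρ ^ 2) -
            g' (‖v‖ ^ 2 / ρ ^ 2) * (2 / ρ ^ 2) * inner ℝ v (w - v)) • Φ (D v) +
          (g (‖w‖ ^ 2 / ρ ^ 2) - g (‖v‖ ^ 2 / ρ ^ 2)) • (Φ (D w) - Φ (D v)) := by
        simp only [truncDeriv, add_apply, smul_apply, ContinuousLinearMap.comp_apply,
          ContinuousLinearMap.smulRight_apply, innerSL_apply_apply, map_sub D w v]
        module
      rw [e]
      refine (norm_add₃_le).trans ?_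
      rw [norm_smul, norm_smul, norm_smul]
      have hDwv : ‖D w - D v‖ ≤ ‖w - v‖ := by
        rw [← map_sub]
        exact hD _
      have k1 : ‖g (‖v‖ ^ 2 / ρ ^ 2)‖ * ‖Φ (D w) - Φ (D v) - DΦ (D v) (D w - D v)‖ ≤
          1 * (10 * ‖w - v‖ ^ (1 + θ)) := by
        gcongr
        · exact hg.abs_le _ (hA0 v)
        · exact (hE _ _).trans (by gcongr)
      have k2 := mul_le_mul (hκ v w (Or.inl h)) (hΦP v h) (norm_nonneg _) (by positivity)
      have k3 := hprod v w h
      rw [← Real.norm_eq_abs] at k2 k3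
      calc _ ≤ _ := add_le_add (add_le_add k1 k2) k3
        _ = _ := by ring
  refine ⟨_, ⟨hexp.lip hθ hderiv, fun v => ?_, hderiv, hexp, ?_, ?_, by positivity, hθ, hθ1⟩⟩
  · rcases le_total P ‖v‖ with h | h
    · rw [hg.eq_zero _ (hfar v h), zero_smul, norm_zero]
      positivity
    · rw [norm_smul]
      exact (mul_le_of_le_one_left (norm_nonneg _) (hg.abs_le _ (hA0 v))).trans (hΦP v h)
  · simp [hΦ0]
  · simp [truncDeriv, hΦ0, hDΦ0]

end Mild

/-! ### The truncated nonlinearity and the admissible exponents -/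

namespace ViscousHJ

open Filter Topology
open scoped ENNReal

/-- Smoothness of χ is given on the half line only. Since χ = 1 on [0, 1], extension by 1 to the
left is smooth on ℝ, and its derivatives have compact support, hence are bounded. -/
theorem IsCutoff.exists_profile {χ : ℝ → ℝ} (hχ : IsCutoff χ) :
    ∃ (g' : ℝ → ℝ) (L : ℝ), Mild.IsProfile χ g' L := by
  let g : ℝ → ℝ := fun r => if r ≤ 0 then 1 else χ r
  have hgχ : ∀ r, 0 ≤ r → g r = χ r := by
    intro r hr
    rcases hr.eq_or_lt with rfl | hr
    · simp [g, hχ.eq_one 0 le_rfl zero_le_one]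
    · simp [g, not_le.mpr hr]
  have hg0 : ∀ r, r ≤ 0 → g r = 1 := fun r hr => by simp [g, hr]
  have hgnonneg : ∀ r, 0 ≤ g r := fun r => by
    rcases le_total r 0 with h | h
    · rw [hg0 r h]
      exact zero_le_one
    · rw [hgχ r h]
      exact hχ.nonneg r h
  have hgle : ∀ r, g r ≤ 1 := fun r => by
    rcases le_total r 0 with h | h
    · rw [hg0 r h]
    · rw [hgχ r h]
      exact hχ.le_one r h
  have hgs : ContDiff ℝ ∞ g := by
    rw [contDiff_iff_contDiffAt]
    intro r
    rcases lt_or_ge 0 r with h | h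
    · refine ((hχ.smooth r h.le).contDiffAt (Ici_mem_nhds h)).congr_of_eventuallyEq ?_
      filter_upwards [Ioi_mem_nhds h] with s hs
      exact hgχ s (le_of_lt hs)
    · refine (contDiffAt_const (c := (1 : ℝ))).congr_of_eventuallyEq ?_
      filter_upwards [Iio_mem_nhds (lt_of_le_of_lt h one_pos)] with s hs
      rcases le_total s 0 with h' | h'
      · exact hg0 s h'
      · rw [hgχ s h', hχ.eq_one s h' (le_of_lt hs)]
  have hdiff : Differentiable ℝ g := hgs.differentiable (by simp)
  have hg1 : ContDiff ℝ ∞ (deriv g) := (contDiff_infty_iff_deriv.mp hgs).2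
  have hdiff1 : Differentiable ℝ (deriv g) := hg1.differentiable (by simp)
  have hg2 : Continuous (deriv (deriv g)) := (contDiff_infty_iff_deriv.mp hg1).2.continuous
  -- At such points, r = 4 included, g attains its minimum 0. The same argument with the maximum 1
  -- covers r ≤ 0.
  have hd4 : ∀ r, 4 ≤ r → deriv g r = 0 := by
    intro r hr
    refine IsLocalMin.deriv_eq_zero (Eventually.of_forall fun s => ?_)
    rw [hgχ r (by linarith), hχ.eq_zero r hr]
    exact hgnonneg s
  have hd0 : ∀ r, r ≤ 0 → deriv g r = 0 := by
    intro r hr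
    refine IsLocalMax.deriv_eq_zero (Eventually.of_forall fun s => ?_)
    rw [hg0 r hr]
    exact hgle s
  have hcs : HasCompactSupport (deriv g) := by
    refine HasCompactSupport.intro (isCompact_Icc (a := (0 : ℝ)) (b := 4)) fun r hr => ?_
    rw [mem_Icc, not_and_or, not_le, not_le] at hr
    rcases hr with h | h
    · exact hd0 r h.le
    · exact hd4 r h.le
  obtain ⟨L₁, hL₁⟩ := hg1.continuous.bounded_above_of_compact_support hcs
  obtain ⟨L₂, hL₂⟩ := hg2.bounded_above_of_compact_support hcs.deriv
  have hL₁0 : 0 ≤ L₁ := (norm_nonneg _).trans (hL₁ 0)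
  have hL₂0 : 0 ≤ L₂ := (norm_nonneg _).trans (hL₂ 0)
  have lip1 : ∀ r s, |g s - g r| ≤ L₁ * |s - r| := fun r s =>
    convex_univ.norm_image_sub_le_of_norm_deriv_le (fun x _ => hdiff x) (fun x _ => hL₁ x)
      (mem_univ r) (mem_univ s)
  have lip2 : ∀ r s, |deriv g s - deriv g r| ≤ L₂ * |s - r| := fun r s =>
    convex_univ.norm_image_sub_le_of_norm_deriv_le (fun x _ => hdiff1 x) (fun x _ => hL₂ x)
      (mem_univ r) (mem_univ s)
  refine ⟨deriv g, L₁ + L₂, fun r hr => ?_, hχ.eq_zero, hd4, fun r => ?_, fun r s hr hs => ?_,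
    fun r s hr hs => ?_⟩
  · rw [abs_of_nonneg (hχ.nonneg r hr)]
    exact hχ.le_one r hr
  · exact (hL₁ r).trans (by linarith)
  · rw [← hgχ r hr, ← hgχ s hs]
    exact (lip1 r s).trans (by gcongr; linarith)
  · rw [← hgχ r hr, ← hgχ s hs]
    have hh : ∀ x, HasDerivAt (fun x => g x - deriv g r * x) (deriv g x - deriv g r) x := fun x => by
      simpa using (hdiff x).hasDerivAt.fun_sub ((hasDerivAt_id' x).const_mul (deriv g r))
    have key := (convex_uIcc r s).norm_image_sub_le_of_norm_hasDerivWithin_le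
      (f := fun x => g x - deriv g r * x) (C := L₂ * |s - r|)
      (fun x _ => (hh x).hasDerivWithinAt) (fun x hx => ?_) left_mem_uIcc right_mem_uIcc
    · simp only [Real.norm_eq_abs] at key
      calc _ = |g s - deriv g r * s - (g r - deriv g r * r)| := by
            congr 1
            ring
        _ ≤ L₂ * |s - r| * |s - r| := key
        _ = L₂ * (s - r) ^ 2 := by rw [mul_assoc, ← sq, sq_abs]
        _ ≤ _ := by gcongr; linarith
    · refine (lip2 r x).trans ?_
      exact mul_le_mul_of_nonneg_left (abs_sub_left_of_mem_uIcc hx) hL₂0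

/-- The exponent `2 / q⋆` of the space containing `|∇v|^{q⋆}`. -/
noncomputable def pStar (N : ℕ) : ℝ≥0∞ := ENNReal.ofReal (2 / qStar N)

theorem qStar_eq (N : ℕ) : qStar N = 1 + 1 / ((N : ℝ) + 1) := by
  unfold qStar
  field_simp
  ring

theorem one_lt_qStar (N : ℕ) : 1 < qStar N := by
  rw [qStar_eq]
  have : 0 < 1 / ((N : ℝ) + 1) := by positivity
  linarith

theorem qStar_le_two (N : ℕ) : qStar N ≤ 2 := by
  rw [qStar_eq]
  have : 1 / ((N : ℝ) + 1) ≤ 1 := by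
    rw [div_le_one (by positivity)]
    linarith [(by positivity : (0 : ℝ) ≤ N)]
  linarith

theorem isExponent_pStar (N : ℕ) : IsExponent (pStar N) ((qStar N - 1) / 2) := by
  have h1 := one_lt_qStar N
  have h2 := qStar_le_two N
  refine ⟨by linarith, by linarith, ?_⟩
  rw [pStar]
  congr 1
  rw [show 1 / 2 + (qStar N - 1) / 2 = qStar N / 2 by ring, one_div_div]

instance (N : ℕ) : Fact (1 ≤ pStar N) := ⟨(isExponent_pStar N).one_le⟩

variable {N : ℕ} {m : ℝ}

/-- The truncated nonlinearity as a map from `H¹_m` to `L^{2/q⋆}_m`. -/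
theorem exists_nonlinearity (N : ℕ) (m : ℝ) {χ : ℝ → ℝ} (hχ : IsCutoff χ) :
    ∃ K : ℝ, ∀ ρ : ℝ, 0 < ρ → ∃ (F : H1m N m → Lp ℝ (pStar N) (weightedMeasure N m))
      (DF : H1m N m → H1m N m →L[ℝ] Lp ℝ (pStar N) (weightedMeasure N m)) (b c : ℝ),
      Mild.IsNonlinearity F DF (K * (2 * ρ) ^ (qStar N - 1)) b c (qStar N - 1) ∧
      ∀ v, F v =ᵐ[volume] truncF χ ρ v := by
  have h1 := one_lt_qStar N
  have h2 := qStar_le_two N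
  obtain ⟨g', L, hg⟩ := hχ.exists_profile
  obtain ⟨Φ, DΦ, hΦ, hΦn, hDΦ, hE⟩ := exists_superposition (μ := weightedMeasure N m)
    (V := Eu N) h1 h2 (p := pStar N) rfl
  have hq : 1 + (qStar N - 1) = qStar N := by ring
  refine ⟨2 + 8 * L, fun ρ hρ => ?_⟩
  obtain ⟨c, hc⟩ := Mild.isNonlinearity_truncation hg hρ (D := sndL N m) H1m.norm_snd_le
    (Φ := Φ) (DΦ := DΦ) (θ := qStar N - 1) (by linarith) (by linarith)
    (fun z => by rw [hq]; exact (hΦn z).le)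
    (fun z => (hDΦ z).trans (by gcongr)) (fun z z' => by rw [hq]; exact hE z z')
  refine ⟨_, _, _, c, hc, fun v => ?_⟩
  filter_upwards [ae_volume (hΦ v.1.snd), ae_volume
    (Lp.coeFn_smul (χ (‖v‖ ^ 2 / ρ ^ 2)) (Φ v.1.snd))] with ξ k1 k2
  rw [sndL_apply, k2, Pi.smul_apply, k1]
  rfl

/-- With b = (q⋆ - 1)/2 = 1/(2(N+1)), the exponent is γ = 1/2 + N/(4(N+1)) < 1, so the Duhamel
singularity is integrable. -/
theorem isSmoothing (hm : 0 ≤ m) : Mild.IsSmoothing (linearFlow N m)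
    (smoothing N m (pStar N)) (1 / 2 + (N : ℝ) / 2 * ((qStar N - 1) / 2)) where
  zero := linearFlow_zero
  add := linearFlow_add hm
  cont := continuousOn_linearFlow hm
  bdd := fun T _ => exists_norm_linearFlow_le N hm T
  comp := linearFlow_comp_smoothing hm (isExponent_pStar N)
  gamma_lt := by
    rw [qStar_eq]
    have : (N : ℝ) / 2 * ((1 + 1 / ((N : ℝ) + 1) - 1) / 2) < 1 / 2 := by
      field_simp
      linarith [(by positivity : (0 : ℝ) ≤ N)]
    linarith
  bound := fun T _ => exists_norm_smoothing_le N hm (isExponent_pStar N) T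

end ViscousHJ

/-! ### Pointwise and H¹_m-valued Duhamel integrals -/

namespace ViscousHJ

open Filter Topology
open scoped ENNReal

variable {N : ℕ} {m : ℝ}

/-- Evaluation of `e^{τ𝓛} f` at a point is a bounded functional of `f`. -/
theorem exists_evaluation {p : ℝ≥0∞} [Fact (1 ≤ p)] {τ : ℝ} (hτ : 0 < τ) (ξ : Eu N) :
    ∃ ℓ : Lp ℝ p (weightedMeasure N m) →L[ℝ] ℝ, ∀ f, ℓ f = ∫ y, kernelL N τ ξ y * f y := by
  have hle := volume_le_weightedMeasure N m
  let J : Lp ℝ p (weightedMeasure N m) →L[ℝ] Lp ℝ p (volume : Measure (Eu N)) :=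
    LinearMap.mkContinuous
      { toFun := fun f => ((Lp.memLp f).mono_measure hle).toLp
        map_add' := fun f g => by
          rw [← MemLp.toLp_add]
          exact MemLp.toLp_congr _ _ (ae_volume (Lp.coeFn_add f g))
        map_smul' := fun c f => by
          rw [← MemLp.toLp_const_smul]
          exact MemLp.toLp_congr _ _ (ae_volume (Lp.coeFn_smul c f)) } 1 fun f => by
      rw [one_mul]
      rw [LinearMap.coe_mk, AddHom.coe_mk, Lp.norm_toLp, Lp.norm_def]
      exact ENNReal.toReal_mono (Lp.eLpNorm_ne_top f) (eLpNorm_mono_measure f hle)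
  have : (ENNReal.conjExponent p).HolderConjugate p := ENNReal.HolderConjugate.symm
  have hq : Fact (1 ≤ ENNReal.conjExponent p) := ⟨ENNReal.HolderConjugate.one_le _ p⟩
  have hk := memLp_kernelL_right hτ ξ (zero_lt_one.trans_le hq.1).ne'
  refine ⟨((ContinuousLinearMap.mul ℝ ℝ).lpPairing volume _ p hk.toLp).comp J, fun f => ?_⟩
  rw [ContinuousLinearMap.comp_apply, ContinuousLinearMap.lpPairing_eq_integral]
  refine integral_congr_ae ?_
  filter_upwards [hk.coeFn_toLp, ((Lp.memLp f).mono_measure hle).coeFn_toLp] with y h1 h2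
  rw [h1]
  exact congrArg (kernelL N τ ξ y * ·) h2

theorem measurable_kernelL : Measurable fun z : (ℝ × Eu N) × Eu N => kernelL N z.1.1 z.1.2 z.2 := by
  unfold kernelL heatKernel gaussian
  fun_prop

/-- `∫ |v| ≤ C ‖v‖_m`. -/
theorem exists_integral_norm_toFun_le (hm : (N : ℝ) / 2 < m) :
    ∃ C : ℝ, ∀ v : H1m N m, ∫ ξ, ‖H1m.toFun v ξ‖ ≤ C * ‖v‖ := by
  obtain ⟨L, hL⟩ := (isDual_one hm).exists_pairing (1 : ℝ)
  refine ⟨‖L‖, fun v => ?_⟩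
  have h1 : L |v.1.fst| = ∫ ξ, ‖H1m.toFun v ξ‖ := by
    rw [hL]
    refine integral_congr_ae ?_
    filter_upwards [ae_volume (Lp.coeFn_abs v.1.fst)] with ξ hξ
    simp [hξ, H1m.toFun]
  rw [← h1]
  refine (le_abs_self _).trans ((L.le_opNorm _).trans ?_)
  rw [norm_abs_eq_norm]
  gcongr
  exact H1m.norm_fst_le v

/-- The Duhamel integral in `H¹_m` may be computed pointwise. -/
theorem toFun_duhamel {p : ℝ≥0∞} {b γ τ : ℝ} [Fact (1 ≤ p)] (hm : (N : ℝ) / 2 < m)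
    (hp : IsExponent p b) (h : Mild.IsSmoothing (linearFlow N m) (smoothing N m p) γ)
    (hτ : 0 ≤ τ) {f : ℝ → Lp ℝ p (weightedMeasure N m)} (hf : ContinuousOn f (Icc 0 τ))
    {w : ℝ → Eu N → ℝ} (hw : ∀ s, f s =ᵐ[volume] w s) :
    (∀ᵐ ξ, IntervalIntegrable (fun s => semigroupL N (τ - s) (w s) ξ) volume 0 τ) ∧
    H1m.toFun (Mild.IsSmoothing.duhamel (smoothing N m p) f τ) =ᵐ[volume]
      fun ξ => ∫ s in (0 : ℝ)..τ, semigroupL N (τ - s) (w s) ξ := by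
  have hm0 := nonneg_of_half_lt hm
  rcases hτ.eq_or_lt with rfl | hτ0
  · refine ⟨Eventually.of_forall fun ξ => IntervalIntegrable.refl, ?_⟩
    simp only [Mild.IsSmoothing.duhamel, intervalIntegral.integral_same]
    exact ae_volume (Lp.coeFn_zero ℝ 2 (weightedMeasure N m))
  let μ : Measure ℝ := volume.restrict (Ioc 0 τ)
  let g : ℝ → Lp ℝ p (weightedMeasure N m) := IccExtend hτ ((Icc 0 τ).domRestrict f)
  have hg : Continuous g := hf.domRestrict.Icc_extend'
  have hgf : ∀ s ∈ Icc 0 τ, g s = f s := fun s hs => IccExtend_of_mem hτ _ hs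
  -- The path variable s and the time q.1 are decoupled: u is continuous in s by boundedness of
  -- evaluation and measurable in (q.1, q.2), hence jointly measurable. The diagonal q.1 = τ - s is
  -- inserted afterwards.
  let u : ℝ → ℝ × Eu N → ℝ := fun s q => if 0 < q.1 then ∫ x, kernelL N q.1 q.2 x * g s x else 0
  have hu : StronglyMeasurable (Function.uncurry u) := by
    refine stronglyMeasurable_uncurry_of_continuous_of_stronglyMeasurable (fun q => ?_) fun s => ?_
    · by_cases hq : 0 < q.1
      · obtain ⟨ℓ, hℓ⟩ := exists_evaluation (m := m) (p := p) hq q.2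
        simp only [u, if_pos hq, ← hℓ]
        exact ℓ.continuous.comp hg
      · simp only [u, if_neg hq]
        exact continuous_const
    · refine StronglyMeasurable.ite (measurableSet_lt measurable_const measurable_fst) ?_
        stronglyMeasurable_const
      have k : StronglyMeasurable fun z : (ℝ × Eu N) × Eu N =>
          kernelL N z.1.1 z.1.2 z.2 * g s z.2 :=
        measurable_kernelL.stronglyMeasurable.mul
          ((Lp.stronglyMeasurable (g s)).comp_measurable measurable_snd)
      exact k.integral_prod_right
  let z : ℝ × Eu N → ℝ := fun q => u q.1 (τ - q.1, q.2)
  have hz : StronglyMeasurable z :=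
    hu.comp_measurable (g := fun q : ℝ × Eu N => (q.1, (τ - q.1, q.2))) (by fun_prop)
  -- The endpoint s = τ is discarded because at time zero the semigroup is the identity, not an
  -- integral operator.
  have hμ : ∀ᵐ s ∂μ, s ∈ Ico 0 τ := by
    filter_upwards [ae_restrict_mem measurableSet_Ioc,
      ae_restrict_of_ae (Measure.ae_ne volume τ)] with s h1 h2
    exact ⟨h1.1.le, lt_of_le_of_ne h1.2 h2⟩
  have hzw : ∀ s ∈ Ico 0 τ, ∀ ξ, z (s, ξ) = semigroupL N (τ - s) (w s) ξ := fun s hs ξ => by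
    have h0 : 0 < τ - s := by linarith [hs.2]
    simp only [z, u, semigroupL, if_pos h0]
    refine integral_congr_ae ?_
    filter_upwards [hw s] with x hx
    rw [hgf s ⟨hs.1, hs.2.le⟩, hx]
  have hzU : ∀ s ∈ Ico 0 τ,
      H1m.toFun (smoothing N m p (τ - s) (f s)) =ᵐ[volume] fun ξ => z (s, ξ) := fun s hs => by
    have h0 : 0 < τ - s := by linarith [hs.2]
    simp only [z, u, if_pos h0, hgf s ⟨hs.1, hs.2.le⟩]
    exact toFun_smoothing hm0 hp h0 (f s)
  have hI := h.intervalIntegrable_duhamel hτ hf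
  have hI' : Integrable (fun s => smoothing N m p (τ - s) (f s)) μ :=
    (intervalIntegrable_iff_integrableOn_Ioc_of_le hτ).mp hI
  -- The embedding of H¹_m in L¹ turns integrability of the H¹_m-valued integrand into integrability
  -- of z on (0, τ] × ℝ^N, as Fubini requires.
  obtain ⟨C, hC⟩ := exists_integral_norm_toFun_le (N := N) hm
  have hzi : Integrable z (μ.prod volume) := by
    refine (integrable_prod_iff hz.aestronglyMeasurable).mpr ⟨?_, ?_⟩
    · filter_upwards [hμ] with s hs
      exact (integrable_toFun hm _).congr (hzU s hs)
    · refine Integrable.mono' (hI'.norm.const_mul C)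
        hz.norm.integral_prod_right.aestronglyMeasurable ?_
      filter_upwards [hμ] with s hs
      rw [Real.norm_of_nonneg (by positivity)]
      refine le_trans (le_of_eq ?_) (hC _)
      refine integral_congr_ae ?_
      filter_upwards [hzU s hs] with ξ hξ
      rw [hξ]
  have hzint : ∀ ξ, ∫ s, z (s, ξ) ∂μ = ∫ s in (0 : ℝ)..τ, semigroupL N (τ - s) (w s) ξ := fun ξ => by
    rw [intervalIntegral.integral_of_le hτ]
    refine integral_congr_ae ?_
    filter_upwards [hμ] with s hs
    exact hzw s hs ξ
  refine ⟨?_, ?_⟩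
  · filter_upwards [hzi.prod_left_ae] with ξ hξ
    rw [intervalIntegrable_iff_integrableOn_Ioc_of_le hτ]
    refine hξ.congr ?_
    filter_upwards [hμ] with s hs
    exact hzw s hs ξ
  · simp only [← hzint]
    -- The two functions are compared against test functions: pairing with ψ is a bounded functional
    -- and commutes with the Bochner integral, while Fubini treats the pointwise integral.
    refine ae_eq_of_integral_contDiff_smul_eq (integrable_toFun hm _).locallyIntegrable
      hzi.integral_prod_right.locallyIntegrable fun ψ hψ hc => ?_
    obtain ⟨L, hL⟩ := (isDual_of_memLp (m := m) (memLp_test hψ.continuous hc)).exists_pairing (1 : ℝ)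
    obtain ⟨M, hM⟩ := hψ.continuous.bounded_above_of_compact_support hc
    have hL' : ∀ v : H1m N m, (L.comp (fstL N m)) v = ∫ ξ, ψ ξ • H1m.toFun v ξ := fun v => by
      rw [ContinuousLinearMap.comp_apply, hL]
      simp [H1m.toFun, mul_comm]
    have hψz : Integrable (fun q : ℝ × Eu N => ψ q.2 • z q) (μ.prod volume) :=
      hzi.bdd_smul M (hψ.continuous.comp continuous_snd).aestronglyMeasurable
        (Eventually.of_forall fun q => hM q.2)
    rw [← hL', Mild.IsSmoothing.duhamel, ← ContinuousLinearMap.intervalIntegral_comp_comm _ hI,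
      intervalIntegral.integral_of_le hτ]
    simp_rw [← integral_smul]
    rw [← integral_integral_swap hψz]
    refine integral_congr_ae ?_
    filter_upwards [hμ] with s hs
    rw [hL']
    refine integral_congr_ae ?_
    filter_upwards [hzU s hs] with ξ hξ
    rw [hξ]

/-- Solutions of the truncated equation are mild solutions in `H¹_m`. -/
theorem isSolution_iff_isMild (hm : (N : ℝ) / 2 < m) {χ : ℝ → ℝ} {ρ : ℝ}
    {F : H1m N m → Lp ℝ (pStar N) (weightedMeasure N m)} (hF : Continuous F)
    (hFv : ∀ v, F v =ᵐ[volume] truncF χ ρ v) {v₀ : H1m N m} {v : ℝ → H1m N m} :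
    IsSolution χ ρ v₀ v ↔
      Mild.IsMild (linearFlow N m) (smoothing N m (pStar N)) F v₀ v := by
  have hm0 := nonneg_of_half_lt hm
  have key := fun (hv : ContinuousOn v (Ici 0)) (τ : ℝ) (hτ : 0 ≤ τ) =>
    toFun_duhamel hm (isExponent_pStar N) (isSmoothing hm0) hτ (f := fun s => F (v s))
      (hF.comp_continuousOn (hv.mono fun s hs => hs.1)) (fun s => hFv (v s))
  have hsub : ∀ τ, 0 ≤ τ → H1m.toFun (linearFlow N m τ v₀ - Mild.IsSmoothing.duhamel
      (smoothing N m (pStar N)) (fun s => F (v s)) τ) =ᵐ[volume] fun ξ =>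
      semigroupL N τ (H1m.toFun v₀) ξ - H1m.toFun (Mild.IsSmoothing.duhamel
      (smoothing N m (pStar N)) (fun s => F (v s)) τ) ξ := fun τ hτ => by
    filter_upwards [toFun_linearFlow hm0 hτ v₀, ae_volume (Lp.coeFn_sub
      (linearFlow N m τ v₀).1.fst (Mild.IsSmoothing.duhamel
      (smoothing N m (pStar N)) (fun s => F (v s)) τ).1.fst)] with ξ h1 h2
    rw [← h1]
    exact h2
  constructor
  · intro h
    refine ⟨h.continuousOn, fun τ hτ => H1m.ext_toFun ?_⟩
    filter_upwards [h.duhamel τ hτ, hsub τ hτ, (key h.continuousOn τ hτ).2] with ξ h1 h2 h3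
    rw [h1, h2, h3]
  · rintro ⟨hv, h⟩
    refine ⟨hv, fun τ hτ => (key hv τ hτ).1, fun τ hτ => ?_⟩
    filter_upwards [hsub τ hτ, (key hv τ hτ).2] with ξ h2 h3
    rw [h τ hτ, h2, h3]

end ViscousHJ

/-! ### Centre manifolds of semiflows -/

namespace CentreMap

open Filter Topology

variable {X E : Type*} [NormedAddCommGroup X] [NormedSpace ℝ X] [NormedAddCommGroup E]
  [NormedSpace ℝ E]

/-- `φ` is a semiflow on `X ≅ ℝ × E` which stays within bounded distance of the linear semigroup
`(α, z) ↦ (α, D τ z)`, and whose deviation from it at time `T` has Lipschitz constant `η`. -/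
structure IsPerturbation (J : X ≃L[ℝ] ℝ × E) (S : ℝ → X →L[ℝ] X) (D : ℝ → E →L[ℝ] E)
    (φ : ℝ → X → X) (T L η : ℝ) : Prop where
  pos : 0 < T
  linear : ∀ τ, 0 ≤ τ → ∀ x, J (S τ x) = ((J x).1, D τ (J x).2)
  zero : ∀ x, φ 0 x = x
  add : ∀ s t, 0 ≤ s → 0 ≤ t → ∀ x, φ (s + t) x = φ s (φ t x)
  near : ∀ τ, 0 ≤ τ → ∃ d, ∀ x, ‖φ τ x - S τ x‖ ≤ d
  lip : ∀ x y, ∀ τ ∈ Icc 0 T, ‖φ τ x - φ τ y‖ ≤ L * ‖x - y‖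
  lip_sub : ∀ x y, ‖(φ T x - S T x) - (φ T y - S T y)‖ ≤ η * ‖x - y‖

namespace IsPerturbation

variable {J : X ≃L[ℝ] ℝ × E} {S : ℝ → X →L[ℝ] X} {D : ℝ → E →L[ℝ] E} {φ : ℝ → X → X}
  {T L η : ℝ}

/-- The deviation from the linear semigroup at time `T` in the coordinates `ℝ × E`. -/
def remainder (J : X ≃L[ℝ] ℝ × E) (S : ℝ → X →L[ℝ] X) (φ : ℝ → X → X) (T : ℝ)
    (x : ℝ × E) : ℝ × E := J (φ T (J.symm x) - S T (J.symm x))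

theorem step_remainder (h : IsPerturbation J S D φ T L η) (x : X) :
    step (D T) (remainder J S φ T) (J x) = J (φ T x) := by
  have h1 := h.linear T h.pos.le x
  have h2 : J (φ T x) = J (S T x) + J (φ T x - S T x) := by rw [← map_add, add_sub_cancel]
  rw [h2, h1]
  simp only [step, remainder, J.symm_apply_apply]
  rfl

theorem iterate_step (h : IsPerturbation J S D φ T L η) (x : X) (n : ℕ) :
    (step (D T) (remainder J S φ T))^[n] (J x) = J (φ (n * T) x) := by
  have hT := h.pos.le
  induction n with
  | zero => simp [h.zero]
  | succ n ih =>
    rw [Function.iterate_succ_apply', ih, h.step_remainder, ← h.add T (n * T) hT (by positivity)]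
    congr 2
    push_cast
    ring

theorem lip_nonneg (h : IsPerturbation J S D φ T L η) : 0 ≤ η := by
  have h1 := h.lip_sub (J.symm (1, 0)) 0
  have h2 : 0 < ‖J.symm ((1 : ℝ), (0 : E)) - 0‖ := by
    rw [sub_zero, norm_pos_iff]
    intro h0
    have := congrArg (fun x => (J x).1) h0
    simp at this
  exact nonneg_of_mul_nonneg_left ((norm_nonneg _).trans h1) h2

theorem isSmall (h : IsPerturbation J S D φ T L η) {lam : ℝ} (hD : ‖D T‖ ≤ lam)
    (hlam : lam ≤ 1 / 4)
    (hη : ‖(J : X →L[ℝ] ℝ × E)‖ * ‖(J.symm : ℝ × E →L[ℝ] X)‖ * η ≤ 1 / 8) :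
    ∃ b, IsSmall (D T) (remainder J S φ T) lam
      (‖(J : X →L[ℝ] ℝ × E)‖ * ‖(J.symm : ℝ × E →L[ℝ] X)‖ * η) b := by
  obtain ⟨d, hd⟩ := h.near T h.pos.le
  refine ⟨‖(J : X →L[ℝ] ℝ × E)‖ * d, hD, fun x y => ?_, fun x => ?_, hlam, hη⟩
  · rw [remainder, remainder, ← map_sub]
    have hη0 := h.lip_nonneg
    have h1 : ‖J.symm x - J.symm y‖ ≤ ‖(J.symm : ℝ × E →L[ℝ] X)‖ * ‖x - y‖ := by
      rw [← map_sub]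
      exact (J.symm : ℝ × E →L[ℝ] X).le_opNorm _
    calc _ ≤ ‖(J : X →L[ℝ] ℝ × E)‖ * _ := (J : X →L[ℝ] ℝ × E).le_opNorm _
      _ ≤ ‖(J : X →L[ℝ] ℝ × E)‖ * (η * (‖(J.symm : ℝ × E →L[ℝ] X)‖ * ‖x - y‖)) := by
        gcongr
        exact (h.lip_sub _ _).trans (by gcongr)
      _ = _ := by ring
  · exact ((J : X →L[ℝ] ℝ × E).le_opNorm _).trans (by gcongr; exact hd _)

/-- The centre manifold of `φ`. -/
def invariantSet (J : X ≃L[ℝ] ℝ × E) (f : ℝ → E) : Set X := range fun α => J.symm (α, f α)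

variable [CompleteSpace E] {lam ε b : ℝ}

theorem mem_invariantSet_iff (hs : IsSmall (D T) (remainder J S φ T) lam ε b) (x : X) :
    x ∈ invariantSet J hs.centre.1 ↔ J x ∈ hs.manifold := by
  constructor
  · rintro ⟨α, rfl⟩
    exact ⟨α, by simp⟩
  · rintro ⟨α, hα⟩
    exact ⟨α, by simp [hα]⟩

theorem image_period (h : IsPerturbation J S D φ T L η)
    (hs : IsSmall (D T) (remainder J S φ T) lam ε b) :
    φ T '' invariantSet J hs.centre.1 = invariantSet J hs.centre.1 := by
  ext x
  rw [mem_invariantSet_iff]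
  constructor
  · rintro ⟨y, hy, rfl⟩
    rw [← h.step_remainder, ← hs.image_manifold]
    exact mem_image_of_mem _ ((mem_invariantSet_iff hs y).mp hy)
  · intro hx
    rw [← hs.image_manifold] at hx
    obtain ⟨y, hy, hyx⟩ := hx
    refine ⟨J.symm y, (mem_invariantSet_iff hs _).mpr (by simpa using hy), J.injective ?_⟩
    rw [← h.step_remainder]
    simpa using hyx

/-- A point x of the set has a backward orbit under φ_T inside the set. Since φ_τ commutes with φ_T,
its image is a backward orbit of φ_τ x, and its stable component stays bounded because φ_τ is within
bounded distance of the linear flow. `mem_manifold_of_backward` concludes. -/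
theorem mapsTo_invariantSet (h : IsPerturbation J S D φ T L η)
    (hs : IsSmall (D T) (remainder J S φ T) lam ε b) {τ : ℝ} (hτ : 0 ≤ τ) :
    MapsTo (φ τ) (invariantSet J hs.centre.1) (invariantSet J hs.centre.1) := by
  intro x hx
  have hpre : ∀ y : invariantSet J hs.centre.1, ∃ z : invariantSet J hs.centre.1,
      φ T z = y := fun y => by
    obtain ⟨z, hz, hzy⟩ := (h.image_period hs).ge y.2
    exact ⟨⟨z, hz⟩, hzy⟩
  choose g hg using hpre
  obtain ⟨d, hd⟩ := h.near τ hτ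
  rw [mem_invariantSet_iff]
  have := hs.mem_manifold_of_backward (fun n => J (φ τ (g^[n] ⟨x, hx⟩))) (fun n => ?_)
    (‖D τ‖ * ‖hs.centre.1‖ + ‖(J : X →L[ℝ] ℝ × E)‖ * d) (fun n => ?_)
  · simpa using this
  · rw [h.step_remainder, ← h.add T τ h.pos.le hτ, add_comm, h.add τ T hτ h.pos.le,
      Function.iterate_succ_apply', hg]
  · set w := g^[n] ⟨x, hx⟩
    have hw := (hs.mem_manifold_iff _).mp ((mem_invariantSet_iff hs _).mp w.2)
    have h2 : J (φ τ w) = J (S τ w) + J (φ τ w - S τ w) := by rw [← map_add, add_sub_cancel]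
    rw [h2, h.linear τ hτ]
    refine (norm_add_le _ _).trans (add_le_add ?_ ?_)
    · refine ((D τ).le_opNorm _).trans ?_
      gcongr
      rw [hw]
      exact hs.centre.1.norm_coe_le_norm _
    · exact (norm_snd_le _).trans
        (((J : X →L[ℝ] ℝ × E).le_opNorm _).trans (by gcongr; exact hd _))

/-- For surjectivity choose n with nT ≥ τ: a point of the form φ_{nT} y equals φ_τ (φ_{nT - τ} y),
and the inner point lies in the set by forward invariance. -/
theorem image_invariantSet (h : IsPerturbation J S D φ T L η)
    (hs : IsSmall (D T) (remainder J S φ T) lam ε b) {τ : ℝ} (hτ : 0 ≤ τ) :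
    φ τ '' invariantSet J hs.centre.1 = invariantSet J hs.centre.1 := by
  have hT := h.pos
  refine (h.mapsTo_invariantSet hs hτ).image_subset.antisymm fun x hx => ?_
  obtain ⟨n, hn⟩ := exists_nat_ge (τ / T)
  rw [div_le_iff₀ hT] at hn
  have hit : ∀ n : ℕ, φ (n * T) '' invariantSet J hs.centre.1 = invariantSet J hs.centre.1 := by
    intro n
    induction n with
    | zero => simp [h.zero]
    | succ n ih =>
      have e : φ ((n + 1 : ℕ) * T) = φ T ∘ φ (n * T) := by
        funext y
        rw [Function.comp_apply, ← h.add T (n * T) hT.le (by positivity)]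
        congr 1
        push_cast
        ring
      rw [e, image_comp, ih, h.image_period hs]
  rw [← hit n] at hx
  obtain ⟨y, hy, rfl⟩ := hx
  refine ⟨φ (n * T - τ) y, h.mapsTo_invariantSet hs (by linarith) hy, ?_⟩
  rw [← h.add τ _ hτ (by linarith), add_sub_cancel]

/-- The shadowing of the time-T map gives the rate at multiples of T, and the Lipschitz bound on [0,
T] interpolates. For uniqueness, two phases approach each other at rate e^{-μT}, which is below 1 -
ε and so excluded by `phase_unique`. -/
theorem existsUnique_phase (h : IsPerturbation J S D φ T L η)
    (hs : IsSmall (D T) (remainder J S φ T) lam ε b) {μ : ℝ} (hμ : 0 ≤ μ)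
    (hlam : lam + 2 * ε ≤ Real.exp (-μ * T)) (hr : Real.exp (-μ * T) < 1 - ε) (v : X) :
    ∃! w, w ∈ invariantSet J hs.centre.1 ∧ ∃ C : ℝ, 0 < C ∧ ∀ τ : ℝ, 0 ≤ τ →
      ‖φ τ v - φ τ w‖ ≤ C * Real.exp (-μ * τ) := by
  have hT := h.pos
  have hκ0 : 0 ≤ lam + 2 * ε := by linarith [hs.lam_nonneg, hs.eps_nonneg]
  have hexp : ∀ n : ℕ, Real.exp (-μ * T) ^ n = Real.exp (-μ * (n * T)) := fun n => by
    rw [← Real.exp_nat_mul]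
    congr 1
    ring
  obtain ⟨β, c, hβ⟩ := hs.exists_phase (J v)
  have hβ' : ∀ n : ℕ, ‖φ (n * T) v - φ (n * T) (J.symm (β, hs.centre.1 β))‖ ≤
      ‖(J.symm : ℝ × E →L[ℝ] X)‖ * |c| * Real.exp (-μ * (n * T)) := fun n => by
    have h1 := hβ n
    have h2 := h.iterate_step (J.symm (β, hs.centre.1 β)) n
    rw [J.apply_symm_apply] at h2
    rw [h.iterate_step, h2, ← map_sub] at h1
    have h3 := (J.symm : ℝ × E →L[ℝ] X).le_opNorm
      (J (φ (n * T) v - φ (n * T) (J.symm (β, hs.centre.1 β))))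
    rw [ContinuousLinearEquiv.coe_coe, J.symm_apply_apply] at h3
    rw [← hexp, mul_assoc]
    refine h3.trans ?_
    gcongr
    refine h1.trans ?_
    gcongr
    exact le_abs_self c
  refine ⟨J.symm (β, hs.centre.1 β), ⟨⟨β, rfl⟩, ?_⟩, ?_⟩
  · set w := J.symm (β, hs.centre.1 β)
    -- The factor e^{μT} compensates for rounding τ down to a multiple of T; adding 1 makes the
    -- constant strictly positive.
    refine ⟨|L| * (‖(J.symm : ℝ × E →L[ℝ] X)‖ * |c|) * Real.exp (μ * T) + 1, by positivity,
      fun τ hτ => ?_⟩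
    set n := ⌊τ / T⌋₊
    have h1 : (n : ℝ) * T ≤ τ := by
      rw [← le_div_iff₀ hT]
      exact Nat.floor_le (by positivity)
    have h2 : τ ≤ n * T + T := by
      have := (Nat.lt_floor_add_one (τ / T)).le
      rw [div_le_iff₀ hT] at this
      linarith
    have h3 : ∀ y, φ τ y = φ (τ - n * T) (φ (n * T) y) := fun y => by
      rw [← h.add _ _ (by linarith) (by positivity), sub_add_cancel]
    rw [h3, h3]
    have h4 : Real.exp (-μ * (n * T)) ≤ Real.exp (μ * T) * Real.exp (-μ * τ) := by
      rw [← Real.exp_add]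
      apply Real.exp_le_exp.mpr
      nlinarith
    calc _ ≤ L * ‖φ (n * T) v - φ (n * T) w‖ := h.lip _ _ _ ⟨by linarith, by linarith⟩
      _ ≤ |L| * (‖(J.symm : ℝ × E →L[ℝ] X)‖ * |c| *
          (Real.exp (μ * T) * Real.exp (-μ * τ))) := by
        gcongr
        · exact le_abs_self L
        · exact (hβ' n).trans (by gcongr)
      _ ≤ _ := by linarith [Real.exp_pos (-μ * τ)]
  · rintro w ⟨⟨α, rfl⟩, C, hC0, hC⟩
    have : α = β := by
      refine hs.phase_unique hr (Real.exp_pos _).le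
        (c := ‖(J : X →L[ℝ] ℝ × E)‖ * (C + ‖(J.symm : ℝ × E →L[ℝ] X)‖ * |c|)) fun n => ?_
      have h1 := h.iterate_step (J.symm (α, hs.centre.1 α)) n
      have h2 := h.iterate_step (J.symm (β, hs.centre.1 β)) n
      rw [J.apply_symm_apply] at h1 h2
      rw [h1, h2, ← map_sub, mul_assoc]
      refine ((J : X →L[ℝ] ℝ × E).le_opNorm _).trans ?_
      gcongr
      have h3 := hC (n * T) (by positivity)
      have h4 := hβ' n
      rw [hexp, add_mul]
      refine (norm_sub_le_norm_sub_add_norm_sub _ (φ (n * T) v) _).trans (add_le_add ?_ h4)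
      rwa [norm_sub_rev]
    rw [this]

theorem contDiff_centre (hs : IsSmall (D T) (remainder J S φ T)
    lam (‖(J : X →L[ℝ] ℝ × E)‖ * ‖(J.symm : ℝ × E →L[ℝ] X)‖ * η) b)
    (h0 : φ T 0 = 0) {c θ : ℝ} {A : X → X →L[ℝ] X} (hc : 0 ≤ c) (hθ : 0 < θ) (hθ1 : θ ≤ 1)
    (hA0 : A 0 = 0) (hA : ∀ x, ‖A x‖ ≤ η)
    (hE : Mild.Expansion (fun x => φ T x - S T x) A c θ) :
    hs.centre.1 0 = 0 ∧ ContDiff ℝ 1 hs.centre.1 ∧ HasDerivAt hs.centre.1 0 0 := by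
  have hR0 : remainder J S φ T 0 = 0 := by simp [remainder, h0]
  refine ⟨hs.centre_zero hR0, hs.contDiff_centre
    (A := fun x => ((J : X →L[ℝ] ℝ × E).comp (A (J.symm x))).comp (J.symm : ℝ × E →L[ℝ] X))
    (c := ‖(J : X →L[ℝ] ℝ × E)‖ * (c * ‖(J.symm : ℝ × E →L[ℝ] X)‖ ^ (1 + θ)))
    (fun x => ?_) (by positivity) hθ hθ1 (fun x y => ?_) hR0 ?_⟩
  · calc _ ≤ ‖(J : X →L[ℝ] ℝ × E)‖ * ‖A (J.symm x)‖ * ‖(J.symm : ℝ × E →L[ℝ] X)‖ :=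
        (ContinuousLinearMap.opNorm_comp_le _ _).trans
          (by gcongr; exact ContinuousLinearMap.opNorm_comp_le _ _)
      _ ≤ ‖(J : X →L[ℝ] ℝ × E)‖ * η * ‖(J.symm : ℝ × E →L[ℝ] X)‖ := by gcongr; exact hA _
      _ = _ := by ring
  · have h1 := hE (J.symm x) (J.symm y)
    have h2 : ‖J.symm y - J.symm x‖ ≤ ‖(J.symm : ℝ × E →L[ℝ] X)‖ * ‖y - x‖ := by
      rw [← map_sub]
      exact (J.symm : ℝ × E →L[ℝ] X).le_opNorm _
    have e : remainder J S φ T y - remainder J S φ T x -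
        ((J : X →L[ℝ] ℝ × E).comp (A (J.symm x))).comp (J.symm : ℝ × E →L[ℝ] X) (y - x) =
        (J : X →L[ℝ] ℝ × E) ((φ T (J.symm y) - S T (J.symm y)) -
          (φ T (J.symm x) - S T (J.symm x)) - A (J.symm x) (J.symm y - J.symm x)) := by
      simp [remainder]
    rw [e, mul_assoc]
    refine ((J : X →L[ℝ] ℝ × E).le_opNorm _).trans ?_
    gcongr
    refine h1.trans ?_
    rw [mul_assoc, ← Real.mul_rpow (norm_nonneg _) (norm_nonneg _)]
    gcongr
  · ext x <;> simp [hA0]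

end IsPerturbation

end CentreMap

/-! ### The splitting by mass and the choice of the time step -/

namespace ViscousHJ

open Filter Topology
open scoped ENNReal

variable {N : ℕ} {m : ℝ}

theorem isClosed_Es (hm : (N : ℝ) / 2 < m) : IsClosed (Es N m : Set (H1m N m)) := by
  have e : (Es N m : Set (H1m N m)) = mass hm ⁻¹' {0} := by
    ext v
    exact mem_Es_iff hm
  rw [e]
  exact isClosed_singleton.preimage (mass hm).continuous

/-- The stable space `E_s` as a normed space in its own right. -/
def StableSpace (N : ℕ) (m : ℝ) : Type := Es N m

namespace StableSpace

noncomputable instance : NormedAddCommGroup (StableSpace N m) :=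
  Submodule.normedAddCommGroup (Es N m)

noncomputable instance : NormedSpace ℝ (StableSpace N m) := Submodule.normedSpace (Es N m)

theorem completeSpace (hm : (N : ℝ) / 2 < m) : CompleteSpace (StableSpace N m) :=
  (isClosed_Es hm).completeSpace_coe

/-- The inclusion of `E_s` into `H¹_m`. -/
noncomputable def incl (N : ℕ) (m : ℝ) : StableSpace N m →ₗᵢ[ℝ] H1m N m := (Es N m).subtypeₗᵢ

theorem incl_mem (z : StableSpace N m) : incl N m z ∈ Es N m := Subtype.property z

/-- The projection `v ↦ v - (∫ v) G` onto `E_s`. -/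
noncomputable def proj (hm : (N : ℝ) / 2 < m) : H1m N m →L[ℝ] StableSpace N m :=
  (ContinuousLinearMap.id ℝ (H1m N m) - (mass hm).smulRight (gaussianH1m N m hm)).codRestrict
    (Es N m) fun v => by
      rw [mem_Es_iff hm]
      simp [mass_gaussianH1m hm]

theorem incl_proj (hm : (N : ℝ) / 2 < m) (v : H1m N m) :
    incl N m (proj hm v) = v - mass hm v • gaussianH1m N m hm := rfl

theorem mass_incl (hm : (N : ℝ) / 2 < m) (z : StableSpace N m) : mass hm (incl N m z) = 0 :=
  (mem_Es_iff hm).mp (incl_mem z)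

end StableSpace

open StableSpace

/-- The splitting `H¹_m = E_c ⊕ E_s`, in the coordinates `α G + z ↦ (α, z)`. -/
noncomputable def splitting (hm : (N : ℝ) / 2 < m) : H1m N m ≃L[ℝ] ℝ × StableSpace N m :=
  ContinuousLinearEquiv.equivOfInverse ((mass hm).prod (proj hm))
    ((ContinuousLinearMap.toSpanSingleton ℝ (gaussianH1m N m hm)).coprod
      (incl N m).toContinuousLinearMap)
    (fun v => by simp [incl_proj])
    (fun x => by
      refine Prod.ext ?_ ((incl N m).injective ?_)
      · simp [mass_gaussianH1m hm, mass_incl hm]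
      · simp [incl_proj, mass_gaussianH1m hm, mass_incl hm])

theorem splitting_apply (hm : (N : ℝ) / 2 < m) (v : H1m N m) :
    splitting hm v = (mass hm v, proj hm v) := rfl

theorem splitting_symm_apply (hm : (N : ℝ) / 2 < m) (α : ℝ) (z : StableSpace N m) :
    (splitting hm).symm (α, z) = α • gaussianH1m N m hm + incl N m z := rfl

/-- The restriction of `e^{τ𝓛}` to `E_s`. -/
noncomputable def stableFlow (hm : (N : ℝ) / 2 < m) (τ : ℝ) :
    StableSpace N m →L[ℝ] StableSpace N m :=
  ((proj hm).comp (linearFlow N m τ)).comp (incl N m).toContinuousLinearMap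

theorem incl_stableFlow (hm : (N : ℝ) / 2 < m) {τ : ℝ} (hτ : 0 ≤ τ) (z : StableSpace N m) :
    incl N m (stableFlow hm τ z) = linearFlow N m τ (incl N m z) := by
  have : mass hm (linearFlow N m τ (incl N m z)) = 0 := by
    rw [mass_linearFlow hm hτ, mass_incl]
  exact (incl_proj hm _).trans (by simp [this])

theorem splitting_linearFlow (hm : (N : ℝ) / 2 < m) {τ : ℝ} (hτ : 0 ≤ τ) (v : H1m N m) :
    splitting hm (linearFlow N m τ v) =
      ((splitting hm v).1, stableFlow hm τ (splitting hm v).2) := by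
  simp only [splitting_apply, mass_linearFlow hm hτ]
  refine Prod.ext rfl ((incl N m).injective ?_)
  rw [incl_stableFlow hm hτ, incl_proj, incl_proj, map_sub, map_smul,
    linearFlow_gaussianH1m hm hτ, mass_linearFlow hm hτ]

/-- Over a long time interval, `e^{T𝓛}` contracts `E_s` by more than `e^{-μT}`. -/
theorem exists_contraction_time (hm : (N : ℝ) / 2 < m) {μ : ℝ} (hμ : 0 < μ) (hμ1 : μ < 1 / 2)
    (hμm : 2 * μ < m - (N : ℝ) / 2) : ∃ T : ℝ, 0 < T ∧ Real.exp (-μ * T) ≤ 1 / 8 ∧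
      ‖stableFlow hm T‖ ≤ Real.exp (-μ * T) / 2 := by
  -- Both restrictions on μ are used here: s must not exceed 1 and must stay below m - N/2, while
  -- s/2 > μ leaves a factor e^{-(s/2 - μ)T} to absorb the constant of the decay estimate.
  obtain ⟨s, hs, hs'⟩ : ∃ s, 2 * μ < s ∧ s < min 1 (m - (N : ℝ) / 2) :=
    exists_between (lt_min (by linarith) hμm)
  have hs1 : s < 1 := hs'.trans_le (min_le_left _ _)
  have hsm : s < m - (N : ℝ) / 2 := hs'.trans_le (min_le_right _ _)
  obtain ⟨C, hC0, hC⟩ := exists_norm_linearFlow_Es_le hm (s := s) (by linarith) hs1.le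
    (by linarith)
  have lim : ∀ a : ℝ, 0 < a → Tendsto (fun T : ℝ => Real.exp (-a * T)) atTop (𝓝 0) := fun a ha =>
    Real.tendsto_exp_atBot.comp (tendsto_id.const_mul_atTop_of_neg (by linarith))
  have l1 := (lim μ hμ).eventually (eventually_le_nhds (by norm_num : (0 : ℝ) < 1 / 8))
  have l2 : ∀ᶠ T in atTop, C * Real.exp (-(s / 2 - μ) * T) ≤ 1 / 2 := by
    have := (lim (s / 2 - μ) (by linarith)).const_mul C
    rw [mul_zero] at this
    exact this.eventually (eventually_le_nhds (by norm_num))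
  obtain ⟨T, h1, h2, h3⟩ := (l1.and (l2.and (eventually_ge_atTop 2))).exists
  refine ⟨T, by linarith, h1, ContinuousLinearMap.opNorm_le_bound _ (by positivity) fun z => ?_⟩
  rw [← (incl N m).norm_map, incl_stableFlow hm (by linarith), ← (incl N m).norm_map z]
  refine (hC T h3 _ (incl_mem z)).trans ?_
  gcongr
  have e : Real.exp (-(s * T / 2)) = Real.exp (-(s / 2 - μ) * T) * Real.exp (-μ * T) := by
    rw [← Real.exp_add]
    congr 1
    ring
  rw [e, ← mul_assoc]
  nlinarith [Real.exp_pos (-μ * T)]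

theorem mass_smulG (hm : (N : ℝ) / 2 < m) (α : ℝ) :
    mass hm (Ec.smulG N m hm α : H1m N m) = α := by
  simp [Ec.smulG, mass_gaussianH1m hm]

/-- The element αG is recovered from its mass α, so a function of the real coordinate becomes a map
on E_c by composition with the mass functional. -/
theorem Wc_eq_invariantSet (hm : (N : ℝ) / 2 < m) (f : ℝ → StableSpace N m) :
    Wc hm (fun e => (f (mass hm (e : H1m N m)) : Es N m)) =
      CentreMap.IsPerturbation.invariantSet (splitting hm) f := by
  ext w
  refine exists_congr fun α => ?_
  simp only [mass_smulG, splitting_symm_apply]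
  exact eq_comm

theorem contDiff_comp_functional {X E : Type*} [NormedAddCommGroup X] [NormedSpace ℝ X]
    [NormedAddCommGroup E] [NormedSpace ℝ E] {g : ℝ → E} (hg : ContDiff ℝ 1 g)
    (hlip : ∀ x y, ‖g x - g y‖ ≤ |x - y|) (h0 : g 0 = 0) (hd : HasDerivAt g 0 0)
    (L : X →L[ℝ] ℝ) (P : Submodule ℝ X) :
    ContDiff ℝ 1 (fun e : P => g (L e)) ∧ (∃ K : ℝ≥0, LipschitzWith K fun e : P => g (L e)) ∧
      g (L ((0 : P) : X)) = 0 ∧ fderiv ℝ (fun e : P => g (L e)) 0 = 0 := by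
  let L' : P →L[ℝ] ℝ := L.comp P.subtypeL
  refine ⟨hg.comp L'.contDiff, ⟨‖L'‖₊, LipschitzWith.of_dist_le_mul fun e e' => ?_⟩, by simp [h0], ?_⟩
  · rw [dist_eq_norm, dist_eq_norm]
    refine (hlip _ _).trans ?_
    rw [← map_sub]
    exact L'.le_opNorm (e - e')
  · have h1 : HasFDerivAt g (ContinuousLinearMap.toSpanSingleton ℝ (0 : E)) (L' 0) := by
      rw [map_zero]
      exact hd.hasFDerivAt
    exact (h1.comp (0 : P) L'.hasFDerivAt).fderiv.trans (by simp)

end ViscousHJ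

/-! ### Choice of the truncation radius and conclusion -/

theorem mainTheorem2 (N : ℕ) (hN : 0 < N) (m : ℝ) (hm : (N : ℝ) / 2 < m)
    (χ : ℝ → ℝ) (hχ : IsCutoff χ)
    (μ : ℝ) (hμ_pos : 0 < μ) (hμ_half : μ < 1 / 2) (hμ_m : 2 * μ < m - (N : ℝ) / 2) :
    ∃ ρ₀ : ℝ, 0 < ρ₀ ∧ ∀ ρ : ℝ, 0 < ρ → ρ < ρ₀ →
      ∃ φ : ℝ → H1m N m → H1m N m, IsTruncatedSemiflow χ ρ φ ∧
      ∃ f : Ec N m hm → Es N m,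
        ContDiff ℝ 1 f ∧ (∃ K : ℝ≥0, LipschitzWith K f) ∧ f 0 = 0 ∧ fderiv ℝ f 0 = 0 ∧
        (∀ τ : ℝ, 0 ≤ τ → φ τ '' Wc hm f = Wc hm f) ∧
        (∀ v₀ : H1m N m, ∃! w₀ : H1m N m, w₀ ∈ Wc hm f ∧
          ∃ C : ℝ, 0 < C ∧ ∀ τ : ℝ, 0 ≤ τ →
            ‖φ τ v₀ - φ τ w₀‖ ≤ C * Real.exp (-μ * τ)) := by
  have hm0 := nonneg_of_half_lt hm
  have hS := isSmoothing (N := N) hm0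
  have hθ : 0 < qStar N - 1 := by linarith [one_lt_qStar N]
  have hθ1 : qStar N - 1 ≤ 1 := by linarith [qStar_le_two N]
  have := StableSpace.completeSpace hm
  obtain ⟨T, hT, hr8, hD⟩ := exists_contraction_time hm hμ_pos hμ_half hμ_m
  obtain ⟨M, hM0, hM⟩ := hS.bdd T hT
  obtain ⟨C, hC0, hC⟩ := hS.bound T hT
  obtain ⟨K, hK⟩ := exists_nonlinearity N m hχ
  have hr := Real.exp_pos (-μ * T)
  set k := C * (T ^ (1 - (1 / 2 + (N : ℝ) / 2 * ((qStar N - 1) / 2))) /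
    (1 - (1 / 2 + (N : ℝ) / 2 * ((qStar N - 1) / 2))))
  set J := splitting hm
  set j := ‖(J : H1m N m →L[ℝ] ℝ × StableSpace N m)‖ * ‖(J.symm : ℝ × StableSpace N m →L[ℝ] H1m N m)‖
  -- The time T and the constants of the linear theory are fixed before ρ. Since the Lipschitz
  -- constant of the nonlinearity tends to zero with ρ, all smallness conditions can be met for
  -- small ρ.
  have lim : ∀ a : ℝ, Filter.Tendsto (fun ρ : ℝ => a * (K * (2 * ρ) ^ (qStar N - 1))) (nhds 0) (nhds 0) := by
    intro a
    have h1 : Continuous fun ρ : ℝ => a * (K * (2 * ρ) ^ (qStar N - 1)) :=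
      continuous_const.mul (continuous_const.mul
        ((continuous_const.mul continuous_id).rpow_const fun _ => Or.inr hθ.le))
    simpa [Real.zero_rpow hθ.ne'] using h1.tendsto 0
  have l1 := (lim k).eventually (eventually_le_nhds (by norm_num : (0 : ℝ) < 1 / 2))
  have l2 := (lim (j * k * (2 * M))).eventually
    -- With lam = e^{-μT}/2, a perturbation of size e^{-μT}/4 gives exactly lam + 2ε ≤ e^{-μT}. As
    -- e^{-μT} ≤ 1/8, the conditions lam ≤ 1/4, ε ≤ 1/8 and e^{-μT} < 1 - ε hold as well.
    (eventually_le_nhds (by positivity : 0 < Real.exp (-μ * T) / 4))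
  obtain ⟨ρ₀, hρ₀, hball⟩ := Metric.eventually_nhds_iff.mp (l1.and l2)
  refine ⟨ρ₀, hρ₀, fun ρ hρ hρlt => ?_⟩
  obtain ⟨hsmall, hj⟩ := hball (y := ρ) (by rwa [Real.dist_eq, sub_zero, abs_of_pos hρ])
  obtain ⟨F, DF, b, c, hF, hFv⟩ := hK ρ hρ
  set ε := K * (2 * ρ) ^ (qStar N - 1)
  obtain ⟨φ, hφ, hφu, hadd, hnear, hlip, hlipR, hφ0, c', A, hc', hA0, hA, hE⟩ :=
    Mild.exists_semiflow hS hF hT hM0 hM hC0 hC hsmall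
  have hP : CentreMap.IsPerturbation J (linearFlow N m) (stableFlow hm) φ T (2 * M)
      (k * ε * (2 * M)) :=
    { pos := hT
      linear := fun τ hτ x => splitting_linearFlow hm hτ x
      zero := fun x => by
        have := (hφ x).2 0 le_rfl
        simpa [Mild.IsSmoothing.duhamel, hS.zero] using this
      add := hadd
      near := hnear
      lip := hlip
      lip_sub := hlipR }
  have hj' : j * (k * ε * (2 * M)) ≤ Real.exp (-μ * T) / 4 := by
    refine le_trans (le_of_eq ?_) hj
    ring
  obtain ⟨d, hs⟩ := hP.isSmall hD (by linarith) (by linarith)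
  obtain ⟨hf0, hf1, hfd⟩ := CentreMap.IsPerturbation.contDiff_centre hs hφ0 hc' hθ hθ1 hA0 hA hE
  obtain ⟨g1, g2, g3, g4⟩ := contDiff_comp_functional hf1 hs.centre.2 hf0 hfd (mass hm) (Ec N m hm)
  refine ⟨φ, fun v₀ => ⟨(isSolution_iff_isMild hm hF.continuous hFv).mpr (hφ v₀), fun v hv =>
    hφu v₀ v ((isSolution_iff_isMild hm hF.continuous hFv).mp hv)⟩,
    fun e => hs.centre.1 (mass hm (e : H1m N m)), g1, g2, g3, g4, ?_⟩
  rw [Wc_eq_invariantSet hm hs.centre.1]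
  exact ⟨fun τ hτ => hP.image_invariantSet hs hτ, fun v₀ =>
    hP.existsUnique_phase hs hμ_pos.le (by linarith) (by linarith) v₀⟩
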